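/- Let $D_0\subset\mathbb R^2$ be a bounded connected open set with boundary of class $C^2$, let $L>0$, let $\mathcal R(x_1,x_2)=(-x_1,x_2)$, and suppose that $D_1=D_0+(-L,0)$ and $D_2=\mathcal R(D_0)+(L,0)$ are disjoint. Let $D=D_1\cup D_2$ be the symmetric dimer, and write $\mathcal R[u]=u\circ\mathcal R$; $u$ is symmetric if $\mathcal R[u]=u$ and antisymmetric if $\mathcal R[u]=-u$. For $\omega\in\mathbb C\setminus\{0\}$ let $\mathcal K_D^\omega[f](x)=\int_D \tfrac i4 H_0^{(1)}(\omega|x-y|)f(y)\,dy$ (principal branch), and let $\mathcal K_D[f](x)=-\tfrac1{2\pi}\int_D\ln|x-y|\,f(y)\,dy$. On $L^2_0(D)=\{f\in L^2(D):\int_D f=0\}$ let $\widetilde{\mathcal K}_D[f]=\mathcal K_D[f]-|D|^{-1}\int_D\mathcal K_D[f]$, with spectrum $\sigma(\widetilde{\mathcal K}_D)$. Assume that the largest eigenvalue $\lambda_-$ of $\widetilde{\mathcal K}_D$ is simple, with an antisymmetric eigenfunction. For $\tau>0$ consider the nonlinear resonance problem $$u=\tau\omega^2\,\mathcal K_D^\omega\big[u+|u|^2u\big],\qquad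 \|u\|_{L^2(D)}^2=\mathcal N,\qquad (\omega,u)\in\mathbb C\times H^2(D), \tag{1}$$ for frequencies in the principal region $$\mathcal F_\tau=\Big\{\omega:\ \operatorname{Re}\omega\ge 0,\ \operatorname{dist}\big((\tau\omega^{2})^{-1},\sigma(\widetilde{\mathcal K}_D)\setminus\{\lambda_-\}\big)>\tfrac12\operatorname{dist}\big(\lambda_-,\sigma(\widetilde{\mathcal K}_D)\setminus\{\lambda_-\}\big)\Big\}.$$ Then there are $\mathcal N_0>0$ and $\tau_0>1$, depending only on $D$, and linear resonances $\omega_{+}^{\rm lin}(\tau),\omega_{-}^{\rm lin}(\tau)$ for $\tau>\tau_0$ (that is, $\varphi=\tau\omega^2\mathcal K^\omega_D[\varphi]$ has a nonzero solution $\varphi\in H^2(D)$ at $\omega=\omega^{\rm lin}_\pm(\tau)$) with $$\omega_+^{\rm lin}(\tau)\sim\sqrt{\frac{4\pi}{|D|\,\tau\ln\tau}},\qquad \omega_-^{\rm lin}(\tau)\sim\sqrt{\frac1{\tau\lambda_-}}\qquad(\tau\to\infty),$$ such that for every $\tau>\tau_0$ the following hold. (i) There are two families $\mathcal N\mapsto(\omega_\pm(\mathcal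 N),u_\pm(\mathcal N))$, $0<\mathcal N<\mathcal N_0$, of solutions of (1), continuous into $\mathbb C\times H^2(D)$, with $u_+$ symmetric and $u_-$ antisymmetric, which bifurcate from the zero solution at the linear resonances: $(\omega_\pm(\mathcal N),u_\pm(\mathcal N))\to(\omega_\pm^{\rm lin}(\tau),0)$ in $\mathbb C\times H^2(D)$ as $\mathcal N\to0^+$. (ii) These are the only ones: for $0<\mathcal N<\mathcal N_0$, the solutions $(\omega,u)$ of (1) with $\omega\in\mathcal F_\tau$ are exactly the pairs $(\omega_+(\mathcal N),e^{i\theta}u_+(\mathcal N))$ and $(\omega_-(\mathcal N),e^{i\theta}u_-(\mathcal N))$, $\theta\in\mathbb R$. (iii) No symmetry-breaking bifurcation occurs along either branch: for every $0<\mathcal N<\mathcal N_0$, each of the points $(\omega_\pm(\mathcal N),u_\pm(\mathcal N))$ has a neighbourhood in $\mathbb C\times H^2(D)$ in which every solution $(\omega,u)$ of $u=\tau\omega^2\mathcal K_D^\omega[u+|u|^2u]$ has $u$ symmetric or antisymmetric. -/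

import Mathlib

open Set Filter Topology MeasureTheory
open scoped ENNReal

noncomputable section

namespace Dimer

/-- The Euclidean plane. -/
abbrev Plane := EuclideanSpace ℝ (Fin 2)

/-! ### Geometry -/

/-- A single particle: a bounded connected (nonempty) open set with boundary of class `C²`, given
near each boundary point as the side `ρ < 0` of a regular level set. -/
structure IsParticle (S : Set Plane) : Prop where
  isOpen : IsOpen S
  isBounded : Bornology.IsBounded S
  isConnected : IsConnected S
  boundary : ∀ p ∈ frontier S, ∃ (U : Set Plane) (ρ : Plane → ℝ), IsOpen U ∧ p ∈ U ∧
    ContDiff ℝ 2 ρ ∧ fderiv ℝ ρ p ≠ 0 ∧ S ∩ U = {x ∈ U | ρ x < 0}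

/-- Reflection in the line `x₁ = 0`. -/
def reflect (x : Plane) : Plane := !₂[-x 0, x 1]

/-- `D₁ = D₀ + (-L, 0)`. -/
def leftParticle (D₀ : Set Plane) (L : ℝ) : Set Plane :=
  (fun x : Plane => x + !₂[-L, 0]) '' D₀

/-- `D₂ = R(D₀) + (L, 0)`. -/
def rightParticle (D₀ : Set Plane) (L : ℝ) : Set Plane :=
  (fun x : Plane => reflect x + !₂[L, 0]) '' D₀

/-- The symmetric dimer `D = D₁ ∪ D₂`. -/
def dimer (D₀ : Set Plane) (L : ℝ) : Set Plane :=
  leftParticle D₀ L ∪ rightParticle D₀ L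

/-- The area `|D|`. -/
def area (D : Set Plane) : ℝ := (volume D).toReal

/-! ### Functions on `D`

A function on `D` is represented by a function on the plane, of which only the values almost
everywhere on `D` matter. -/

/-- `u` and `v` agree almost everywhere on `D`. -/
def EqOnAE (D : Set Plane) (u v : Plane → ℂ) : Prop := u =ᵐ[volume.restrict D] v

/-- `R u = u` on `D`. -/
def IsSymm (D : Set Plane) (u : Plane → ℂ) : Prop := EqOnAE D (fun x => u (reflect x)) u

/-- `R u = -u` on `D`. -/
def IsAntisymm (D : Set Plane) (u : Plane → ℂ) : Prop :=
  EqOnAE D (fun x => u (reflect x)) (fun x => -u x)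

/-- The squared norm `‖u‖²` of `L²(D)`. -/
def normSq (D : Set Plane) (u : Plane → ℂ) : ℝ := ∫ x in D, ‖u x‖ ^ 2

/-- Partial derivative of a test function. -/
def partialDeriv (i : Fin 2) (φ : Plane → ℝ) (x : Plane) : ℝ :=
  fderiv ℝ φ x (EuclideanSpace.single i 1)

/-- `g` is the weak derivative `∂ᵢ u` on the open set `D`. -/
def IsWeakDeriv (D : Set Plane) (i : Fin 2) (u g : Plane → ℂ) : Prop :=
  ∀ φ : Plane → ℝ, ContDiff ℝ ((⊤ : ℕ∞) : WithTop ℕ∞) φ → HasCompactSupport φ → tsupport φ ⊆ D →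
    ∫ x in D, (partialDeriv i φ x : ℂ) * u x = -∫ x in D, (φ x : ℂ) * g x

/-- `u`, its weak gradient `g` and its weak second derivatives `h` all lie in `L²(D)`. -/
structure IsH2Jet (D : Set Plane) (u : Plane → ℂ) (g : Fin 2 → Plane → ℂ)
    (h : Fin 2 → Fin 2 → Plane → ℂ) : Prop where
  memLp : MemLp u 2 (volume.restrict D)
  memLp_grad : ∀ i, MemLp (g i) 2 (volume.restrict D)
  memLp_hess : ∀ i j, MemLp (h i j) 2 (volume.restrict D)
  grad : ∀ i, IsWeakDeriv D i u (g i)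
  hess : ∀ i j, IsWeakDeriv D j (g i) (h i j)

/-- The Sobolev space `H²(D)`. -/
def MemH2 (D : Set Plane) (u : Plane → ℂ) : Prop := ∃ g h, IsH2Jet D u g h

/-- The norm of `H²(D)` (the sum of the `L²` norms of `u` and of its weak derivatives up to order
two); its value is `∞` when `u` is not in `H²(D)`. Weak derivatives are unique almost everywhere,
so all terms of the infimum are equal. -/
def h2Norm (D : Set Plane) (u : Plane → ℂ) : ℝ≥0∞ :=
  ⨅ (g : Fin 2 → Plane → ℂ) (h : Fin 2 → Fin 2 → Plane → ℂ) (_ : IsH2Jet D u g h),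
    eLpNorm u 2 (volume.restrict D) + ∑ i, eLpNorm (g i) 2 (volume.restrict D)
      + ∑ i, ∑ j, eLpNorm (h i j) 2 (volume.restrict D)

/-! ### The outgoing Green's function and the resonance problem -/

/-- Bessel function `J₀`. -/
def besselJ0 (z : ℂ) : ℂ :=
  ∑' k : ℕ, (-1) ^ k * (z ^ 2 / 4) ^ k / ((k.factorial : ℂ) ^ 2)

/-- Bessel function of the second kind `Y₀` (principal branch of the logarithm). -/
def besselY0 (z : ℂ) : ℂ :=
  2 / Real.pi * ((Complex.log (z / 2) + Real.eulerMascheroniConstant) * besselJ0 z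
    + ∑' k : ℕ, (-1) ^ (k + 1) * ((harmonic k : ℚ) : ℂ) * (z ^ 2 / 4) ^ k
        / ((k.factorial : ℂ) ^ 2))

/-- Hankel function of the first kind and order zero. -/
def hankel0 (z : ℂ) : ℂ := besselJ0 z + Complex.I * besselY0 z

/-- The outgoing Green's function of `-(Δ + ω²)` in the plane. -/
def green (ω : ℂ) (x : Plane) : ℂ := Complex.I / 4 * hankel0 (ω * ‖x‖)

/-- The volume potential `K_D^ω`. -/
def volumePotential (D : Set Plane) (ω : ℂ) (f : Plane → ℂ) (x : Plane) : ℂ :=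
  ∫ y in D, green ω (x - y) * f y

/-- The Kerr map `N(u) = u + |u|² u`. -/
def kerr (u : Plane → ℂ) (x : Plane) : ℂ := u x + (‖u x‖ ^ 2 : ℝ) * u x

/-- `(ω, u) ∈ ℂ × H²(D)` solves `u = τ ω² K_D^ω[N(u)]` on `D` (`u = 0` is allowed). -/
def IsSolution (D : Set Plane) (τ : ℝ) (ω : ℂ) (u : Plane → ℂ) : Prop :=
  MemH2 D u ∧ EqOnAE D u (fun x => τ * ω ^ 2 * volumePotential D ω (kerr u) x)

/-- `ω` is a linear resonance: `φ = τ ω² K_D^ω[φ]` on `D` for some nonzero `φ ∈ H²(D)`. -/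
def IsLinearResonance (D : Set Plane) (τ : ℝ) (ω : ℂ) : Prop :=
  ∃ φ : Plane → ℂ, MemH2 D φ ∧ ¬ EqOnAE D φ (fun _ => 0) ∧
    EqOnAE D φ (fun x => τ * ω ^ 2 * volumePotential D ω φ x)

/-! ### The limiting operator on mean-zero functions -/

/-- The Newtonian (logarithmic) potential `K_D`. -/
def newtonPotential (D : Set Plane) (f : Plane → ℂ) (x : Plane) : ℂ :=
  ∫ y in D, ((-(1 / (2 * Real.pi)) * Real.log ‖x - y‖ : ℝ) : ℂ) * f y

/-- The operator `K_D[f] - |D|⁻¹ ∫_D K_D[f]`, considered on `L²₀(D)`. -/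
def reducedPotential (D : Set Plane) (f : Plane → ℂ) (x : Plane) : ℂ :=
  newtonPotential D f x - (∫ y in D, newtonPotential D f y) / area D

/-- The space `L²₀(D)` of square-integrable functions of mean zero. -/
def MemL20 (D : Set Plane) (f : Plane → ℂ) : Prop :=
  MemLp f 2 (volume.restrict D) ∧ ∫ x in D, f x = 0

/-- `f ∈ L²₀(D)` is an eigenfunction of the reduced potential with eigenvalue `μ`. -/
def IsEigenfunction (D : Set Plane) (μ : ℝ) (f : Plane → ℂ) : Prop :=
  MemL20 D f ∧ ¬ EqOnAE D f (fun _ => 0) ∧ EqOnAE D (reducedPotential D f) (fun x => μ * f x)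

/-- `lam` is the largest eigenvalue of the reduced potential on `L²₀(D)`, it is simple, and its
eigenfunction is antisymmetric. -/
def IsPrincipalAntisymm (D : Set Plane) (lam : ℝ) : Prop :=
  (∀ (μ : ℝ) (f : Plane → ℂ), IsEigenfunction D μ f → μ ≤ lam) ∧
  ∃ φ : Plane → ℂ, IsEigenfunction D lam φ ∧ IsAntisymm D φ ∧
    ∀ f : Plane → ℂ, IsEigenfunction D lam f → ∃ c : ℂ, EqOnAE D f (fun x => c * φ x)

/-- The spectrum of the reduced potential on `L²₀(D)`: the `z` for which `z - K` is not a bijection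
of `L²₀(D)` (functions equal almost everywhere on `D` being identified). -/
def reducedSpectrum (D : Set Plane) : Set ℂ :=
  {z | ¬ ∀ f : Plane → ℂ, MemL20 D f → ∃ v : Plane → ℂ,
      (MemL20 D v ∧ EqOnAE D (fun x => z * v x - reducedPotential D v x) f) ∧
      ∀ w : Plane → ℂ, MemL20 D w → EqOnAE D (fun x => z * w x - reducedPotential D w x) f →
        EqOnAE D w v}

/-- The set of scaled frequencies `ŵ` with `dist(ŵ⁻², σ ∖ {lam}) > ½ dist(lam, σ ∖ {lam})`. -/
def scaledRegion (D : Set Plane) (lam : ℝ) : Set ℂ :=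
  {w | Metric.infDist (lam : ℂ) (reducedSpectrum D \ {(lam : ℂ)}) / 2 <
    Metric.infDist ((w ^ 2)⁻¹) (reducedSpectrum D \ {(lam : ℂ)})}

/-- The frequencies `ω` in the closed right half-plane whose scaling `√τ ω` lies in the region
above. -/
def frequencyRegion (D : Set Plane) (lam τ : ℝ) : Set ℂ :=
  {ω | 0 ≤ ω.re ∧ (Real.sqrt τ : ℂ) * ω ∈ scaledRegion D lam}

/-! ### Solution families and bifurcations -/

/-- A continuous family `(ω(N), u(N))`, `0 < N < N₀`, of solutions normalized by `‖u(N)‖² = N`,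
which bifurcates from the zero solution at the frequency `ωlin`. -/
structure IsBranch (D : Set Plane) (τ N₀ : ℝ) (ωlin : ℂ) (ω : ℝ → ℂ) (u : ℝ → Plane → ℂ) :
    Prop where
  solution : ∀ N ∈ Ioo 0 N₀, IsSolution D τ (ω N) (u N)
  normalized : ∀ N ∈ Ioo 0 N₀, normSq D (u N) = N
  continuous_freq : ContinuousOn ω (Ioo 0 N₀)
  continuous_state : ∀ N ∈ Ioo 0 N₀,
    Tendsto (fun M => h2Norm D (fun x => u M x - u N x)) (𝓝 N) (𝓝 0)
  tendsto_freq : Tendsto ω (𝓝[>] 0) (𝓝 ωlin)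
  tendsto_state : Tendsto (fun N => h2Norm D (u N)) (𝓝[>] 0) (𝓝 0)

/-- `(ω₀, u₀)` is a symmetry-breaking bifurcation point: arbitrarily close to it in `ℂ × H²(D)`
there are solutions that are neither symmetric nor antisymmetric. -/
def IsSymmetryBreakingPoint (D : Set Plane) (τ : ℝ) (ω₀ : ℂ) (u₀ : Plane → ℂ) : Prop :=
  ∀ δ : ℝ, 0 < δ → ∃ (ω : ℂ) (u : Plane → ℂ), IsSolution D τ ω u ∧ ‖ω - ω₀‖ < δ ∧
    h2Norm D (fun x => u x - u₀ x) < ENNReal.ofReal δ ∧ ¬ IsSymm D u ∧ ¬ IsAntisymm D u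

/-- `u = e^{iθ} v` on `D` for some real `θ`. -/
def EqUpToPhase (D : Set Plane) (u v : Plane → ℂ) : Prop :=
  ∃ θ : ℝ, EqOnAE D u (fun x => Complex.exp (θ * Complex.I) * v x)

end Dimer

end

set_option linter.unusedSectionVars false

noncomputable section

namespace Dimer

open Metric (ball closedBall infDist)
open Real (log sqrt)
open scoped NNReal

local notation "⟪" x ", " y "⟫" => inner ℂ x y
local notation "vol[" D "]" => Measure.restrict volume D
local notation "𝔻" => closedBall (0 : ℂ) 1
local notation "smooth" => ((⊤ : ℕ∞) : WithTop ℕ∞)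

/-! ### Maps with small bounds and small Lipschitz constants -/

section BoundedLipschitz

variable {P X E F G : Type*} [SeminormedAddCommGroup X]
  [NormedAddCommGroup E] [NormedSpace ℂ E] [NormedAddCommGroup F] [NormedSpace ℂ F]
  [NormedAddCommGroup G] [NormedSpace ℂ G]

/-- The maps `f p` are, on the sets `S p`, bounded by a multiple of `ρ p` and Lipschitz with
constant a multiple of `ρ p`, uniformly in the parameter `p`. -/
def BddLip (S : P → Set X) (ρ : P → ℝ) (f : P → X → E) : Prop :=
  ∃ C : ℝ, 0 ≤ C ∧ ∀ p, (∀ x ∈ S p, ‖f p x‖ ≤ C * ρ p) ∧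
    ∀ x ∈ S p, ∀ y ∈ S p, ‖f p x - f p y‖ ≤ C * ρ p * ‖x - y‖

variable {S : P → Set X} {ρ ρ' : P → ℝ}

theorem BddLip.mono {f : P → X → E} (h : BddLip S ρ f) (c : ℝ) (hc : 0 ≤ c)
    (hρ : ∀ p, ρ p ≤ c * ρ' p) : BddLip S ρ' f := by
  obtain ⟨C, hC, h⟩ := h
  refine ⟨C * c, by positivity, fun p => ?_⟩
  have h1 : C * ρ p ≤ C * c * ρ' p := by
    rw [mul_assoc]; exact mul_le_mul_of_nonneg_left (hρ p) hC
  exact ⟨fun x hx => ((h p).1 x hx).trans h1, fun x hx y hy =>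
    ((h p).2 x hx y hy).trans (mul_le_mul_of_nonneg_right h1 (norm_nonneg _))⟩

theorem BddLip.add {f g : P → X → E} (hf : BddLip S ρ f) (hg : BddLip S ρ g) :
    BddLip S ρ (fun p x => f p x + g p x) := by
  obtain ⟨C, hC, hf⟩ := hf
  obtain ⟨D, hD, hg⟩ := hg
  refine ⟨C + D, by positivity, fun p => ⟨fun x hx => ?_, fun x hx y hy => ?_⟩⟩
  · exact (norm_add_le _ _).trans (by linarith [(hf p).1 x hx, (hg p).1 x hx])
  · have e : f p x + g p x - (f p y + g p y) = (f p x - f p y) + (g p x - g p y) := by abel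
    rw [e]
    exact (norm_add_le _ _).trans (by linarith [(hf p).2 x hx y hy, (hg p).2 x hx y hy])

theorem BddLip.neg {f : P → X → E} (hf : BddLip S ρ f) : BddLip S ρ (fun p x => -f p x) := by
  obtain ⟨C, hC, hf⟩ := hf
  refine ⟨C, hC, fun p => ⟨fun x hx => ?_, fun x hx y hy => ?_⟩⟩
  · rw [norm_neg]; exact (hf p).1 x hx
  · rw [neg_sub_neg, norm_sub_rev]; exact (hf p).2 x hx y hy

theorem BddLip.sub {f g : P → X → E} (hf : BddLip S ρ f) (hg : BddLip S ρ g) :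
    BddLip S ρ (fun p x => f p x - g p x) := by
  simpa only [sub_eq_add_neg] using hf.add hg.neg

theorem BddLip.bilin (B : E →L[ℂ] F →L[ℂ] G) {f : P → X → E} {g : P → X → F}
    (hf : BddLip S ρ f) (hg : BddLip S ρ' g) :
    BddLip S (fun p => ρ p * ρ' p) (fun p x => B (f p x) (g p x)) := by
  have hB : 0 ≤ ‖B‖ := norm_nonneg B
  obtain ⟨C, hC, hf⟩ := hf
  obtain ⟨D, hD, hg⟩ := hg
  refine ⟨2 * ‖B‖ * C * D, by positivity, fun p => ⟨fun x hx => ?_, fun x hx y hy => ?_⟩⟩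
  · have h1 := (hf p).1 x hx
    have h2 := (hg p).1 x hx
    have h3 : ‖f p x‖ * ‖g p x‖ ≤ (C * ρ p) * (D * ρ' p) :=
      mul_le_mul h1 h2 (norm_nonneg _) ((norm_nonneg _).trans h1)
    calc ‖B (f p x) (g p x)‖ ≤ ‖B‖ * ‖f p x‖ * ‖g p x‖ := B.le_opNorm₂ _ _
      _ = ‖B‖ * (‖f p x‖ * ‖g p x‖) := by ring
      _ ≤ ‖B‖ * ((C * ρ p) * (D * ρ' p)) := mul_le_mul_of_nonneg_left h3 hB
      _ ≤ 2 * (‖B‖ * ((C * ρ p) * (D * ρ' p))) := by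
          have : 0 ≤ ‖B‖ * ((C * ρ p) * (D * ρ' p)) :=
            mul_nonneg hB ((mul_nonneg (norm_nonneg _) (norm_nonneg _)).trans h3)
          linarith
      _ = _ := by ring
  · have e : B (f p x) (g p x) - B (f p y) (g p y)
        = B (f p x - f p y) (g p x) + B (f p y) (g p x - g p y) := by
      simp only [map_sub, sub_apply]; abel
    have h1 := (hf p).2 x hx y hy
    have h2 := (hg p).1 x hx
    have h3 := (hf p).1 y hy
    have h4 := (hg p).2 x hx y hy
    have h5 : ‖f p x - f p y‖ * ‖g p x‖ ≤ (C * ρ p * ‖x - y‖) * (D * ρ' p) :=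
      mul_le_mul h1 h2 (norm_nonneg _) ((norm_nonneg _).trans h1)
    have h6 : ‖f p y‖ * ‖g p x - g p y‖ ≤ (C * ρ p) * (D * ρ' p * ‖x - y‖) :=
      mul_le_mul h3 h4 (norm_nonneg _) ((norm_nonneg _).trans h3)
    rw [e]
    calc _ ≤ ‖B (f p x - f p y) (g p x)‖ + ‖B (f p y) (g p x - g p y)‖ := norm_add_le _ _
      _ ≤ ‖B‖ * ‖f p x - f p y‖ * ‖g p x‖ + ‖B‖ * ‖f p y‖ * ‖g p x - g p y‖ :=
          add_le_add (B.le_opNorm₂ _ _) (B.le_opNorm₂ _ _)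
      _ = ‖B‖ * (‖f p x - f p y‖ * ‖g p x‖ + ‖f p y‖ * ‖g p x - g p y‖) := by ring
      _ ≤ ‖B‖ * ((C * ρ p * ‖x - y‖) * (D * ρ' p) + (C * ρ p) * (D * ρ' p * ‖x - y‖)) :=
          mul_le_mul_of_nonneg_left (add_le_add h5 h6) hB
      _ = _ := by ring

theorem BddLip.smul {f : P → X → ℂ} {g : P → X → F} (hf : BddLip S ρ f) (hg : BddLip S ρ' g) :
    BddLip S (fun p => ρ p * ρ' p) (fun p x => f p x • g p x) :=
  BddLip.bilin (ContinuousLinearMap.lsmul ℂ ℂ) hf hg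

theorem BddLip.clm (L : E →L[ℂ] F) {f : P → X → E} (hf : BddLip S ρ f) :
    BddLip S ρ (fun p x => L (f p x)) := by
  obtain ⟨C, hC, hf⟩ := hf
  refine ⟨‖L‖ * C, by positivity, fun p => ⟨fun x hx => ?_, fun x hx y hy => ?_⟩⟩
  · rw [mul_assoc]
    exact (L.le_opNorm _).trans (mul_le_mul_of_nonneg_left ((hf p).1 x hx) (norm_nonneg _))
  · rw [← map_sub, mul_assoc, mul_assoc, ← mul_assoc C]
    exact (L.le_opNorm _).trans (mul_le_mul_of_nonneg_left ((hf p).2 x hx y hy) (norm_nonneg _))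

/-- Maps that do not depend on the variable. -/
theorem BddLip.of_le {v : P → E} (c : ℝ) (hc : 0 ≤ c) (h : ∀ p, ‖v p‖ ≤ c * ρ p) :
    BddLip S ρ (fun p _ => v p) := by
  refine ⟨c, hc, fun p => ⟨fun x _ => h p, fun x _ y _ => ?_⟩⟩
  rw [sub_self, norm_zero]
  exact mul_nonneg ((norm_nonneg _).trans (h p)) (norm_nonneg _)

theorem BddLip.const (v : E) : BddLip S (fun _ : P => (1 : ℝ)) (fun _ _ => v) :=
  BddLip.of_le ‖v‖ (norm_nonneg _) fun p => by simp

theorem BddLip.inv {f : P → X → ℂ} {m : P → ℝ} (hf : BddLip S ρ f) (hm : ∀ p, 0 < m p)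
    (hfm : ∀ p, ∀ x ∈ S p, m p ≤ ‖f p x‖) (c : ℝ) (hc : 0 ≤ c) (hρ : ∀ p, ρ p ≤ c * m p) :
    BddLip S (fun p => (m p)⁻¹) (fun p x => (f p x)⁻¹) := by
  obtain ⟨C, hC, hf⟩ := hf.mono c hc hρ
  refine ⟨1 + C, by positivity, fun p => ⟨fun x hx => ?_, fun x hx y hy => ?_⟩⟩
  · rw [norm_inv]
    have h1 : ‖f p x‖⁻¹ ≤ (m p)⁻¹ := inv_anti₀ (hm p) (hfm p x hx)
    have h2 : 0 < (m p)⁻¹ := inv_pos.2 (hm p)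
    nlinarith
  · have hx0 : 0 < ‖f p x‖ := (hm p).trans_le (hfm p x hx)
    have hy0 : 0 < ‖f p y‖ := (hm p).trans_le (hfm p y hy)
    have e : (f p x)⁻¹ - (f p y)⁻¹ = (f p y - f p x) * ((f p x)⁻¹ * (f p y)⁻¹) := by
      have := norm_pos_iff.1 hx0
      have := norm_pos_iff.1 hy0
      field_simp
    have h1 : ‖f p x‖⁻¹ ≤ (m p)⁻¹ := inv_anti₀ (hm p) (hfm p x hx)
    have h2 : ‖f p y‖⁻¹ ≤ (m p)⁻¹ := inv_anti₀ (hm p) (hfm p y hy)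
    have h3 : ‖f p x‖⁻¹ * ‖f p y‖⁻¹ ≤ (m p)⁻¹ * (m p)⁻¹ :=
      mul_le_mul h1 h2 (by positivity) (inv_pos.2 (hm p)).le
    have h4 := (hf p).2 x hx y hy
    rw [e, norm_mul, norm_mul, norm_inv, norm_inv, norm_sub_rev]
    calc ‖f p x - f p y‖ * (‖f p x‖⁻¹ * ‖f p y‖⁻¹)
        ≤ (C * m p * ‖x - y‖) * ((m p)⁻¹ * (m p)⁻¹) :=
          mul_le_mul h4 h3 (by positivity) ((norm_nonneg _).trans h4)
      _ = C * (m p)⁻¹ * ‖x - y‖ := by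
          have := (hm p).ne'
          field_simp
      _ ≤ _ := by
          have : 0 ≤ (m p)⁻¹ * ‖x - y‖ := mul_nonneg (inv_pos.2 (hm p)).le (norm_nonneg _)
          nlinarith

/-- Composition with a Lipschitz map vanishing at the origin. -/
theorem BddLip.comp_lipschitz {f : P → X → E} (hf : BddLip S ρ f) {Φ : E → F} {s : Set E} {B : ℝ}
    (hB : 0 ≤ B) (hs : (0 : E) ∈ s) (h0 : Φ 0 = 0)
    (hΦ : ∀ a ∈ s, ∀ b ∈ s, ‖Φ a - Φ b‖ ≤ B * ‖a - b‖) (hfs : ∀ p, ∀ x ∈ S p, f p x ∈ s) :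
    BddLip S ρ (fun p x => Φ (f p x)) := by
  obtain ⟨C, hC, hf⟩ := hf
  refine ⟨B * C, by positivity, fun p => ⟨fun x hx => ?_, fun x hx y hy => ?_⟩⟩
  · have := hΦ _ (hfs p x hx) 0 hs
    rw [h0, sub_zero, sub_zero] at this
    rw [mul_assoc]
    exact this.trans (mul_le_mul_of_nonneg_left ((hf p).1 x hx) hB)
  · rw [mul_assoc, mul_assoc, ← mul_assoc C]
    exact (hΦ _ (hfs p x hx) _ (hfs p y hy)).trans
      (mul_le_mul_of_nonneg_left ((hf p).2 x hx y hy) hB)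

theorem BddLip.norm {f : P → X → E} (hf : BddLip S ρ f) :
    BddLip S ρ (fun p x => ((‖f p x‖ : ℝ) : ℂ)) := by
  obtain ⟨C, hC, hf⟩ := hf
  refine ⟨C, hC, fun p => ⟨fun x hx => ?_, fun x hx y hy => ?_⟩⟩
  · rw [Complex.norm_real, norm_norm]; exact (hf p).1 x hx
  · rw [← Complex.ofReal_sub, Complex.norm_real]
    exact (abs_norm_sub_norm_le _ _).trans ((hf p).2 x hx y hy)

theorem BddLip.prodMk {f : P → X → E} {g : P → X → F} (hf : BddLip S ρ f) (hg : BddLip S ρ g) :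
    BddLip S ρ (fun p x => (f p x, g p x)) := by
  simpa using (hf.clm (ContinuousLinearMap.inl ℂ E F)).add (hg.clm (ContinuousLinearMap.inr ℂ E F))

end BoundedLipschitz

/-- A family of contractions of a closed ball has continuous fixed points. -/
theorem exists_fixedPoint_family {E : Type*} [NormedAddCommGroup E] [CompleteSpace E] (x₀ : E)
    {r N₀ : ℝ} (hr : 0 < r) (Φ : ℝ → E → E)
    (hlip : ∀ N ∈ Icc 0 N₀, ∀ x ∈ closedBall x₀ r, ∀ y ∈ closedBall x₀ r,
      ‖Φ N x - Φ N y‖ ≤ 1 / 2 * ‖x - y‖)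
    (hcen : ∀ N ∈ Icc 0 N₀, ‖Φ N x₀ - x₀‖ ≤ r / 2)
    (hcont : ∀ x ∈ closedBall x₀ r, ContinuousOn (fun N => Φ N x) (Icc 0 N₀)) :
    ∃ x : ℝ → E, (∀ N ∈ Icc 0 N₀, x N ∈ closedBall x₀ r ∧ Φ N (x N) = x N ∧
      (∀ y ∈ closedBall x₀ r, Φ N y = y → y = x N) ∧ ‖x N - x₀‖ ≤ 2 * ‖Φ N x₀ - x₀‖) ∧
      ContinuousOn x (Icc 0 N₀) := by
  have hx₀ : x₀ ∈ closedBall x₀ r := Metric.mem_closedBall_self hr.le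
  have hmaps : ∀ N ∈ Icc 0 N₀, MapsTo (Φ N) (closedBall x₀ r) (closedBall x₀ r) := by
    intro N hN x hx
    have h1 := hlip N hN x hx x₀ hx₀
    have h2 := hcen N hN
    rw [mem_closedBall_iff_norm] at hx ⊢
    have e : Φ N x - x₀ = (Φ N x - Φ N x₀) + (Φ N x₀ - x₀) := by abel
    rw [e]
    exact (norm_add_le _ _).trans (by linarith)
  have hex : ∀ N ∈ Icc 0 N₀, ∃ x ∈ closedBall x₀ r, Φ N x = x := by
    intro N hN
    have hc : ContractingWith (1 / 2) ((hmaps N hN).restrict (Φ N) _ _) := by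
      refine ⟨by norm_num, LipschitzWith.of_dist_le_mul fun x y => ?_⟩
      rw [Subtype.dist_eq, dist_eq_norm, Subtype.dist_eq, dist_eq_norm]
      have := hlip N hN x x.2 y y.2
      simpa using this
    obtain ⟨y, hy, hfix, -⟩ := ContractingWith.exists_fixedPoint'
      (Metric.isClosed_closedBall.isComplete) (hmaps N hN) hc hx₀ (edist_ne_top _ _)
    exact ⟨y, hy, hfix⟩
  choose! x hx hfix using hex
  refine ⟨x, fun N hN => ⟨hx N hN, hfix N hN, fun y hy hy' => ?_, ?_⟩, ?_⟩
  · have := hlip N hN y hy _ (hx N hN)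
    rw [hy', hfix N hN] at this
    have h0 : ‖y - x N‖ = 0 := by linarith [norm_nonneg (y - x N)]
    exact sub_eq_zero.1 (norm_eq_zero.1 h0)
  · have h1 := hlip N hN _ (hx N hN) x₀ hx₀
    have e : x N - x₀ = (Φ N (x N) - Φ N x₀) + (Φ N x₀ - x₀) := by rw [hfix N hN]; abel
    have h2 := norm_add_le (Φ N (x N) - Φ N x₀) (Φ N x₀ - x₀)
    rw [← e] at h2
    linarith
  · intro N hN
    have h1 : ∀ M ∈ Icc 0 N₀, ‖x M - x N‖ ≤ 2 * ‖Φ M (x N) - Φ N (x N)‖ := by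
      intro M hM
      have h1 := hlip M hM _ (hx M hM) _ (hx N hN)
      have e : x M - x N = (Φ M (x M) - Φ M (x N)) + (Φ M (x N) - Φ N (x N)) := by
        rw [hfix M hM, hfix N hN]; abel
      have h2 := norm_add_le (Φ M (x M) - Φ M (x N)) (Φ M (x N) - Φ N (x N))
      rw [← e] at h2
      linarith
    have h2 : Tendsto (fun M => 2 * ‖Φ M (x N) - Φ N (x N)‖) (𝓝[Icc 0 N₀] N) (𝓝 0) := by
      have h3 : Tendsto (fun M => Φ M (x N)) (𝓝[Icc 0 N₀] N) (𝓝 (Φ N (x N))) :=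
        hcont _ (hx N hN) N hN
      have := ((h3.sub_const (Φ N (x N))).norm).const_mul 2
      simpa using this
    rw [ContinuousWithinAt, tendsto_iff_norm_sub_tendsto_zero]
    refine squeeze_zero' (.of_forall fun _ => norm_nonneg _) ?_ h2
    filter_upwards [self_mem_nhdsWithin] with M hM using h1 M hM

/-! ### The resonance problem in an abstract Hilbert space -/


section Abstract

variable {H : Type*} [NormedAddCommGroup H] [InnerProductSpace ℂ H]

/-- The data of the resonance problem: the constant mode `e`, the principal mode `φ` of `K`, a
reduced resolvent `S` at its eigenvalue `lam`, the frequency dependent corrections `J` and `Y`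
and a truncated nonlinearity `g`. -/
structure ResonanceSystem (H : Type*) [NormedAddCommGroup H] [InnerProductSpace ℂ H] where
  (e φ : H)
  (K S : H →L[ℂ] H)
  (lam κ : ℝ)
  (c₀ : ℂ)
  (J Y : ℂ → H →L[ℂ] H)
  (g : H → H)
  (B G : ℝ)
  norm_e : ‖e‖ = 1
  norm_φ : ‖φ‖ = 1
  inner_e_φ : ⟪e, φ⟫ = 0
  lam_pos : 0 < lam
  κ_pos : 0 < κ
  K_φ : K φ = (lam : ℂ) • φ
  inner_φ_K : ∀ u, ⟪φ, K u⟫ = lam * ⟪φ, u⟫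
  inner_e_S : ∀ u, ⟪e, S u⟫ = 0
  inner_φ_S : ∀ u, ⟪φ, S u⟫ = 0
  resolvent_S : ∀ u, (lam : ℂ) • S u - K (S u) + ⟪e, K (S u)⟫ • e = u - ⟪e, u⟫ • e - ⟪φ, u⟫ • φ
  S_resolvent : ∀ u, ⟪e, u⟫ = 0 → ⟪φ, u⟫ = 0 → S ((lam : ℂ) • u - K u) = u
  S_e : S e = 0
  S_φ : S φ = 0
  B_nonneg : 0 ≤ B
  J_zero : J 0 = 0
  Y_zero : Y 0 = 0
  J_lip : ∀ a ∈ 𝔻, ∀ b ∈ 𝔻,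
    ‖J a - J b‖ ≤ B * ‖a - b‖
  Y_lip : ∀ a ∈ 𝔻, ∀ b ∈ 𝔻,
    ‖Y a - Y b‖ ≤ B * ‖a - b‖
  G_nonneg : 0 ≤ G
  g_zero : g 0 = 0
  g_lip : ∀ u v, ‖g u - g v‖ ≤ G * ‖u - v‖

namespace ResonanceSystem

variable (s : ResonanceSystem H)

/-- The large coefficient of the constant mode. -/
def coeff (τ : ℝ) (Z : ℂ) : ℂ := s.κ * (log τ + Complex.log Z) + s.c₀

/-- The operator of the linear problem without its large part. -/
def pert (τ : ℝ) (Z : ℂ) : H →L[ℂ] H :=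
  s.coeff τ Z • s.J ((τ * Z)⁻¹) + s.Y ((τ * Z)⁻¹)

/-- The nonlinear term normalized by the mass `N`. -/
def nonlin (N : ℝ) (u : H) : H := ((N : ℂ) * ((‖u‖ : ℂ) ^ 2)⁻¹) • s.g u

/-- The right-hand side without the large coefficient and without its linear part `K u`. -/
def rest (τ N : ℝ) (Z : ℂ) (u : H) : H :=
  s.K (s.nonlin N u) + s.pert τ Z (u + s.nonlin N u)

/-- The nonlinear resonance equation, with spectral parameter `Z = (τ ω²)⁻¹`. -/
def Solves (τ N : ℝ) (Z : ℂ) (u : H) : Prop :=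
  Z • u = (s.coeff τ Z * ⟪s.e, u + s.nonlin N u⟫) • s.e + s.K u + s.rest τ N Z u

/-- The amplitude of the constant mode along the principal branch. -/
def meanAmp (τ N : ℝ) (Z : ℂ) (u : H) : ℂ :=
  (Z - s.coeff τ Z)⁻¹ * (s.coeff τ Z * ⟪s.e, s.nonlin N u⟫ + ⟪s.e, s.K u + s.rest τ N Z u⟫)

/-- The fixed point map of the principal branch. -/
def mapMinus (τ N : ℝ) (x : ℂ × H) : ℂ × H :=
  (s.lam + ⟪s.φ, s.rest τ N x.1 (s.φ + x.2)⟫,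
    s.meanAmp τ N x.1 (s.φ + x.2) • s.e +
      s.S (s.meanAmp τ N x.1 (s.φ + x.2) • s.K s.e + s.rest τ N x.1 (s.φ + x.2)
        - (x.1 - s.lam) • x.2))

/-- The size of `Z` along the branch of the constant mode. -/
def large (τ : ℝ) : ℝ := s.κ * log τ

/-- The fixed point map of the branch of the constant mode. -/
def mapPlus (τ N : ℝ) (x : ℂ × H) : ℂ × H :=
  ((s.large τ : ℂ)⁻¹ * (s.coeff τ (s.large τ * x.1) * (1 + ⟪s.e, s.nonlin N (s.e + x.2)⟫)
      + ⟪s.e, s.K (s.e + x.2) + s.rest τ N (s.large τ * x.1) (s.e + x.2)⟫),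
    (s.large τ * x.1)⁻¹ • (s.K (s.e + x.2) + s.rest τ N (s.large τ * x.1) (s.e + x.2)
      - ⟪s.e, s.K (s.e + x.2) + s.rest τ N (s.large τ * x.1) (s.e + x.2)⟫ • s.e))

theorem inner_e_e : ⟪s.e, s.e⟫ = 1 := by
  rw [inner_self_eq_norm_sq_to_K, s.norm_e]; simp

theorem inner_φ_φ : ⟪s.φ, s.φ⟫ = 1 := by
  rw [inner_self_eq_norm_sq_to_K, s.norm_φ]; simp

theorem inner_φ_e : ⟪s.φ, s.e⟫ = 0 := by
  rw [← inner_conj_symm, s.inner_e_φ, map_zero]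

theorem mapPlus_fixed_iff {τ N : ℝ} {ζ : ℂ} {v : H} (hτ : (s.large τ : ℂ) ≠ 0) (hζ : ζ ≠ 0) :
    s.mapPlus τ N (ζ, v) = (ζ, v) ↔
      ⟪s.e, v⟫ = 0 ∧ s.Solves τ N (s.large τ * ζ) (s.e + v) := by
  have he := s.inner_e_e
  simp only [mapPlus, Prod.mk.injEq, Solves]
  set Z : ℂ := s.large τ * ζ with hZ
  have hZ0 : Z ≠ 0 := mul_ne_zero hτ hζ
  set h := s.K (s.e + v) + s.rest τ N Z (s.e + v) with hh
  set n := s.nonlin N (s.e + v) with hn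
  rw [inv_mul_eq_iff_eq_mul₀ hτ, ← hZ, inv_smul_eq_iff₀ hZ0, add_assoc _ (s.K _), ← hh]
  constructor
  · rintro ⟨h1, h2⟩
    have h3 : ⟪s.e, v⟫ = 0 := by
      have := congrArg (fun u => ⟪s.e, u⟫) h2
      simp only [inner_sub_right, inner_smul_right, he] at this
      have h4 : Z * ⟪s.e, v⟫ = 0 := by rw [← this]; ring
      exact (mul_eq_zero.1 h4).resolve_left hZ0
    refine ⟨h3, ?_⟩
    rw [smul_add, ← h2, inner_add_right s.e (s.e + v), inner_add_right s.e s.e, he, h3, add_zero]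
    linear_combination (norm := module) -h1 • s.e
  · rintro ⟨h3, h4⟩
    have h5 := congrArg (fun u => ⟪s.e, u⟫) h4
    simp only [inner_add_right, inner_smul_right, he, h3] at h5
    refine ⟨?_, ?_⟩
    · linear_combination -h5
    · have h6 : Z • v = (s.coeff τ Z * ⟪s.e, s.e + v + n⟫) • s.e + h - Z • s.e := by
        rw [← h4]; module
      have h7 : Z = s.coeff τ Z * ⟪s.e, s.e + v + n⟫ + ⟪s.e, h⟫ := by
        simp only [inner_add_right, he, h3]; linear_combination h5
      rw [h6]
      nth_rewrite 2 [h7]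
      module

theorem mapMinus_fixed_iff {τ N : ℝ} {Z : ℂ} {ψ : H} (hZ : Z - s.coeff τ Z ≠ 0) :
    s.mapMinus τ N (Z, ψ) = (Z, ψ) ↔
      ⟪s.φ, ψ⟫ = 0 ∧ s.Solves τ N Z (s.φ + ψ) := by
  have he := s.inner_e_e
  have hφ := s.inner_φ_φ
  have heφ := s.inner_e_φ
  have hφe := s.inner_φ_e
  simp only [mapMinus, Prod.mk.injEq, Solves]
  set h := s.rest τ N Z (s.φ + ψ) with hh
  set n := s.nonlin N (s.φ + ψ) with hn
  set a := s.meanAmp τ N Z (s.φ + ψ) with ha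
  set C := s.coeff τ Z with hC
  have ha' : (Z - C) * a = C * ⟪s.e, n⟫ + ⟪s.e, s.K (s.φ + ψ) + h⟫ := by
    rw [ha, meanAmp, mul_inv_cancel_left₀ hZ]
  constructor
  · rintro ⟨h1, h2⟩
    set w := s.S (a • s.K s.e + h - (Z - s.lam) • ψ) with hw
    have hew : ⟪s.e, w⟫ = 0 := s.inner_e_S _
    have hφw : ⟪s.φ, w⟫ = 0 := s.inner_φ_S _
    have hφψ : ⟪s.φ, ψ⟫ = 0 := by
      rw [← h2, inner_add_right, inner_smul_right, hφe, hφw]; ring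
    have heψ : ⟪s.e, ψ⟫ = a := by
      rw [← h2, inner_add_right, inner_smul_right, he, hew]; ring
    refine ⟨hφψ, ?_⟩
    have h3 := s.resolvent_S (a • s.K s.e + h - (Z - s.lam) • ψ)
    rw [← hw] at h3
    have hKψ : s.K ψ = a • s.K s.e + s.K w := by rw [← h2]; simp
    obtain ⟨α, β, hαβ⟩ : ∃ α β : ℂ, Z • (s.φ + ψ) - ((C * ⟪s.e, s.φ + ψ + n⟫) • s.e
        + s.K (s.φ + ψ) + h) = α • s.e + β • s.φ := by
      refine ⟨(s.lam * a - ⟪s.e, s.K w⟫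
          - ⟪s.e, a • s.K s.e + h - (Z - s.lam) • ψ⟫) - C * ⟪s.e, s.φ + ψ + n⟫,
        Z - s.lam - ⟪s.φ, a • s.K s.e + h - (Z - s.lam) • ψ⟫, ?_⟩
      have h4 : (s.lam : ℂ) • w = a • s.K s.e + h - (Z - s.lam) • ψ
          - ⟪s.e, a • s.K s.e + h - (Z - s.lam) • ψ⟫ • s.e
          - ⟪s.φ, a • s.K s.e + h - (Z - s.lam) • ψ⟫ • s.φ + s.K w - ⟪s.e, s.K w⟫ • s.e := by
        rw [← h3]; module
      have h5 : (s.lam : ℂ) • ψ = (s.lam * a) • s.e + (s.lam : ℂ) • w := by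
        nth_rewrite 1 [← h2]; module
      rw [h4] at h5
      rw [map_add, s.K_φ, hKψ]
      linear_combination (norm := module) h5
    have h6 := congrArg (fun u => ⟪s.e, u⟫) hαβ
    have h7 := congrArg (fun u => ⟪s.φ, u⟫) hαβ
    simp only [inner_add_right, inner_sub_right, inner_smul_right, he, hφ, heφ, hφe, heψ, hφψ,
      s.inner_φ_K, map_add] at h6 h7
    simp only [map_add, inner_add_right] at ha'
    have hα : α = 0 := by
      linear_combination -h6 + ha'
    have hβ : β = 0 := by
      rw [← h1] at h7; linear_combination -h7
    rw [hα, hβ, zero_smul, zero_smul, add_zero, sub_eq_zero] at hαβ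
    exact hαβ
  · rintro ⟨hφψ, h4⟩
    have h5 := congrArg (fun u => ⟪s.e, u⟫) h4
    have h6 := congrArg (fun u => ⟪s.φ, u⟫) h4
    simp only [inner_add_right, inner_smul_right, he, hφ, heφ, hφe, hφψ, s.inner_φ_K] at h5 h6
    have heψ : ⟪s.e, ψ⟫ = a := by
      refine mul_left_cancel₀ hZ ?_
      rw [ha']
      simp only [inner_add_right]
      linear_combination h5
    refine ⟨by linear_combination -h6, ?_⟩
    have hw1 : ⟪s.e, ψ - a • s.e⟫ = 0 := by
      rw [inner_sub_right, inner_smul_right, he, heψ]; ring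
    have hw2 : ⟪s.φ, ψ - a • s.e⟫ = 0 := by
      rw [inner_sub_right, inner_smul_right, hφe, hφψ]; ring
    have h7 : a • s.K s.e + h - (Z - s.lam) • ψ = ((s.lam : ℂ) • (ψ - a • s.e) - s.K (ψ - a • s.e))
        + (s.lam * a - C * ⟪s.e, s.φ + ψ + n⟫) • s.e + (Z - s.lam) • s.φ := by
      have h8 : h = Z • (s.φ + ψ) - (C * ⟪s.e, s.φ + ψ + n⟫) • s.e - s.K (s.φ + ψ) := by
        rw [h4]; abel
      rw [h8, map_add, s.K_φ, map_sub, map_smul]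
      module
    rw [h7, map_add, map_add, s.S_resolvent _ hw1 hw2, map_smul, map_smul, s.S_e, s.S_φ]
    module

end ResonanceSystem

end Abstract

theorem norm_log_sub_log_le {a : ℝ} (ha : 0 < a) {z w : ℂ}
    (hz : z ∈ closedBall (a : ℂ) (a / 2)) (hw : w ∈ closedBall (a : ℂ) (a / 2)) :
    ‖Complex.log z - Complex.log w‖ ≤ 2 / a * ‖z - w‖ := by
  have hre : ∀ x ∈ closedBall (a : ℂ) (a / 2), a / 2 ≤ x.re := by
    intro x hx
    rw [mem_closedBall_iff_norm] at hx
    have h1 := (abs_le.1 ((Complex.abs_re_le_norm (x - a)).trans hx)).1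
    simp only [Complex.sub_re, Complex.ofReal_re] at h1
    linarith
  refine (convex_closedBall (a : ℂ) (a / 2)).norm_image_sub_le_of_norm_hasDerivWithin_le
    (f := Complex.log) (f' := fun x => x⁻¹) (fun x hx => ?_) (fun x hx => ?_) hw hz
  · refine (Complex.hasDerivAt_log (Or.inl ?_)).hasDerivWithinAt
    have := hre x hx
    linarith
  · have h1 : a / 2 ≤ ‖x‖ := (hre x hx).trans ((le_abs_self _).trans (Complex.abs_re_le_norm x))
    rw [norm_inv, show 2 / a = (a / 2)⁻¹ by field_simp]
    exact inv_anti₀ (by positivity) h1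

theorem half_le_norm_of_mem_closedBall {a : ℝ} (ha : 0 < a) {z : ℂ}
    (hz : z ∈ closedBall (a : ℂ) (a / 2)) : a / 2 ≤ ‖z‖ := by
  rw [mem_closedBall_iff_norm, norm_sub_rev] at hz
  have := norm_sub_norm_le (a : ℂ) z
  rw [Complex.norm_of_nonneg ha.le] at this
  linarith

section BL
variable {P X : Type*} [SeminormedAddCommGroup X] {S : P → Set X}

theorem BddLip.clog {a : ℝ} (ha : 0 < a) {f : P → X → ℂ} (hf : BddLip S (fun _ => 1) f)
    (hfs : ∀ p, ∀ x ∈ S p, f p x ∈ closedBall (a : ℂ) (a / 2)) :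
    BddLip S (fun _ => 1) (fun p x => Complex.log (f p x)) := by
  obtain ⟨C, hC, hf⟩ := hf
  have ha' : (a : ℂ) ∈ closedBall (a : ℂ) (a / 2) :=
    Metric.mem_closedBall_self (by positivity)
  refine ⟨‖Complex.log a‖ + 1 + 2 / a * C, by positivity, fun p => ⟨fun x hx => ?_,
    fun x hx y hy => ?_⟩⟩
  · have h1 := norm_log_sub_log_le ha (hfs p x hx) ha'
    have h2 := mem_closedBall_iff_norm.1 (hfs p x hx)
    have h3 : 2 / a * ‖f p x - a‖ ≤ 2 / a * (a / 2) := by gcongr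
    have h4 : 2 / a * (a / 2) = 1 := by field_simp
    have h5 := norm_add_le (Complex.log (f p x) - Complex.log a) (Complex.log a)
    rw [sub_add_cancel] at h5
    have : 0 ≤ 2 / a * C := by positivity
    linarith
  · have h1 := norm_log_sub_log_le ha (hfs p x hx) (hfs p y hy)
    have h2 := (hf p).2 x hx y hy
    have h3 : 2 / a * ‖f p x - f p y‖ ≤ 2 / a * (C * 1 * ‖x - y‖) := by gcongr
    have : 0 ≤ (‖Complex.log a‖ + 1) * ‖x - y‖ := by positivity
    nlinarith

end BL

/-- The parameters `(τ, N)` with `τ ≥ τ₁`, `0 ≤ N ≤ 1`. -/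
abbrev Params (τ₁ : ℝ) := {p : ℝ × ℝ // τ₁ ≤ p.1 ∧ 0 ≤ p.2 ∧ p.2 ≤ 1}

/-- The smallness of the fixed point maps. -/
def smallness (τ N : ℝ) : ℝ := N + (sqrt (log τ))⁻¹

section Logs

theorem one_le_log {τ : ℝ} (hτ : 3 ≤ τ) : 1 ≤ log τ := by
  rw [Real.le_log_iff_exp_le (by linarith)]
  have := Real.exp_one_lt_d9
  linarith

theorem log_le_two_sqrt {x : ℝ} (hx : 0 < x) : log x ≤ 2 * sqrt x := by
  have h := Real.log_le_sub_one_of_pos (Real.sqrt_pos.2 hx)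
  rw [Real.log_sqrt hx.le] at h
  linarith

theorem inv_log_le_smallness {τ N : ℝ} (hτ : 3 ≤ τ) (hN : 0 ≤ N) :
    (log τ)⁻¹ ≤ smallness τ N := by
  have h1 := one_le_log hτ
  have h2 : sqrt (log τ) ≤ log τ := by
    rw [Real.sqrt_le_left (by linarith)]; nlinarith
  have h3 : (log τ)⁻¹ ≤ (sqrt (log τ))⁻¹ :=
    inv_anti₀ (Real.sqrt_pos.2 (by linarith)) h2
  unfold smallness; linarith

theorem log_mul_inv_le_smallness {τ N : ℝ} (hτ : 3 ≤ τ) (hN : 0 ≤ N) :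
    log τ * τ⁻¹ ≤ 4 * smallness τ N := by
  have h1 := one_le_log hτ
  have h2 := log_le_two_sqrt (x := τ) (by linarith)
  have h3 : log τ * log τ ≤ 4 * τ := by
    have := Real.mul_self_sqrt (show 0 ≤ τ by linarith)
    nlinarith [Real.sqrt_nonneg τ]
  have h4 : log τ * τ⁻¹ ≤ 4 * (log τ)⁻¹ := by
    rw [← div_eq_mul_inv, ← div_eq_mul_inv, div_le_div_iff₀ (by linarith) (by linarith)]
    exact h3
  linarith [inv_log_le_smallness hτ hN]

theorem inv_le_smallness {τ N : ℝ} (hτ : 3 ≤ τ) (hN : 0 ≤ N) : τ⁻¹ ≤ smallness τ N := by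
  have h1 := one_le_log hτ
  have h2 : log τ ≤ τ := by linarith [Real.log_le_sub_one_of_pos (show 0 < τ by linarith)]
  exact (inv_anti₀ (by linarith) h2).trans (inv_log_le_smallness hτ hN)

theorem smallness_le {τ N : ℝ} (hτ : 3 ≤ τ) (hN : N ≤ 1) : smallness τ N ≤ 2 := by
  have h1 : 1 ≤ sqrt (log τ) := Real.one_le_sqrt.2 (one_le_log hτ)
  have := inv_le_one_of_one_le₀ h1
  unfold smallness; linarith

theorem smallness_nonneg {τ N : ℝ} (hN : 0 ≤ N) : 0 ≤ smallness τ N := by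
  unfold smallness; positivity

theorem tendsto_smallness_zero : Tendsto (fun τ => smallness τ 0) atTop (𝓝 0) := by
  have h : Tendsto (fun τ => (sqrt (log τ))⁻¹) atTop (𝓝 0) :=
    (Real.tendsto_sqrt_atTop.comp Real.tendsto_log_atTop).inv_tendsto_atTop
  simpa [smallness] using h

/-- The smallness can be made smaller than any given positive number. -/
theorem exists_smallness_le (τ₁ : ℝ) {η : ℝ} (hη : 0 < η) :
    ∃ N₀ : ℝ, 0 < N₀ ∧ N₀ ≤ 1 ∧ ∃ τ₀ : ℝ, 3 ≤ τ₀ ∧ τ₁ ≤ τ₀ ∧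
      ∀ τ ≥ τ₀, ∀ N ≤ N₀, smallness τ N ≤ η := by
  have h := tendsto_smallness_zero.eventually (gt_mem_nhds (half_pos hη))
  obtain ⟨T, hT⟩ := eventually_atTop.1 h
  refine ⟨min 1 (η / 2), by positivity, min_le_left _ _, max (max 3 τ₁) T,
    (le_max_left _ _).trans (le_max_left _ _), (le_max_right _ _).trans (le_max_left _ _),
    fun τ hτ N hN => ?_⟩
  have h1 := hT τ ((le_max_right _ _).trans hτ)
  have h2 := hN.trans (min_le_right 1 (η / 2))
  unfold smallness at *
  linarith

end Logs

namespace ResonanceSystem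

variable {H : Type*} [NormedAddCommGroup H] [InnerProductSpace ℂ H] (s : ResonanceSystem H)
  {X : Type*} [SeminormedAddCommGroup X] {τ₁ : ℝ} {S : Params τ₁ → Set X}

theorem bddLip_nonlin {U : Params τ₁ → X → H} (hU : BddLip S (fun _ => 1) U)
    (hU1 : ∀ p, ∀ x ∈ S p, 1 / 2 ≤ ‖U p x‖) :
    BddLip S (fun p => p.1.2) (fun p x => s.nonlin p.1.2 (U p x)) := by
  have h1 : BddLip S (fun _ => 1) (fun p x => s.g (U p x)) :=
    hU.comp_lipschitz s.G_nonneg (mem_univ _) s.g_zero (fun a _ b _ => s.g_lip a b)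
      (fun _ _ _ => mem_univ _)
  have h2 := (hU.norm.inv (m := fun _ => 1 / 2) (fun _ => by norm_num)
    (fun p x hx => by rw [Complex.norm_real, norm_norm]; exact hU1 p x hx) 2 (by norm_num)
    (fun _ => by norm_num)).mono (ρ' := fun _ => 1) 2 (by norm_num) (fun _ => by norm_num)
  have h3 : BddLip S (fun p => p.1.2) (fun p _ => ((p.1.2 : ℝ) : ℂ)) :=
    BddLip.of_le 1 zero_le_one fun p => by
      rw [Complex.norm_of_nonneg p.2.2.1, one_mul]
  have h4 := (h3.smul (h2.smul h2)).smul h1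
  have h := h4.mono (ρ' := fun p => p.1.2) 1 zero_le_one fun p => by simp
  simpa only [nonlin, smul_eq_mul, sq, mul_inv] using h

theorem bddLip_rest (hτ₁ : 3 ≤ τ₁) {U : Params τ₁ → X → H} {Z : Params τ₁ → X → ℂ}
    (hU : BddLip S (fun _ => 1) U) (hU1 : ∀ p, ∀ x ∈ S p, 1 / 2 ≤ ‖U p x‖)
    (hC : BddLip S (fun p => log p.1.1) (fun p x => s.coeff p.1.1 (Z p x)))
    (hq : BddLip S (fun p => p.1.1⁻¹) (fun p x => (p.1.1 * Z p x)⁻¹))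
    (hq1 : ∀ p, ∀ x ∈ S p, ‖(p.1.1 * Z p x)⁻¹‖ ≤ 1) :
    BddLip S (fun p => smallness p.1.1 p.1.2)
      (fun p x => s.rest p.1.1 p.1.2 (Z p x) (U p x)) := by
  have hn := s.bddLip_nonlin hU hU1
  have hn1 : BddLip S (fun _ => 1) (fun p x => s.nonlin p.1.2 (U p x)) :=
    hn.mono 1 zero_le_one fun p => by simpa using p.2.2.2
  have hnε : BddLip S (fun p => smallness p.1.1 p.1.2) (fun p x => s.nonlin p.1.2 (U p x)) :=
    hn.mono 1 zero_le_one fun p => by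
      have := inv_nonneg.2 (Real.sqrt_nonneg (log p.1.1))
      unfold smallness
      linarith
  have hq' : ∀ p, ∀ x ∈ S p, (p.1.1 * Z p x)⁻¹ ∈ 𝔻 := fun p x hx => by
    rw [mem_closedBall_zero_iff]; exact hq1 p x hx
  have h0 : (0 : ℂ) ∈ 𝔻 := Metric.mem_closedBall_self zero_le_one
  have hJ := hq.comp_lipschitz s.B_nonneg h0 s.J_zero s.J_lip hq'
  have hY := hq.comp_lipschitz s.B_nonneg h0 s.Y_zero s.Y_lip hq'
  have hE : BddLip S (fun p => smallness p.1.1 p.1.2) (fun p x => s.pert p.1.1 (Z p x)) := by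
    refine BddLip.add ((hC.smul hJ).mono 4 (by norm_num) fun p => ?_)
      (hY.mono 1 zero_le_one fun p => ?_)
    · exact log_mul_inv_le_smallness (hτ₁.trans p.2.1) p.2.2.1
    · rw [one_mul]; exact inv_le_smallness (hτ₁.trans p.2.1) p.2.2.1
  refine (hnε.clm s.K).add (((hE.bilin (ContinuousLinearMap.id ℂ (H →L[ℂ] H))
    (hU.add hn1))).mono 1 zero_le_one fun p => by simp)

end ResonanceSystem

/-- Fixed points of small perturbations of a constant map. -/
theorem exists_fixedPoints_of_bddLip {E : Type*} [NormedAddCommGroup E] [CompleteSpace E]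
    (x₀ : E) {r₁ τ₁ D : ℝ} (hr₁ : 0 < r₁) (hD : 0 ≤ D) (Φ : ℝ → ℝ → E → E)
    (Ψ : Params τ₁ → E → E) (Θ : E → E)
    (hΦ : ∀ p : Params τ₁, ∀ x ∈ closedBall x₀ r₁,
      Φ p.1.1 p.1.2 x = x₀ + Ψ p x + Θ x)
    (hΨ : BddLip (fun _ => closedBall x₀ r₁) (fun p => smallness p.1.1 p.1.2) Ψ)
    (hΘ0 : Θ x₀ = 0)
    (hΘ : ∀ r ≤ r₁, ∀ x ∈ closedBall x₀ r, ∀ y ∈ closedBall x₀ r,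
      ‖Θ x - Θ y‖ ≤ D * r * ‖x - y‖)
    (hcont : ∀ τ, ∀ x, Continuous fun N => Φ τ N x) (rbar : ℝ) (hrbar : 0 < rbar) :
    ∃ r N₀ τ₀ C : ℝ, 0 < r ∧ r ≤ rbar ∧ r ≤ r₁ ∧ 0 < N₀ ∧ N₀ ≤ 1 ∧ τ₁ ≤ τ₀ ∧
      ∃ x : ℝ → ℝ → E, ∀ τ ≥ τ₀,
        (∀ N ∈ Icc 0 N₀, x τ N ∈ closedBall x₀ r ∧ Φ τ N (x τ N) = x τ N ∧
          (∀ y ∈ closedBall x₀ r, Φ τ N y = y → y = x τ N)) ∧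
        ContinuousOn (x τ) (Icc 0 N₀) ∧ ‖x τ 0 - x₀‖ ≤ C * smallness τ 0 := by
  obtain ⟨C, hC, hΨ⟩ := hΨ
  set r := min (min rbar r₁) (1 / (4 * (D + 1))) with hr
  have hr0 : 0 < r := by positivity
  have hrr₁ : r ≤ r₁ := (min_le_left _ _).trans (min_le_right _ _)
  have hDr : D * r ≤ 1 / 4 := by
    have h1 : r ≤ 1 / (4 * (D + 1)) := min_le_right _ _
    have h2 : D * r ≤ D * (1 / (4 * (D + 1))) := mul_le_mul_of_nonneg_left h1 hD
    refine h2.trans ?_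
    rw [mul_one_div, div_le_div_iff₀ (by positivity) (by norm_num)]
    linarith
  obtain ⟨N₀, hN₀, hN₀1, τ₀, -, hτ₀, hsm⟩ :=
    exists_smallness_le τ₁ (η := min (1 / 4) (r / 2) / (C + 1)) (by positivity)
  have hsub : closedBall x₀ r ⊆ closedBall x₀ r₁ :=
    Metric.closedBall_subset_closedBall hrr₁
  have hx₀ : x₀ ∈ closedBall x₀ r := Metric.mem_closedBall_self hr0.le
  have hCs : ∀ τ ≥ τ₀, ∀ N ∈ Icc 0 N₀, C * smallness τ N ≤ min (1 / 4) (r / 2) := by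
    intro τ hτ N hN
    have h1 := hsm τ hτ N hN.2
    rw [le_div_iff₀ (by positivity)] at h1
    have h2 := smallness_nonneg (τ := τ) hN.1
    linarith
  have hkey : ∀ τ ≥ τ₀, ∃ x : ℝ → E, (∀ N ∈ Icc 0 N₀, x N ∈ closedBall x₀ r ∧
      Φ τ N (x N) = x N ∧ (∀ y ∈ closedBall x₀ r, Φ τ N y = y → y = x N) ∧
        ‖x N - x₀‖ ≤ 2 * ‖Φ τ N x₀ - x₀‖) ∧ ContinuousOn x (Icc 0 N₀) := by
    intro τ hτ
    refine exists_fixedPoint_family x₀ hr0 (Φ τ) ?_ ?_ fun x _ => (hcont τ x).continuousOn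
    · intro N hN x hx y hy
      let p : Params τ₁ := ⟨(τ, N), hτ₀.trans hτ, hN.1, hN.2.trans hN₀1⟩
      have h1 := (hΨ p).2 x (hsub hx) y (hsub hy)
      have h2 := hΘ r hrr₁ x hx y hy
      have h3 := (hCs τ hτ N hN).trans (min_le_left _ _)
      have e : Φ τ N x - Φ τ N y = (Ψ p x - Ψ p y) + (Θ x - Θ y) := by
        rw [hΦ p x (hsub hx), hΦ p y (hsub hy)]; abel
      rw [e]
      have h4 : C * smallness τ N * ‖x - y‖ ≤ 1 / 4 * ‖x - y‖ := by gcongr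
      have h5 : D * r * ‖x - y‖ ≤ 1 / 4 * ‖x - y‖ := by gcongr
      exact (norm_add_le _ _).trans (by linarith [show ‖Ψ p x - Ψ p y‖ ≤ _ from h1])
    · intro N hN
      let p : Params τ₁ := ⟨(τ, N), hτ₀.trans hτ, hN.1, hN.2.trans hN₀1⟩
      have h1 : ‖Ψ p x₀‖ ≤ C * smallness τ N := (hΨ p).1 x₀ (hsub hx₀)
      rw [hΦ p x₀ (hsub hx₀), hΘ0, add_zero, add_sub_cancel_left]
      exact h1.trans ((hCs τ hτ N hN).trans (min_le_right _ _))
  choose! x hx using hkey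
  refine ⟨r, N₀, τ₀, 2 * C, hr0, (min_le_left _ _).trans (min_le_left _ _), hrr₁, hN₀, hN₀1, hτ₀,
    x, fun τ hτ => ⟨fun N hN => ?_, (hx τ hτ).2, ?_⟩⟩
  · obtain ⟨h1, h2, h3, -⟩ := (hx τ hτ).1 N hN
    exact ⟨h1, h2, h3⟩
  · have h0 : (0 : ℝ) ∈ Icc 0 N₀ := ⟨le_rfl, hN₀.le⟩
    obtain ⟨-, -, -, h4⟩ := (hx τ hτ).1 0 h0
    let p : Params τ₁ := ⟨(τ, 0), hτ₀.trans hτ, le_rfl, zero_le_one⟩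
    have h1 : ‖Ψ p x₀‖ ≤ C * smallness τ 0 := (hΨ p).1 x₀ (hsub hx₀)
    rw [hΦ p x₀ (hsub hx₀), hΘ0, add_zero, add_sub_cancel_left] at h4
    linarith

theorem bddLip_id {P E : Type*} [NormedAddCommGroup E] (x₀ : E) (r : ℝ) :
    BddLip (fun _ : P => closedBall x₀ r) (fun _ => 1) (fun _ x => x) := by
  refine ⟨max 1 (‖x₀‖ + r), zero_le_one.trans (le_max_left _ _), fun p => ⟨fun x hx => ?_,
    fun x _ y _ => ?_⟩⟩
  · rw [mem_closedBall_iff_norm] at hx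
    have := norm_add_le (x - x₀) x₀
    rw [sub_add_cancel] at this
    rw [mul_one]
    exact le_trans (by linarith) (le_max_right _ _)
  · rw [mul_one]
    exact le_mul_of_one_le_left (norm_nonneg _) (le_max_left _ _)

namespace ResonanceSystem

variable {H : Type*} [NormedAddCommGroup H] [InnerProductSpace ℂ H] (s : ResonanceSystem H)

/-- Bound on the logarithm on the half-size disc around a positive number. -/
theorem exists_norm_log_le {a : ℝ} (ha : 0 < a) :
    ∃ D, 0 ≤ D ∧ ∀ z ∈ closedBall (a : ℂ) (a / 2), ‖Complex.log z‖ ≤ D ∧ ‖z‖ ≤ D := by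
  refine ⟨‖Complex.log a‖ + 1 + 2 * a, by positivity, fun z hz => ⟨?_, ?_⟩⟩
  · have h1 := norm_log_sub_log_le ha hz (Metric.mem_closedBall_self (by positivity))
    have h2 := mem_closedBall_iff_norm.1 hz
    have h3 : 2 / a * ‖z - a‖ ≤ 2 / a * (a / 2) := by gcongr
    have h4 : 2 / a * (a / 2) = 1 := by field_simp
    have h5 := norm_add_le (Complex.log z - Complex.log a) (Complex.log a)
    rw [sub_add_cancel] at h5
    linarith
  · have h2 := mem_closedBall_iff_norm.1 hz
    have h5 := norm_add_le (z - a) a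
    rw [sub_add_cancel, Complex.norm_of_nonneg ha.le] at h5
    linarith [norm_nonneg (Complex.log a)]

/-- The large coefficient is indeed large. -/
theorem exists_le_norm_sub_coeff :
    ∃ T : ℝ, ∀ τ ≥ T, ∀ z ∈ closedBall (s.lam : ℂ) (s.lam / 2),
      s.κ * log τ / 2 ≤ ‖z - s.coeff τ z‖ := by
  obtain ⟨D, hD, h⟩ := exists_norm_log_le s.lam_pos
  have hκ := s.κ_pos
  have h1 : ∀ᶠ τ in atTop, (2 / s.κ) * (D + s.κ * D + ‖s.c₀‖) ≤ log τ :=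
    Real.tendsto_log_atTop.eventually_ge_atTop _
  obtain ⟨T, hT⟩ := eventually_atTop.1 (h1.and (eventually_ge_atTop 1))
  refine ⟨T, fun τ hτ z hz => ?_⟩
  obtain ⟨h2, h3⟩ := hT τ hτ
  obtain ⟨h4, h5⟩ := h z hz
  have hl : 0 ≤ log τ := Real.log_nonneg h3
  have h6 : D + s.κ * D + ‖s.c₀‖ ≤ s.κ * log τ / 2 := by
    rw [div_mul_eq_mul_div, div_le_iff₀ hκ] at h2
    linarith
  have h7 : ‖((s.κ * log τ : ℝ) : ℂ)‖ = s.κ * log τ := by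
    rw [Complex.norm_of_nonneg (by positivity)]
  have e : ((s.κ * log τ : ℝ) : ℂ) =
      z - s.κ * Complex.log z - s.c₀ - (z - s.coeff τ z) := by
    unfold coeff; push_cast; ring
  have h8 := norm_sub_le (z - s.κ * Complex.log z - s.c₀) (z - s.coeff τ z)
  rw [← e, h7] at h8
  have h9 : ‖z - s.κ * Complex.log z - s.c₀‖ ≤ D + s.κ * D + ‖s.c₀‖ := by
    refine (norm_sub_le _ _).trans (add_le_add_left ((norm_sub_le _ _).trans (add_le_add h5 ?_)) _)
    rw [norm_mul, Complex.norm_of_nonneg hκ.le]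
    exact mul_le_mul_of_nonneg_left h4 hκ.le
  linarith

theorem continuous_rest (τ : ℝ) (Z : ℂ) (u : H) : Continuous fun N => s.rest τ N Z u := by
  unfold rest nonlin
  fun_prop

theorem continuous_nonlin (u : H) : Continuous fun N => s.nonlin N u := by
  unfold nonlin
  fun_prop

/-- The principal branch. -/
theorem exists_branch_minus [CompleteSpace H] (rbar : ℝ) (hrbar : 0 < rbar) :
    ∃ r N₀ τ₀ C : ℝ, 0 < r ∧ r ≤ rbar ∧ r ≤ s.lam / 2 ∧ 0 < N₀ ∧ 3 ≤ τ₀ ∧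
      ∃ (Z : ℝ → ℝ → ℂ) (u : ℝ → ℝ → H), ∀ τ ≥ τ₀,
        (∀ N ∈ Icc 0 N₀, ‖Z τ N - s.lam‖ ≤ r ∧ ‖u τ N - s.φ‖ ≤ r ∧ ⟪s.φ, u τ N - s.φ⟫ = 0 ∧
          s.Solves τ N (Z τ N) (u τ N) ∧
          ∀ (z : ℂ) (v : H), ‖z - s.lam‖ ≤ r → ‖v - s.φ‖ ≤ r → ⟪s.φ, v - s.φ⟫ = 0 → s.Solves τ N z v →
            z = Z τ N ∧ v = u τ N) ∧
        ContinuousOn (Z τ) (Icc 0 N₀) ∧ ContinuousOn (u τ) (Icc 0 N₀) ∧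
        ‖Z τ 0 - s.lam‖ ≤ C * smallness τ 0 := by
  have hlam := s.lam_pos
  have hκ := s.κ_pos
  obtain ⟨T, hT⟩ := s.exists_le_norm_sub_coeff
  set r₁ := min (s.lam / 2) (1 / 2) with hr₁
  have hr₁0 : 0 < r₁ := by positivity
  set τ₁ := max (max 3 T) (2 / s.lam) with hτ₁
  have hτ₁3 : 3 ≤ τ₁ := (le_max_left _ _).trans (le_max_left _ _)
  set x₀ : ℂ × H := (s.lam, 0) with hx₀
  set S : Params τ₁ → Set (ℂ × H) := fun _ => closedBall x₀ r₁ with hS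
  have hmem1 : ∀ p, ∀ x ∈ S p, ∀ r, x ∈ closedBall x₀ r → ‖x.1 - s.lam‖ ≤ r ∧ ‖x.2‖ ≤ r := by
    intro p x _ r hx
    rw [mem_closedBall_iff_norm, Prod.norm_def] at hx
    have h1 := max_le_iff.1 hx
    simpa [hx₀] using h1
  have hmem : ∀ p, ∀ x ∈ S p, x.1 ∈ closedBall (s.lam : ℂ) (s.lam / 2) ∧ ‖x.2‖ ≤ 1 / 2 := by
    intro p x hx
    obtain ⟨h1, h2⟩ := hmem1 p x hx r₁ hx
    exact ⟨mem_closedBall_iff_norm.2 (h1.trans (min_le_left _ _)), h2.trans (min_le_right _ _)⟩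
  have hid : BddLip S (fun _ => 1) (fun _ x => x) := bddLip_id x₀ r₁
  have hZ : BddLip S (fun _ => 1) (fun _ x => x.1) := hid.clm (ContinuousLinearMap.fst ℂ ℂ H)
  have hψ : BddLip S (fun _ => 1) (fun _ x => x.2) := hid.clm (ContinuousLinearMap.snd ℂ ℂ H)
  have hU : BddLip S (fun _ => 1) (fun _ x => s.φ + x.2) := (BddLip.const s.φ).add hψ
  have hU1 : ∀ p, ∀ x ∈ S p, 1 / 2 ≤ ‖s.φ + x.2‖ := by
    intro p x hx
    have h1 := (hmem p x hx).2
    have h2 := norm_sub_norm_le s.φ (-x.2)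
    rw [norm_neg, sub_neg_eq_add, s.norm_φ] at h2
    linarith
  have hl1 : ∀ p : Params τ₁, 1 ≤ log p.1.1 := fun p => one_le_log (hτ₁3.trans p.2.1)
  have hC : BddLip S (fun p => log p.1.1) (fun p x => s.coeff p.1.1 x.1) := by
    have h1 : BddLip S (fun p => log p.1.1) (fun p _ => ((log p.1.1 : ℝ) : ℂ)) :=
      BddLip.of_le 1 zero_le_one fun p => by
        rw [Complex.norm_of_nonneg (by linarith [hl1 p]), one_mul]
    have h2 : BddLip S (fun p => log p.1.1) (fun p x => Complex.log x.1) :=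
      (hZ.clog hlam fun p x hx => (hmem p x hx).1).mono 1 zero_le_one fun p => by
        simpa using hl1 p
    have h3 : BddLip S (fun p => log p.1.1) (fun _ _ => s.c₀) :=
      (BddLip.const s.c₀).mono 1 zero_le_one fun p => by simpa using hl1 p
    have h4 := ((BddLip.const (S := S) (s.κ : ℂ)).smul (h1.add h2)).mono
      (ρ' := fun p => log p.1.1) 1 zero_le_one fun p => by simp
    exact h4.add h3
  have hτ0 : ∀ p : Params τ₁, 0 < p.1.1 := fun p => by linarith [hτ₁3.trans p.2.1]
  have hq0 : BddLip S (fun _ => 1) (fun _ x => x.1⁻¹) :=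
    (hZ.inv (m := fun _ => s.lam / 2) (fun _ => by positivity)
      (fun p x hx => half_le_norm_of_mem_closedBall hlam (hmem p x hx).1) (2 / s.lam)
      (by positivity) (fun _ => by field_simp; rfl)).mono (2 / s.lam) (by positivity)
      (fun _ => by field_simp; rfl)
  have hq : BddLip S (fun p => p.1.1⁻¹) (fun p x => (p.1.1 * x.1)⁻¹) := by
    have h1 : BddLip S (fun p => p.1.1⁻¹) (fun p _ => ((p.1.1 : ℝ) : ℂ)⁻¹) :=
      BddLip.of_le 1 zero_le_one fun p => by
        rw [norm_inv, Complex.norm_of_nonneg (hτ0 p).le, one_mul]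
    simpa only [mul_inv, smul_eq_mul, mul_one] using h1.smul hq0
  have hq1 : ∀ p, ∀ x ∈ S p, ‖((p : Params τ₁).1.1 * x.1 : ℂ)⁻¹‖ ≤ 1 := by
    intro p x hx
    have h1 := half_le_norm_of_mem_closedBall hlam (hmem p x hx).1
    have h2 : 2 / s.lam ≤ p.1.1 := (le_max_right _ _).trans p.2.1
    rw [norm_inv, norm_mul, Complex.norm_of_nonneg (hτ0 p).le]
    refine inv_le_one_of_one_le₀ ?_
    calc (1 : ℝ) = 2 / s.lam * (s.lam / 2) := by field_simp
      _ ≤ p.1.1 * ‖x.1‖ := mul_le_mul h2 h1 (by positivity) (hτ0 p).le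
  have hrest := s.bddLip_rest hτ₁3 hU hU1 hC hq hq1
  have hn := s.bddLip_nonlin hU hU1
  have hinv : BddLip S (fun p => (log p.1.1)⁻¹) (fun p x => (x.1 - s.coeff p.1.1 x.1)⁻¹) := by
    have h1 : BddLip S (fun p => log p.1.1) (fun p x => x.1 - s.coeff p.1.1 x.1) :=
      (hZ.mono 1 zero_le_one fun p => by simpa using hl1 p).sub hC
    refine (h1.inv (m := fun p => s.κ * log p.1.1 / 2) (fun p => ?_) (fun p x hx => ?_)
      (2 / s.κ) (by positivity) (fun p => by field_simp; rfl)).mono (2 / s.κ) (by positivity)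
      fun p => ?_
    · have := hl1 p; positivity
    · exact hT p.1.1 (((le_max_right _ _).trans (le_max_left _ _)).trans p.2.1) _ (hmem p x hx).1
    · have := hl1 p; field_simp; rfl
  have ha : BddLip S (fun p => smallness p.1.1 p.1.2)
      (fun p x => s.meanAmp p.1.1 p.1.2 x.1 (s.φ + x.2)) := by
    have h1 := hn.clm (innerSL ℂ s.e)
    have h2 := (hinv.smul (hC.smul h1)).mono (ρ' := fun p => smallness p.1.1 p.1.2) 1 zero_le_one
      fun p => by
        have := hl1 p
        have h3 := inv_nonneg.2 (Real.sqrt_nonneg (log p.1.1))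
        rw [inv_mul_cancel_left₀ (by positivity)]
        unfold smallness; linarith
    have h3 : BddLip S (fun _ => 1) (fun p x => s.K (s.φ + x.2)
        + s.rest p.1.1 p.1.2 x.1 (s.φ + x.2)) :=
      (hU.clm s.K).add (hrest.mono 2 zero_le_two fun p => by
        linarith [smallness_le (hτ₁3.trans p.2.1) p.2.2.2])
    have h4 := (hinv.smul (h3.clm (innerSL ℂ s.e))).mono (ρ' := fun p => smallness p.1.1 p.1.2) 1
      zero_le_one fun p => by
        rw [mul_one, one_mul]; exact inv_log_le_smallness (hτ₁3.trans p.2.1) p.2.2.1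
    have h5 := h2.add h4
    simpa only [meanAmp, mul_add, smul_eq_mul, innerSL_apply_apply] using h5
  let Ψ : Params τ₁ → ℂ × H → ℂ × H := fun p x =>
    (⟪s.φ, s.rest p.1.1 p.1.2 x.1 (s.φ + x.2)⟫,
      s.meanAmp p.1.1 p.1.2 x.1 (s.φ + x.2) • s.e +
      s.S (s.meanAmp p.1.1 p.1.2 x.1 (s.φ + x.2) • s.K s.e
        + s.rest p.1.1 p.1.2 x.1 (s.φ + x.2)))
  let Θ : ℂ × H → ℂ × H := fun x => (0, -s.S ((x.1 - s.lam) • x.2))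
  have hΨ : BddLip S (fun p => smallness p.1.1 p.1.2) Ψ := by
    have h1 : ∀ v : H, BddLip S (fun p => smallness p.1.1 p.1.2)
        (fun p x => s.meanAmp p.1.1 p.1.2 x.1 (s.φ + x.2) • v) := fun v =>
      (ha.smul (BddLip.const v)).mono 1 zero_le_one fun p => by simp
    exact (hrest.clm (innerSL ℂ s.φ)).prodMk
      ((h1 s.e).add (((h1 (s.K s.e)).add hrest).clm s.S))
  obtain ⟨r, N₀, τ₀, C, h1, h2, h3, h4, h5, h6, x, hx⟩ := exists_fixedPoints_of_bddLip x₀ hr₁0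
    (D := 2 * ‖s.S‖) (by positivity) s.mapMinus Ψ Θ
    (fun p x _ => by
      simp only [mapMinus, hx₀, Ψ, Θ, Prod.mk_add_mk, add_zero, zero_add, Prod.mk.injEq, true_and]
      rw [map_sub]; abel)
    hΨ (by simp [Θ, hx₀]) (fun r hr x hx y hy => by
      have hp : Params τ₁ := ⟨(τ₁, 0), le_rfl, le_rfl, zero_le_one⟩
      obtain ⟨hx1, hx2⟩ := hmem1 hp x (Metric.closedBall_subset_closedBall hr hx) r hx
      obtain ⟨hy1, hy2⟩ := hmem1 hp y (Metric.closedBall_subset_closedBall hr hy) r hy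
      have e : Θ x - Θ y = (0, -s.S ((x.1 - s.lam) • (x.2 - y.2) + (x.1 - y.1) • y.2)) := by
        simp only [Θ, Prod.mk_sub_mk, sub_zero, Prod.mk.injEq, true_and]
        rw [neg_sub_neg, ← map_sub, ← map_neg]
        congr 1; module
      have hn1 : ‖x.1 - y.1‖ ≤ ‖x - y‖ := norm_fst_le (x - y)
      have hn2 : ‖x.2 - y.2‖ ≤ ‖x - y‖ := norm_snd_le (x - y)
      have hr0 : 0 ≤ r := (norm_nonneg _).trans hx2
      have h7 : ‖(x.1 - s.lam) • (x.2 - y.2) + (x.1 - y.1) • y.2‖ ≤ 2 * r * ‖x - y‖ := by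
        refine (norm_add_le _ _).trans ?_
        rw [norm_smul, norm_smul]
        have h8 := mul_le_mul hx1 hn2 (norm_nonneg _) hr0
        have h9 := mul_le_mul hn1 hy2 (norm_nonneg _) (norm_nonneg _)
        linarith
      rw [e, Prod.norm_def, norm_zero, norm_neg, max_eq_right (norm_nonneg _)]
      refine (s.S.le_opNorm _).trans ?_
      have := mul_le_mul_of_nonneg_left h7 (norm_nonneg s.S)
      linarith)
    (fun τ x => by
      have h1 := s.continuous_rest τ x.1 (s.φ + x.2)
      have h2 := s.continuous_nonlin (s.φ + x.2)
      unfold mapMinus meanAmp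
      fun_prop) rbar hrbar
  have hτ₀ : 3 ≤ τ₀ := hτ₁3.trans h6
  have hne : ∀ τ ≥ τ₀, ∀ z : ℂ, ‖z - s.lam‖ ≤ r → z - s.coeff τ z ≠ 0 := by
    intro τ hτ z hz h0
    have h7 := hT τ ((((le_max_right _ _).trans (le_max_left _ _)).trans h6).trans hτ) z
      (mem_closedBall_iff_norm.2 (hz.trans (h3.trans (min_le_left _ _))))
    rw [h0, norm_zero] at h7
    have := one_le_log (hτ₀.trans hτ)
    nlinarith
  refine ⟨r, N₀, τ₀, C, h1, h2, h3.trans (min_le_left _ _), h4, hτ₀,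
    fun τ N => (x τ N).1, fun τ N => s.φ + (x τ N).2, fun τ hτ => ?_⟩
  obtain ⟨hx1, hx2, hx3⟩ := hx τ hτ
  refine ⟨fun N hN => ?_, hx2.fst, continuousOn_const.add hx2.snd,
    (norm_fst_le (x τ 0 - x₀)).trans hx3⟩
  obtain ⟨hb, hfix, huniq⟩ := hx1 N hN
  have hp : Params τ₁ := ⟨(τ₁, 0), le_rfl, le_rfl, zero_le_one⟩
  obtain ⟨hb1, hb2⟩ := hmem1 hp _ (Metric.closedBall_subset_closedBall h3 hb) r hb
  obtain ⟨h7, h8⟩ := (s.mapMinus_fixed_iff (τ := τ) (N := N) (Z := (x τ N).1) (ψ := (x τ N).2)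
    (hne τ hτ _ hb1)).1 hfix
  simp only [add_sub_cancel_left]
  refine ⟨hb1, hb2, h7, h8, fun z v hz hv hφv hsol => ?_⟩
  have h9 := (s.mapMinus_fixed_iff (τ := τ) (N := N) (Z := z) (ψ := v - s.φ)
    (hne τ hτ _ hz)).2 ⟨hφv, by rwa [add_sub_cancel]⟩
  have h10 := huniq (z, v - s.φ) (by
    rw [mem_closedBall_iff_norm, Prod.norm_def]
    exact max_le (by simpa [hx₀] using hz) (by simpa [hx₀] using hv)) h9
  rw [← h10]
  simp

end ResonanceSystem

namespace ResonanceSystem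

variable {H : Type*} [NormedAddCommGroup H] [InnerProductSpace ℂ H] (s : ResonanceSystem H)

theorem exists_le_large (M : ℝ) : ∃ T : ℝ, ∀ τ ≥ T, M ≤ s.large τ :=
  eventually_atTop.1 ((Real.tendsto_log_atTop.const_mul_atTop s.κ_pos).eventually_ge_atTop M)

theorem coeff_large {τ : ℝ} (h : 0 < s.large τ) {ζ : ℂ} (hζ : ζ ≠ 0) :
    s.coeff τ (s.large τ * ζ) =
      s.large τ + (s.κ * (log (s.large τ) + Complex.log ζ) + s.c₀) := by
  unfold coeff
  rw [Complex.log_ofReal_mul h hζ]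
  unfold large
  push_cast
  ring

theorem abs_log_large_div_le {τ : ℝ} (hτ : 3 ≤ τ) :
    |log (s.large τ)| ≤ (|log s.κ| + 2) * sqrt (log τ) := by
  have h1 := one_le_log hτ
  have h2 : 1 ≤ sqrt (log τ) := Real.one_le_sqrt.2 h1
  unfold large
  rw [Real.log_mul s.κ_pos.ne' (by positivity)]
  refine (abs_add_le _ _).trans ?_
  rw [abs_of_nonneg (Real.log_nonneg h1)]
  have h3 := log_le_two_sqrt (x := log τ) (by linarith)
  nlinarith [abs_nonneg (log s.κ)]

/-- The branch of the constant mode. -/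
theorem exists_branch_plus [CompleteSpace H] (rbar : ℝ) (hrbar : 0 < rbar) :
    ∃ r N₀ τ₀ C : ℝ, 0 < r ∧ r ≤ rbar ∧ r ≤ 1 / 2 ∧ 0 < N₀ ∧ 3 ≤ τ₀ ∧
      ∃ (ζ : ℝ → ℝ → ℂ) (u : ℝ → ℝ → H), ∀ τ ≥ τ₀,
        (∀ N ∈ Icc 0 N₀, ‖ζ τ N - 1‖ ≤ r ∧ ‖u τ N - s.e‖ ≤ r ∧ ⟪s.e, u τ N - s.e⟫ = 0 ∧
          s.Solves τ N (s.large τ * ζ τ N) (u τ N) ∧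
          ∀ (z : ℂ) (v : H), ‖z - 1‖ ≤ r → ‖v - s.e‖ ≤ r → ⟪s.e, v - s.e⟫ = 0 →
            s.Solves τ N (s.large τ * z) v → z = ζ τ N ∧ v = u τ N) ∧
        ContinuousOn (ζ τ) (Icc 0 N₀) ∧ ContinuousOn (u τ) (Icc 0 N₀) ∧
        ‖ζ τ 0 - 1‖ ≤ C * smallness τ 0 := by
  have hκ := s.κ_pos
  obtain ⟨T, hT⟩ := s.exists_le_large 2
  set τ₁ := max 3 T with hτ₁
  have hτ₁3 : 3 ≤ τ₁ := le_max_left _ _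
  set x₀ : ℂ × H := (1, 0) with hx₀
  set S : Params τ₁ → Set (ℂ × H) := fun _ => closedBall x₀ (1 / 2) with hS
  have hmem1 : ∀ x, ∀ r, x ∈ closedBall x₀ r → ‖x.1 - 1‖ ≤ r ∧ ‖x.2‖ ≤ r := by
    intro x r hx
    rw [mem_closedBall_iff_norm, Prod.norm_def] at hx
    have h1 := max_le_iff.1 hx
    simpa [hx₀] using h1
  have hball : ∀ z : ℂ, ‖z - 1‖ ≤ 1 / 2 → z ∈ closedBall ((1 : ℝ) : ℂ) (1 / 2) := by
    intro z hz
    rw [mem_closedBall_iff_norm, Complex.ofReal_one]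
    exact hz
  have hmem : ∀ p, ∀ x ∈ S p, x.1 ∈ closedBall ((1 : ℝ) : ℂ) (1 / 2) ∧ ‖x.2‖ ≤ 1 / 2 := by
    intro p x hx
    obtain ⟨h1, h2⟩ := hmem1 x (1 / 2) hx
    exact ⟨hball _ h1, h2⟩
  have hid : BddLip S (fun _ => 1) (fun _ x => x) := bddLip_id x₀ (1 / 2)
  have hζ : BddLip S (fun _ => 1) (fun _ x => x.1) := hid.clm (ContinuousLinearMap.fst ℂ ℂ H)
  have hψ : BddLip S (fun _ => 1) (fun _ x => x.2) := hid.clm (ContinuousLinearMap.snd ℂ ℂ H)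
  have hU : BddLip S (fun _ => 1) (fun _ x => s.e + x.2) := (BddLip.const s.e).add hψ
  have hU1 : ∀ p, ∀ x ∈ S p, 1 / 2 ≤ ‖s.e + x.2‖ := by
    intro p x hx
    have h1 := (hmem p x hx).2
    have h2 := norm_sub_norm_le s.e (-x.2)
    rw [norm_neg, sub_neg_eq_add, s.norm_e] at h2
    linarith
  have hζ1 : ∀ p, ∀ x ∈ S p, 1 / 2 ≤ ‖x.1‖ := fun p x hx =>
    half_le_norm_of_mem_closedBall one_pos (hmem p x hx).1
  have hl1 : ∀ p : Params τ₁, 1 ≤ log p.1.1 := fun p => one_le_log (hτ₁3.trans p.2.1)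
  have hL2 : ∀ p : Params τ₁, 2 ≤ s.large p.1.1 := fun p => hT _ ((le_max_right _ _).trans p.2.1)
  have hη : BddLip S (fun p => sqrt (log p.1.1)) (fun p x =>
      s.κ * (log (s.large p.1.1) + Complex.log x.1) + s.c₀) := by
    have h0 : ∀ p : Params τ₁, 1 ≤ sqrt (log p.1.1) := fun p =>
      Real.one_le_sqrt.2 (hl1 p)
    have h1 : BddLip S (fun p => sqrt (log p.1.1))
        (fun p _ => ((log (s.large p.1.1) : ℝ) : ℂ)) :=
      BddLip.of_le (|log s.κ| + 2) (by positivity) fun p => by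
        rw [Complex.norm_real]; exact s.abs_log_large_div_le (hτ₁3.trans p.2.1)
    have h2 : BddLip S (fun p => sqrt (log p.1.1)) (fun p x => Complex.log x.1) :=
      (hζ.clog one_pos fun p x hx => (hmem p x hx).1).mono 1 zero_le_one fun p => by
        simpa using h0 p
    have h3 : BddLip S (fun p => sqrt (log p.1.1)) (fun _ _ => s.c₀) :=
      (BddLip.const s.c₀).mono 1 zero_le_one fun p => by simpa using h0 p
    have h4 := ((BddLip.const (S := S) (s.κ : ℂ)).smul (h1.add h2)).mono
      (ρ' := fun p => sqrt (log p.1.1)) 1 zero_le_one fun p => by simp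
    exact h4.add h3
  have hΛ : BddLip S (fun p => (log p.1.1)⁻¹) (fun p _ => ((s.large p.1.1 : ℝ) : ℂ)⁻¹) :=
    BddLip.of_le s.κ⁻¹ (by positivity) fun p => by
      rw [norm_inv, Complex.norm_of_nonneg (by linarith [hL2 p]), large, mul_inv]
  have hΛη := (hΛ.smul hη).mono (ρ' := fun p => smallness p.1.1 p.1.2) 1 zero_le_one fun p => by
    have h1 := hl1 p
    have h2 : 0 < sqrt (log p.1.1) := Real.sqrt_pos.2 (by linarith)
    have h3 : (log p.1.1)⁻¹ * sqrt (log p.1.1)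
        = (sqrt (log p.1.1))⁻¹ := by
      nth_rewrite 1 [← Real.mul_self_sqrt (show 0 ≤ log p.1.1 by linarith)]
      rw [mul_inv, mul_assoc, inv_mul_cancel₀ h2.ne', mul_one]
    have h4 := p.2.2.1
    unfold smallness
    linarith
  have hsol0 : ∀ p : Params τ₁, ∀ x ∈ S p, s.coeff p.1.1 (s.large p.1.1 * x.1) =
      s.large p.1.1 + (s.κ * (log (s.large p.1.1) + Complex.log x.1) + s.c₀) := by
    intro p x hx
    refine s.coeff_large (by linarith [hL2 p]) (norm_pos_iff.1 ?_)
    linarith [hζ1 p x hx]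
  have hC : BddLip S (fun p => log p.1.1)
      (fun p x => s.coeff p.1.1 (s.large p.1.1 * x.1)) := by
    have h1 : BddLip S (fun p => log p.1.1) (fun p _ => ((s.large p.1.1 : ℝ) : ℂ)) :=
      BddLip.of_le s.κ hκ.le fun p => by
        rw [Complex.norm_of_nonneg (by linarith [hL2 p]), large]
    have h2 := h1.add (hη.mono (ρ' := fun p => log p.1.1) 1 zero_le_one fun p => by
      rw [one_mul, Real.sqrt_le_left (by linarith [hl1 p])]; nlinarith [hl1 p])
    obtain ⟨C, hC, h⟩ := h2
    refine ⟨C, hC, fun p => ⟨fun x hx => ?_, fun x hx y hy => ?_⟩⟩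
    · beta_reduce; rw [hsol0 p x hx]; exact (h p).1 x hx
    · beta_reduce; rw [hsol0 p x hx, hsol0 p y hy]; exact (h p).2 x hx y hy
  have hτ0 : ∀ p : Params τ₁, 0 < p.1.1 := fun p => by linarith [hτ₁3.trans p.2.1]
  have hζi : BddLip S (fun _ => 1) (fun _ x => x.1⁻¹) :=
    (hζ.inv (m := fun _ => 1 / 2) (fun _ => by positivity) hζ1 2
      (by positivity) (fun _ => by norm_num)).mono 2 (by positivity) (fun _ => by norm_num)
  have hZi : BddLip S (fun p => (log p.1.1)⁻¹) (fun p x => (s.large p.1.1 * x.1)⁻¹) := by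
    simpa only [mul_inv, smul_eq_mul, mul_one] using hΛ.smul hζi
  have hq : BddLip S (fun p => p.1.1⁻¹) (fun p x => (p.1.1 * (s.large p.1.1 * x.1))⁻¹) := by
    have h1 : BddLip S (fun p => p.1.1⁻¹) (fun p _ => ((p.1.1 : ℝ) : ℂ)⁻¹) :=
      BddLip.of_le 1 zero_le_one fun p => by
        rw [norm_inv, Complex.norm_of_nonneg (hτ0 p).le, one_mul]
    have h2 := (h1.smul hZi).mono (ρ' := fun p => p.1.1⁻¹) 1 zero_le_one fun p => by
      rw [one_mul]
      exact mul_le_of_le_one_right (inv_nonneg.2 (hτ0 p).le) (inv_le_one_of_one_le₀ (hl1 p))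
    simpa only [mul_inv, smul_eq_mul] using h2
  have hq1 : ∀ p, ∀ x ∈ S p,
      ‖((p : Params τ₁).1.1 * (s.large p.1.1 * x.1) : ℂ)⁻¹‖ ≤ 1 := by
    intro p x hx
    have h2 : 1 ≤ p.1.1 := by linarith [hτ₁3.trans p.2.1]
    rw [norm_inv, norm_mul, norm_mul, Complex.norm_of_nonneg (hτ0 p).le,
      Complex.norm_of_nonneg (by linarith [hL2 p])]
    refine inv_le_one_of_one_le₀ ?_
    have h3 : 1 ≤ s.large p.1.1 * ‖x.1‖ := by nlinarith [hL2 p, hζ1 p x hx]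
    nlinarith
  have hrest := s.bddLip_rest hτ₁3 hU hU1 hC hq hq1
  have hn := s.bddLip_nonlin hU hU1
  have hh : BddLip S (fun _ => 1) (fun p x => s.K (s.e + x.2)
      + s.rest p.1.1 p.1.2 (s.large p.1.1 * x.1) (s.e + x.2)) :=
    (hU.clm s.K).add (hrest.mono 2 zero_le_two fun p => by
      linarith [smallness_le (hτ₁3.trans p.2.1) p.2.2.2])
  have hl : ∀ p : Params τ₁, (log p.1.1)⁻¹ * 1 ≤ 1 * smallness p.1.1 p.1.2 := fun p => by
    rw [mul_one, one_mul]; exact inv_log_le_smallness (hτ₁3.trans p.2.1) p.2.2.1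
  have hN : ∀ p : Params τ₁, p.1.2 ≤ 1 * smallness p.1.1 p.1.2 := fun p => by
    have h3 := inv_nonneg.2 (Real.sqrt_nonneg (log p.1.1))
    unfold smallness; linarith
  let Ψ : Params τ₁ → ℂ × H → ℂ × H := fun p x =>
    ((s.large p.1.1 : ℂ)⁻¹ • (s.κ * (log (s.large p.1.1) + Complex.log x.1) + s.c₀)
      + (⟪s.e, s.nonlin p.1.2 (s.e + x.2)⟫ + ((s.large p.1.1 : ℂ)⁻¹ • (s.κ *
        (log (s.large p.1.1) + Complex.log x.1) + s.c₀)) •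
          ⟪s.e, s.nonlin p.1.2 (s.e + x.2)⟫)
      + (s.large p.1.1 : ℂ)⁻¹ • ⟪s.e, s.K (s.e + x.2)
          + s.rest p.1.1 p.1.2 (s.large p.1.1 * x.1) (s.e + x.2)⟫,
    (s.large p.1.1 * x.1)⁻¹ • (s.K (s.e + x.2)
        + s.rest p.1.1 p.1.2 (s.large p.1.1 * x.1) (s.e + x.2)
      - ⟪s.e, s.K (s.e + x.2) + s.rest p.1.1 p.1.2 (s.large p.1.1 * x.1) (s.e + x.2)⟫ • s.e))
  have hΨ : BddLip S (fun p => smallness p.1.1 p.1.2) Ψ := by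
    have h1 := (hn.clm (innerSL ℂ s.e)).mono (ρ' := fun p => smallness p.1.1 p.1.2) 1 zero_le_one hN
    have h2 := (hΛη.smul h1).mono (ρ' := fun p => smallness p.1.1 p.1.2) 2 zero_le_two fun p =>
      mul_le_mul_of_nonneg_right (smallness_le (hτ₁3.trans p.2.1) p.2.2.2)
        (smallness_nonneg p.2.2.1)
    have h3 := (hΛ.smul (hh.clm (innerSL ℂ s.e))).mono (ρ' := fun p => smallness p.1.1 p.1.2) 1
      zero_le_one hl
    have h4 := (((hh.clm (innerSL ℂ s.e)).smul (BddLip.const s.e)).mono (ρ' := fun _ => 1) 1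
      zero_le_one fun _ => by norm_num)
    have h5 := (hZi.smul (hh.sub h4)).mono (ρ' := fun p => smallness p.1.1 p.1.2) 1
      zero_le_one hl
    exact ((hΛη.add (h1.add h2)).add h3).prodMk h5
  obtain ⟨r, N₀, τ₀, C, h1, h2, h3, h4, h5, h6, x, hx⟩ := exists_fixedPoints_of_bddLip x₀
    (r₁ := 1 / 2) (by norm_num) (D := 0) le_rfl s.mapPlus Ψ (fun _ => 0)
    (fun p x hx => by
      have hL : (s.large p.1.1 : ℂ) ≠ 0 := by
        have := hL2 p
        exact_mod_cast (by linarith : s.large p.1.1 ≠ 0)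
      simp only [mapPlus, hx₀, Ψ, Prod.mk_add_mk, add_zero, zero_add, Prod.mk.injEq, and_true]
      rw [hsol0 p x hx]
      simp only [smul_eq_mul]
      field_simp
      ring)
    hΨ rfl (fun r hr x hx y hy => by simp)
    (fun τ x => by
      have h1 := s.continuous_rest τ (s.large τ * x.1) (s.e + x.2)
      have h2 := s.continuous_nonlin (s.e + x.2)
      unfold mapPlus
      fun_prop) rbar hrbar
  have hτ₀ : 3 ≤ τ₀ := hτ₁3.trans h6
  have hne : ∀ z : ℂ, ‖z - 1‖ ≤ r → z ≠ 0 := by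
    intro z hz
    have := half_le_norm_of_mem_closedBall one_pos (hball z (hz.trans h3))
    exact norm_pos_iff.1 (by linarith)
  refine ⟨r, N₀, τ₀, C, h1, h2, h3, h4, hτ₀,
    fun τ N => (x τ N).1, fun τ N => s.e + (x τ N).2, fun τ hτ => ?_⟩
  have hL : (s.large τ : ℂ) ≠ 0 := by
    have := hT τ (((le_max_right _ _).trans h6).trans hτ)
    exact_mod_cast (by linarith : s.large τ ≠ 0)
  obtain ⟨hx1, hx2, hx3⟩ := hx τ hτ
  refine ⟨fun N hN => ?_, hx2.fst, continuousOn_const.add hx2.snd,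
    (norm_fst_le (x τ 0 - x₀)).trans hx3⟩
  obtain ⟨hb, hfix, huniq⟩ := hx1 N hN
  obtain ⟨hb1, hb2⟩ := hmem1 _ r hb
  obtain ⟨h7, h8⟩ := (s.mapPlus_fixed_iff (τ := τ) (N := N) (ζ := (x τ N).1) (v := (x τ N).2)
    hL (hne _ hb1)).1 hfix
  simp only [add_sub_cancel_left]
  refine ⟨hb1, hb2, h7, h8, fun z v hz hv hφv hsol => ?_⟩
  have h9 := (s.mapPlus_fixed_iff (τ := τ) (N := N) (ζ := z) (v := v - s.e)
    hL (hne _ hz)).2 ⟨hφv, by rwa [add_sub_cancel]⟩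
  have h10 := huniq (z, v - s.e) (by
    rw [mem_closedBall_iff_norm, Prod.norm_def]
    exact max_le (by simpa [hx₀] using hz) (by simpa [hx₀] using hv)) h9
  rw [← h10]
  simp

end ResonanceSystem

namespace ResonanceSystem

variable {H : Type*} [NormedAddCommGroup H] [InnerProductSpace ℂ H] (s : ResonanceSystem H)

theorem norm_inner_e_le (u : H) : ‖⟪s.e, u⟫‖ ≤ ‖u‖ := by
  simpa [s.norm_e] using norm_inner_le_norm (𝕜 := ℂ) s.e u

theorem norm_inner_φ_le (u : H) : ‖⟪s.φ, u⟫‖ ≤ ‖u‖ := by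
  simpa [s.norm_φ] using norm_inner_le_norm (𝕜 := ℂ) s.φ u

/-- A solution `u` of unit norm of the resonance equation, with general coefficients `Z`, `c`, `q`
and a small nonlinear term `n`. -/
structure Candidate (δ C₁ τ N : ℝ) (Z c q : ℂ) (u n : H) : Prop where
  norm_eq : ‖u‖ = 1
  norm_nonlin : ‖n‖ ≤ C₁ * N
  le_norm : δ ≤ ‖Z‖
  resolvent : ∀ w, ⟪s.e, w⟫ = 0 → ⟪s.φ, w⟫ = 0 → δ * ‖w‖ ≤ ‖Z • w - s.K w + ⟪s.e, s.K w⟫ • s.e‖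
  coeff : ‖c - (s.κ * (log τ + log ‖Z‖) : ℝ)‖ ≤ C₁
  norm_freq : ‖q‖ = (τ * ‖Z‖)⁻¹
  eq : Z • u = (c * ⟪s.e, u + n⟫) • s.e + s.K u + (s.K n + (c • s.J q + s.Y q) (u + n))

theorem abs_log_le {δ z : ℝ} (hδ : 0 < δ) (hz : δ ≤ z) : |log z| ≤ z * (1 + (δ ^ 2)⁻¹) := by
  have hz0 : 0 < z := hδ.trans_le hz
  have h0 : 0 ≤ z * (δ ^ 2)⁻¹ := by positivity
  rw [abs_le]
  constructor
  · have h1 := Real.log_le_sub_one_of_pos (inv_pos.2 hz0)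
    rw [Real.log_inv] at h1
    have h2 : z⁻¹ ≤ z * (δ ^ 2)⁻¹ := by
      rw [← div_eq_mul_inv, inv_eq_one_div, div_le_div_iff₀ hz0 (by positivity)]
      nlinarith
    linarith
  · have h1 := Real.log_le_sub_one_of_pos hz0
    linarith

theorem exists_norm_pert_le {δ C₁ : ℝ} (hδ : 0 < δ) (hC₁ : 0 ≤ C₁) :
    ∃ D T : ℝ, 0 ≤ D ∧ ∀ τ N : ℝ, 3 ≤ τ → T ≤ τ → 0 ≤ N → ∀ {Z c q : ℂ} {u n : H},
      s.Candidate δ C₁ τ N Z c q u n → ‖c • s.J q + s.Y q‖ ≤ D * smallness τ N := by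
  have hκ := s.κ_pos
  have hB := s.B_nonneg
  set A : ℝ := s.κ * (δ⁻¹ + (1 + (δ ^ 2)⁻¹)) + C₁ * δ⁻¹ with hA
  have hA0 : 0 ≤ A := by positivity
  refine ⟨s.B * (4 * A) + s.B * δ⁻¹, δ⁻¹, by positivity, fun τ N hτ hT hN Z c q u n h => ?_⟩
  have hτ0 : 0 < τ := by linarith
  have hl := one_le_log hτ
  have hZ0 : 0 < ‖Z‖ := hδ.trans_le h.le_norm
  have hZi : ‖Z‖⁻¹ ≤ δ⁻¹ := inv_anti₀ hδ h.le_norm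
  have hq1 : ‖q‖ ≤ τ⁻¹ * δ⁻¹ := by
    rw [h.norm_freq, mul_inv]; exact mul_le_mul_of_nonneg_left hZi (by positivity)
  have hq : q ∈ 𝔻 := by
    rw [mem_closedBall_zero_iff, h.norm_freq]
    refine inv_le_one_of_one_le₀ ?_
    calc 1 = δ⁻¹ * δ := by field_simp
      _ ≤ τ * ‖Z‖ := mul_le_mul hT h.le_norm hδ.le hτ0.le
  have h0 : (0 : ℂ) ∈ 𝔻 := Metric.mem_closedBall_self zero_le_one
  have hJ := s.J_lip q hq 0 h0
  have hY := s.Y_lip q hq 0 h0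
  rw [s.J_zero, sub_zero, sub_zero] at hJ
  rw [s.Y_zero, sub_zero, sub_zero] at hY
  have hc : ‖c‖ ≤ s.κ * (log τ + |log ‖Z‖|) + C₁ := by
    have h1 := norm_add_le (c - (s.κ * (log τ + log ‖Z‖) : ℝ))
      ((s.κ * (log τ + log ‖Z‖) : ℝ) : ℂ)
    rw [sub_add_cancel, Complex.norm_real, Real.norm_eq_abs, abs_mul, abs_of_pos hκ] at h1
    have h2 := abs_add_le (log τ) (log ‖Z‖)
    rw [abs_of_nonneg (by linarith : 0 ≤ log τ)] at h2
    have h3 := mul_le_mul_of_nonneg_left h2 hκ.le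
    linarith [h.coeff]
  have hcq : ‖c‖ * ‖Z‖⁻¹ ≤ A * log τ := by
    have h1 : |log ‖Z‖| * ‖Z‖⁻¹ ≤ 1 + (δ ^ 2)⁻¹ := by
      rw [← div_eq_mul_inv, div_le_iff₀ hZ0, mul_comm]
      exact abs_log_le hδ h.le_norm
    have h3 : 0 ≤ δ⁻¹ := by positivity
    calc ‖c‖ * ‖Z‖⁻¹ ≤ (s.κ * (log τ + |log ‖Z‖|) + C₁) * ‖Z‖⁻¹ :=
          mul_le_mul_of_nonneg_right hc (by positivity)
      _ = s.κ * (log τ * ‖Z‖⁻¹ + |log ‖Z‖| * ‖Z‖⁻¹) + C₁ * ‖Z‖⁻¹ := by ring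
      _ ≤ s.κ * (log τ * δ⁻¹ + log τ * (1 + (δ ^ 2)⁻¹)) + C₁ * (log τ * δ⁻¹) := by
          have h4 : log τ * ‖Z‖⁻¹ ≤ log τ * δ⁻¹ :=
            mul_le_mul_of_nonneg_left hZi (by linarith)
          have h5 : 1 + (δ ^ 2)⁻¹ ≤ log τ * (1 + (δ ^ 2)⁻¹) :=
            le_mul_of_one_le_left (by positivity) hl
          have h6 : ‖Z‖⁻¹ ≤ log τ * δ⁻¹ := hZi.trans (le_mul_of_one_le_left h3 hl)
          exact add_le_add (mul_le_mul_of_nonneg_left (by linarith) hκ.le)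
            (mul_le_mul_of_nonneg_left h6 hC₁)
      _ = A * log τ := by rw [hA]; ring
  have h1 : ‖c‖ * ‖q‖ ≤ A * (4 * smallness τ N) := by
    rw [h.norm_freq, mul_inv]
    calc ‖c‖ * (τ⁻¹ * ‖Z‖⁻¹) = (‖c‖ * ‖Z‖⁻¹) * τ⁻¹ := by ring
      _ ≤ (A * log τ) * τ⁻¹ := mul_le_mul_of_nonneg_right hcq (by positivity)
      _ = A * (log τ * τ⁻¹) := by ring
      _ ≤ _ := mul_le_mul_of_nonneg_left (log_mul_inv_le_smallness hτ hN) hA0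
  have h2 : ‖q‖ ≤ δ⁻¹ * smallness τ N := by
    refine hq1.trans ?_
    rw [mul_comm]
    exact mul_le_mul_of_nonneg_left (inv_le_smallness hτ hN) (by positivity)
  calc ‖c • s.J q + s.Y q‖ ≤ ‖c‖ * ‖s.J q‖ + ‖s.Y q‖ := by
        refine (norm_add_le _ _).trans ?_; rw [norm_smul]
    _ ≤ ‖c‖ * (s.B * ‖q‖) + s.B * ‖q‖ :=
        add_le_add (mul_le_mul_of_nonneg_left hJ (norm_nonneg _)) hY
    _ = s.B * (‖c‖ * ‖q‖) + s.B * ‖q‖ := by ring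
    _ ≤ s.B * (A * (4 * smallness τ N)) + s.B * (δ⁻¹ * smallness τ N) :=
        add_le_add (mul_le_mul_of_nonneg_left h1 hB) (mul_le_mul_of_nonneg_left h2 hB)
    _ = _ := by ring

set_option maxHeartbeats 2000000 in
/-- Every candidate is close to a multiple of one of the two modes. -/
theorem localization {δ C₁ : ℝ} (hδ : 0 < δ) (hC₁ : 0 ≤ C₁) {η : ℝ} (hη : 0 < η) :
    ∃ N₀ τ₀ : ℝ, 0 < N₀ ∧ 3 ≤ τ₀ ∧ ∀ τ N : ℝ, τ₀ ≤ τ → N ∈ Icc 0 N₀ → ∀ {Z c q : ℂ} {u n : H},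
      s.Candidate δ C₁ τ N Z c q u n →
      (∃ b : ℂ, 1 / 2 ≤ ‖b‖ ∧ ⟪s.e, b⁻¹ • u - s.e⟫ = 0 ∧ ‖b⁻¹ • u - s.e‖ ≤ η ∧
        ‖Z - s.large τ‖ ≤ η * s.large τ) ∨
      (∃ b : ℂ, 1 / 2 ≤ ‖b‖ ∧ ⟪s.φ, b⁻¹ • u - s.φ⟫ = 0 ∧ ‖b⁻¹ • u - s.φ‖ ≤ η ∧
        ‖Z - s.lam‖ ≤ η) := by
  have hκ := s.κ_pos
  obtain ⟨D, T, hD, hpert⟩ := s.exists_norm_pert_le hδ hC₁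
  obtain ⟨k, hk⟩ : ∃ x : ℝ, x = ‖s.K‖ := ⟨_, rfl⟩
  have hk0 : 0 ≤ k := hk ▸ norm_nonneg _
  -- bounds of the lower order terms
  obtain ⟨A, hA⟩ : ∃ x : ℝ, x = k * C₁ + D * (1 + C₁) := ⟨_, rfl⟩
  have hA0 : 0 ≤ A := by rw [hA]; positivity
  obtain ⟨M, hM⟩ : ∃ x : ℝ, x = k + 2 * A := ⟨_, rfl⟩
  have hM0 : 0 ≤ M := by rw [hM]; positivity
  -- constants of the principal mode
  obtain ⟨A₁, hA₁⟩ : ∃ x : ℝ, x = 2 * C₁ + 4 / s.κ * M := ⟨_, rfl⟩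
  have hA₁0 : 0 ≤ A₁ := by rw [hA₁]; positivity
  obtain ⟨A₂, hA₂⟩ : ∃ x : ℝ, x = 3 * (A₁ * k + A) / δ := ⟨_, rfl⟩
  have hA₂0 : 0 ≤ A₂ := by rw [hA₂]; positivity
  -- constants of the constant mode
  obtain ⟨A₃, hA₃⟩ : ∃ x : ℝ, x = 8 * M / s.κ := ⟨_, rfl⟩
  have hA₃0 : 0 ≤ A₃ := by rw [hA₃]; positivity
  obtain ⟨A₄, hA₄⟩ : ∃ x : ℝ, x = 4 * s.κ + 2 * (2 * C₁ + 2 * M) + 16 * s.κ ^ 2 := ⟨_, rfl⟩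
  have hA₄0 : 0 < A₄ := by rw [hA₄]; positivity
  obtain ⟨A₅, hA₅⟩ : ∃ x : ℝ, x = |log A₄| + |log (s.κ / 4)| + 2 := ⟨_, rfl⟩
  have hA₅0 : 0 ≤ A₅ := by rw [hA₅]; positivity
  obtain ⟨A₆, hA₆⟩ : ∃ x : ℝ, x = A₅ + C₁ / s.κ := ⟨_, rfl⟩
  have hA₆0 : 0 ≤ A₆ := by rw [hA₆]; positivity
  obtain ⟨A₇, hA₇⟩ : ∃ x : ℝ, x = 2 * C₁ * (1 + 2 * A₆) + 2 * M / s.κ + A₆ := ⟨_, rfl⟩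
  have hA₇0 : 0 ≤ A₇ := by rw [hA₇]; positivity
  obtain ⟨Q, hQ⟩ : ∃ x : ℝ, x = A₁ + A₂ + A + A₃ + A₇ + C₁ + 1 := ⟨_, rfl⟩
  have hQ0 : 0 < Q := by rw [hQ]; positivity
  have hlarge : ∀ᶠ τ in atTop, 2 * (|log δ| + C₁ / s.κ) + 1 ≤ log τ :=
    Real.tendsto_log_atTop.eventually_ge_atTop _
  obtain ⟨T', hT'⟩ := eventually_atTop.1 hlarge
  obtain ⟨N₀, hN₀, hN₀1, τ₀, hτ₀3, hτ₀T, hsm⟩ := exists_smallness_le (max T T')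
    (η := min (1 / 2) (η / 2) / Q) (by positivity)
  refine ⟨N₀, τ₀, hN₀, hτ₀3, fun τ N hτ hN Z c q u n h => ?_⟩
  set σ := smallness τ N with hσ
  have hτ3 : 3 ≤ τ := hτ₀3.trans hτ
  have hN0 : 0 ≤ N := hN.1
  have hσ0 : 0 ≤ σ := smallness_nonneg hN0
  have hQσ : Q * σ ≤ min (1 / 2) (η / 2) := by
    have := hsm τ hτ N hN.2
    rw [le_div_iff₀ hQ0] at this
    linarith
  have hQσ1 : Q * σ ≤ 1 / 2 := hQσ.trans (min_le_left _ _)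
  have hQσ2 : Q * σ ≤ η / 2 := hQσ.trans (min_le_right _ _)
  have hσ2 : σ ≤ 2 := smallness_le hτ3 (hN.2.trans hN₀1)
  have hl := one_le_log hτ3
  set l := log τ with hl'
  have hsq : 1 ≤ sqrt l := Real.one_le_sqrt.2 hl
  have hsqi : (sqrt l)⁻¹ ≤ σ := by simp only [hσ, smallness]; linarith
  have hNσ : N ≤ σ := by
    have := inv_nonneg.2 (Real.sqrt_nonneg l)
    simp only [hσ, smallness]; linarith
  have hli : l⁻¹ ≤ σ := inv_log_le_smallness hτ3 hN0
  have hN1 : N ≤ 1 := hN.2.trans hN₀1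
  have hE := hpert τ N hτ3 ((le_max_left _ _).trans (hτ₀T.trans hτ)) hN0 h
  have hlT := hT' τ ((le_max_right _ _).trans (hτ₀T.trans hτ))
  set g := s.K n + (c • s.J q + s.Y q) (u + n) with hg
  have hn : ‖n‖ ≤ C₁ * N := h.norm_nonlin
  have hn' : ‖n‖ ≤ C₁ * σ := hn.trans (mul_le_mul_of_nonneg_left hNσ hC₁)
  have hgn : ‖g‖ ≤ A * σ := by
    have h1 : ‖u + n‖ ≤ 1 + C₁ := by
      refine (norm_add_le _ _).trans ?_
      rw [h.norm_eq]
      nlinarith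
    calc ‖g‖ ≤ ‖s.K‖ * ‖n‖ + ‖c • s.J q + s.Y q‖ * ‖u + n‖ :=
          (norm_add_le _ _).trans (add_le_add (s.K.le_opNorm _)
            (ContinuousLinearMap.le_opNorm _ _))
      _ ≤ k * (C₁ * σ) + (D * σ) * (1 + C₁) :=
          add_le_add (by rw [← hk]; exact mul_le_mul_of_nonneg_left hn' hk0)
            (mul_le_mul hE h1 (norm_nonneg _) (by positivity))
      _ = A * σ := by rw [hA]; ring
  have hKu : ‖s.K u‖ ≤ k := by
    have := s.K.le_opNorm u
    rwa [h.norm_eq, mul_one, ← hk] at this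
  have hKg : ‖s.K u + g‖ ≤ M := by
    refine (norm_add_le _ _).trans ?_
    have : A * σ ≤ A * 2 := mul_le_mul_of_nonneg_left hσ2 hA0
    rw [hM]; linarith
  have hZ0 : 0 < ‖Z‖ := hδ.trans_le h.le_norm
  have heq := h.eq
  rw [add_assoc, ← hg] at heq
  have he := s.inner_e_e
  have hφ := s.inner_φ_φ
  have heφ := s.inner_e_φ
  have hφe := s.inner_φ_e
  set a := ⟪s.e, u⟫ with ha
  set b := ⟪s.φ, u⟫ with hb
  -- the equation for the mean
  have hea : (Z - c) * a = c * ⟪s.e, n⟫ + ⟪s.e, s.K u + g⟫ := by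
    have h1 := congrArg (fun v => ⟪s.e, v⟫) heq
    simp only [inner_add_right, inner_smul_right, he] at h1
    simp only [inner_add_right]
    linear_combination h1
  have hea' : ‖Z - c‖ * ‖a‖ ≤ ‖c‖ * (C₁ * N) + M := by
    rw [← norm_mul, hea]
    refine (norm_add_le _ _).trans (add_le_add ?_ ((s.norm_inner_e_le _).trans hKg))
    rw [norm_mul]
    exact mul_le_mul_of_nonneg_left ((s.norm_inner_e_le _).trans hn) (norm_nonneg _)
  -- size of the large coefficient
  have hclow : s.κ * l / 2 ≤ ‖c‖ := by
    have h1 := norm_sub_norm_le ((s.κ * (l + log ‖Z‖) : ℝ) : ℂ) c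
    rw [Complex.norm_real, Real.norm_eq_abs, norm_sub_rev] at h1
    have h2 := (le_abs_self _).trans (sub_le_iff_le_add.1 (h1.trans h.coeff))
    have h3 : log δ ≤ log ‖Z‖ := Real.log_le_log hδ h.le_norm
    have h4 := neg_abs_le (log δ)
    have h5 : s.κ * (l - |log δ|) ≤ s.κ * (l + log ‖Z‖) :=
      mul_le_mul_of_nonneg_left (by linarith) hκ.le
    have h6 : s.κ * (2 * (|log δ| + C₁ / s.κ) + 1) ≤ s.κ * l :=
      mul_le_mul_of_nonneg_left hlT hκ.le
    have h7 : s.κ * (C₁ / s.κ) = C₁ := by field_simp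
    nlinarith
  have hκl : 0 < s.κ * l := by positivity
  have hlarge' : s.large τ = s.κ * l := rfl
  by_cases hcase : ‖Z‖ ≤ ‖c‖ / 2
  · right
    have hZc : ‖c‖ / 2 ≤ ‖Z - c‖ := by
      have := norm_sub_norm_le c Z
      rw [norm_sub_rev] at this
      linarith
    have hab : ‖a‖ ≤ A₁ * σ := by
      have hc0 : 0 < ‖c‖ := by linarith
      have h1 : ‖c‖ / 2 * ‖a‖ ≤ ‖c‖ * (C₁ * N) + M :=
        (mul_le_mul_of_nonneg_right hZc (norm_nonneg _)).trans hea'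
      have h2 : ‖a‖ ≤ 2 * (C₁ * N) + 2 * M / ‖c‖ := by
        rw [← sub_le_iff_le_add', le_div_iff₀ hc0]
        linarith
      have h3 : 2 * M / ‖c‖ ≤ 2 * M / (s.κ * l / 2) :=
        div_le_div_of_nonneg_left (by positivity) (by positivity) hclow
      have h4 : 2 * M / (s.κ * l / 2) = 4 / s.κ * M * l⁻¹ := by field_simp; ring
      have h5 : 4 / s.κ * M * l⁻¹ ≤ 4 / s.κ * M * σ := mul_le_mul_of_nonneg_left hli (by positivity)
      have h6 : C₁ * N ≤ C₁ * σ := mul_le_mul_of_nonneg_left hNσ hC₁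
      rw [hA₁]; linarith
    have heb : (Z - s.lam) * b = ⟪s.φ, g⟫ := by
      have h1 := congrArg (fun v => ⟪s.φ, v⟫) heq
      simp only [inner_add_right, inner_smul_right, hφe, s.inner_φ_K] at h1
      linear_combination h1
    set w := u - a • s.e - b • s.φ with hw
    have hew : ⟪s.e, w⟫ = 0 := by
      simp only [hw, inner_sub_right, inner_smul_right, he, heφ]; ring
    have hφw : ⟪s.φ, w⟫ = 0 := by
      simp only [hw, inner_sub_right, inner_smul_right, hφ, hφe]; ring
    have hu : u = a • s.e + b • s.φ + w := by rw [hw]; abel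
    have hwb : ‖w‖ ≤ A₂ * σ := by
      have h1 := h.resolvent w hew hφw
      obtain ⟨α, β, hαβ⟩ : ∃ α β : ℂ, Z • w - s.K w + ⟪s.e, s.K w⟫ • s.e
          = a • s.K s.e + g + α • s.e + β • s.φ := by
        refine ⟨c * ⟪s.e, u + n⟫ - Z * a + ⟪s.e, s.K w⟫, s.lam * b - Z * b, ?_⟩
        have h2 : Z • w = Z • u - (Z * a) • s.e - (Z * b) • s.φ := by rw [hw]; module
        have h3 : s.K u = a • s.K s.e + (b * s.lam) • s.φ + s.K w := by
          nth_rewrite 1 [hu]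
          rw [map_add, map_add, map_smul, map_smul, s.K_φ]; module
        rw [h2, heq, h3]; module
      have h2 : Z • w - s.K w + ⟪s.e, s.K w⟫ • s.e = (a • s.K s.e + g)
          - ⟪s.e, a • s.K s.e + g⟫ • s.e - ⟪s.φ, a • s.K s.e + g⟫ • s.φ := by
        have h3 := congrArg (fun v => ⟪s.e, v⟫) hαβ
        have h4 := congrArg (fun v => ⟪s.φ, v⟫) hαβ
        simp only [inner_add_right, inner_sub_right, inner_smul_right, he, hφ, heφ, hφe, hew, hφw,
          s.inner_φ_K] at h3 h4
        have hα : α = -⟪s.e, a • s.K s.e + g⟫ := by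
          simp only [inner_add_right, inner_smul_right]; linear_combination -h3
        have hβ : β = -⟪s.φ, a • s.K s.e + g⟫ := by
          simp only [inner_add_right, inner_smul_right, s.inner_φ_K, hφe]
          linear_combination -h4
        rw [hαβ, hα, hβ]; module
      have h5 : ‖a • s.K s.e + g‖ ≤ (A₁ * k + A) * σ := by
        refine (norm_add_le _ _).trans ?_
        rw [norm_smul]
        have h6 : ‖s.K s.e‖ ≤ k := by
          have := s.K.le_opNorm s.e
          rwa [s.norm_e, mul_one, ← hk] at this
        have h7 := mul_le_mul hab h6 (norm_nonneg _) (by positivity)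
        linarith
      have h6 : ‖Z • w - s.K w + ⟪s.e, s.K w⟫ • s.e‖ ≤ 3 * ‖a • s.K s.e + g‖ := by
        rw [h2]
        refine (norm_sub_le _ _).trans ?_
        have h7 := norm_sub_le (a • s.K s.e + g) (⟪s.e, a • s.K s.e + g⟫ • s.e)
        rw [norm_smul, s.norm_e, mul_one] at h7
        rw [norm_smul, s.norm_φ, mul_one]
        linarith [s.norm_inner_e_le (a • s.K s.e + g), s.norm_inner_φ_le (a • s.K s.e + g)]
      rw [hA₂, div_mul_eq_mul_div, le_div_iff₀ hδ]
      linarith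
    have hsum : ‖a • s.e + w‖ ≤ (A₁ + A₂) * σ := by
      refine (norm_add_le _ _).trans ?_
      rw [norm_smul, s.norm_e, mul_one]; linarith
    have hQ' : (A₁ + A₂) * σ ≤ Q * σ :=
      mul_le_mul_of_nonneg_right (by rw [hQ]; linarith) hσ0
    have hb2 : 1 / 2 ≤ ‖b‖ := by
      have h1 : u = b • s.φ + (a • s.e + w) := by rw [hw]; abel
      have h2 := norm_add_le (b • s.φ) (a • s.e + w)
      rw [← h1, h.norm_eq, norm_smul, s.norm_φ, mul_one] at h2
      linarith
    have hb0 : b ≠ 0 := norm_pos_iff.1 (by linarith)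
    have hub : b⁻¹ • u - s.φ = b⁻¹ • (a • s.e + w) := by
      have h1 : a • s.e + w = u - b • s.φ := by rw [hw]; abel
      rw [h1, smul_sub, smul_smul, inv_mul_cancel₀ hb0, one_smul]
    have hbi : ‖b‖⁻¹ ≤ 2 := by
      rw [show (2 : ℝ) = (1 / 2)⁻¹ by norm_num]; exact inv_anti₀ (by norm_num) hb2
    refine ⟨b, hb2, ?_, ?_, ?_⟩
    · rw [inner_sub_right, inner_smul_right, hφ, ← hb, inv_mul_cancel₀ hb0, sub_self]
    · rw [hub, norm_smul, norm_inv]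
      have := mul_le_mul hbi hsum (norm_nonneg _) zero_le_two
      linarith
    · have h1 : ‖Z - s.lam‖ * ‖b‖ ≤ A * σ := by
        rw [← norm_mul, heb]; exact (s.norm_inner_φ_le _).trans hgn
      have h2 : A * σ ≤ Q * σ := mul_le_mul_of_nonneg_right (by rw [hQ]; linarith) hσ0
      have h3 := mul_le_mul_of_nonneg_left hb2 (norm_nonneg (Z - s.lam))
      linarith
  · left
    rw [not_le] at hcase
    have hZl : s.κ * l / 4 ≤ ‖Z‖ := by linarith
    set v := u - a • s.e with hv
    have hev : ⟪s.e, v⟫ = 0 := by simp only [hv, inner_sub_right, inner_smul_right, he]; ring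
    have hZv : Z • v = (s.K u + g) - ⟪s.e, s.K u + g⟫ • s.e := by
      obtain ⟨α, hα⟩ : ∃ α : ℂ, Z • v = s.K u + g + α • s.e :=
        ⟨c * ⟪s.e, u + n⟫ - Z * a, by rw [hv, smul_sub, heq]; module⟩
      have h3 := congrArg (fun v => ⟪s.e, v⟫) hα
      simp only [inner_add_right, inner_smul_right, he, hev] at h3
      have hα' : α = -⟪s.e, s.K u + g⟫ := by
        simp only [inner_add_right]; linear_combination -h3
      rw [hα, hα']; module
    have hvb : ‖v‖ ≤ A₃ * σ := by
      have h1 : ‖Z‖ * ‖v‖ ≤ 2 * M := by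
        rw [← norm_smul, hZv]
        refine (norm_sub_le _ _).trans ?_
        rw [norm_smul, s.norm_e, mul_one]
        linarith [s.norm_inner_e_le (s.K u + g)]
      have h2 : s.κ * l / 4 * ‖v‖ ≤ 2 * M :=
        (mul_le_mul_of_nonneg_right hZl (norm_nonneg _)).trans h1
      have h3 : ‖v‖ ≤ A₃ * l⁻¹ := by
        rw [hA₃, ← div_eq_mul_inv, div_div, le_div_iff₀ hκl]; linarith
      exact h3.trans (mul_le_mul_of_nonneg_left hli hA₃0)
    have hA₃Q : A₃ * σ ≤ Q * σ := mul_le_mul_of_nonneg_right (by rw [hQ]; linarith) hσ0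
    have ha2 : 1 / 2 ≤ ‖a‖ := by
      have h1 : u = a • s.e + v := by rw [hv]; abel
      have h2 := norm_add_le (a • s.e) v
      rw [← h1, h.norm_eq, norm_smul, s.norm_e, mul_one] at h2
      linarith
    have ha0 : a ≠ 0 := norm_pos_iff.1 (by linarith)
    have hai : ‖a‖⁻¹ ≤ 2 := by
      rw [show (2 : ℝ) = (1 / 2)⁻¹ by norm_num]; exact inv_anti₀ (by norm_num) ha2
    have hZc : ‖Z - c‖ ≤ 2 * (C₁ * N) * ‖c‖ + 2 * M := by
      have := mul_le_mul_of_nonneg_left ha2 (norm_nonneg (Z - c))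
      linarith
    have hC₁N : C₁ * N ≤ 1 / 2 := by
      have h1 : C₁ * N ≤ C₁ * σ := mul_le_mul_of_nonneg_left hNσ hC₁
      have h2 : C₁ * σ ≤ Q * σ := mul_le_mul_of_nonneg_right (by rw [hQ]; linarith) hσ0
      linarith
    have hcup : ‖c‖ ≤ |s.κ * (l + log ‖Z‖)| + C₁ := by
      have h1 := norm_add_le (c - (s.κ * (l + log ‖Z‖) : ℝ))
        ((s.κ * (l + log ‖Z‖) : ℝ) : ℂ)
      rw [sub_add_cancel, Complex.norm_real, Real.norm_eq_abs] at h1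
      linarith [h.coeff]
    have hpos : 0 ≤ s.κ * (l + log ‖Z‖) := by
      have h3 : log δ ≤ log ‖Z‖ := Real.log_le_log hδ h.le_norm
      have h4 := neg_abs_le (log δ)
      have h5 : 0 ≤ C₁ / s.κ := by positivity
      have : 0 ≤ l + log ‖Z‖ := by linarith [abs_nonneg (log δ)]
      positivity
    rw [abs_of_nonneg hpos] at hcup
    have hZup : ‖Z‖ ≤ A₄ * l := by
      have h1 : ‖Z‖ ≤ ‖c‖ + ‖Z - c‖ := by
        have := norm_add_le c (Z - c)
        rwa [add_sub_cancel] at this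
      have h2 : 2 * (C₁ * N) * ‖c‖ ≤ 1 * ‖c‖ :=
        mul_le_mul_of_nonneg_right (by linarith) (norm_nonneg _)
      have h3 := log_le_two_sqrt hZ0
      have h4 : s.κ * log ‖Z‖ ≤ s.κ * (2 * sqrt ‖Z‖) :=
        mul_le_mul_of_nonneg_left h3 hκ.le
      have h5 := Real.mul_self_sqrt hZ0.le
      have h6 : 4 * s.κ * sqrt ‖Z‖ ≤ ‖Z‖ / 2 + 8 * s.κ ^ 2 := by
        nlinarith [sq_nonneg (sqrt ‖Z‖ - 4 * s.κ)]
      have h7 : ‖Z‖ ≤ 4 * s.κ * l + 2 * (2 * C₁ + 2 * M) + 16 * s.κ ^ 2 := by nlinarith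
      have h8 : 2 * (2 * C₁ + 2 * M) ≤ 2 * (2 * C₁ + 2 * M) * l :=
        le_mul_of_one_le_right (by positivity) hl
      have h9 : 16 * s.κ ^ 2 ≤ 16 * s.κ ^ 2 * l := le_mul_of_one_le_right (by positivity) hl
      rw [hA₄]; linarith
    have hlogZ : |log ‖Z‖| ≤ A₅ * sqrt l := by
      have hl0 : 0 < l := by linarith
      have h1 : log ‖Z‖ ≤ log A₄ + log l := by
        rw [← Real.log_mul hA₄0.ne' hl0.ne']; exact Real.log_le_log hZ0 hZup
      have h2 : log (s.κ / 4) + log l ≤ log ‖Z‖ := by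
        rw [← Real.log_mul (by positivity) hl0.ne']
        exact Real.log_le_log (by positivity) (by linarith)
      have h3 := log_le_two_sqrt hl0
      have h4 : 0 ≤ log l := Real.log_nonneg hl
      have h5 : |log A₄| ≤ |log A₄| * sqrt l :=
        le_mul_of_one_le_right (abs_nonneg _) hsq
      have h6 : |log (s.κ / 4)| ≤ |log (s.κ / 4)| * sqrt l :=
        le_mul_of_one_le_right (abs_nonneg _) hsq
      have h7 := le_abs_self (log A₄)
      have h8 := neg_abs_le (log (s.κ / 4))
      have h9 : 0 ≤ sqrt l := Real.sqrt_nonneg l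
      have h10 := abs_nonneg (log A₄)
      have h11 := abs_nonneg (log (s.κ / 4))
      rw [abs_le, hA₅]
      constructor <;> linarith
    have hcΛ : ‖c - s.large τ‖ ≤ A₆ * σ * s.large τ := by
      have e : c - (s.large τ : ℂ) = (c - (s.κ * (l + log ‖Z‖) : ℝ))
          + ((s.κ * log ‖Z‖ : ℝ) : ℂ) := by rw [hlarge']; push_cast; ring
      rw [e]
      refine (norm_add_le _ _).trans ?_
      rw [Complex.norm_real, Real.norm_eq_abs, abs_mul, abs_of_pos hκ]
      have h1 : sqrt l ≤ σ * l := by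
        have h2 := mul_le_mul_of_nonneg_right hsqi (by linarith : 0 ≤ l)
        refine le_trans (le_of_eq ?_) h2
        rw [eq_comm, inv_mul_eq_iff_eq_mul₀ (by positivity), Real.mul_self_sqrt (by linarith)]
      have h3 : s.κ * |log ‖Z‖| ≤ s.κ * (A₅ * (σ * l)) :=
        mul_le_mul_of_nonneg_left (hlogZ.trans (mul_le_mul_of_nonneg_left h1 hA₅0)) hκ.le
      have h4 : C₁ ≤ C₁ * (σ * l) := le_mul_of_one_le_right hC₁ (hsq.trans h1)
      have h5 : A₆ * σ * s.large τ = s.κ * (A₅ * (σ * l)) + C₁ * (σ * l) := by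
        rw [hA₆, hlarge']; field_simp
      rw [h5]; linarith [h.coeff]
    refine ⟨a, ha2, ?_, ?_, ?_⟩
    · rw [inner_sub_right, inner_smul_right, he, ← ha, inv_mul_cancel₀ ha0, sub_self]
    · have hua : a⁻¹ • u - s.e = a⁻¹ • v := by
        rw [hv, smul_sub, smul_smul, inv_mul_cancel₀ ha0, one_smul]
      rw [hua, norm_smul, norm_inv]
      have := mul_le_mul hai hvb (norm_nonneg _) zero_le_two
      linarith
    · have hΛ0 : 0 < s.large τ := hκl
      have h1 : ‖c‖ ≤ (1 + 2 * A₆) * s.large τ := by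
        have h2 := norm_add_le (c - s.large τ) (s.large τ : ℂ)
        rw [sub_add_cancel, Complex.norm_of_nonneg hΛ0.le] at h2
        have h3 : A₆ * σ * s.large τ ≤ A₆ * 2 * s.large τ := by gcongr
        linarith
      have h2 : ‖Z - s.large τ‖ ≤ ‖Z - c‖ + ‖c - s.large τ‖ := by
        have := norm_add_le (Z - c) (c - s.large τ)
        rwa [sub_add_sub_cancel] at this
      have h3 : 2 * (C₁ * N) * ‖c‖ ≤ 2 * (C₁ * σ) * ((1 + 2 * A₆) * s.large τ) := by gcongr
      have h4 : 2 * M ≤ 2 * M / s.κ * σ * s.large τ := by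
        have h5 : 1 ≤ σ * l := by
          have := mul_le_mul_of_nonneg_right hli (by linarith : 0 ≤ l)
          rwa [inv_mul_cancel₀ (by linarith)] at this
        have h6 : 2 * M / s.κ * σ * s.large τ = 2 * M * (σ * l) := by rw [hlarge']; field_simp
        rw [h6]; exact le_mul_of_one_le_right (by positivity) h5
      have h5 : ‖Z - s.large τ‖ ≤ A₇ * σ * s.large τ := by
        rw [hA₇]; linarith
      have h6 : A₇ * σ ≤ η := by
        have h7 : A₇ * σ ≤ Q * σ := mul_le_mul_of_nonneg_right (by rw [hQ]; linarith) hσ0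
        linarith
      exact h5.trans (mul_le_mul_of_nonneg_right h6 hΛ0.le)

end ResonanceSystem

section Spectral

variable {H : Type*} [NormedAddCommGroup H] [InnerProductSpace ℂ H]

theorem isClosed_spectrum_clm [CompleteSpace H] (A : H →L[ℂ] H) : IsClosed (spectrum ℂ A) :=
  spectrum.isClosed A

/-- A normal operator moves vectors by at least the distance to its spectrum. -/
theorem infDist_spectrum_mul_norm_le [CompleteSpace H] (A : H →L[ℂ] H) (hA : IsSelfAdjoint A)
    {z : ℂ} {δ : ℝ} (hδ : 0 < δ) (hz : ∀ x ∈ spectrum ℂ A, δ ≤ dist z x) (w : H) :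
    δ * ‖w‖ ≤ ‖z • w - A w‖ := by
  have hu : IsUnit (algebraMap ℂ (H →L[ℂ] H) z - A) := by
    rw [← spectrum.notMem_iff]
    intro h
    have := hz z h
    rw [dist_self] at this
    linarith
  obtain ⟨b, hb⟩ := hu
  have hcomm : Commute (star (b : H →L[ℂ] H)) b := by
    rw [hb, star_sub, hA.star_eq, ← algebraMap_star_comm]
    exact (Algebra.commute_algebraMap_left _ _).sub_left
      ((Algebra.commute_algebraMap_right _ _).sub_right (Commute.refl A))
  have hn : IsStarNormal ((b⁻¹ : (H →L[ℂ] H)ˣ) : H →L[ℂ] H) := by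
    refine ⟨?_⟩
    have h1 : star ((b⁻¹ : (H →L[ℂ] H)ˣ) : H →L[ℂ] H) = ((star b)⁻¹ : (H →L[ℂ] H)ˣ) := by
      rw [← star_inv, Units.coe_star]
    rw [h1]
    have h2 : Commute (star b) b := Units.ext hcomm
    exact congrArg Units.val (h2.inv_inv).eq
  have hr : spectralRadius ℂ ((b⁻¹ : (H →L[ℂ] H)ˣ) : H →L[ℂ] H) ≤ ENNReal.ofReal δ⁻¹ := by
    rw [spectralRadius]
    refine iSup₂_le fun k hk => ?_
    rw [← spectrum.map_inv, Set.mem_inv, hb, ← spectrum.singleton_sub_eq] at hk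
    obtain ⟨x, hx, y, hy, hxy⟩ := Set.mem_sub.1 hk
    rw [Set.mem_singleton_iff] at hx
    have h1 := hz y hy
    rw [dist_eq_norm, ← hx, hxy, norm_inv] at h1
    rw [ENNReal.coe_nnreal_eq, coe_nnnorm]
    refine ENNReal.ofReal_le_ofReal ?_
    have hk0 : 0 < ‖k‖⁻¹ := hδ.trans_le h1
    rw [← inv_inv ‖k‖]
    exact inv_anti₀ hδ h1
  rw [hn.spectralRadius_eq_nnnorm, ENNReal.coe_nnreal_eq, coe_nnnorm,
    ENNReal.ofReal_le_ofReal_iff (by positivity)] at hr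
  have h1 : w = ((b⁻¹ : (H →L[ℂ] H)ˣ) : H →L[ℂ] H) (z • w - A w) := by
    have h2 : z • w - A w = (b : H →L[ℂ] H) w := by
      rw [hb]; simp [Algebra.algebraMap_eq_smul_one]
    rw [h2, ← mul_apply_eq_comp, Units.inv_mul, one_apply_eq_self]
  have h3 := ContinuousLinearMap.le_opNorm ((b⁻¹ : (H →L[ℂ] H)ˣ) : H →L[ℂ] H) (z • w - A w)
  rw [← h1] at h3
  have h4 := h3.trans (mul_le_mul_of_nonneg_right hr (norm_nonneg _))
  rwa [← div_eq_inv_mul, le_div_iff₀ hδ, mul_comm] at h4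

/-- The orthogonal projection along a unit vector `e`. -/
def projOff (e : H) : H →L[ℂ] H := ContinuousLinearMap.id ℂ H - (innerSL ℂ e).smulRight e

theorem projOff_apply (e u : H) : projOff e u = u - ⟪e, u⟫ • e := by
  simp [projOff]

theorem projOff_of_inner_eq_zero {e u : H} (h : ⟪e, u⟫ = 0) : projOff e u = u := by
  rw [projOff_apply, h, zero_smul, sub_zero]

theorem inner_projOff {e : H} (he : ‖e‖ = 1) (u : H) : ⟪e, projOff e u⟫ = 0 := by
  rw [projOff_apply, inner_sub_right, inner_smul_right, inner_self_eq_norm_sq_to_K, he]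
  simp

theorem inner_projOff_left (e u v : H) : ⟪projOff e u, v⟫ = ⟪u, projOff e v⟫ := by
  rw [projOff_apply, projOff_apply, inner_sub_left, inner_sub_right, inner_smul_left,
    inner_smul_right, inner_conj_symm]
  ring

/-- The compression of `K` to the orthogonal complement of `e`. -/
def compression (e : H) (K : H →L[ℂ] H) : H →L[ℂ] H := projOff e ∘L K ∘L projOff e

theorem compression_apply {e u : H} (K : H →L[ℂ] H) (h : ⟪e, u⟫ = 0) :
    compression e K u = K u - ⟪e, K u⟫ • e := by
  simp [compression, projOff_of_inner_eq_zero h, projOff_apply]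

theorem inner_compression {e : H} (he : ‖e‖ = 1) (K : H →L[ℂ] H) (u : H) :
    ⟪e, compression e K u⟫ = 0 := inner_projOff he _

theorem compression_symm {K : H →L[ℂ] H} (e : H) (hK : (K : H →ₗ[ℂ] H).IsSymmetric) :
    (compression e K : H →ₗ[ℂ] H).IsSymmetric := by
  intro u v
  change ⟪projOff e (K (projOff e u)), v⟫ = ⟪u, projOff e (K (projOff e v))⟫
  rw [inner_projOff_left, ← inner_projOff_left e u]
  exact hK _ _

theorem compression_compact {K : H →L[ℂ] H} (e : H) (hK : IsCompactOperator K) :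
    IsCompactOperator (compression e K) :=
  (hK.comp_clm (projOff e)).clm_comp (projOff e)

/-- The spectrum of the compression of `K`, as an operator on the orthogonal complement of `e`. -/
def compressionSpectrum (e : H) (K : H →L[ℂ] H) : Set ℂ :=
  {z | ¬ ∀ f, ⟪e, f⟫ = 0 → ∃ v, (⟪e, v⟫ = 0 ∧ z • v - compression e K v = f) ∧
    ∀ w, ⟪e, w⟫ = 0 → z • w - compression e K w = f → w = v}

/-- A compact self-adjoint operator `K` with an eigenvector `φ` orthogonal to `e`, whose eigenvalue
is simple for the compression of `K`. -/
structure SimpleMode (e φ : H) (K : H →L[ℂ] H) (lam : ℝ) : Prop where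
  norm_e : ‖e‖ = 1
  norm_φ : ‖φ‖ = 1
  inner_e_φ : ⟪e, φ⟫ = 0
  compact : IsCompactOperator K
  symm : (K : H →ₗ[ℂ] H).IsSymmetric
  eigen : K φ = (lam : ℂ) • φ
  lam_pos : 0 < lam
  simple : ∀ v, ⟪e, v⟫ = 0 → compression e K v = (lam : ℂ) • v → ∃ c : ℂ, v = c • φ

/-- The orthogonal complement of the two modes. -/
def modeCompl (e φ : H) : Submodule ℂ H := (Submodule.span ℂ {e, φ})ᗮ

theorem mem_modeCompl {e φ w : H} : w ∈ modeCompl e φ ↔ ⟪e, w⟫ = 0 ∧ ⟪φ, w⟫ = 0 := by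
  rw [modeCompl, Submodule.mem_orthogonal]
  constructor
  · intro h
    exact ⟨h e (Submodule.subset_span (by simp)), h φ (Submodule.subset_span (by simp))⟩
  · rintro ⟨h1, h2⟩ u hu
    obtain ⟨a, b, rfl⟩ := Submodule.mem_span_pair.1 hu
    rw [inner_add_left, inner_smul_left, inner_smul_left, h1, h2]; ring

namespace SimpleMode

variable {e φ : H} {K : H →L[ℂ] H} {lam : ℝ}

theorem inner_φ_φ (h : SimpleMode e φ K lam) : ⟪φ, φ⟫ = 1 := by
  rw [inner_self_eq_norm_sq_to_K, h.norm_φ]; simp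

theorem inner_e_e (h : SimpleMode e φ K lam) : ⟪e, e⟫ = 1 := by
  rw [inner_self_eq_norm_sq_to_K, h.norm_e]; simp

theorem inner_φ_e (h : SimpleMode e φ K lam) : ⟪φ, e⟫ = 0 := by
  rw [← inner_conj_symm, h.inner_e_φ, map_zero]

theorem inner_φ_K (h : SimpleMode e φ K lam) (u : H) : ⟪φ, K u⟫ = lam * ⟪φ, u⟫ := by
  have h1 : ⟪K φ, u⟫ = ⟪φ, K u⟫ := h.symm φ u
  rw [← h1, h.eigen, inner_smul_left, Complex.conj_ofReal]

theorem compression_φ (h : SimpleMode e φ K lam) : compression e K φ = (lam : ℂ) • φ := by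
  rw [compression_apply K h.inner_e_φ, h.eigen, inner_smul_right, h.inner_e_φ, mul_zero, zero_smul,
    sub_zero]

theorem inner_φ_compression (h : SimpleMode e φ K lam) {u : H} (hu : ⟪e, u⟫ = 0) :
    ⟪φ, compression e K u⟫ = lam * ⟪φ, u⟫ := by
  rw [compression_apply K hu, inner_sub_right, inner_smul_right, h.inner_φ_e, h.inner_φ_K]
  ring

theorem compression_mem (h : SimpleMode e φ K lam) :
    ∀ w ∈ modeCompl e φ, compression e K w ∈ modeCompl e φ := by
  intro w hw
  rw [mem_modeCompl] at hw ⊢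
  refine ⟨inner_compression h.norm_e K w, ?_⟩
  rw [h.inner_φ_compression hw.1, hw.2, mul_zero]

/-- The restriction of the compression of `K` to the orthogonal complement of the two modes. -/
def restr (h : SimpleMode e φ K lam) : modeCompl e φ →L[ℂ] modeCompl e φ :=
  (compression e K).restrict h.compression_mem

theorem coe_restr (h : SimpleMode e φ K lam) (w : modeCompl e φ) :
    (h.restr w : H) = compression e K w := rfl

instance [CompleteSpace H] : CompleteSpace (modeCompl e φ) :=
  inferInstanceAs (CompleteSpace (Submodule.span ℂ {e, φ})ᗮ)

variable [CompleteSpace H] (h : SimpleMode e φ K lam)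
include h

theorem isSelfAdjoint_restr : IsSelfAdjoint h.restr := by
  refine LinearMap.IsSymmetric.isSelfAdjoint fun u v => ?_
  exact compression_symm e h.symm u v

theorem isCompactOperator_restr : IsCompactOperator h.restr :=
  (compression_compact e h.compact).restrict' (V := modeCompl e φ) h.compression_mem

theorem lam_notMem_spectrum : (lam : ℂ) ∉ spectrum ℂ h.restr := by
  have hl : (lam : ℂ) ≠ 0 := by exact_mod_cast h.lam_pos.ne'
  rw [← h.isCompactOperator_restr.hasEigenvalue_iff_mem_spectrum hl]
  intro hev
  obtain ⟨v, hv, hv0⟩ := hev.exists_hasEigenvector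
  rw [Module.End.mem_eigenspace_iff] at hv
  have hv' : compression e K v = (lam : ℂ) • (v : H) := congrArg Subtype.val hv
  have hm := mem_modeCompl.1 v.2
  obtain ⟨c, hc⟩ := h.simple v hm.1 hv'
  have h1 := hm.2
  rw [hc, inner_smul_right, h.inner_φ_φ, mul_one] at h1
  rw [h1, zero_smul] at hc
  exact hv0 (Subtype.ext hc)

theorem compressionSpectrum_diff :
    compressionSpectrum e K \ {(lam : ℂ)} = spectrum ℂ h.restr := by
  ext z
  by_cases hz : z = lam
  · subst hz
    simp [h.lam_notMem_spectrum]
  have hz' : z - lam ≠ 0 := sub_ne_zero.2 hz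
  have key : z ∈ compressionSpectrum e K ↔ z ∈ spectrum ℂ h.restr := by
    rw [compressionSpectrum, Set.mem_ofPred_eq, spectrum.mem_iff, not_iff_not,
      ContinuousLinearMap.isUnit_iff_bijective]
    have happ : ∀ w : modeCompl e φ, ((algebraMap ℂ _ z - h.restr) w : H)
        = z • (w : H) - compression e K w := by
      intro w
      simp [Algebra.algebraMap_eq_smul_one, h.coe_restr]
    constructor
    · intro H1
      constructor
      · intro x y hxy
        have hd : z • ((x - y : modeCompl e φ) : H) - compression e K (x - y : modeCompl e φ)
            = 0 := by
          rw [← happ, map_sub, hxy, sub_self]; rfl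
        have hm := mem_modeCompl.1 (x - y).2
        obtain ⟨v, -, hu⟩ := H1 0 (inner_zero_right e)
        have h1 := hu _ hm.1 hd
        have h2 := hu 0 (inner_zero_right e) (by simp)
        exact sub_eq_zero.1 (Subtype.ext (h1.trans h2.symm))
      · intro f
        have hm := mem_modeCompl.1 f.2
        obtain ⟨v, ⟨hv, hvf⟩, -⟩ := H1 f hm.1
        have hφv : ⟪φ, v⟫ = 0 := by
          have := congrArg (fun u => ⟪φ, u⟫) hvf
          simp only [inner_sub_right, inner_smul_right, h.inner_φ_compression hv, hm.2] at this
          have h3 : (z - lam) * ⟪φ, v⟫ = 0 := by linear_combination this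
          exact (mul_eq_zero.1 h3).resolve_left hz'
        refine ⟨⟨v, mem_modeCompl.2 ⟨hv, hφv⟩⟩, Subtype.ext ?_⟩
        rw [happ]; exact hvf
    · rintro ⟨hinj, hsurj⟩ f hf
      have hdec : ∀ u, ⟪e, u⟫ = 0 → u - ⟪φ, u⟫ • φ ∈ modeCompl e φ := by
        intro u hu
        rw [mem_modeCompl, inner_sub_right, inner_sub_right, inner_smul_right, inner_smul_right, hu,
          h.inner_e_φ, h.inner_φ_φ]
        simp
      obtain ⟨g, hg⟩ := hsurj ⟨f - ⟪φ, f⟫ • φ, hdec f hf⟩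
      have hg' : z • (g : H) - compression e K g = f - ⟪φ, f⟫ • φ := by
        rw [← happ, hg]
      have hgm := mem_modeCompl.1 g.2
      refine ⟨(⟪φ, f⟫ / (z - lam)) • φ + g, ⟨?_, ?_⟩, ?_⟩
      · rw [inner_add_right, inner_smul_right, h.inner_e_φ, hgm.1]; ring
      · rw [map_add, map_smul, h.compression_φ]
        have h1 : (⟪φ, f⟫ / (z - lam)) * (z - lam) = ⟪φ, f⟫ := div_mul_cancel₀ _ hz'
        linear_combination (norm := module) hg' + h1 • φ
      · intro w hw hwf
        have hφw : ⟪φ, w⟫ = ⟪φ, f⟫ / (z - lam) := by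
          have := congrArg (fun u => ⟪φ, u⟫) hwf
          simp only [inner_sub_right, inner_smul_right, h.inner_φ_compression hw] at this
          rw [eq_div_iff hz']; linear_combination this
        have h1 : (⟨w - ⟪φ, w⟫ • φ, hdec w hw⟩ : modeCompl e φ) = g := by
          refine hinj (Subtype.ext ?_)
          rw [happ, happ, hg', map_sub, map_smul, h.compression_φ]
          have h1 : ⟪φ, w⟫ * (z - lam) = ⟪φ, f⟫ := by rw [hφw, div_mul_cancel₀ _ hz']
          linear_combination (norm := module) hwf - h1 • φ
        rw [← h1, ← hφw]; simp
  simp [key, hz]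

theorem infDist_pos (hne : (spectrum ℂ h.restr).Nonempty) :
    0 < infDist (lam : ℂ) (compressionSpectrum e K \ {(lam : ℂ)}) := by
  rw [h.compressionSpectrum_diff]
  have hc : IsClosed (spectrum ℂ h.restr) := isClosed_spectrum_clm h.restr
  exact (hc.notMem_iff_infDist_pos hne).1 h.lam_notMem_spectrum

theorem resolvent_bound {z : ℂ} {δ : ℝ} (hδ : 0 < δ)
    (hz : δ ≤ infDist z (compressionSpectrum e K \ {(lam : ℂ)})) (w : H) (hw : ⟪e, w⟫ = 0)
    (hw' : ⟪φ, w⟫ = 0) : δ * ‖w‖ ≤ ‖z • w - K w + ⟪e, K w⟫ • e‖ := by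
  rw [h.compressionSpectrum_diff] at hz
  have := infDist_spectrum_mul_norm_le h.restr h.isSelfAdjoint_restr hδ
    (fun x hx => hz.trans (Metric.infDist_le_dist_of_mem hx)) ⟨w, mem_modeCompl.2 ⟨hw, hw'⟩⟩
  have e1 : ‖z • w - K w + ⟪e, K w⟫ • e‖
      = ‖z • (⟨w, mem_modeCompl.2 ⟨hw, hw'⟩⟩ : modeCompl e φ)
        - h.restr ⟨w, mem_modeCompl.2 ⟨hw, hw'⟩⟩‖ := by
    change _ = ‖z • w - compression e K w‖
    rw [compression_apply K hw]
    congr 1; abel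
  rw [e1]
  exact this

/-- The reduced resolvent at the simple eigenvalue. -/
theorem exists_reducedResolvent : ∃ S : H →L[ℂ] H, (∀ u, ⟪e, S u⟫ = 0) ∧ (∀ u, ⟪φ, S u⟫ = 0) ∧
    (∀ u, (lam : ℂ) • S u - K (S u) + ⟪e, K (S u)⟫ • e = u - ⟪e, u⟫ • e - ⟪φ, u⟫ • φ) ∧
    (∀ u, ⟪e, u⟫ = 0 → ⟪φ, u⟫ = 0 → S ((lam : ℂ) • u - K u) = u) ∧ S e = 0 ∧ S φ = 0 := by
  have hu := h.lam_notMem_spectrum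
  rw [spectrum.notMem_iff] at hu
  obtain ⟨b, hb⟩ := hu
  let Q : H →L[ℂ] modeCompl e φ := (projOff φ ∘L projOff e).codRestrict (modeCompl e φ) (fun u => by
    rw [mem_modeCompl]
    refine ⟨?_, inner_projOff h.norm_φ _⟩
    rw [ContinuousLinearMap.comp_apply, projOff_apply φ, inner_sub_right, inner_projOff h.norm_e,
      inner_smul_right, h.inner_e_φ]
    ring)
  have hQ : ∀ u, (Q u : H) = u - ⟪e, u⟫ • e - ⟪φ, u⟫ • φ := by
    intro u
    change projOff φ (projOff e u) = _
    rw [projOff_apply φ, projOff_apply e, inner_sub_right, inner_smul_right, h.inner_φ_e]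
    module
  let S : H →L[ℂ] H := (modeCompl e φ).subtypeL ∘L
    ((b⁻¹ : (modeCompl e φ →L[ℂ] modeCompl e φ)ˣ) : modeCompl e φ →L[ℂ] modeCompl e φ) ∘L Q
  have hS : ∀ u, S u = (((b⁻¹ : (modeCompl e φ →L[ℂ] modeCompl e φ)ˣ) :
      modeCompl e φ →L[ℂ] modeCompl e φ) (Q u) : H) := fun u => rfl
  have hSm : ∀ u, ⟪e, S u⟫ = 0 ∧ ⟪φ, S u⟫ = 0 := fun u => mem_modeCompl.1 (by
    rw [hS]; exact Subtype.prop _)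
  have hbapp : ∀ w : modeCompl e φ, (((b : modeCompl e φ →L[ℂ] modeCompl e φ) w : modeCompl e φ) : H)
      = (lam : ℂ) • (w : H) - compression e K w := by
    intro w
    rw [hb]
    simp [Algebra.algebraMap_eq_smul_one, h.coe_restr]
  refine ⟨S, fun u => (hSm u).1, fun u => (hSm u).2, fun u => ?_, fun u hu hu' => ?_, ?_, ?_⟩
  · have h1 := hbapp (((b⁻¹ : (modeCompl e φ →L[ℂ] modeCompl e φ)ˣ) :
      modeCompl e φ →L[ℂ] modeCompl e φ) (Q u))
    rw [← mul_apply_eq_comp, Units.mul_inv, one_apply_eq_self, hQ, ← hS,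
      compression_apply K (hSm u).1] at h1
    rw [h1]; abel
  · have h1 : Q ((lam : ℂ) • u - K u) = (b : modeCompl e φ →L[ℂ] modeCompl e φ)
        ⟨u, mem_modeCompl.2 ⟨hu, hu'⟩⟩ := by
      refine Subtype.ext ?_
      have h2 : ⟪e, (lam : ℂ) • u - K u⟫ = -⟪e, K u⟫ := by
        rw [inner_sub_right, inner_smul_right, hu]; ring
      have h3 : ⟪φ, (lam : ℂ) • u - K u⟫ = 0 := by
        rw [inner_sub_right, inner_smul_right, h.inner_φ_K]; ring
      rw [hQ, hbapp, compression_apply K hu, h2, h3]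
      module
    rw [hS, h1, ← mul_apply_eq_comp, Units.inv_mul, one_apply_eq_self]
  · have h1 : Q e = 0 := Subtype.ext (by rw [hQ, h.inner_e_e, h.inner_φ_e]; simp)
    rw [hS, h1, map_zero]; rfl
  · have h1 : Q φ = 0 := Subtype.ext (by rw [hQ, h.inner_e_φ, h.inner_φ_φ]; simp)
    rw [hS, h1, map_zero]; rfl

/-- Unit vectors on which the compression tends to zero put `0` into the spectrum. -/
theorem zero_mem_spectrum (hf : ∀ ε > 0, ∃ f, ⟪e, f⟫ = 0 ∧ ‖f‖ = 1 ∧ ‖compression e K f‖ ≤ ε) :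
    (0 : ℂ) ∈ spectrum ℂ h.restr := by
  by_contra h0
  rw [spectrum.zero_notMem_iff] at h0
  obtain ⟨b, hb⟩ := h0
  set B := ((b⁻¹ : (modeCompl e φ →L[ℂ] modeCompl e φ)ˣ) : modeCompl e φ →L[ℂ] modeCompl e φ)
  have hl := h.lam_pos
  have hB : 0 ≤ ‖B‖ := norm_nonneg B
  obtain ⟨f, hef, hf1, hfε⟩ := hf (1 / (2 * (1 / lam + 2 * ‖B‖ + 1))) (by positivity)
  set ε := ‖compression e K f‖ with hε
  have h1 : ‖⟪φ, f⟫‖ ≤ ε / lam := by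
    have h2 := norm_inner_le_norm (𝕜 := ℂ) φ (compression e K f)
    rw [h.inner_φ_compression hef, h.norm_φ, one_mul, norm_mul, Complex.norm_of_nonneg hl.le] at h2
    rw [le_div_iff₀ hl, mul_comm]; exact h2
  have hdec : f - ⟪φ, f⟫ • φ ∈ modeCompl e φ := by
    rw [mem_modeCompl, inner_sub_right, inner_sub_right, inner_smul_right, inner_smul_right, hef,
      h.inner_e_φ, h.inner_φ_φ]
    simp
  set w : modeCompl e φ := ⟨f - ⟪φ, f⟫ • φ, hdec⟩ with hw
  have h2 : ‖h.restr w‖ ≤ 2 * ε := by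
    change ‖compression e K (f - ⟪φ, f⟫ • φ)‖ ≤ 2 * ε
    rw [map_sub, map_smul, h.compression_φ]
    refine (norm_sub_le _ _).trans ?_
    rw [norm_smul, norm_smul, h.norm_φ, Complex.norm_of_nonneg hl.le, mul_one]
    rw [le_div_iff₀ hl] at h1
    linarith
  have h3 : ‖w‖ ≤ ‖B‖ * (2 * ε) := by
    have h4 : w = B (h.restr w) := by
      rw [← hb, ← mul_apply_eq_comp, Units.inv_mul, one_apply_eq_self]
    rw [h4]
    exact (B.le_opNorm _).trans (mul_le_mul_of_nonneg_left h2 hB)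
  have h5 : ‖f‖ ≤ ε / lam + ‖B‖ * (2 * ε) := by
    have h6 : f = ⟪φ, f⟫ • φ + (w : H) := by rw [hw]; simp
    rw [h6]
    refine (norm_add_le _ _).trans (add_le_add ?_ h3)
    rw [norm_smul, h.norm_φ, mul_one]; exact h1
  rw [hf1] at h5
  have h7 : ε * (2 * (1 / lam + 2 * ‖B‖ + 1)) ≤ 1 := by
    rwa [le_div_iff₀ (by positivity)] at hfε
  have h8 : ε / lam = ε * (1 / lam) := by ring
  have h9 : 0 ≤ ε := norm_nonneg _
  nlinarith

end SimpleMode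

/-- A compact self-adjoint operator which is positive somewhere has a positive eigenvalue. -/
theorem exists_pos_eigenvalue [CompleteSpace H] {A : H →L[ℂ] H} (hA : IsCompactOperator A)
    (hs : (A : H →ₗ[ℂ] H).IsSymmetric) {f : H} (hf : 0 < (⟪A f, f⟫).re) :
    ∃ μ : ℝ, 0 < μ ∧ ∃ v, v ≠ 0 ∧ A v = (μ : ℂ) • v := by
  by_contra! hcon
  have hsa : IsSelfAdjoint (-A) := hs.isSelfAdjoint.neg
  have hnn : 0 ≤ -A := by
    rw [StarOrderedRing.nonneg_iff_spectrum_nonneg (R := ℝ) (-A) hsa]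
    intro x hx
    by_contra! hx0
    rw [← spectrum.algebraMap_mem_iff ℂ, ← spectrum.neg_eq, Set.mem_neg] at hx
    have hne : -(algebraMap ℝ ℂ x) ≠ 0 := by
      simpa using hx0.ne
    rw [← hA.hasEigenvalue_iff_mem_spectrum hne] at hx
    obtain ⟨v, hv, hv0⟩ := hx.exists_hasEigenvector
    rw [Module.End.mem_eigenspace_iff] at hv
    refine hcon (-x) (by linarith) v hv0 ?_
    have : A v = _ := hv
    rw [this]; simp
  rw [ContinuousLinearMap.nonneg_iff_isPositive] at hnn
  have := hnn.re_inner_nonneg_left f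
  simp only [neg_apply, inner_neg_left, map_neg] at this
  have h2 : RCLike.re (⟪A f, f⟫) = (⟪A f, f⟫).re := rfl
  linarith

end Spectral

/-! ### Geometry of the dimer -/

/-- The reflection as a linear isometry. -/
def reflectEquiv : Plane ≃ₗᵢ[ℝ] Plane where
  toLinearEquiv := LinearEquiv.ofInvolutive
    { toFun := reflect
      map_add' := fun x y => by ext i; fin_cases i <;> simp [reflect] <;> ring
      map_smul' := fun c x => by ext i; fin_cases i <;> simp [reflect] }
    (fun x => by ext i; fin_cases i <;> simp [reflect])
  norm_map' := fun x => by
    change ‖reflect x‖ = ‖x‖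
    simp [EuclideanSpace.norm_eq, reflect, Fin.sum_univ_two]

theorem reflect_reflect (x : Plane) : reflect (reflect x) = x := by
  ext i; fin_cases i <;> simp [reflect]

theorem reflect_sub (x y : Plane) : reflect (x - y) = reflect x - reflect y :=
  map_sub reflectEquiv x y

theorem norm_reflect (x : Plane) : ‖reflect x‖ = ‖x‖ := reflectEquiv.norm_map x

theorem measurePreserving_reflect : MeasurePreserving reflect volume volume :=
  reflectEquiv.measurePreserving

/-- Uniform interior balls at all small scales. -/
def HasInteriorBalls (S : Set Plane) : Prop :=
  ∃ κ r₀ : ℝ, 0 < κ ∧ 0 < r₀ ∧ ∀ x ∈ S, ∀ r, 0 < r → r ≤ r₀ →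
    ∃ p, ball p (κ * r) ⊆ S ∩ ball x r

theorem exists_interior_balls_of_frontier {S : Set Plane} (hS : IsParticle S) {p : Plane}
    (hp : p ∈ frontier S) : ∃ κ r₀ η : ℝ, 0 < κ ∧ 0 < r₀ ∧ 0 < η ∧
      ∀ x ∈ S ∩ ball p η, ∀ r, 0 < r → r ≤ r₀ →
        ∃ q, ball q (κ * r) ⊆ S ∩ ball x r := by
  obtain ⟨U, ρ, hU, hpU, hρ, hρ', hSU⟩ := hS.boundary p hp
  set f := fderiv ℝ ρ p with hf
  have hstrict : HasStrictFDerivAt ρ f p := hρ.contDiffAt.hasStrictFDerivAt (by norm_num)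
  obtain ⟨v₀, hv₀⟩ : ∃ v, f v ≠ 0 := by
    by_contra! hcon
    exact hρ' (ContinuousLinearMap.ext fun v => by simpa using hcon v)
  set v : Plane := (-(f v₀)⁻¹) • v₀ with hv
  have hfv : f v = -1 := by
    rw [hv, map_smul, smul_eq_mul, neg_mul, inv_mul_cancel₀ hv₀]
  set V : ℝ := ‖v‖ + 1 with hV
  have hV0 : 0 < V := by positivity
  set κ₀ : ℝ := 1 / (2 * (‖f‖ + 1)) with hκ₀
  have hκ₀0 : 0 < κ₀ := by positivity
  set κ₁ : ℝ := min κ₀ 1 with hκ₁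
  have hκ₁0 : 0 < κ₁ := by positivity
  have hfκ : ‖f‖ * κ₁ ≤ 1 / 2 := by
    have h1 : ‖f‖ * κ₁ ≤ ‖f‖ * κ₀ := mul_le_mul_of_nonneg_left (min_le_left _ _) (norm_nonneg _)
    refine h1.trans ?_
    rw [hκ₀, mul_one_div, div_le_div_iff₀ (by positivity) (by norm_num)]
    linarith
  have hstrict' := hstrict.isLittleO.def (show 0 < 1 / (4 * V) by positivity)
  rw [nhds_prod_eq] at hstrict'
  obtain ⟨ε, hε, hε'⟩ : ∃ ε > 0, ∀ x ∈ ball p ε, ∀ y ∈ ball p ε,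
      ‖ρ x - ρ y - f (x - y)‖ ≤ 1 / (4 * V) * ‖x - y‖ := by
    obtain ⟨ε, hε, h⟩ := ((Metric.nhds_basis_ball (x := p)).prod_self).mem_iff.1 hstrict'
    exact ⟨ε, hε, fun x hx y hy => h (Set.mk_mem_prod hx hy)⟩
  obtain ⟨ε', hε'0, hεU⟩ := Metric.isOpen_iff.1 hU p hpU
  set η := min ε ε' / 2 with hη
  have hη0 : 0 < η := by positivity
  refine ⟨κ₁ / V, η, η, by positivity, hη0, hη0, fun x hx r hr hrη => ?_⟩
  -- the ball around `x + t v` with `t = r / V`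
  set t := r / V with ht
  have ht0 : 0 < t := by positivity
  have htV : t * V = r := div_mul_cancel₀ _ hV0.ne'
  refine ⟨x + t • v, fun y hy => ?_⟩
  set z := y - (x + t • v) with hz
  have hzn : ‖z‖ < κ₁ * t := by
    have := mem_ball_iff_norm.1 hy
    calc ‖z‖ < κ₁ / V * r := this
      _ = κ₁ * t := by rw [ht]; ring
  have hyx : y - x = t • v + z := by rw [hz]; abel
  have hzt : ‖z‖ < t := hzn.trans_le (mul_le_of_le_one_left ht0.le (min_le_right _ _))
  have hyx' : ‖y - x‖ < r := by
    rw [hyx]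
    calc ‖t • v + z‖ ≤ t * ‖v‖ + ‖z‖ := by
          refine (norm_add_le _ _).trans ?_
          rw [norm_smul, Real.norm_of_nonneg ht0.le]
      _ < t * ‖v‖ + t := by linarith
      _ = r := by rw [← htV, hV]; ring
  have hxp := mem_ball_iff_norm.1 hx.2
  have hyp : ‖y - p‖ < 2 * η := by
    have := norm_add_le (y - x) (x - p)
    rw [sub_add_sub_cancel] at this
    linarith
  have h2η : 2 * η = min ε ε' := by rw [hη]; ring
  have hyε : y ∈ ball p ε := mem_ball_iff_norm.2 (by
    have := min_le_left ε ε'; linarith)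
  have hyε' : y ∈ U := hεU (mem_ball_iff_norm.2 (by have := min_le_right ε ε'; linarith))
  have hxε : x ∈ ball p ε := mem_ball_iff_norm.2 (by
    have := min_le_left ε ε'; linarith)
  have hxU : x ∈ U := hεU (mem_ball_iff_norm.2 (by have := min_le_right ε ε'; linarith))
  have hρx : ρ x < 0 := by
    have : x ∈ S ∩ U := ⟨hx.1, hxU⟩
    rw [hSU] at this
    exact this.2
  have h1 := hε' y hyε x hxε
  have h2 : f (y - x) ≤ -(t / 2) := by
    rw [hyx, map_add, map_smul, hfv, smul_eq_mul]
    have h3 : f z ≤ ‖f‖ * ‖z‖ := (le_abs_self _).trans (f.le_opNorm z)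
    have h4 : ‖f‖ * ‖z‖ ≤ ‖f‖ * (κ₁ * t) := mul_le_mul_of_nonneg_left hzn.le (norm_nonneg _)
    have h5 : ‖f‖ * κ₁ * t ≤ 1 / 2 * t := mul_le_mul_of_nonneg_right hfκ ht0.le
    linarith
  have h3 : 1 / (4 * V) * ‖y - x‖ ≤ t / 4 := by
    calc 1 / (4 * V) * ‖y - x‖ ≤ 1 / (4 * V) * r := by gcongr
      _ = t / 4 := by rw [ht]; field_simp
  have h4 := (le_abs_self _).trans h1
  have hy : y ∈ S ∩ U := by
    rw [hSU]
    exact ⟨hyε', by linarith⟩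
  exact ⟨hy.1, mem_ball_iff_norm.2 hyx'⟩

theorem IsParticle.hasInteriorBalls {S : Set Plane} (hS : IsParticle S) : HasInteriorBalls S := by
  have hK : IsCompact (closure S) := hS.isBounded.isCompact_closure
  have key : ∃ κ r₀ : ℝ, 0 < κ ∧ 0 < r₀ ∧ ∀ x ∈ S ∩ closure S, ∀ r, 0 < r → r ≤ r₀ →
      ∃ p, ball p (κ * r) ⊆ S ∩ ball x r := by
    refine hK.induction_on (p := fun T => ∃ κ r₀ : ℝ, 0 < κ ∧ 0 < r₀ ∧ ∀ x ∈ S ∩ T, ∀ r, 0 < r →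
      r ≤ r₀ → ∃ p, ball p (κ * r) ⊆ S ∩ ball x r) ?_ ?_ ?_ ?_
    · exact ⟨1, 1, one_pos, one_pos, fun x hx => hx.2.elim⟩
    · rintro T T' hTT' ⟨κ, r₀, h1, h2, h3⟩
      exact ⟨κ, r₀, h1, h2, fun x hx => h3 x ⟨hx.1, hTT' hx.2⟩⟩
    · rintro T T' ⟨κ, r₀, h1, h2, h3⟩ ⟨κ', r₀', h1', h2', h3'⟩
      refine ⟨min κ κ', min r₀ r₀', lt_min h1 h1', lt_min h2 h2', fun x hx r hr hr' => ?_⟩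
      rcases hx.2 with hxT | hxT
      · obtain ⟨p, hp⟩ := h3 x ⟨hx.1, hxT⟩ r hr (hr'.trans (min_le_left _ _))
        exact ⟨p, (Metric.ball_subset_ball
          (mul_le_mul_of_nonneg_right (min_le_left _ _) hr.le)).trans hp⟩
      · obtain ⟨p, hp⟩ := h3' x ⟨hx.1, hxT⟩ r hr (hr'.trans (min_le_right _ _))
        exact ⟨p, (Metric.ball_subset_ball
          (mul_le_mul_of_nonneg_right (min_le_right _ _) hr.le)).trans hp⟩
    · intro p hp
      by_cases hpS : p ∈ S
      · obtain ⟨ε, hε, hb⟩ := Metric.isOpen_iff.1 hS.isOpen p hpS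
        refine ⟨ball p (ε / 2), mem_nhdsWithin_of_mem_nhds
          (Metric.ball_mem_nhds p (by positivity)), 1, ε / 2, one_pos, by positivity, ?_⟩
        intro x hx r hr hr'
        refine ⟨x, fun y hy => ?_⟩
        rw [one_mul] at hy
        refine ⟨hb ?_, hy⟩
        rw [Metric.mem_ball] at hy ⊢
        have := Metric.mem_ball.1 hx.2
        linarith [dist_triangle y x p]
      · have hpf : p ∈ frontier S := ⟨hp, by rwa [hS.isOpen.interior_eq]⟩
        obtain ⟨κ, r₀, η, h1, h2, h3, h4⟩ := exists_interior_balls_of_frontier hS hpf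
        exact ⟨ball p η, mem_nhdsWithin_of_mem_nhds (Metric.ball_mem_nhds p h3), κ, r₀,
          h1, h2, h4⟩
  obtain ⟨κ, r₀, h1, h2, h3⟩ := key
  exact ⟨κ, r₀, h1, h2, fun x hx => h3 x ⟨hx, subset_closure hx⟩⟩

theorem HasInteriorBalls.union {S T : Set Plane} (hS : HasInteriorBalls S)
    (hT : HasInteriorBalls T) : HasInteriorBalls (S ∪ T) := by
  obtain ⟨κ, r₀, h1, h2, h3⟩ := hS
  obtain ⟨κ', r₀', h1', h2', h3'⟩ := hT
  refine ⟨min κ κ', min r₀ r₀', lt_min h1 h1', lt_min h2 h2', fun x hx r hr hr' => ?_⟩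
  rcases hx with hxT | hxT
  · obtain ⟨p, hp⟩ := h3 x hxT r hr (hr'.trans (min_le_left _ _))
    exact ⟨p, ((Metric.ball_subset_ball (mul_le_mul_of_nonneg_right (min_le_left _ _) hr.le)).trans
      hp).trans (inter_subset_inter_left _ subset_union_left)⟩
  · obtain ⟨p, hp⟩ := h3' x hxT r hr (hr'.trans (min_le_right _ _))
    exact ⟨p, ((Metric.ball_subset_ball (mul_le_mul_of_nonneg_right (min_le_right _ _) hr.le)).trans
      hp).trans (inter_subset_inter_left _ subset_union_right)⟩

theorem HasInteriorBalls.image {S : Set Plane} (hS : HasInteriorBalls S) (f : Plane ≃ᵢ Plane) :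
    HasInteriorBalls (f '' S) := by
  obtain ⟨κ, r₀, h1, h2, h3⟩ := hS
  refine ⟨κ, r₀, h1, h2, ?_⟩
  rintro _ ⟨x, hx, rfl⟩ r hr hr'
  obtain ⟨p, hp⟩ := h3 x hx r hr hr'
  refine ⟨f p, ?_⟩
  rw [← f.image_ball, ← f.image_ball, ← image_inter f.injective]
  exact image_mono hp

theorem leftParticle_eq (D₀ : Set Plane) (L : ℝ) :
    leftParticle D₀ L = IsometryEquiv.addRight (!₂[-L, 0] : Plane) '' D₀ := rfl

theorem rightParticle_eq (D₀ : Set Plane) (L : ℝ) : rightParticle D₀ L =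
    (reflectEquiv.toIsometryEquiv.trans (IsometryEquiv.addRight (!₂[L, 0] : Plane))) '' D₀ := rfl

theorem rightParticle_eq_image_reflect (D₀ : Set Plane) (L : ℝ) :
    rightParticle D₀ L = reflect '' leftParticle D₀ L := by
  rw [leftParticle, rightParticle, image_image]
  refine image_congr fun x _ => ?_
  ext i; fin_cases i <;> simp [reflect] <;> ring

theorem reflect_preimage_dimer (D₀ : Set Plane) (L : ℝ) :
    reflect ⁻¹' dimer D₀ L = dimer D₀ L := by
  have hinv : Function.Involutive reflect := reflect_reflect
  rw [← hinv.image_eq_preimage_symm, dimer, image_union, rightParticle_eq_image_reflect, image_image]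
  simp [reflect_reflect, union_comm]

/-- A nonempty bounded open set, symmetric under the reflection, with interior balls. -/
structure ReflectionDomain (D : Set Plane) : Prop where
  isOpen : IsOpen D
  isBounded : Bornology.IsBounded D
  nonempty : D.Nonempty
  reflect_preimage : reflect ⁻¹' D = D
  interiorBalls : HasInteriorBalls D

theorem reflectionDomain_dimer {D₀ : Set Plane} (h : IsParticle D₀) (L : ℝ) : ReflectionDomain (dimer D₀ L) where
  isOpen := by
    rw [dimer, leftParticle_eq, rightParticle_eq]
    have ho : ∀ f : Plane ≃ᵢ Plane, IsOpen (f '' D₀) := fun f =>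
      f.toHomeomorph.isOpenMap _ h.isOpen
    exact (ho _).union (ho _)
  isBounded := by
    rw [dimer, leftParticle_eq, rightParticle_eq]
    have hb : ∀ f : Plane ≃ᵢ Plane, Bornology.IsBounded (f '' D₀) := fun f =>
      f.isometry.lipschitz.isBounded_image h.isBounded
    exact (hb _).union (hb _)
  nonempty := (h.isConnected.nonempty.image _).inl
  reflect_preimage := reflect_preimage_dimer D₀ L
  interiorBalls := by
    rw [dimer, leftParticle_eq, rightParticle_eq]
    exact (h.hasInteriorBalls.image _).union (h.hasInteriorBalls.image _)

/-! ### Convolution operators on `L²(D)` -/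

section Kernel

variable {D : Set Plane} [hD : Fact (ReflectionDomain D)]

include hD in
theorem measurableSet_domain : MeasurableSet D := hD.out.isOpen.measurableSet

include hD in
theorem volume_domain_lt_top : volume D < ∞ := hD.out.isBounded.measure_lt_top

include hD in
theorem volume_domain_pos : 0 < volume D := hD.out.isOpen.measure_pos _ hD.out.nonempty

include hD in
theorem area_pos : 0 < area D :=
  ENNReal.toReal_pos volume_domain_pos.ne' volume_domain_lt_top.ne

instance : IsFiniteMeasure vol[D] :=
  isFiniteMeasure_restrict.2 volume_domain_lt_top.ne

include hD in
theorem ae_mem_domain : ∀ᵐ x ∂vol[D], x ∈ D := ae_restrict_mem measurableSet_domain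

/-- The square-integrable functions on `D`. -/
abbrev L2 (D : Set Plane) := Lp ℂ 2 vol[D]

/-- A ball about the origin which contains all differences of points of `D`. -/
def diffBall (D : Set Plane) : Set Plane := ball 0 (Metric.diam D + 1)

theorem sub_mem_diffBall {x y : Plane} (hx : x ∈ D) (hy : y ∈ D) : x - y ∈ diffBall D := by
  rw [diffBall, mem_ball_zero_iff, ← dist_eq_norm]
  linarith [Metric.dist_le_diam_of_mem hD.out.isBounded hx hy]

theorem measurableSet_diffBall (D : Set Plane) : MeasurableSet (diffBall D) := measurableSet_ball

instance (D : Set Plane) : IsFiniteMeasure (volume.restrict (diffBall D)) :=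
  isFiniteMeasure_restrict.2 measure_ball_lt_top.ne

/-- A measurable kernel, square-integrable on the differences of points of `D`. -/
structure IsKernel (D : Set Plane) (k : Plane → ℂ) : Prop where
  measurable : Measurable k
  memLp : MemLp k 2 (volume.restrict (diffBall D))

/-- The norm of a kernel. -/
def kerNorm (D : Set Plane) (k : Plane → ℂ) : ℝ :=
  (eLpNorm k 2 (volume.restrict (diffBall D))).toReal

theorem kerNorm_nonneg (k : Plane → ℂ) : 0 ≤ kerNorm D k := ENNReal.toReal_nonneg

/-- The potential of `f` with the kernel `k`. -/
def conv (D : Set Plane) (k : Plane → ℂ) (f : Plane → ℂ) (x : Plane) : ℂ :=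
  ∫ y in D, k (x - y) * f y

theorem eLpNorm_shift_le {E : Type*} [NormedAddCommGroup E] {k : Plane → E}
    (hk : StronglyMeasurable k) (p : ℝ≥0∞) {x : Plane} (hx : x ∈ D) :
    eLpNorm (fun y => k (x - y)) p vol[D]
      ≤ eLpNorm k p (volume.restrict (diffBall D)) := by
  have h1 : D ⊆ (fun y => x - y) ⁻¹' diffBall D := fun y hy => sub_mem_diffBall hx hy
  have h2 := (Measure.measurePreserving_sub_left (volume : Measure Plane) x).restrict_preimage
    (measurableSet_diffBall D)
  exact (eLpNorm_mono_measure _ (Measure.restrict_mono h1 le_rfl)).trans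
    (eLpNorm_comp_measurePreserving hk.aestronglyMeasurable h2).le

theorem memLp_shift {E : Type*} [NormedAddCommGroup E] {k : Plane → E} (hk : StronglyMeasurable k)
    {p : ℝ≥0∞} (hp : MemLp k p (volume.restrict (diffBall D))) {x : Plane} (hx : x ∈ D) :
    MemLp (fun y => k (x - y)) p vol[D] :=
  ⟨(hk.comp_measurable (measurable_const.sub measurable_id)).aestronglyMeasurable,
    (eLpNorm_shift_le hk p hx).trans_lt hp.2⟩

theorem IsKernel.integrable {k f : Plane → ℂ} (hk : IsKernel D k)
    (hf : MemLp f 2 vol[D]) {x : Plane} (hx : x ∈ D) :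
    Integrable (fun y => k (x - y) * f y) vol[D] :=
  (memLp_shift hk.measurable.stronglyMeasurable hk.memLp hx).integrable_mul hf

theorem norm_integral_mul_le {μ : Measure Plane} {a b : Plane → ℂ} (ha : MemLp a 2 μ)
    (hb : MemLp b 2 μ) :
    ‖∫ y, a y * b y ∂μ‖ ≤ (eLpNorm a 2 μ).toReal * (eLpNorm b 2 μ).toReal := by
  have h1 : ‖∫ y, a y * b y ∂μ‖ ≤ (∫⁻ y, ‖a y * b y‖ₑ ∂μ).toReal := by
    refine (norm_integral_le_integral_norm _).trans (le_of_eq ?_)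
    exact integral_norm_eq_lintegral_enorm (ha.1.mul hb.1)
  refine h1.trans ?_
  rw [← ENNReal.toReal_mul]
  refine ENNReal.toReal_mono (ENNReal.mul_ne_top ha.2.ne hb.2.ne) ?_
  have h2 := eLpNorm_smul_le_mul_eLpNorm (p := 2) (q := 2) (r := 1) hb.1 ha.1
  rwa [eLpNorm_one_eq_lintegral_enorm] at h2

theorem IsKernel.norm_conv_le {k f : Plane → ℂ} (hk : IsKernel D k)
    (hf : MemLp f 2 vol[D]) {x : Plane} (hx : x ∈ D) :
    ‖conv D k f x‖ ≤ kerNorm D k * (eLpNorm f 2 vol[D]).toReal := by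
  refine (norm_integral_mul_le
    (memLp_shift hk.measurable.stronglyMeasurable hk.memLp hx) hf).trans ?_
  gcongr
  exact ENNReal.toReal_mono hk.memLp.2.ne (eLpNorm_shift_le hk.measurable.stronglyMeasurable 2 hx)

theorem aestronglyMeasurable_conv {k f : Plane → ℂ} (hk : Measurable k)
    (hf : AEStronglyMeasurable f vol[D]) :
    AEStronglyMeasurable (conv D k f) vol[D] := by
  refine AEStronglyMeasurable.integral_prod_right'
    (f := fun z : Plane × Plane => k (z.1 - z.2) * f z.2) ?_
  exact (hk.comp (measurable_fst.sub measurable_snd)).aestronglyMeasurable.mul hf.comp_snd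

theorem IsKernel.memLp_conv {k f : Plane → ℂ} (hk : IsKernel D k)
    (hf : MemLp f 2 vol[D]) : MemLp (conv D k f) 2 vol[D] :=
  MemLp.of_bound (aestronglyMeasurable_conv hk.measurable hf.1) _
    (ae_mem_domain.mono fun _ hx => hk.norm_conv_le hf hx)

theorem conv_congr {k f g : Plane → ℂ} (h : f =ᵐ[vol[D]] g) : conv D k f = conv D k g := by
  funext x
  exact integral_congr_ae (h.mono fun y hy => by simp only [hy])

theorem conv_congr_kernel {k l : Plane → ℂ} (h : ∀ z ≠ 0, k z = l z) (f : Plane → ℂ) :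
    conv D k f = conv D l f := by
  funext x
  refine integral_congr_ae (ae_restrict_of_ae ?_)
  have : ∀ᵐ y : Plane, y ≠ x := by
    rw [ae_iff]; simp
  exact this.mono fun y hy => by simp only [h (x - y) (sub_ne_zero.2 hy.symm)]

theorem norm_le_sqrt_area {f : L2 D} {C : ℝ} (hC : 0 ≤ C)
    (h : ∀ᵐ x ∂vol[D], ‖f x‖ ≤ C) : ‖f‖ ≤ sqrt (area D) * C := by
  refine (Lp.norm_le_of_ae_bound hC h).trans (le_of_eq ?_)
  rw [Real.sqrt_eq_rpow, area, measureUnivNNReal]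
  simp [ENNReal.toReal, ENNReal.toNNReal_ofNat]

theorem IsKernel.conv_add {k f g : Plane → ℂ} (hk : IsKernel D k)
    (hf : MemLp f 2 vol[D]) (hg : MemLp g 2 vol[D]) {x : Plane}
    (hx : x ∈ D) : conv D k (fun y => f y + g y) x = conv D k f x + conv D k g x := by
  simp only [conv, mul_add]
  exact integral_add (hk.integrable hf hx) (hk.integrable hg hx)

theorem conv_const_mul (k f : Plane → ℂ) (c : ℂ) (x : Plane) :
    conv D k (fun y => c * f y) x = c * conv D k f x := by
  simp only [conv, ← integral_const_mul]
  congr 1; funext y; ring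

/-- The potential with kernel `k` as a linear map on `L²(D)`. -/
def IsKernel.lin {k : Plane → ℂ} (hk : IsKernel D k) : L2 D →ₗ[ℂ] L2 D where
  toFun f := (hk.memLp_conv (Lp.memLp f)).toLp
  map_add' f g := by
    rw [← MemLp.toLp_add]
    refine MemLp.toLp_congr _ _ ?_
    rw [conv_congr (Lp.coeFn_add f g)]
    filter_upwards [ae_mem_domain] with x hx
    exact hk.conv_add (Lp.memLp f) (Lp.memLp g) hx
  map_smul' c f := by
    rw [RingHom.id_apply, ← MemLp.toLp_const_smul]
    refine MemLp.toLp_congr _ _ (.of_forall fun x => ?_)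
    rw [conv_congr (Lp.coeFn_smul c f)]
    exact conv_const_mul k f c x

theorem IsKernel.norm_lin_le {k : Plane → ℂ} (hk : IsKernel D k) (f : L2 D) :
    ‖hk.lin f‖ ≤ sqrt (area D) * kerNorm D k * ‖f‖ := by
  rw [mul_assoc]
  refine norm_le_sqrt_area (mul_nonneg (kerNorm_nonneg k) (norm_nonneg f)) ?_
  have h1 : hk.lin f =ᵐ[vol[D]] conv D k f :=
    (hk.memLp_conv (Lp.memLp f)).coeFn_toLp
  filter_upwards [ae_mem_domain, h1] with x hx h
  rw [h]
  exact hk.norm_conv_le (Lp.memLp f) hx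

open Classical in
/-- The convolution operator on `L²(D)`; zero if `k` is not a kernel. -/
def kop (D : Set Plane) [hD : Fact (ReflectionDomain D)] (k : Plane → ℂ) : L2 D →L[ℂ] L2 D :=
  if hk : IsKernel D k then
    LinearMap.mkContinuous hk.lin (sqrt (area D) * kerNorm D k) hk.norm_lin_le
  else 0

theorem IsKernel.kop_apply {k : Plane → ℂ} (hk : IsKernel D k) (f : L2 D) :
    kop D k f = (hk.memLp_conv (Lp.memLp f)).toLp := by
  simp only [kop, hk, dif_pos]; rfl

theorem IsKernel.coeFn_kop {k : Plane → ℂ} (hk : IsKernel D k) (f : L2 D) :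
    kop D k f =ᵐ[vol[D]] conv D k f := by
  rw [hk.kop_apply]; exact MemLp.coeFn_toLp _

theorem IsKernel.norm_kop_le {k : Plane → ℂ} (hk : IsKernel D k) :
    ‖kop D k‖ ≤ sqrt (area D) * kerNorm D k := by
  simp only [kop, hk, dif_pos]
  exact LinearMap.mkContinuous_norm_le _ (mul_nonneg (Real.sqrt_nonneg _) (kerNorm_nonneg k)) _

theorem IsKernel.kop_toLp {k f : Plane → ℂ} (hk : IsKernel D k)
    (hf : MemLp f 2 vol[D]) : kop D k hf.toLp = (hk.memLp_conv hf).toLp := by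
  rw [hk.kop_apply]
  exact MemLp.toLp_congr _ _ (by rw [conv_congr hf.coeFn_toLp])

theorem IsKernel.add {k l : Plane → ℂ} (hk : IsKernel D k) (hl : IsKernel D l) :
    IsKernel D (fun z => k z + l z) := ⟨hk.1.add hl.1, hk.2.add hl.2⟩

theorem IsKernel.sub {k l : Plane → ℂ} (hk : IsKernel D k) (hl : IsKernel D l) :
    IsKernel D (fun z => k z - l z) := ⟨hk.1.sub hl.1, hk.2.sub hl.2⟩

theorem IsKernel.const_mul {k : Plane → ℂ} (hk : IsKernel D k) (c : ℂ) :
    IsKernel D (fun z => c * k z) := ⟨hk.1.const_mul c, hk.2.const_mul c⟩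

theorem isKernel_of_bound {k : Plane → ℂ} (hk : Measurable k) {C : ℝ}
    (h : ∀ z ∈ diffBall D, ‖k z‖ ≤ C) : IsKernel D k :=
  ⟨hk, MemLp.of_bound hk.aestronglyMeasurable C
    ((ae_restrict_mem (measurableSet_diffBall D)).mono fun z hz => h z hz)⟩

theorem isKernel_const (c : ℂ) : IsKernel D (fun _ => c) :=
  isKernel_of_bound measurable_const (C := ‖c‖) fun _ _ => le_rfl

/-- A constant such that a kernel bounded by `C` has norm at most `C` times the constant. -/
def ballConst (D : Set Plane) : ℝ := sqrt (volume (diffBall D)).toReal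

theorem kerNorm_le {k : Plane → ℂ} {C : ℝ} (hC : 0 ≤ C) (h : ∀ z ∈ diffBall D, ‖k z‖ ≤ C) :
    kerNorm D k ≤ ballConst D * C := by
  have h1 := eLpNorm_le_of_ae_bound (p := 2) (f := k) (μ := volume.restrict (diffBall D))
    ((ae_restrict_mem (measurableSet_diffBall D)).mono fun z hz => h z hz)
  have h2 := ENNReal.toReal_mono (by
    refine ENNReal.mul_ne_top (ENNReal.rpow_ne_top_of_nonneg (by simp) ?_) ENNReal.ofReal_ne_top
    exact (measure_lt_top _ _).ne) h1
  refine h2.trans (le_of_eq ?_)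
  rw [ENNReal.toReal_mul, ENNReal.toReal_ofReal hC, ballConst, Real.sqrt_eq_rpow,
    ← ENNReal.toReal_rpow]
  simp

theorem kop_add {k l : Plane → ℂ} (hk : IsKernel D k) (hl : IsKernel D l) :
    kop D (fun z => k z + l z) = kop D k + kop D l := by
  ext1 f
  rw [add_apply, (hk.add hl).kop_apply, hk.kop_apply, hl.kop_apply,
    ← MemLp.toLp_add]
  refine MemLp.toLp_congr _ _ ?_
  filter_upwards [ae_mem_domain] with x hx
  simp only [conv, Pi.add_apply, add_mul]
  exact integral_add (hk.integrable (Lp.memLp f) hx) (hl.integrable (Lp.memLp f) hx)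

theorem kop_const_mul {k : Plane → ℂ} (hk : IsKernel D k) (c : ℂ) :
    kop D (fun z => c * k z) = c • kop D k := by
  ext1 f
  rw [smul_apply, (hk.const_mul c).kop_apply, hk.kop_apply,
    ← MemLp.toLp_const_smul]
  refine MemLp.toLp_congr _ _ (.of_forall fun x => ?_)
  simp only [conv, Pi.smul_apply, smul_eq_mul, ← integral_const_mul, mul_assoc]

theorem kop_sub {k l : Plane → ℂ} (hk : IsKernel D k) (hl : IsKernel D l) :
    kop D (fun z => k z - l z) = kop D k - kop D l := by
  have h := kop_add (hk.sub hl) hl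
  simp only [sub_add_cancel] at h
  rw [h, add_sub_cancel_right]

/-- The normalized constant function. -/
def constMode (D : Set Plane) [hD : Fact (ReflectionDomain D)] : L2 D :=
  (memLp_const (((sqrt (area D))⁻¹ : ℝ) : ℂ) :
    MemLp (fun _ => (((sqrt (area D))⁻¹ : ℝ) : ℂ)) 2 vol[D]).toLp

theorem coeFn_constMode :
    constMode D =ᵐ[vol[D]] fun _ => (((sqrt (area D))⁻¹ : ℝ) : ℂ) :=
  MemLp.coeFn_toLp _

theorem inner_constMode (f : L2 D) :
    ⟪constMode D, f⟫ = ((sqrt (area D))⁻¹ : ℝ) * ∫ x in D, f x := by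
  rw [L2.inner_def, ← integral_const_mul]
  refine integral_congr_ae ?_
  filter_upwards [coeFn_constMode (D := D)] with x hx
  rw [hx, RCLike.inner_apply, Complex.conj_ofReal, mul_comm]

theorem norm_constMode : ‖constMode D‖ = 1 := by
  have h1 : ⟪constMode D, constMode D⟫ = 1 := by
    rw [inner_constMode, integral_congr_ae coeFn_constMode, integral_const, measureReal_restrict_apply_univ,
      measureReal_def]
    change _ * (area D • _) = _
    rw [Complex.real_smul, ← Complex.ofReal_mul, ← Complex.ofReal_mul]
    have ha := area_pos (D := D)
    have hs := Real.sq_sqrt ha.le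
    have hs' : sqrt (area D) ≠ 0 := (Real.sqrt_pos.2 ha).ne'
    rw [show (sqrt (area D))⁻¹ * (area D * (sqrt (area D))⁻¹) = 1 by
      field_simp; rw [hs]]
    simp
  rw [inner_self_eq_norm_sq_to_K] at h1
  have h2 : ‖constMode D‖ ^ 2 = 1 := by
    have := congrArg norm h1
    rwa [norm_pow, RCLike.norm_ofReal, abs_norm, norm_one] at this
  exact (pow_eq_one_iff_of_nonneg (norm_nonneg _) two_ne_zero).1 h2

theorem inner_constMode_eq_zero {f : L2 D} : ⟪constMode D, f⟫ = 0 ↔ ∫ x in D, f x = 0 := by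
  rw [inner_constMode]
  have ha := Real.sqrt_pos.2 (area_pos (D := D))
  simp [ha.ne']

theorem kop_const (c : ℂ) (f : L2 D) :
    kop D (fun _ => c) f = (c * area D * ⟪constMode D, f⟫) • constMode D := by
  rw [(isKernel_const c).kop_apply]
  refine Lp.ext ?_
  filter_upwards [MemLp.coeFn_toLp ((isKernel_const c).memLp_conv (Lp.memLp f)),
    Lp.coeFn_smul (c * area D * ⟪constMode D, f⟫) (constMode D),
    coeFn_constMode (D := D)] with x h1 h2 h3
  rw [h1, h2, Pi.smul_apply, h3, inner_constMode, smul_eq_mul, conv, integral_const_mul]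
  have ha := area_pos (D := D)
  have hs : ((area D : ℝ) : ℂ) = (sqrt (area D) : ℂ) * (sqrt (area D) : ℂ) := by
    rw [← Complex.ofReal_mul, Real.mul_self_sqrt ha.le]
  have hs' : (sqrt (area D) : ℂ) ≠ 0 := by exact_mod_cast (Real.sqrt_pos.2 ha).ne'
  rw [hs]; push_cast; field_simp

end Kernel

section Reflection

variable {D : Set Plane} [hD : Fact (ReflectionDomain D)]

include hD in
theorem measurePreserving_reflect_domain :
    MeasurePreserving reflect vol[D] vol[D] := by
  have := measurePreserving_reflect.restrict_preimage (measurableSet_domain (D := D))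
  rwa [hD.out.reflect_preimage] at this

/-- Reflection of functions on `D`. -/
def reflectL2 (D : Set Plane) [hD : Fact (ReflectionDomain D)] : L2 D →ₗᵢ[ℂ] L2 D :=
  Lp.compMeasurePreservingₗᵢ ℂ reflect measurePreserving_reflect_domain

theorem coeFn_reflectL2 (f : L2 D) :
    reflectL2 D f =ᵐ[vol[D]] fun x => f (reflect x) :=
  Lp.coeFn_compMeasurePreserving f measurePreserving_reflect_domain

include hD in
theorem ae_reflect {p : Plane → Prop} (h : ∀ᵐ x ∂vol[D], p x) :
    ∀ᵐ x ∂vol[D], p (reflect x) :=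
  measurePreserving_reflect_domain.quasiMeasurePreserving.ae h

include hD in
theorem integral_comp_reflect (f : Plane → ℂ) :
    ∫ x in D, f (reflect x) = ∫ x in D, f x :=
  measurePreserving_reflect_domain.integral_comp
    (reflectEquiv.toHomeomorph.measurableEmbedding) f

include hD in
theorem conv_comp_reflect {k : Plane → ℂ} (hk : ∀ z, k (reflect z) = k z) (f : Plane → ℂ)
    (x : Plane) : conv D k (fun y => f (reflect y)) x = conv D k f (reflect x) := by
  rw [conv, conv, ← integral_comp_reflect]
  refine integral_congr_ae (.of_forall fun y => ?_)
  simp only [reflect_reflect]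
  rw [← hk (x - reflect y), reflect_sub, reflect_reflect]

theorem kop_reflectL2 {k : Plane → ℂ} (hk : IsKernel D k) (hr : ∀ z, k (reflect z) = k z)
    (f : L2 D) : kop D k (reflectL2 D f) = reflectL2 D (kop D k f) := by
  refine Lp.ext ?_
  filter_upwards [hk.coeFn_kop (reflectL2 D f), coeFn_reflectL2 (kop D k f),
    ae_reflect (hk.coeFn_kop f)] with x h1 h2 h3
  rw [h1, h2, h3, conv_congr (coeFn_reflectL2 f), conv_comp_reflect hr]

theorem reflectL2_constMode : reflectL2 D (constMode D) = constMode D := by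
  refine Lp.ext ?_
  filter_upwards [coeFn_reflectL2 (constMode D), coeFn_constMode (D := D),
    ae_reflect (coeFn_constMode (D := D))] with x h1 h2 h3
  rw [h1, h2, h3]

end Reflection

section Symmetric

variable {D : Set Plane} [hD : Fact (ReflectionDomain D)]

theorem IsKernel.integrable_prod {k f g : Plane → ℂ} (hk : IsKernel D k)
    (hf : MemLp f 2 vol[D]) (hg : MemLp g 2 vol[D]) :
    Integrable (fun z : Plane × Plane => g z.1 * (k (z.1 - z.2) * f z.2))
      (vol[D].prod vol[D]) := by
  have hm : AEStronglyMeasurable (fun z : Plane × Plane => g z.1 * (k (z.1 - z.2) * f z.2))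
      (vol[D].prod vol[D]) :=
    hg.1.comp_fst.mul ((hk.measurable.comp (measurable_fst.sub
      measurable_snd)).aestronglyMeasurable.mul hf.1.comp_snd)
  rw [integrable_prod_iff hm]
  have hk' : IsKernel D (fun z => (‖k z‖ : ℂ)) := by
    refine ⟨by have := hk.measurable; fun_prop, ?_⟩
    exact hk.memLp.norm.ofReal
  have hf' : MemLp (fun y => (‖f y‖ : ℂ)) 2 vol[D] := hf.norm.ofReal
  refine ⟨ae_mem_domain.mono fun x hx => (hk.integrable hf hx).const_mul (g x), ?_⟩
  have hc := (hk'.memLp_conv hf').norm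
  have : Integrable (fun x => ‖g x‖ * ‖conv D (fun z => (‖k z‖ : ℂ)) (fun y => (‖f y‖ : ℂ)) x‖)
      vol[D] := hg.norm.integrable_mul hc
  refine this.congr (.of_forall fun x => ?_)
  simp only [norm_mul, integral_const_mul]
  congr 1
  have : conv D (fun z => (‖k z‖ : ℂ)) (fun y => (‖f y‖ : ℂ)) x
      = ((∫ y in D, ‖k (x - y)‖ * ‖f y‖ : ℝ) : ℂ) := by
    rw [conv, ← integral_complex_ofReal]; push_cast; rfl
  rw [this, Complex.norm_of_nonneg]
  exact integral_nonneg fun y => by positivity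

/-- The potential with an even kernel is symmetric for the bilinear pairing. -/
theorem IsKernel.integral_mul_conv {k f g : Plane → ℂ} (hk : IsKernel D k)
    (heven : ∀ z, k (-z) = k z) (hf : MemLp f 2 vol[D])
    (hg : MemLp g 2 vol[D]) :
    ∫ x in D, g x * conv D k f x = ∫ y in D, f y * conv D k g y := by
  have h := integral_integral_swap (f := fun x y => g x * (k (x - y) * f y))
    (hk.integrable_prod hf hg)
  simp only [integral_const_mul] at h
  simp only [conv]
  rw [h]
  refine integral_congr_ae (.of_forall fun y => ?_)
  simp only
  rw [← integral_const_mul]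
  refine integral_congr_ae (.of_forall fun x => ?_)
  simp only
  rw [← heven (y - x), neg_sub]; ring

theorem kop_symm {k : Plane → ℂ} (hk : IsKernel D k) (heven : ∀ z, k (-z) = k z)
    (hreal : ∀ z, starRingEnd ℂ (k z) = k z) : (kop D k : L2 D →ₗ[ℂ] L2 D).IsSymmetric := by
  intro f g
  change ⟪kop D k f, g⟫ = ⟪f, kop D k g⟫
  rw [L2.inner_def, L2.inner_def]
  have hconj : ∀ x, starRingEnd ℂ (conv D k f x) = conv D k (fun y => starRingEnd ℂ (f y)) x := by
    intro x
    simp only [conv]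
    rw [← integral_conj]
    refine integral_congr_ae (.of_forall fun y => ?_)
    simp only [map_mul, hreal]
  have hfs : MemLp (fun y => starRingEnd ℂ (f y)) 2 vol[D] := (Lp.memLp f).star
  have h := hk.integral_mul_conv heven hfs (Lp.memLp g)
  refine (integral_congr_ae ?_).trans (h.trans (integral_congr_ae ?_))
  · filter_upwards [hk.coeFn_kop f] with x hx
    rw [RCLike.inner_apply, hx, hconj]
  · filter_upwards [hk.coeFn_kop g] with x hx
    rw [RCLike.inner_apply, hx, mul_comm]

end Symmetric

section Compact

variable {D : Set Plane} [hD : Fact (ReflectionDomain D)]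

/-- The continuous real functions `g` for which `g (x - y)` is a finite sum of products. -/
def separableKernels : Subalgebra ℝ C(Plane, ℝ) where
  carrier := {g | ∃ (ι : Type) (_ : Fintype ι) (a b : ι → C(Plane, ℝ)),
    ∀ x y, g (x - y) = ∑ i, a i x * b i y}
  mul_mem' := by
    rintro g h ⟨ι, _, a, b, hg⟩ ⟨κ, _, c, d, hh⟩
    refine ⟨ι × κ, inferInstance, fun p => a p.1 * c p.2, fun p => b p.1 * d p.2, fun x y => ?_⟩
    rw [ContinuousMap.mul_apply, hg, hh, Finset.sum_mul_sum, Fintype.sum_prod_type]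
    refine Finset.sum_congr rfl fun i _ => Finset.sum_congr rfl fun j _ => ?_
    simp only [ContinuousMap.mul_apply]; ring
  add_mem' := by
    rintro g h ⟨ι, _, a, b, hg⟩ ⟨κ, _, c, d, hh⟩
    refine ⟨ι ⊕ κ, inferInstance, Sum.elim a c, Sum.elim b d, fun x y => ?_⟩
    rw [ContinuousMap.add_apply, hg, hh, Fintype.sum_sum_type]
    simp
  algebraMap_mem' r :=
    ⟨Unit, inferInstance, fun _ => algebraMap ℝ _ r, fun _ => 1, fun x y => by simp⟩

theorem separatesPoints_separableKernels : separableKernels.SeparatesPoints := by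
  intro x y hxy
  obtain ⟨i, hi⟩ : ∃ i, x i ≠ y i := by
    by_contra! h; exact hxy (by ext i; exact h i)
  have hc : Continuous fun z : Plane => z i := by fun_prop
  refine ⟨fun z => z i, ⟨⟨fun z => z i, hc⟩, ⟨Bool, inferInstance,
    fun b => bif b then ⟨fun z => z i, hc⟩ else 1, fun b => bif b then 1 else -⟨fun z => z i, hc⟩,
    fun x y => ?_⟩, rfl⟩, hi⟩
  simp [sub_eq_add_neg]

theorem isKernel_of_continuous {k : Plane → ℂ} (hk : Continuous k) : IsKernel D k := by
  obtain ⟨C, hC⟩ := (isCompact_closedBall (0 : Plane) (Metric.diam D + 1)).exists_bound_of_continuousOn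
    hk.continuousOn
  exact isKernel_of_bound hk.measurable fun z hz => hC z (Metric.ball_subset_closedBall hz)

include hD in
theorem memLp_of_continuous {f : Plane → ℂ} (hf : Continuous f) :
    MemLp f 2 vol[D] := by
  obtain ⟨C, hC⟩ := hD.out.isBounded.isCompact_closure.exists_bound_of_continuousOn hf.continuousOn
  exact MemLp.of_bound hf.aestronglyMeasurable C
    (ae_mem_domain.mono fun x hx => hC x (subset_closure hx))

theorem isCompactOperator_kop_separable {g : C(Plane, ℝ)} (hg : g ∈ separableKernels) :
    IsCompactOperator (kop D fun z => (g z : ℂ)) := by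
  obtain ⟨ι, _, a, b, hab⟩ := hg
  have hk : IsKernel D fun z => (g z : ℂ) := isKernel_of_continuous (by fun_prop)
  have ha : ∀ i, MemLp (fun x => (a i x : ℂ)) 2 vol[D] := fun i =>
    memLp_of_continuous (by fun_prop)
  have hb : ∀ i, MemLp (fun x => (b i x : ℂ)) 2 vol[D] := fun i =>
    memLp_of_continuous (by fun_prop)
  have heq : kop D (fun z => (g z : ℂ))
      = ∑ i, (innerSL ℂ (hb i).toLp).smulRight (ha i).toLp := by
    ext1 f
    have hin : ∀ i, ⟪(hb i).toLp, f⟫ = ∫ y in D, (b i y : ℂ) * f y := by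
      intro i
      rw [L2.inner_def]
      refine integral_congr_ae ?_
      filter_upwards [(hb i).coeFn_toLp] with y hy
      rw [hy, RCLike.inner_apply, Complex.conj_ofReal, mul_comm]
    have h2 : (∑ i, (innerSL ℂ (hb i).toLp).smulRight (ha i).toLp : L2 D →L[ℂ] L2 D) f
        = ∑ i, ((ha i).const_smul (∫ y in D, (b i y : ℂ) * f y)).toLp := by
      rw [sum_apply]
      refine Finset.sum_congr rfl fun i _ => ?_
      rw [ContinuousLinearMap.smulRight_apply, innerSL_apply_apply, hin, MemLp.toLp_const_smul]
    rw [h2]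
    refine Lp.ext ?_
    set F : ι → L2 D := fun i => ((ha i).const_smul (∫ y in D, (b i y : ℂ) * f y)).toLp with hF
    have h3 : ∀ᵐ x ∂vol[D], ∀ i,
        F i x = (∫ y in D, (b i y : ℂ) * f y) * (a i x : ℂ) :=
      ae_all_iff.2 fun i => ((ha i).const_smul (∫ y in D, (b i y : ℂ) * f y)).coeFn_toLp
    filter_upwards [hk.coeFn_kop f, h3, Lp.coeFn_finsetSum Finset.univ F] with x hx h3 h4
    rw [hx, h4, Finset.sum_apply, conv]
    simp only [h3, hab]
    push_cast
    simp only [Finset.sum_mul]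
    rw [integral_finsetSum]
    · refine Finset.sum_congr rfl fun i _ => ?_
      rw [← integral_mul_const]
      congr 1; funext y; ring
    · intro i _
      have : Integrable (fun y => (b i y : ℂ) * f y) vol[D] :=
        (hb i).integrable_mul (Lp.memLp f)
      simpa only [mul_assoc] using this.const_mul (a i x : ℂ)
  rw [heq]
  have hsum : ∀ s : Finset ι, IsCompactOperator
      (∑ i ∈ s, (innerSL ℂ (hb i).toLp).smulRight (ha i).toLp : L2 D →L[ℂ] L2 D) := by
    classical
    intro s
    induction s using Finset.induction_on with
    | empty => simpa using isCompactOperator_zero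
    | insert i s hi ih =>
      rw [Finset.sum_insert hi]
      refine IsCompactOperator.add (f := ((innerSL ℂ (hb i).toLp).smulRight (ha i).toLp : L2 D →L[ℂ] L2 D)) ?_ ih
      exact (isCompactOperator_of_locallyCompactSpace_rng
        (ContinuousLinearMap.toSpanSingleton ℂ (ha i).toLp)).comp_clm (innerSL ℂ (hb i).toLp)
  exact hsum _

theorem kerNorm_add_le {k l : Plane → ℂ} (hk : IsKernel D k) (hl : IsKernel D l) :
    kerNorm D (fun z => k z + l z) ≤ kerNorm D k + kerNorm D l := by
  rw [kerNorm, kerNorm, kerNorm, ← ENNReal.toReal_add hk.memLp.2.ne hl.memLp.2.ne]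
  exact ENNReal.toReal_mono (ENNReal.add_ne_top.2 ⟨hk.memLp.2.ne, hl.memLp.2.ne⟩)
    (eLpNorm_add_le hk.memLp.1 hl.memLp.1 (by norm_num))

/-- Convolution operators with real kernels are compact. -/
theorem isCompactOperator_kop {k : Plane → ℝ} (hk : IsKernel D fun z => (k z : ℂ)) :
    IsCompactOperator (kop D fun z => (k z : ℂ)) := by
  have hmem : MemLp k 2 (volume.restrict (diffBall D)) := by
    have := hk.memLp.re
    simpa using this
  have key : ∀ ε > 0, ∃ T : L2 D →L[ℂ] L2 D, IsCompactOperator T ∧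
      ‖(kop D fun z => (k z : ℂ)) - T‖ < ε := by
    intro ε hε
    set A := sqrt (area D) with hA
    have hA0 : 0 ≤ A := Real.sqrt_nonneg _
    set B := ballConst D
    have hB0 : 0 ≤ B := Real.sqrt_nonneg _
    set η := ε / (2 * (A * (1 + B) + 1)) with hη
    have hη0 : 0 < η := by positivity
    obtain ⟨g, -, hg1, hg2, hg3⟩ := hmem.exists_hasCompactSupport_eLpNorm_sub_le (by norm_num)
      (ε := ENNReal.ofReal η) (by simpa using hη0)
    obtain ⟨h, hh1, hh2⟩ :=
      ContinuousMap.exists_mem_subalgebra_near_continuous_of_isCompact_of_separatesPoints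
        separatesPoints_separableKernels ⟨g, hg2⟩
        (isCompact_closedBall (0 : Plane) (Metric.diam D + 1)) hη0
    have hgk : IsKernel D fun z => (g z : ℂ) := isKernel_of_continuous (by fun_prop)
    have hhk : IsKernel D fun z => (h z : ℂ) := isKernel_of_continuous (by fun_prop)
    refine ⟨kop D fun z => (h z : ℂ), isCompactOperator_kop_separable hh1, ?_⟩
    rw [← kop_sub hk hhk]
    have e1 : (fun z => (k z : ℂ) - (h z : ℂ))
        = fun z => ((k z : ℂ) - (g z : ℂ)) + ((g z : ℂ) - (h z : ℂ)) := by
      funext z; ring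
    have n1 : kerNorm D (fun z => (k z : ℂ) - (g z : ℂ)) ≤ η := by
      have : eLpNorm (fun z => (k z : ℂ) - (g z : ℂ)) 2 (volume.restrict (diffBall D))
          = eLpNorm (k - g) 2 (volume.restrict (diffBall D)) := by
        refine eLpNorm_congr_norm_ae (.of_forall fun z => ?_)
        rw [← Complex.ofReal_sub, Complex.norm_real]; rfl
      rw [kerNorm, this]
      exact ENNReal.toReal_le_of_le_ofReal hη0.le hg1
    have n2 : kerNorm D (fun z => (g z : ℂ) - (h z : ℂ)) ≤ B * η := by
      refine kerNorm_le hη0.le fun z hz => ?_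
      rw [← Complex.ofReal_sub, Complex.norm_real, norm_sub_rev]
      exact (hh2 z (Metric.ball_subset_closedBall hz)).le
    have n3 : kerNorm D (fun z => (k z : ℂ) - (h z : ℂ)) ≤ (1 + B) * η := by
      rw [e1]
      refine (kerNorm_add_le (hk.sub hgk) (hgk.sub hhk)).trans ?_
      linarith
    refine ((hk.sub hhk).norm_kop_le).trans_lt ?_
    calc A * _ ≤ A * ((1 + B) * η) := by gcongr
      _ = (A * (1 + B)) * η := by ring
      _ ≤ (A * (1 + B) + 1) * η := by gcongr; linarith
      _ = ε / 2 := by rw [hη]; field_simp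
      _ < ε := by linarith
  choose T hT1 hT2 using fun n : ℕ => key (1 / ((n : ℝ) + 1)) (by positivity)
  refine isCompactOperator_of_tendsto (l := atTop) (F := T) ?_ (.of_forall hT1)
  rw [tendsto_iff_norm_sub_tendsto_zero]
  refine squeeze_zero (fun n => norm_nonneg _) (fun n => ?_)
    tendsto_one_div_add_atTop_nhds_zero_nat
  rw [norm_sub_rev]; exact (hT2 n).le

end Compact

/-! ### The logarithmic kernel -/

/-- The real logarithmic kernel. -/
def logKernelR (z : Plane) : ℝ := -(1 / (2 * Real.pi)) * log ‖z‖

/-- The logarithmic kernel. -/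
def logKernel (z : Plane) : ℂ := (logKernelR z : ℂ)

theorem finrank_plane : Module.finrank ℝ Plane = 2 := by simp

theorem integrableOn_inv_norm (r : ℝ) :
    IntegrableOn (fun z : Plane => ‖z‖⁻¹) (ball 0 r) volume := by
  rw [integrableOn_fun_norm_addHaar (μ := volume) (f := fun t => t⁻¹), finrank_plane]
  have : IntegrableOn (fun _ : ℝ => (1 : ℝ)) (Ioo 0 r) := by simp
  refine this.congr_fun (fun t ht => ?_) measurableSet_Ioo
  have : t ≠ 0 := ht.1.ne'
  simp [this]

theorem abs_log_pow_six_le {t R : ℝ} (ht : 0 < t) (htR : t ≤ R) :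
    |log t| ^ 6 ≤ 6 ^ 6 * t⁻¹ + R ^ 6 := by
  have hR : 0 < R := ht.trans_le htR
  rcases le_or_gt t 1 with h | h
  · have h1 := (Real.abs_log_mul_self_rpow_lt t (1 / 6) ht h (by norm_num)).le
    have h2 : |log t * t ^ (1 / 6 : ℝ)| ^ 6 ≤ 6 ^ 6 := by
      calc _ ≤ (1 / (1 / 6) : ℝ) ^ 6 := pow_le_pow_left₀ (abs_nonneg _) h1 6
        _ = 6 ^ 6 := by norm_num
    rw [abs_mul, mul_pow, abs_of_nonneg (Real.rpow_nonneg ht.le (1 / 6 : ℝ)), ← Real.rpow_natCast (t ^ (1 / 6 : ℝ)) 6,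
      ← Real.rpow_mul ht.le] at h2
    norm_num at h2
    have h3 : |log t| ^ 6 ≤ 6 ^ 6 * t⁻¹ := by
      rw [← div_eq_mul_inv, le_div_iff₀ ht]
      norm_num; linarith
    have : 0 ≤ R ^ 6 := by positivity
    linarith
  · have h1 : |log t| ≤ R := by
      rw [abs_of_nonneg (Real.log_nonneg h.le)]
      linarith [Real.log_le_sub_one_of_pos ht]
    have h2 := pow_le_pow_left₀ (abs_nonneg (log t)) h1 6
    have : 0 ≤ 6 ^ 6 * t⁻¹ := by positivity
    linarith

theorem measurable_logKernelR : Measurable logKernelR := by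
  unfold logKernelR; fun_prop

theorem measurable_logKernel : Measurable logKernel :=
  Complex.measurable_ofReal.comp measurable_logKernelR

theorem memLp_log_norm (r : ℝ) :
    MemLp (fun z : Plane => log ‖z‖) 6 (volume.restrict (ball 0 r)) := by
  have hm : Measurable fun z : Plane => log ‖z‖ := by fun_prop
  rw [← integrable_norm_rpow_iff hm.aestronglyMeasurable (by norm_num) (by norm_num)]
  have hfin : IsFiniteMeasure (volume.restrict (ball (0 : Plane) r)) :=
    isFiniteMeasure_restrict.2 measure_ball_lt_top.ne
  have hi : Integrable (fun z : Plane => 6 ^ 6 * ‖z‖⁻¹ + r ^ 6)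
      (volume.restrict (ball 0 r)) :=
    (Integrable.const_mul (integrableOn_inv_norm r) _).add (integrable_const _)
  refine hi.mono' (hm.norm.pow_const _).aestronglyMeasurable ?_
  filter_upwards [ae_restrict_mem measurableSet_ball, ae_restrict_of_ae
    (compl_mem_ae_iff.2 (measure_singleton (0 : Plane)))] with z hz hz0
  have h0 : 0 < ‖z‖ := norm_pos_iff.2 hz0
  rw [mem_ball_zero_iff] at hz
  have := abs_log_pow_six_le h0 hz.le
  simp only [ENNReal.toReal_ofNat]
  rw [Real.norm_of_nonneg (by positivity), Real.norm_eq_abs]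
  exact_mod_cast this

theorem memLp_logKernel (D : Set Plane) : MemLp logKernel 6 (volume.restrict (diffBall D)) := by
  have := ((memLp_log_norm (Metric.diam D + 1)).const_mul (-(1 / (2 * Real.pi)))).ofReal (K := ℂ)
  exact this

section Spectral

variable {D : Set Plane} [hD : Fact (ReflectionDomain D)]

theorem isKernel_logKernel : IsKernel D logKernel :=
  ⟨measurable_logKernel, (memLp_logKernel D).mono_exponent (by norm_num)⟩

theorem logKernel_neg (z : Plane) : logKernel (-z) = logKernel z := by
  simp [logKernel, logKernelR]

theorem logKernel_reflect (z : Plane) : logKernel (reflect z) = logKernel z := by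
  simp [logKernel, logKernelR, norm_reflect]

theorem newtonPotential_eq (f : Plane → ℂ) : newtonPotential D f = conv D logKernel f := rfl

/-- The logarithmic potential on `L²(D)`. -/
def logOp (D : Set Plane) [hD : Fact (ReflectionDomain D)] : L2 D →L[ℂ] L2 D := kop D logKernel

theorem isCompactOperator_logOp : IsCompactOperator (logOp D) :=
  isCompactOperator_kop (k := logKernelR) isKernel_logKernel

theorem logOp_symm : (logOp D : L2 D →ₗ[ℂ] L2 D).IsSymmetric :=
  kop_symm isKernel_logKernel logKernel_neg fun z => by simp [logKernel]

theorem coeFn_logOp (f : L2 D) : logOp D f =ᵐ[vol[D]] conv D logKernel f :=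
  isKernel_logKernel.coeFn_kop f

theorem coeFn_compression_logOp {f : L2 D} (hf : ⟪constMode D, f⟫ = 0) :
    compression (constMode D) (logOp D) f =ᵐ[vol[D]] reducedPotential D f := by
  rw [compression_apply _ hf]
  filter_upwards [Lp.coeFn_sub (logOp D f) (⟪constMode D, logOp D f⟫ • constMode D),
    Lp.coeFn_smul (⟪constMode D, logOp D f⟫) (constMode D), coeFn_logOp f,
    coeFn_constMode (D := D)] with x h1 h2 h3 h4
  rw [h1, Pi.sub_apply, h2, Pi.smul_apply, h3, h4, reducedPotential, newtonPotential_eq,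
    inner_constMode, integral_congr_ae (coeFn_logOp f), smul_eq_mul]
  congr 1
  have ha := area_pos (D := D)
  have hs : ((area D : ℝ) : ℂ) = (sqrt (area D) : ℂ) * (sqrt (area D) : ℂ) := by
    rw [← Complex.ofReal_mul, Real.mul_self_sqrt ha.le]
  have hs' : (sqrt (area D) : ℂ) ≠ 0 := by exact_mod_cast (Real.sqrt_pos.2 ha).ne'
  rw [hs]; push_cast; field_simp

theorem reducedPotential_congr {f g : Plane → ℂ} (h : f =ᵐ[vol[D]] g) :
    reducedPotential D f = reducedPotential D g := by
  funext x
  simp only [reducedPotential, newtonPotential_eq, conv_congr h]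

theorem memL20_coe (f : L2 D) : MemL20 D f ↔ ⟪constMode D, f⟫ = 0 :=
  ⟨fun h => inner_constMode_eq_zero.2 h.2, fun h => ⟨Lp.memLp f, inner_constMode_eq_zero.1 h⟩⟩

theorem MemL20.inner_toLp {f : Plane → ℂ} (hf : MemL20 D f) : ⟪constMode D, hf.1.toLp⟫ = 0 := by
  rw [inner_constMode_eq_zero, integral_congr_ae hf.1.coeFn_toLp, hf.2]

theorem resolvent_eq_iff {z : ℂ} {v f : L2 D} (hv : ⟪constMode D, v⟫ = 0) :
    z • v - compression (constMode D) (logOp D) v = f ↔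
      EqOnAE D (fun x => z * v x - reducedPotential D v x) f := by
  have h : (z • v - compression (constMode D) (logOp D) v : L2 D)
      =ᵐ[vol[D]] fun x => z * v x - reducedPotential D v x := by
    filter_upwards [Lp.coeFn_sub (z • v) (compression (constMode D) (logOp D) v),
      Lp.coeFn_smul z v, coeFn_compression_logOp hv] with x h1 h2 h3
    rw [h1, Pi.sub_apply, h2, h3]; rfl
  constructor
  · rintro rfl
    exact h.symm
  · intro h2
    exact Lp.ext (h.trans h2)

theorem reducedSpectrum_eq : reducedSpectrum D = compressionSpectrum (constMode D) (logOp D) := by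
  ext z
  rw [reducedSpectrum, compressionSpectrum, Set.mem_ofPred_eq, Set.mem_ofPred_eq, not_iff_not]
  constructor
  · intro H f hf
    obtain ⟨v, ⟨hv, hv1⟩, hv2⟩ := H f ((memL20_coe f).2 hf)
    refine ⟨hv.1.toLp, ⟨hv.inner_toLp, ?_⟩, fun w hw hwf => ?_⟩
    · rw [resolvent_eq_iff hv.inner_toLp]
      rw [reducedPotential_congr hv.1.coeFn_toLp]
      filter_upwards [hv.1.coeFn_toLp, hv1] with x h1 h2
      rw [h1, h2]
    · refine Lp.ext ?_
      exact (hv2 w ((memL20_coe w).2 hw) ((resolvent_eq_iff hw).1 hwf)).trans hv.1.coeFn_toLp.symm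
  · intro H f hf
    obtain ⟨v, ⟨hv, hv1⟩, hv2⟩ := H hf.1.toLp hf.inner_toLp
    refine ⟨v, ⟨(memL20_coe v).2 hv, ?_⟩, fun w hw hwf => ?_⟩
    · exact ((resolvent_eq_iff hv).1 hv1).trans hf.1.coeFn_toLp
    · have := hv2 hw.1.toLp hw.inner_toLp (by
        rw [resolvent_eq_iff hw.inner_toLp, reducedPotential_congr hw.1.coeFn_toLp]
        filter_upwards [hw.1.coeFn_toLp, hwf, hf.1.coeFn_toLp] with x h1 h2 h3
        rw [h1, h2, h3])
      rw [← this]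
      exact hw.1.coeFn_toLp.symm

theorem isEigenfunction_coe {μ : ℝ} {v : L2 D} : IsEigenfunction D μ v ↔
    ⟪constMode D, v⟫ = 0 ∧ v ≠ 0 ∧ compression (constMode D) (logOp D) v = (μ : ℂ) • v := by
  rw [IsEigenfunction, memL20_coe]
  refine and_congr_right fun hv => and_congr ?_ ?_
  · rw [not_iff_not]; exact (Lp.eq_zero_iff_ae_eq_zero (f := v)).symm
  · have h1 := coeFn_compression_logOp hv
    have h2 := Lp.coeFn_smul (μ : ℂ) v
    constructor
    · intro h
      refine Lp.ext (h1.trans (h.trans ?_))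
      filter_upwards [h2] with x hx
      rw [hx]; rfl
    · intro h
      refine h1.symm.trans ?_
      rw [h]
      filter_upwards [h2] with x hx
      rw [hx]; rfl

theorem IsEigenfunction.congr {μ : ℝ} {f g : Plane → ℂ} (hf : IsEigenfunction D μ f)
    (h : f =ᵐ[vol[D]] g) : IsEigenfunction D μ g := by
  refine ⟨⟨hf.1.1.ae_eq h, by rw [← integral_congr_ae h]; exact hf.1.2⟩, fun hg => hf.2.1 (h.trans hg),
    ?_⟩
  rw [← reducedPotential_congr h]
  filter_upwards [hf.2.2, h] with x h1 h2
  rw [h1, h2]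

/-- The difference of the indicators of two balls. -/
def ballDipole (a b : Plane) (r : ℝ) (x : Plane) : ℝ :=
  (ball a r).indicator 1 x - (ball b r).indicator 1 x

theorem measurable_ballDipole (a b : Plane) (r : ℝ) : Measurable (ballDipole a b r) :=
  (measurable_one.indicator measurableSet_ball).sub (measurable_one.indicator measurableSet_ball)

theorem memLp_ballDipole (a b : Plane) (r : ℝ) :
    MemLp (fun x => (ballDipole a b r x : ℂ)) 2 vol[D] := by
  refine MemLp.of_bound (Complex.measurable_ofReal.comp
    (measurable_ballDipole a b r)).aestronglyMeasurable 2 (.of_forall fun x => ?_)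
  rw [Complex.norm_real, Real.norm_eq_abs, ballDipole]
  by_cases h1 : x ∈ ball a r <;> by_cases h2 : x ∈ ball b r <;>
    simp [h1, h2]

theorem integral_indicator_ball_mul {p : Plane} {r : ℝ} (h : ball p r ⊆ D)
    (g : Plane → ℝ) :
    ∫ x in D, (ball p r).indicator 1 x * g x = ∫ x in ball p r, g x := by
  have : (fun x => (ball p r).indicator 1 x * g x) = (ball p r).indicator g := by
    funext x
    by_cases hx : x ∈ ball p r <;> simp [hx]
  rw [this, integral_indicator measurableSet_ball, Measure.restrict_restrict measurableSet_ball,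
    inter_eq_left.2 h]

end Spectral

section Spectral

variable {D : Set Plane} [hD : Fact (ReflectionDomain D)]

theorem ballDipole_swap (a b : Plane) (r : ℝ) (x : Plane) :
    ballDipole b a r x = -ballDipole a b r x := by simp [ballDipole]

theorem integral_mul_ballDipole {a b : Plane} {r : ℝ} (ha : ball a r ⊆ D)
    (hb : ball b r ⊆ D) {g : Plane → ℝ} (hg : Integrable g vol[D]) :
    ∫ x in D, g x * ballDipole a b r x
      = (∫ x in ball a r, g x) - ∫ x in ball b r, g x := by
  rw [← integral_indicator_ball_mul ha, ← integral_indicator_ball_mul hb, ← integral_sub]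
  · refine integral_congr_ae (.of_forall fun x => ?_)
    simp only [ballDipole]; ring
  · refine (hg.indicator (measurableSet_ball (x := a) (ε := r))).congr (.of_forall fun x => ?_)
    by_cases hx : x ∈ ball a r <;> simp [hx]
  · refine (hg.indicator (measurableSet_ball (x := b) (ε := r))).congr (.of_forall fun x => ?_)
    by_cases hx : x ∈ ball b r <;> simp [hx]

theorem integrable_logKernelR {x : Plane} (hx : x ∈ D) :
    Integrable (fun y => logKernelR (x - y)) vol[D] := by
  have h := (memLp_shift measurable_logKernel.stronglyMeasurable
    (isKernel_logKernel (D := D)).memLp hx).integrable (by norm_num)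
  exact h.re

theorem volume_real_ball_eq (a b : Plane) (r : ℝ) :
    volume.real (ball a r) = volume.real (ball b r) := by
  rw [measureReal_def, measureReal_def, Measure.addHaar_ball_center,
    Measure.addHaar_ball_center _ b]

/-- The logarithmic potential of a dipole is positive near its positive pole. -/
theorem logPotential_ballDipole_ge {a b : Plane} {r : ℝ} (hr : 0 < r) (hd : 6 * r ≤ dist a b)
    (ha : ball a r ⊆ D) (hb : ball b r ⊆ D) {x : Plane} (hx : x ∈ ball a r) :
    volume.real (ball a r) * (log 2 / (2 * Real.pi))
      ≤ ∫ y in D, logKernelR (x - y) * ballDipole a b r y := by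
  have hint := integrable_logKernelR (D := D) (ha hx)
  rw [integral_mul_ballDipole ha hb hint]
  have hpi := Real.pi_pos
  have hi : ∀ {c : Plane}, ball c r ⊆ D →
      IntegrableOn (fun y => logKernelR (x - y)) (ball c r) := fun hc =>
    IntegrableOn.mono_set hint hc
  have h1 : volume.real (ball a r) * (-(1 / (2 * Real.pi)) * log (2 * r))
      ≤ ∫ y in ball a r, logKernelR (x - y) := by
    rw [← smul_eq_mul, ← setIntegral_const]
    refine setIntegral_mono_ae_restrict (integrableOn_const measure_ball_lt_top.ne) (hi ha) ?_
    filter_upwards [ae_restrict_mem measurableSet_ball,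
      ae_restrict_of_ae (compl_mem_ae_iff.2 (measure_singleton x))] with y hy hyx
    have h0 : 0 < ‖x - y‖ := norm_pos_iff.2 (sub_ne_zero.2 fun h => hyx h.symm)
    have h2 : ‖x - y‖ ≤ 2 * r := by
      rw [← dist_eq_norm]
      have := dist_triangle_right x y a
      rw [Metric.mem_ball] at hx hy
      linarith
    have := Real.log_le_log h0 h2
    exact mul_le_mul_of_nonpos_left this (by simp; positivity)
  have h2 : ∫ y in ball b r, logKernelR (x - y)
      ≤ volume.real (ball a r) * (-(1 / (2 * Real.pi)) * log (4 * r)) := by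
    rw [volume_real_ball_eq a b, ← smul_eq_mul, ← setIntegral_const]
    refine setIntegral_mono_on (hi hb) (integrableOn_const measure_ball_lt_top.ne)
      measurableSet_ball fun y hy => ?_
    have h2 : 4 * r ≤ ‖x - y‖ := by
      rw [← dist_eq_norm]
      have h3 := dist_triangle a x b
      have h4 := dist_triangle x y b
      rw [Metric.mem_ball] at hx hy
      rw [dist_comm a x] at h3
      linarith
    have := Real.log_le_log (by positivity) h2
    exact mul_le_mul_of_nonpos_left this (by simp; positivity)
  have h3 : log (4 * r) - log (2 * r) = log 2 := by
    rw [← Real.log_div (by positivity) (by positivity)]; congr 1; field_simp; norm_num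
  have h4 : volume.real (ball a r) * (log 2 / (2 * Real.pi))
      = volume.real (ball a r) * (-(1 / (2 * Real.pi)) * log (2 * r))
        - volume.real (ball a r) * (-(1 / (2 * Real.pi)) * log (4 * r)) := by
    rw [← h3]; ring
  rw [h4]; linarith

/-- The dipole as an element of `L²(D)`. -/
def dipole (D : Set Plane) [hD : Fact (ReflectionDomain D)] (a b : Plane) (r : ℝ) : L2 D :=
  (memLp_ballDipole (D := D) a b r).toLp

theorem coeFn_dipole (a b : Plane) (r : ℝ) :
    dipole D a b r =ᵐ[vol[D]] fun x => (ballDipole a b r x : ℂ) := MemLp.coeFn_toLp _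

theorem inner_constMode_dipole {a b : Plane} {r : ℝ} (ha : ball a r ⊆ D)
    (hb : ball b r ⊆ D) : ⟪constMode D, dipole D a b r⟫ = 0 := by
  rw [inner_constMode_eq_zero, integral_congr_ae (coeFn_dipole a b r), integral_complex_ofReal]
  have h := integral_mul_ballDipole ha hb (integrable_const (μ := vol[D]) (1 : ℝ))
  simp only [one_mul] at h
  rw [h, setIntegral_const, setIntegral_const, volume_real_ball_eq a b]
  simp

theorem conv_ballDipole (a b : Plane) (r : ℝ) (x : Plane) :
    conv D logKernel (fun y => (ballDipole a b r y : ℂ)) x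
      = ((∫ y in D, logKernelR (x - y) * ballDipole a b r y : ℝ) : ℂ) := by
  rw [conv, ← integral_complex_ofReal]
  simp only [logKernel, Complex.ofReal_mul]

theorem re_inner_logOp_dipole_pos {a b : Plane} {r : ℝ} (hr : 0 < r) (hd : 6 * r ≤ dist a b)
    (ha : ball a r ⊆ D) (hb : ball b r ⊆ D) :
    0 < (⟪logOp D (dipole D a b r), dipole D a b r⟫).re := by
  set ψ : Plane → ℝ := fun x => ∫ y in D, logKernelR (x - y) * ballDipole a b r y with hψ
  have hin : ⟪logOp D (dipole D a b r), dipole D a b r⟫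
      = ((∫ x in D, ψ x * ballDipole a b r x : ℝ) : ℂ) := by
    rw [L2.inner_def, ← integral_complex_ofReal]
    refine integral_congr_ae ?_
    filter_upwards [coeFn_logOp (dipole D a b r), coeFn_dipole (D := D) a b r] with x h1 h2
    rw [RCLike.inner_apply, h1, h2, conv_congr (coeFn_dipole a b r), conv_ballDipole,
      Complex.conj_ofReal, Complex.ofReal_mul, mul_comm]
  rw [hin, Complex.ofReal_re]
  have hψi : Integrable ψ vol[D] := by
    have h := (isKernel_logKernel (D := D)).memLp_conv (memLp_ballDipole (D := D) a b r)
    have h2 := (h.integrable (by norm_num)).re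
    refine h2.congr (.of_forall fun x => ?_)
    simp only [conv_ballDipole]
    exact Complex.ofReal_re _
  rw [integral_mul_ballDipole ha hb hψi]
  set c := volume.real (ball a r) * (log 2 / (2 * Real.pi)) with hc
  have hV : 0 < volume.real (ball a r) :=
    ENNReal.toReal_pos (Metric.measure_ball_pos _ _ hr).ne' measure_ball_lt_top.ne
  have hc0 : 0 < c := by
    have := Real.log_pos (by norm_num : (1 : ℝ) < 2)
    have := Real.pi_pos
    positivity
  have h1 : volume.real (ball a r) * c ≤ ∫ x in ball a r, ψ x := by
    rw [← smul_eq_mul, ← setIntegral_const]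
    exact setIntegral_mono_on (integrableOn_const measure_ball_lt_top.ne)
      (IntegrableOn.mono_set hψi ha) measurableSet_ball
      fun x hx => logPotential_ballDipole_ge hr hd ha hb hx
  have h2 : ∫ x in ball b r, ψ x ≤ volume.real (ball a r) * (-c) := by
    rw [volume_real_ball_eq a b, ← smul_eq_mul, ← setIntegral_const]
    refine setIntegral_mono_on (IntegrableOn.mono_set hψi hb)
      (integrableOn_const measure_ball_lt_top.ne) measurableSet_ball fun x hx => ?_
    have h3 := logPotential_ballDipole_ge hr (by rwa [dist_comm]) hb ha hx
    rw [volume_real_ball_eq b a] at h3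
    simp only [ballDipole_swap a b, mul_neg, integral_neg] at h3
    linarith
  have := mul_pos hV hc0
  linarith

theorem exists_dipole_centers (D : Set Plane) [hD : Fact (ReflectionDomain D)] :
    ∃ a b : Plane, ∃ r₀ > 0, ∀ r, 0 < r → r ≤ r₀ → 6 * r ≤ dist a b ∧
      ball a r ⊆ D ∧ ball b r ⊆ D := by
  obtain ⟨p, hp⟩ := hD.out.nonempty
  obtain ⟨ρ, hρ, hball⟩ := Metric.isOpen_iff.1 hD.out.isOpen p hp
  have hd : dist p (p + (ρ / 2) • (EuclideanSpace.single 0 1 : Plane)) = ρ / 2 := by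
    rw [dist_self_add_right, norm_smul, Real.norm_of_nonneg (by positivity)]
    simp
  refine ⟨p, p + (ρ / 2) • EuclideanSpace.single 0 1, ρ / 12, by positivity, fun r hr hr0 => ?_⟩
  refine ⟨by rw [hd]; linarith, fun x hx => hball ?_, fun x hx => hball ?_⟩
  · rw [Metric.mem_ball] at hx ⊢
    linarith
  · rw [Metric.mem_ball] at hx ⊢
    have := dist_triangle x (p + (ρ / 2) • (EuclideanSpace.single 0 1 : Plane)) p
    rw [dist_comm (p + _) p, hd] at this
    linarith

/-- The logarithmic potential is small on functions with small support. -/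
theorem exists_volume_norm_logOp_le (D : Set Plane) [hD : Fact (ReflectionDomain D)] {ε : ℝ}
    (hε : 0 < ε) : ∃ δ : ℝ, 0 < δ ∧ ∀ s : Set Plane, MeasurableSet s → volume s ≤ ENNReal.ofReal δ →
      ∀ f : L2 D, (∀ᵐ x ∂vol[D], x ∉ s → f x = 0) → ‖logOp D f‖ ≤ ε * ‖f‖ := by
  have hs := Real.sqrt_pos.2 (area_pos (D := D))
  set η := ε / sqrt (area D) with hη
  have hη0 : 0 < η := by positivity
  have hk := isKernel_logKernel (D := D)
  obtain ⟨δ, hδ, H⟩ := hk.memLp.eLpNorm_indicator_le (by norm_num) (by norm_num) hη0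
  refine ⟨δ, hδ, fun s hs hvol f hf => ?_⟩
  have hpt : ∀ᵐ x ∂vol[D], ‖logOp D f x‖ ≤ η * ‖f‖ := by
    filter_upwards [coeFn_logOp f, ae_mem_domain] with x hx hxD
    rw [hx]
    set t : Set Plane := (fun y => x - y) ⁻¹' s with ht
    have htm : MeasurableSet t := hs.preimage (measurable_const.sub measurable_id)
    have hmp := Measure.measurePreserving_sub_left (volume : Measure Plane) x
    have hle : eLpNorm (t.indicator logKernel) 2 (volume.restrict (diffBall D))
        ≤ ENNReal.ofReal η := by
      refine H t htm ((Measure.restrict_apply_le _ _).trans ?_)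
      rwa [hmp.measure_preimage hs.nullMeasurableSet]
    have hk' : IsKernel D (t.indicator logKernel) :=
      ⟨measurable_logKernel.indicator htm, hk.memLp.indicator htm⟩
    have hconv : conv D logKernel f x = conv D (t.indicator logKernel) f x := by
      refine integral_congr_ae ?_
      filter_upwards [hf] with y hy
      by_cases hys : y ∈ s
      · have : x - y ∈ t := by simpa [ht] using hys
        rw [indicator_of_mem this]
      · rw [hy hys, mul_zero, mul_zero]
    rw [hconv]
    refine (hk'.norm_conv_le (Lp.memLp f) hxD).trans ?_
    rw [← Lp.norm_def]
    gcongr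
    exact ENNReal.toReal_le_of_le_ofReal hη0.le hle
  refine (norm_le_sqrt_area (by positivity) hpt).trans (le_of_eq ?_)
  rw [hη]; field_simp

theorem exists_unit_norm_logOp_le (D : Set Plane) [hD : Fact (ReflectionDomain D)] {ε : ℝ}
    (hε : 0 < ε) : ∃ f : L2 D, ⟪constMode D, f⟫ = 0 ∧ ‖f‖ = 1 ∧ ‖logOp D f‖ ≤ ε := by
  obtain ⟨a, b, r₀, hr₀, H⟩ := exists_dipole_centers D
  obtain ⟨δ, hδ, hsmall⟩ := exists_volume_norm_logOp_le D hε
  have htend : Tendsto (fun r : ℝ => volume (ball a r ∪ ball b r)) (𝓝[>] 0) (𝓝 0) := by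
    have h1 : Tendsto (fun r : ℝ => ENNReal.ofReal (r ^ 2) * volume (ball (0 : Plane) 1)
        + ENNReal.ofReal (r ^ 2) * volume (ball (0 : Plane) 1)) (𝓝[>] 0) (𝓝 0) := by
      have h2 : Tendsto (fun r : ℝ => ENNReal.ofReal (r ^ 2)) (𝓝[>] 0) (𝓝 0) := by
        rw [← ENNReal.ofReal_zero]
        refine ENNReal.tendsto_ofReal (tendsto_nhdsWithin_of_tendsto_nhds ?_)
        have : Continuous fun r : ℝ => r ^ 2 := by fun_prop
        simpa using this.tendsto 0
      have h3 := ENNReal.Tendsto.mul_const (b := volume (ball (0 : Plane) 1)) h2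
        (Or.inr measure_ball_lt_top.ne)
      simpa using h3.add h3
    refine tendsto_of_tendsto_of_tendsto_of_le_of_le' tendsto_const_nhds h1
      (.of_forall fun _ => zero_le) ?_
    filter_upwards [self_mem_nhdsWithin] with r hr
    refine (measure_union_le _ _).trans (le_of_eq ?_)
    rw [Measure.addHaar_ball volume a (le_of_lt hr), Measure.addHaar_ball volume b (le_of_lt hr), finrank_plane]
  have hev : ∀ᶠ r : ℝ in 𝓝[>] 0, 0 < r ∧ r ≤ r₀ ∧
      volume (ball a r ∪ ball b r) < ENNReal.ofReal δ := by
    refine (eventually_mem_nhdsWithin).and (Eventually.and ?_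
      (htend.eventually (gt_mem_nhds (by simpa using hδ))))
    exact eventually_nhdsWithin_of_eventually_nhds (eventually_le_nhds hr₀)
  obtain ⟨r, hr, hr1, hvol⟩ := hev.exists
  obtain ⟨hd, ha, hb⟩ := H r hr hr1
  set f := dipole D a b r with hf
  have hf0 : f ≠ 0 := by
    intro h0
    have := re_inner_logOp_dipole_pos hr hd ha hb
    rw [← hf, h0] at this
    simp at this
  have hfn : 0 < ‖f‖ := norm_pos_iff.2 hf0
  have hsupp : ∀ᵐ x ∂vol[D], x ∉ ball a r ∪ ball b r → f x = 0 := by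
    filter_upwards [coeFn_dipole (D := D) a b r] with x hx hxs
    rw [mem_union, not_or] at hxs
    rw [hf, hx, ballDipole, indicator_of_notMem hxs.1, indicator_of_notMem hxs.2]
    simp
  have hle := hsmall _ (measurableSet_ball.union measurableSet_ball) hvol.le f hsupp
  refine ⟨((‖f‖⁻¹ : ℝ) : ℂ) • f, ?_, ?_, ?_⟩
  · rw [inner_smul_right, hf, inner_constMode_dipole ha hb, mul_zero]
  · rw [norm_smul, Complex.norm_real, norm_inv, norm_norm, inv_mul_cancel₀ hfn.ne']
  · rw [map_smul, norm_smul, Complex.norm_real, norm_inv, norm_norm, inv_mul_le_iff₀ hfn, mul_comm]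
    exact hle

theorem IsPrincipalAntisymm.lam_pos {lam : ℝ} (h : IsPrincipalAntisymm D lam) : 0 < lam := by
  obtain ⟨a, b, r₀, hr₀, H⟩ := exists_dipole_centers D
  obtain ⟨hd, ha, hb⟩ := H r₀ hr₀ le_rfl
  have hpos := re_inner_logOp_dipole_pos hr₀ hd ha hb
  have h0 := inner_constMode_dipole ha hb
  have heq : ⟪compression (constMode D) (logOp D) (dipole D a b r₀), dipole D a b r₀⟫
      = ⟪logOp D (dipole D a b r₀), dipole D a b r₀⟫ := by
    rw [compression, ContinuousLinearMap.comp_apply, ContinuousLinearMap.comp_apply,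
      inner_projOff_left, projOff_of_inner_eq_zero h0]
  rw [← heq] at hpos
  obtain ⟨μ, hμ, v, hv0, hv⟩ := exists_pos_eigenvalue
    (compression_compact (constMode D) isCompactOperator_logOp)
    (compression_symm (constMode D) logOp_symm) hpos
  have hve : ⟪constMode D, v⟫ = 0 := by
    have h1 := inner_compression norm_constMode (logOp D) v
    rw [hv, inner_smul_right] at h1
    exact (mul_eq_zero.1 h1).resolve_left (by exact_mod_cast hμ.ne')
  exact hμ.trans_le (h.1 μ v (isEigenfunction_coe.2 ⟨hve, hv0, hv⟩))

theorem isAntisymm_coe {f : L2 D} : IsAntisymm D f ↔ reflectL2 D f = -f := by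
  constructor
  · intro h
    refine Lp.ext ?_
    filter_upwards [coeFn_reflectL2 f, h, Lp.coeFn_neg f] with x h1 h2 h3
    rw [h1, h2, h3]; rfl
  · intro h
    refine (coeFn_reflectL2 f).symm.trans ?_
    rw [h]
    exact Lp.coeFn_neg f

theorem isSymm_coe {f : L2 D} : IsSymm D f ↔ reflectL2 D f = f := by
  constructor
  · intro h
    exact Lp.ext ((coeFn_reflectL2 f).trans h)
  · intro h
    refine (coeFn_reflectL2 f).symm.trans ?_
    rw [h]

include hD in
theorem IsAntisymm.congr {f g : Plane → ℂ} (hf : IsAntisymm D f) (h : f =ᵐ[vol[D]] g) :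
    IsAntisymm D g := by
  filter_upwards [hf, h, ae_reflect h] with x h1 h2 h3
  rw [← h3, h1, h2]

include hD in
theorem IsSymm.congr {f g : Plane → ℂ} (hf : IsSymm D f) (h : f =ᵐ[vol[D]] g) :
    IsSymm D g := by
  filter_upwards [hf, h, ae_reflect h] with x h1 h2 h3
  rw [← h3, h1, h2]

theorem inner_constMode_of_antisymm {f : L2 D} (h : reflectL2 D f = -f) :
    ⟪constMode D, f⟫ = 0 := by
  have h1 : ⟪reflectL2 D (constMode D), reflectL2 D f⟫ = ⟪constMode D, f⟫ :=
    (reflectL2 D).inner_map_map _ _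
  rw [reflectL2_constMode, h, inner_neg_right] at h1
  have : (2 : ℂ) * ⟪constMode D, f⟫ = 0 := by linear_combination -h1
  exact (mul_eq_zero.1 this).resolve_left two_ne_zero

/-- A principal antisymmetric eigenfunction gives a simple mode of the logarithmic potential. -/
theorem IsPrincipalAntisymm.exists_simpleMode {lam : ℝ} (h : IsPrincipalAntisymm D lam) :
    ∃ φ : L2 D, SimpleMode (constMode D) φ (logOp D) lam ∧ reflectL2 D φ = -φ := by
  obtain ⟨φ₀, hφ₀, hanti, hsimple⟩ := h.2
  set f : L2 D := hφ₀.1.1.toLp with hf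
  have hfc : f =ᵐ[vol[D]] φ₀ := hφ₀.1.1.coeFn_toLp
  have hfe : IsEigenfunction D lam f := hφ₀.congr hfc.symm
  obtain ⟨he, hf0, heig⟩ := isEigenfunction_coe.1 hfe
  have hfa : reflectL2 D f = -f := isAntisymm_coe.1 (hanti.congr hfc.symm)
  have hn : 0 < ‖f‖ := norm_pos_iff.2 hf0
  have hKf : reflectL2 D (logOp D f) = -logOp D f := by
    rw [logOp, ← kop_reflectL2 isKernel_logKernel logKernel_reflect, hfa, map_neg]
  have heig' : logOp D f = (lam : ℂ) • f := by
    rw [← heig, compression_apply _ he, inner_constMode_of_antisymm hKf, zero_smul, sub_zero]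
  refine ⟨((‖f‖⁻¹ : ℝ) : ℂ) • f, ⟨norm_constMode, ?_, ?_, isCompactOperator_logOp, logOp_symm, ?_,
    h.lam_pos, ?_⟩, ?_⟩
  · rw [norm_smul, Complex.norm_real, norm_inv, norm_norm, inv_mul_cancel₀ hn.ne']
  · rw [inner_smul_right, he, mul_zero]
  · rw [map_smul, heig', smul_comm]
  · intro v hv hveig
    by_cases hv0 : v = 0
    · exact ⟨0, by rw [hv0, zero_smul]⟩
    obtain ⟨c, hc⟩ := hsimple v (isEigenfunction_coe.2 ⟨hv, hv0, hveig⟩)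
    refine ⟨c * ‖f‖, ?_⟩
    rw [smul_smul, mul_assoc, ← Complex.ofReal_mul, mul_inv_cancel₀ hn.ne', Complex.ofReal_one,
      mul_one]
    refine Lp.ext ?_
    filter_upwards [hc, Lp.coeFn_smul c f, hfc] with x h1 h2 h3
    rw [h1, h2, Pi.smul_apply, h3]; rfl
  · rw [map_smul, hfa, smul_neg]

theorem SimpleMode.zero_mem {φ : L2 D} {lam : ℝ}
    (h : SimpleMode (constMode D) φ (logOp D) lam) : (0 : ℂ) ∈ spectrum ℂ h.restr := by
  refine h.zero_mem_spectrum fun ε hε => ?_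
  obtain ⟨f, h1, h2, h3⟩ := exists_unit_norm_logOp_le D (half_pos hε)
  refine ⟨f, h1, h2, ?_⟩
  rw [compression_apply _ h1]
  refine (norm_sub_le _ _).trans ?_
  rw [norm_smul, norm_constMode, mul_one]
  have := norm_inner_le_norm (𝕜 := ℂ) (constMode D) (logOp D f)
  rw [norm_constMode, one_mul] at this
  linarith

/-- Half the distance of the principal eigenvalue to the rest of the spectrum. -/
def halfGap (D : Set Plane) (lam : ℝ) : ℝ :=
  infDist (lam : ℂ) (reducedSpectrum D \ {(lam : ℂ)}) / 2

theorem SimpleMode.halfGap_pos {φ : L2 D} {lam : ℝ}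
    (h : SimpleMode (constMode D) φ (logOp D) lam) : 0 < halfGap D lam := by
  have := h.infDist_pos ⟨0, h.zero_mem⟩
  rw [halfGap, reducedSpectrum_eq]
  linarith

theorem SimpleMode.infDist_le_norm {φ : L2 D} {lam : ℝ}
    (h : SimpleMode (constMode D) φ (logOp D) lam) (z : ℂ) :
    infDist z (reducedSpectrum D \ {(lam : ℂ)}) ≤ ‖z‖ := by
  rw [reducedSpectrum_eq, h.compressionSpectrum_diff]
  simpa using Metric.infDist_le_dist_of_mem (x := z) h.zero_mem

end Spectral

/-! ### The Green's function -/

theorem differentiable_tsum_of_le_inv_factorial {a : ℕ → ℂ} (ha : ∀ k, ‖a k‖ ≤ ((k.factorial : ℝ))⁻¹) :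
    Differentiable ℂ fun t : ℂ => ∑' k, a k * (t / 4) ^ k := by
  intro t
  have h : DifferentiableOn ℂ (fun t : ℂ => ∑' k, a k * (t / 4) ^ k) (ball 0 (‖t‖ + 1)) := by
    refine Complex.differentiableOn_tsum_of_summable_norm (Real.summable_pow_div_factorial (‖t‖ + 1))
      (fun k => by fun_prop) Metric.isOpen_ball fun k w hw => ?_
    rw [norm_mul, norm_pow, div_eq_inv_mul ((‖t‖ + 1) ^ k)]
    rw [mem_ball_zero_iff] at hw
    have hw4 : ‖w / 4‖ ≤ ‖t‖ + 1 := by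
      rw [norm_div]; norm_num
      have := norm_nonneg w
      linarith
    gcongr
    exact ha k
  exact h.differentiableAt (Metric.isOpen_ball.mem_nhds (by simp))

/-- The entire function with `besselJ0 z = besselJ (z ^ 2)`. -/
def besselJ (t : ℂ) : ℂ := ∑' k : ℕ, (-1) ^ k * (t / 4) ^ k / ((k.factorial : ℂ) ^ 2)

/-- The entire part of the function of the second kind, as a function of the square. -/
def besselY (t : ℂ) : ℂ :=
  ∑' k : ℕ, (-1) ^ (k + 1) * ((harmonic k : ℚ) : ℂ) * (t / 4) ^ k / ((k.factorial : ℂ) ^ 2)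

theorem one_le_factorial (k : ℕ) : (1 : ℝ) ≤ k.factorial := by
  exact_mod_cast Nat.one_le_iff_ne_zero.2 k.factorial_ne_zero

theorem differentiable_besselJ : Differentiable ℂ besselJ := by
  have h := differentiable_tsum_of_le_inv_factorial
    (a := fun k => (-1) ^ k / ((k.factorial : ℂ) ^ 2)) (fun k => by
      have := one_le_factorial k
      rw [norm_div, norm_pow, norm_pow, norm_neg, norm_one, one_pow, Complex.norm_natCast,
        one_div]
      gcongr
      nlinarith)
  convert h using 1
  funext t
  refine tsum_congr fun k => ?_
  ring

theorem harmonic_le (k : ℕ) : ((harmonic k : ℚ) : ℝ) ≤ k.factorial := by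
  have h1 : (harmonic k : ℚ) ≤ k := by
    rw [harmonic]
    calc ∑ i ∈ Finset.range k, ((i + 1 : ℕ) : ℚ)⁻¹ ≤ ∑ i ∈ Finset.range k, (1 : ℚ) := by
          refine Finset.sum_le_sum fun i _ => inv_le_one_of_one_le₀ ?_
          push_cast; linarith [(Nat.cast_nonneg i : (0 : ℚ) ≤ i)]
      _ = k := by simp
  have h2 : ((harmonic k : ℚ) : ℝ) ≤ k := by exact_mod_cast h1
  exact h2.trans (by exact_mod_cast Nat.self_le_factorial k)

theorem harmonic_nonneg (k : ℕ) : 0 ≤ ((harmonic k : ℚ) : ℝ) := by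
  have : (0 : ℚ) ≤ harmonic k := by
    rw [harmonic]; exact Finset.sum_nonneg fun i _ => by positivity
  exact_mod_cast this

theorem differentiable_besselY : Differentiable ℂ besselY := by
  have h := differentiable_tsum_of_le_inv_factorial
    (a := fun k => (-1) ^ (k + 1) * ((harmonic k : ℚ) : ℂ) / ((k.factorial : ℂ) ^ 2)) (fun k => by
      have h1 := one_le_factorial k
      rw [norm_div, norm_mul, norm_pow, norm_pow, norm_neg, norm_one, one_pow, Complex.norm_natCast,
        one_mul, ← Complex.ofReal_ratCast, Complex.norm_of_nonneg (harmonic_nonneg k)]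
      rw [div_le_iff₀ (by positivity), pow_two, ← mul_assoc, inv_mul_cancel₀ (by positivity), one_mul]
      exact harmonic_le k)
  convert h using 1
  funext t
  refine tsum_congr fun k => ?_
  ring

theorem besselJ_zero : besselJ 0 = 1 := by
  rw [besselJ, tsum_eq_single 0]
  · simp
  · intro k hk; simp [hk]

theorem besselY_zero : besselY 0 = 0 := by
  rw [besselY, tsum_eq_single 0]
  · simp
  · intro k hk; simp [hk]

/-- The coefficient of the constant part of the Green's function. -/
def greenCoeff (ω : ℂ) : ℂ :=
  Complex.I / 4 - (Complex.log ω - log 2 + Real.eulerMascheroniConstant) / (2 * Real.pi)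

/-- The kernel multiplying the coefficient, up to a constant. -/
def jKernel (q : ℂ) (z : Plane) : ℂ := besselJ (q * (‖z‖ ^ 2 : ℝ)) - 1

/-- The regular remainder of the Green's function. -/
def yKernel (q : ℂ) (z : Plane) : ℂ :=
  logKernel z * (besselJ (q * (‖z‖ ^ 2 : ℝ)) - 1) - besselY (q * (‖z‖ ^ 2 : ℝ)) / (2 * Real.pi)

theorem green_eq {ω : ℂ} (hω : ω ≠ 0) {z : Plane} (hz : z ≠ 0) :
    green ω z = greenCoeff ω + logKernel z
      + (greenCoeff ω * jKernel (ω ^ 2) z + yKernel (ω ^ 2) z) := by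
  have h0 : 0 < ‖z‖ := norm_pos_iff.2 hz
  have hlog : Complex.log (ω * ‖z‖ / 2) = log ‖z‖ - log 2 + Complex.log ω := by
    rw [mul_div_assoc, show ((‖z‖ : ℂ) / 2) = ((‖z‖ / 2 : ℝ) : ℂ) by push_cast; rfl,
      Complex.log_mul_ofReal _ (by positivity) _ hω, Real.log_div h0.ne' two_ne_zero]
    push_cast; ring
  have hj : besselJ0 (ω * ‖z‖) = besselJ (ω ^ 2 * (‖z‖ ^ 2 : ℝ)) := by
    rw [besselJ0, besselJ]; push_cast; rw [mul_pow]
  have hy : (∑' k : ℕ, (-1) ^ (k + 1) * ((harmonic k : ℚ) : ℂ) * ((ω * ‖z‖) ^ 2 / 4) ^ k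
        / ((k.factorial : ℂ) ^ 2)) = besselY (ω ^ 2 * (‖z‖ ^ 2 : ℝ)) := by
    rw [besselY]; push_cast; rw [mul_pow]
  rw [green, hankel0, besselY0, hy, hj, hlog, jKernel, yKernel, greenCoeff, logKernel, logKernelR]
  have hpi : (Real.pi : ℂ) ≠ 0 := by exact_mod_cast Real.pi_ne_zero
  have hI := Complex.I_sq
  push_cast
  field_simp
  ring_nf
  simp only [hI]
  ring

theorem exists_lipschitz_of_differentiable {F : ℂ → ℂ} (hF : Differentiable ℂ F) (R : ℝ) :
    ∃ C : ℝ, 0 ≤ C ∧ ∀ s ∈ closedBall (0 : ℂ) R, ∀ t ∈ closedBall (0 : ℂ) R,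
      ‖F s - F t‖ ≤ C * ‖s - t‖ := by
  have hd : Continuous (deriv F) := (hF.contDiff (n := 1)).continuous_deriv le_rfl
  obtain ⟨C, hC⟩ := (isCompact_closedBall (0 : ℂ) R).exists_bound_of_continuousOn hd.continuousOn
  refine ⟨max C 0, le_max_right _ _, fun s hs t ht => ?_⟩
  exact (convex_closedBall (0 : ℂ) R).norm_image_sub_le_of_norm_deriv_le
    (fun x _ => hF x) (fun x hx => (hC x hx).trans (le_max_left _ _)) ht hs

theorem exists_bound_sq_mul_log (R : ℝ) :
    ∃ C : ℝ, 0 ≤ C ∧ ∀ z : Plane, ‖z‖ ≤ R → ‖z‖ ^ 2 * ‖logKernel z‖ ≤ C := by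
  have hc : Continuous fun t : ℝ => (1 / (2 * Real.pi)) * (t * (t * log t)) := by
    have := Real.continuous_mul_log
    fun_prop
  obtain ⟨C, hC⟩ := (isCompact_Icc (a := (0 : ℝ)) (b := R)).exists_bound_of_continuousOn
    hc.continuousOn
  refine ⟨max C 0, le_max_right _ _, fun z hz => ?_⟩
  refine le_trans (le_of_eq ?_) ((hC ‖z‖ ⟨norm_nonneg z, hz⟩).trans (le_max_left _ _))
  rw [logKernel, Complex.norm_real, logKernelR, norm_mul, norm_mul, norm_mul, norm_mul, norm_neg,
    norm_norm]
  ring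

section Operators

variable {D : Set Plane} [hD : Fact (ReflectionDomain D)]

theorem measurable_jKernel (q : ℂ) : Measurable (jKernel q) := by
  have := differentiable_besselJ.continuous
  unfold jKernel
  exact Continuous.measurable (by fun_prop)

theorem measurable_yKernel (q : ℂ) : Measurable (yKernel q) := by
  have h1 := differentiable_besselJ.continuous
  have h2 := differentiable_besselY.continuous
  unfold yKernel
  refine (measurable_logKernel.mul (Continuous.measurable (by fun_prop))).sub
    (Continuous.measurable (by fun_prop))

/-- Both regular kernels depend on `q` in a Lipschitz way. -/
theorem exists_kernel_lipschitz (D : Set Plane) : ∃ C : ℝ, 0 ≤ C ∧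
    ∀ p ∈ 𝔻, ∀ q ∈ 𝔻, ∀ z ∈ diffBall D,
      ‖jKernel p z - jKernel q z‖ ≤ C * ‖p - q‖ ∧ ‖yKernel p z - yKernel q z‖ ≤ C * ‖p - q‖ := by
  set R := Metric.diam D + 1 with hR
  have hR0 : 0 ≤ R := by have := Metric.diam_nonneg (s := D); linarith
  obtain ⟨A, hA0, hA⟩ := exists_lipschitz_of_differentiable differentiable_besselJ (R ^ 2)
  obtain ⟨B, hB0, hB⟩ := exists_lipschitz_of_differentiable differentiable_besselY (R ^ 2)
  obtain ⟨M, hM0, hM⟩ := exists_bound_sq_mul_log R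
  refine ⟨A * R ^ 2 + (M * A + B * R ^ 2), by positivity, fun p hp q hq z hz => ?_⟩
  rw [diffBall, mem_ball_zero_iff, ← hR] at hz
  rw [mem_closedBall_zero_iff] at hp hq
  have hz2 : ‖z‖ ^ 2 ≤ R ^ 2 := pow_le_pow_left₀ (norm_nonneg z) hz.le 2
  have hmem : ∀ w : ℂ, ‖w‖ ≤ 1 → w * ((‖z‖ ^ 2 : ℝ) : ℂ) ∈ closedBall (0 : ℂ) (R ^ 2) := by
    intro w hw
    rw [mem_closedBall_zero_iff, norm_mul, Complex.norm_of_nonneg (by positivity)]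
    calc ‖w‖ * ‖z‖ ^ 2 ≤ 1 * R ^ 2 := by gcongr
      _ = R ^ 2 := one_mul _
  have hsub : ‖p * ((‖z‖ ^ 2 : ℝ) : ℂ) - q * ((‖z‖ ^ 2 : ℝ) : ℂ)‖ = ‖z‖ ^ 2 * ‖p - q‖ := by
    rw [← sub_mul, norm_mul, Complex.norm_of_nonneg (by positivity), mul_comm]
  have h1 := hA _ (hmem p hp) _ (hmem q hq)
  have h2 := hB _ (hmem p hp) _ (hmem q hq)
  rw [hsub] at h1 h2
  have hpq := norm_nonneg (p - q)
  have h1' : ‖jKernel p z - jKernel q z‖ ≤ A * (‖z‖ ^ 2 * ‖p - q‖) := by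
    rw [jKernel, jKernel, sub_sub_sub_cancel_right]; exact h1
  constructor
  · refine h1'.trans ?_
    calc A * (‖z‖ ^ 2 * ‖p - q‖) ≤ A * (R ^ 2 * ‖p - q‖) := by gcongr
      _ ≤ _ := by
        have : 0 ≤ (M * A + B * R ^ 2) * ‖p - q‖ := by positivity
        linarith
  · have e : yKernel p z - yKernel q z = logKernel z * (jKernel p z - jKernel q z)
        - (besselY (p * ((‖z‖ ^ 2 : ℝ) : ℂ)) - besselY (q * ((‖z‖ ^ 2 : ℝ) : ℂ))) / (2 * Real.pi) := by
      simp only [yKernel, jKernel]; ring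
    have h3 : ‖logKernel z * (jKernel p z - jKernel q z)‖ ≤ M * A * ‖p - q‖ := by
      rw [norm_mul]
      calc ‖logKernel z‖ * ‖jKernel p z - jKernel q z‖ ≤ ‖logKernel z‖ * (A * (‖z‖ ^ 2 * ‖p - q‖)) := by
            gcongr
        _ = (‖z‖ ^ 2 * ‖logKernel z‖) * A * ‖p - q‖ := by ring
        _ ≤ M * A * ‖p - q‖ := by gcongr; exact hM z hz.le
    have h4 : ‖(besselY (p * ((‖z‖ ^ 2 : ℝ) : ℂ)) - besselY (q * ((‖z‖ ^ 2 : ℝ) : ℂ))) / (2 * Real.pi)‖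
        ≤ B * R ^ 2 * ‖p - q‖ := by
      rw [norm_div]
      have h5 : (1 : ℝ) ≤ ‖(2 * Real.pi : ℂ)‖ := by
        rw [norm_mul, Complex.norm_of_nonneg Real.pi_pos.le]
        have := Real.pi_gt_three
        norm_num; linarith
      refine (div_le_self (norm_nonneg _) h5).trans (h2.trans ?_)
      calc B * (‖z‖ ^ 2 * ‖p - q‖) ≤ B * (R ^ 2 * ‖p - q‖) := by gcongr
        _ = _ := by ring
    rw [e]
    refine (norm_sub_le _ _).trans ?_
    have : 0 ≤ A * R ^ 2 * ‖p - q‖ := by positivity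
    linarith

theorem jKernel_zero (z : Plane) : jKernel 0 z = 0 := by simp [jKernel, besselJ_zero]

theorem yKernel_zero (z : Plane) : yKernel 0 z = 0 := by
  simp [yKernel, besselJ_zero, besselY_zero]

/-- A Lipschitz constant for the regular kernels. -/
def kernelConst (D : Set Plane) : ℝ := (exists_kernel_lipschitz D).choose

theorem kernelConst_nonneg (D : Set Plane) : 0 ≤ kernelConst D :=
  (exists_kernel_lipschitz D).choose_spec.1

theorem kernel_lipschitz {p q : ℂ} (hp : p ∈ 𝔻)
    (hq : q ∈ 𝔻) {z : Plane} (hz : z ∈ diffBall D) :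
    ‖jKernel p z - jKernel q z‖ ≤ kernelConst D * ‖p - q‖ ∧
      ‖yKernel p z - yKernel q z‖ ≤ kernelConst D * ‖p - q‖ :=
  (exists_kernel_lipschitz D).choose_spec.2 p hp q hq z hz

theorem norm_kernel_le {q : ℂ} (hq : q ∈ 𝔻) {z : Plane}
    (hz : z ∈ diffBall D) :
    ‖jKernel q z‖ ≤ kernelConst D * ‖q‖ ∧ ‖yKernel q z‖ ≤ kernelConst D * ‖q‖ := by
  have := kernel_lipschitz hq (Metric.mem_closedBall_self zero_le_one) hz
  simpa only [jKernel_zero, yKernel_zero, sub_zero] using this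

theorem isKernel_jKernel {q : ℂ} (hq : q ∈ 𝔻) : IsKernel D (jKernel q) :=
  isKernel_of_bound (measurable_jKernel q) fun _ hz => (norm_kernel_le hq hz).1

theorem isKernel_yKernel {q : ℂ} (hq : q ∈ 𝔻) : IsKernel D (yKernel q) :=
  isKernel_of_bound (measurable_yKernel q) fun _ hz => (norm_kernel_le hq hz).2

theorem norm_kop_sub_le {k l : Plane → ℂ} (hk : IsKernel D k) (hl : IsKernel D l) {C : ℝ}
    (hC : 0 ≤ C) (h : ∀ z ∈ diffBall D, ‖k z - l z‖ ≤ C) :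
    ‖kop D k - kop D l‖ ≤ sqrt (area D) * (ballConst D * C) := by
  rw [← kop_sub hk hl]
  refine (hk.sub hl).norm_kop_le.trans ?_
  gcongr
  exact kerNorm_le hC h

/-- A Lipschitz constant for the regular operators. -/
def opConst (D : Set Plane) : ℝ := sqrt (area D) * (ballConst D * kernelConst D)

theorem opConst_nonneg (D : Set Plane) : 0 ≤ opConst D :=
  mul_nonneg (Real.sqrt_nonneg _) (mul_nonneg (Real.sqrt_nonneg _) (kernelConst_nonneg D))

theorem norm_kop_jKernel_sub_le {p q : ℂ} (hp : p ∈ 𝔻)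
    (hq : q ∈ 𝔻) :
    ‖kop D (jKernel p) - kop D (jKernel q)‖ ≤ opConst D * ‖p - q‖ := by
  have := norm_kop_sub_le (isKernel_jKernel (D := D) hp) (isKernel_jKernel hq)
    (mul_nonneg (kernelConst_nonneg D) (norm_nonneg _)) fun z hz => (kernel_lipschitz hp hq hz).1
  rw [opConst]; linarith

theorem norm_kop_yKernel_sub_le {p q : ℂ} (hp : p ∈ 𝔻)
    (hq : q ∈ 𝔻) :
    ‖kop D (yKernel p) - kop D (yKernel q)‖ ≤ opConst D * ‖p - q‖ := by
  have := norm_kop_sub_le (isKernel_yKernel (D := D) hp) (isKernel_yKernel hq)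
    (mul_nonneg (kernelConst_nonneg D) (norm_nonneg _)) fun z hz => (kernel_lipschitz hp hq hz).2
  rw [opConst]; linarith

theorem kop_eq_zero {k : Plane → ℂ} (h : ∀ z, k z = 0) : kop D k = 0 := by
  have hk : k = fun z => (0 : ℂ) * (0 : ℂ) := by funext z; rw [h, zero_mul]
  rw [hk, kop_const_mul (isKernel_const 0), zero_smul]

theorem jKernel_reflect (q : ℂ) (z : Plane) : jKernel q (reflect z) = jKernel q z := by
  simp [jKernel, norm_reflect]

theorem yKernel_reflect (q : ℂ) (z : Plane) : yKernel q (reflect z) = yKernel q z := by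
  simp [yKernel, norm_reflect, logKernel_reflect]

/-- The Green's function away from the origin. -/
def greenKernel (c q : ℂ) (z : Plane) : ℂ :=
  (c + logKernel z) + (c * jKernel q z + yKernel q z)

theorem isKernel_greenKernel (c : ℂ) {q : ℂ} (hq : q ∈ 𝔻) :
    IsKernel D (greenKernel c q) :=
  ((isKernel_const c).add isKernel_logKernel).add
    (((isKernel_jKernel hq).const_mul c).add (isKernel_yKernel hq))

theorem kop_greenKernel (c : ℂ) {q : ℂ} (hq : q ∈ 𝔻) (f : L2 D) :
    kop D (greenKernel c q) f = (c * area D * ⟪constMode D, f⟫) • constMode D + logOp D f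
      + (c • kop D (jKernel q) f + kop D (yKernel q) f) := by
  have h1 := kop_add ((isKernel_const (D := D) c).add isKernel_logKernel)
    (((isKernel_jKernel hq).const_mul c).add (isKernel_yKernel hq))
  have h2 := kop_add (isKernel_const (D := D) c) isKernel_logKernel
  have h3 := kop_add ((isKernel_jKernel (D := D) hq).const_mul c) (isKernel_yKernel hq)
  have h4 := kop_const_mul (isKernel_jKernel (D := D) hq) c
  change kop D (fun z => (c + logKernel z) + (c * jKernel q z + yKernel q z)) f = _
  rw [h1, h2, h3, h4, ← kop_const]
  rfl

theorem conv_green {ω : ℂ} (hω : ω ≠ 0) (f : Plane → ℂ) :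
    conv D (green ω) f = conv D (greenKernel (greenCoeff ω) (ω ^ 2)) f :=
  conv_congr_kernel (fun _ hz => green_eq hω hz) f

end Operators

/-! ### Integral inequalities -/

/-- Minkowski's integral inequality for a weighted integral. -/
theorem lintegral_rpow_lintegral_mul_le {X Y : Type*} [MeasurableSpace X] [MeasurableSpace Y]
    {μ : Measure X} {ν : Measure Y} [SFinite μ] [SFinite ν] {p : ℝ} (hp : 1 < p) {a : Y → ℝ≥0∞}
    {b : X → Y → ℝ≥0∞} (ha : AEMeasurable a ν) (hb : Measurable (Function.uncurry b)) {B : ℝ≥0∞}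
    (hB : ∀ᵐ t ∂ν, ∫⁻ x, b x t ^ p ∂μ ≤ B) :
    ∫⁻ x, (∫⁻ t, a t * b x t ∂ν) ^ p ∂μ ≤ (∫⁻ t, a t ∂ν) ^ p * B := by
  have hp0 : 0 < p := by linarith
  have hq : p.HolderConjugate (p / (p - 1)) := Real.HolderConjugate.conjExponent hp
  set q := p / (p - 1) with hqd
  have hq0 : 0 < q := hq.symm.pos
  have hbx : ∀ x, Measurable (b x) := fun x => hb.comp measurable_prodMk_left
  have hpq : 1 / q + 1 / p = 1 := by
    have := hq.inv_add_inv_eq_one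
    rw [one_div, one_div, add_comm]; exact this
  have key : ∀ x, (∫⁻ t, a t * b x t ∂ν) ^ p
      ≤ (∫⁻ t, a t ∂ν) ^ (p - 1) * ∫⁻ t, a t * b x t ^ p ∂ν := by
    intro x
    have h1 := ENNReal.lintegral_mul_le_Lp_mul_Lq ν hq.symm (f := fun t => a t ^ (1 / q))
      (g := fun t => a t ^ (1 / p) * b x t) (ha.pow_const _)
      ((ha.pow_const _).mul (hbx x).aemeasurable)
    have e1 : ∀ t, a t ^ (1 / q) * (a t ^ (1 / p) * b x t) = a t * b x t := by
      intro t
      rw [← mul_assoc, ← ENNReal.rpow_add_of_nonneg _ _ (by positivity) (by positivity), hpq,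
        ENNReal.rpow_one]
    have e2 : ∀ t, (a t ^ (1 / q)) ^ q = a t := by
      intro t
      rw [← ENNReal.rpow_mul, one_div, inv_mul_cancel₀ hq0.ne', ENNReal.rpow_one]
    have e3 : ∀ t, (a t ^ (1 / p) * b x t) ^ p = a t * b x t ^ p := by
      intro t
      rw [ENNReal.mul_rpow_of_nonneg _ _ hp0.le, ← ENNReal.rpow_mul, one_div,
        inv_mul_cancel₀ hp0.ne', ENNReal.rpow_one]
    simp only [Pi.mul_apply, e1, e2, e3] at h1
    calc (∫⁻ t, a t * b x t ∂ν) ^ p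
        ≤ ((∫⁻ t, a t ∂ν) ^ (1 / q) * (∫⁻ t, a t * b x t ^ p ∂ν) ^ (1 / p)) ^ p :=
          ENNReal.rpow_le_rpow h1 hp0.le
      _ = _ := by
          rw [ENNReal.mul_rpow_of_nonneg _ _ hp0.le, ← ENNReal.rpow_mul, ← ENNReal.rpow_mul,
            one_div p, inv_mul_cancel₀ hp0.ne', ENNReal.rpow_one]
          congr 2
          rw [hqd]; field_simp
  have hm : AEMeasurable (fun z : X × Y => a z.2 * b z.1 z.2 ^ p) (μ.prod ν) :=
    (ha.comp_quasiMeasurePreserving Measure.quasiMeasurePreserving_snd).mul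
      (hb.pow_const p).aemeasurable
  calc ∫⁻ x, (∫⁻ t, a t * b x t ∂ν) ^ p ∂μ
      ≤ ∫⁻ x, (∫⁻ t, a t ∂ν) ^ (p - 1) * ∫⁻ t, a t * b x t ^ p ∂ν ∂μ := lintegral_mono key
    _ = (∫⁻ t, a t ∂ν) ^ (p - 1) * ∫⁻ x, ∫⁻ t, a t * b x t ^ p ∂ν ∂μ := by
        rw [lintegral_const_mul'' _ hm.lintegral_prod_right']
    _ = (∫⁻ t, a t ∂ν) ^ (p - 1) * ∫⁻ t, a t * ∫⁻ x, b x t ^ p ∂μ ∂ν := by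
        rw [lintegral_lintegral_swap hm]
        congr 1
        refine lintegral_congr fun t => ?_
        rw [lintegral_const_mul]
        exact (hb.comp measurable_prodMk_right).pow_const p
    _ ≤ (∫⁻ t, a t ∂ν) ^ (p - 1) * ∫⁻ t, a t * B ∂ν := by
        gcongr 1
        refine lintegral_mono_ae (hB.mono fun t ht => ?_)
        gcongr
    _ = (∫⁻ t, a t ∂ν) ^ (p - 1) * ((∫⁻ t, a t ∂ν) ^ (1 : ℝ) * B) := by
        rw [lintegral_mul_const'' _ ha, ENNReal.rpow_one]
    _ = _ := by
        rw [← mul_assoc, ← ENNReal.rpow_add_of_nonneg _ _ (by linarith) zero_le_one,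
          sub_add_cancel]

/-- A functional bounded by the norm of a representation in a Hilbert space is represented. -/
theorem exists_representative {E H : Type*} [AddCommGroup E] [Module ℝ E] [NormedAddCommGroup H]
    [InnerProductSpace ℝ H] [CompleteSpace H] (ι : E →ₗ[ℝ] H) (ℓ : E →ₗ[ℝ] ℝ) {C : ℝ} (hC : 0 ≤ C)
    (h : ∀ x, |ℓ x| ≤ C * ‖ι x‖) : ∃ v : H, ‖v‖ ≤ C ∧ ∀ x, ℓ x = inner ℝ v (ι x) := by
  obtain ⟨g, hg⟩ := ι.rangeRestrict.exists_rightInverse_of_surjective ι.range_rangeRestrict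
  have hg' : ∀ y : LinearMap.range ι, ι (g y) = y := fun y =>
    congrArg Subtype.val (LinearMap.congr_fun hg y)
  let L : LinearMap.range ι →L[ℝ] ℝ := LinearMap.mkContinuous (ℓ ∘ₗ g) C fun y => by
    have := h (g y)
    rw [hg'] at this
    exact this
  have hL : ‖L‖ ≤ C := LinearMap.mkContinuous_norm_le _ hC _
  obtain ⟨M, hM1, hM2⟩ := exists_extension_norm_eq _ L
  refine ⟨(InnerProductSpace.toDual ℝ H).symm M, by rw [LinearIsometryEquiv.norm_map, hM2]; exact hL,
    fun x => ?_⟩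
  rw [InnerProductSpace.toDual_symm_apply]
  have h1 := hM1 ⟨ι x, LinearMap.mem_range_self ι x⟩
  rw [h1]
  change ℓ x = ℓ (g ⟨ι x, _⟩)
  have h2 := h (x - g ⟨ι x, LinearMap.mem_range_self ι x⟩)
  rw [map_sub, map_sub, hg', sub_self, norm_zero, mul_zero] at h2
  exact sub_eq_zero.1 (abs_nonpos_iff.1 h2)

/-! ### Calculus of test functions -/

/-- Smooth functions with compact support. -/
structure IsTest (φ : Plane → ℝ) : Prop where
  contDiff : ContDiff ℝ smooth φ
  compact : HasCompactSupport φ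

theorem contDiff_partialDeriv {φ : Plane → ℝ} (h : ContDiff ℝ smooth φ)
    (i : Fin 2) : ContDiff ℝ smooth (partialDeriv i φ) := by
  have : ContDiff ℝ smooth (fderiv ℝ φ) := h.fderiv_right le_rfl
  exact this.clm_apply contDiff_const

theorem tsupport_partialDeriv_subset (i : Fin 2) (φ : Plane → ℝ) :
    tsupport (partialDeriv i φ) ⊆ tsupport φ := by
  refine closure_minimal (fun x hx => ?_) (isClosed_tsupport φ)
  refine tsupport_fderiv_subset ℝ (subset_closure ?_)
  intro h0
  exact hx (by simp [partialDeriv, h0])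

theorem IsTest.partialDeriv {φ : Plane → ℝ} (h : IsTest φ) (i : Fin 2) :
    IsTest (partialDeriv i φ) :=
  ⟨contDiff_partialDeriv h.contDiff i,
    h.compact.mono' ((subset_closure.trans (tsupport_partialDeriv_subset i φ)))⟩

theorem IsTest.mul {φ ψ : Plane → ℝ} (h : IsTest φ) (hψ : IsTest ψ) : IsTest fun x => φ x * ψ x :=
  ⟨h.contDiff.mul hψ.contDiff, h.compact.mul_right⟩

theorem IsTest.add {φ ψ : Plane → ℝ} (h : IsTest φ) (hψ : IsTest ψ) : IsTest fun x => φ x + ψ x :=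
  ⟨h.contDiff.add hψ.contDiff, h.compact.add hψ.compact⟩

theorem IsTest.const_mul {φ : Plane → ℝ} (h : IsTest φ) (c : ℝ) : IsTest fun x => c * φ x :=
  ⟨contDiff_const.mul h.contDiff, h.compact.mul_left⟩

theorem IsTest.integrable {φ : Plane → ℝ} (h : IsTest φ) : Integrable φ :=
  h.contDiff.continuous.integrable_of_hasCompactSupport h.compact

theorem IsTest.memLp {φ : Plane → ℝ} (h : IsTest φ) (p : ℝ≥0∞) : MemLp φ p :=
  h.contDiff.continuous.memLp_of_hasCompactSupport h.compact

theorem IsTest.differentiable {φ : Plane → ℝ} (h : IsTest φ) : Differentiable ℝ φ :=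
  h.contDiff.differentiable (by simp)

theorem IsTest.integral_mul_partialDeriv {φ ψ : Plane → ℝ} (h : IsTest φ) (hψ : IsTest ψ)
    (i : Fin 2) : ∫ x, φ x * Dimer.partialDeriv i ψ x = -∫ x, Dimer.partialDeriv i φ x * ψ x :=
  integral_mul_fderiv_eq_neg_fderiv_mul_of_integrable ((h.partialDeriv i).mul hψ).integrable
    (h.mul (hψ.partialDeriv i)).integrable (h.mul hψ).integrable
    (fun x _ => h.differentiable x) (fun x _ => hψ.differentiable x)

theorem partialDeriv_comm {φ : Plane → ℝ} (h : ContDiff ℝ smooth φ) (i j : Fin 2) :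
    partialDeriv i (partialDeriv j φ) = partialDeriv j (partialDeriv i φ) := by
  have hd : Differentiable ℝ (fderiv ℝ φ) :=
    (h.fderiv_right (m := smooth) le_rfl).differentiable (by simp)
  have key : ∀ (i j : Fin 2) x, partialDeriv i (partialDeriv j φ) x
      = fderiv ℝ (fderiv ℝ φ) x (EuclideanSpace.single i 1) (EuclideanSpace.single j 1) := by
    intro i j x
    have : partialDeriv j φ = fun x => fderiv ℝ φ x (EuclideanSpace.single j 1) := rfl
    rw [this, partialDeriv, fderiv_clm_apply (hd x) (differentiableAt_const _)]
    simp
  funext x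
  rw [key, key]
  have h2 : (2 : WithTop ℕ∞) ≤ smooth :=
    WithTop.coe_le_coe.2 (le_top : (2 : ℕ∞) ≤ ⊤)
  exact (h.contDiffAt.isSymmSndFDerivAt (by simpa using h2)).eq _ _

/-- The Laplacian. -/
def laplacian (φ : Plane → ℝ) (x : Plane) : ℝ :=
  partialDeriv 0 (partialDeriv 0 φ) x + partialDeriv 1 (partialDeriv 1 φ) x

theorem IsTest.laplacian {φ : Plane → ℝ} (h : IsTest φ) : IsTest (laplacian φ) :=
  ((h.partialDeriv 0).partialDeriv 0).add ((h.partialDeriv 1).partialDeriv 1)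

theorem IsTest.integral_hessian_sq {φ : Plane → ℝ} (h : IsTest φ) (i j : Fin 2) :
    ∫ x, Dimer.partialDeriv i (Dimer.partialDeriv j φ) x ^ 2
      = ∫ x, Dimer.partialDeriv i (Dimer.partialDeriv i φ) x
          * Dimer.partialDeriv j (Dimer.partialDeriv j φ) x := by
  have hi := h.partialDeriv i
  have hj := h.partialDeriv j
  have h1 := (hj.partialDeriv i).integral_mul_partialDeriv hj i
  have h2 := (hi.partialDeriv i).integral_mul_partialDeriv hj j
  have e : Dimer.partialDeriv i (Dimer.partialDeriv i (Dimer.partialDeriv j φ))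
      = Dimer.partialDeriv j (Dimer.partialDeriv i (Dimer.partialDeriv i φ)) := by
    rw [partialDeriv_comm h.contDiff i j, partialDeriv_comm hi.contDiff i j]
  rw [e] at h1
  rw [h2, ← h1]
  simp only [pow_two]

theorem IsTest.integral_hessian_sq_le {φ : Plane → ℝ} (h : IsTest φ) (i j : Fin 2) :
    ∫ x, Dimer.partialDeriv i (Dimer.partialDeriv j φ) x ^ 2 ≤ ∫ x, Dimer.laplacian φ x ^ 2 := by
  have ht : ∀ a b c d : Fin 2, Integrable fun x =>
      Dimer.partialDeriv a (Dimer.partialDeriv b φ) x * Dimer.partialDeriv c (Dimer.partialDeriv d φ) x :=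
    fun a b c d => (((h.partialDeriv b).partialDeriv a).mul ((h.partialDeriv d).partialDeriv c)).integrable
  have hsq : ∀ a b : Fin 2, Integrable fun x =>
      Dimer.partialDeriv a (Dimer.partialDeriv b φ) x ^ 2 := fun a b => by
    simpa only [pow_two] using ht a b a b
  have hL : ∫ x, Dimer.laplacian φ x ^ 2
      = (∫ x, Dimer.partialDeriv 0 (Dimer.partialDeriv 0 φ) x ^ 2)
        + (∫ x, Dimer.partialDeriv 1 (Dimer.partialDeriv 1 φ) x ^ 2)
        + 2 * ∫ x, Dimer.partialDeriv 0 (Dimer.partialDeriv 1 φ) x ^ 2 := by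
    have s1 : ∫ x, (Dimer.partialDeriv 0 (Dimer.partialDeriv 0 φ) x ^ 2
        + Dimer.partialDeriv 1 (Dimer.partialDeriv 1 φ) x ^ 2) = _ :=
      integral_add (hsq 0 0) (hsq 1 1)
    have s2 : ∫ x, ((Dimer.partialDeriv 0 (Dimer.partialDeriv 0 φ) x ^ 2
        + Dimer.partialDeriv 1 (Dimer.partialDeriv 1 φ) x ^ 2)
        + 2 * (Dimer.partialDeriv 0 (Dimer.partialDeriv 0 φ) x
          * Dimer.partialDeriv 1 (Dimer.partialDeriv 1 φ) x)) = _ :=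
      integral_add ((hsq 0 0).add (hsq 1 1)) ((ht 0 0 1 1).const_mul 2)
    rw [h.integral_hessian_sq 0 1, ← integral_const_mul, ← s1, ← s2]
    refine integral_congr_ae (.of_forall fun x => ?_)
    simp only [Dimer.laplacian]; ring
  have hn : ∀ a b : Fin 2, 0 ≤ ∫ x, Dimer.partialDeriv a (Dimer.partialDeriv b φ) x ^ 2 :=
    fun a b => integral_nonneg fun x => sq_nonneg _
  have h00 := hn 0 0
  have h11 := hn 1 1
  have h01 := hn 0 1
  have hc := partialDeriv_comm h.contDiff 1 0
  rw [hL]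
  fin_cases i <;> fin_cases j <;> simp only [Fin.zero_eta, Fin.mk_one, hc] <;> linarith

theorem eLpNorm_two_le_of_integral_sq_le {f g : Plane → ℝ} (hf : MemLp f 2) (hg : MemLp g 2)
    (h : ∫ x, f x ^ 2 ≤ ∫ x, g x ^ 2) : eLpNorm f 2 volume ≤ eLpNorm g 2 volume := by
  rw [hf.eLpNorm_eq_integral_rpow_norm (by norm_num) (by norm_num),
    hg.eLpNorm_eq_integral_rpow_norm (by norm_num) (by norm_num)]
  refine ENNReal.ofReal_le_ofReal (Real.rpow_le_rpow ?_ ?_ (by simp))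
  · exact integral_nonneg fun x => by positivity
  · simpa using h

/-- Convolution on the plane. -/
def planeConv (k φ : Plane → ℝ) (x : Plane) : ℝ := ∫ t, k t * φ (x - t)

theorem planeConv_eq_convolution (k φ : Plane → ℝ) :
    planeConv k φ = convolution k φ (ContinuousLinearMap.mul ℝ ℝ) volume := rfl

theorem planeConv_swap (k φ : Plane → ℝ) (x : Plane) :
    planeConv k φ x = ∫ t, k (x - t) * φ t := by
  rw [planeConv, ← integral_sub_left_eq_self _ volume x]
  simp only [sub_sub_self]

theorem planeConv_comm (k φ : Plane → ℝ) : planeConv k φ = planeConv φ k := by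
  funext x
  rw [planeConv_swap, planeConv]
  congr 1; funext t; ring

theorem contDiff_planeConv {k φ : Plane → ℝ} (hk : LocallyIntegrable k) (hφ : IsTest φ) :
    ContDiff ℝ smooth (planeConv k φ) := by
  rw [planeConv_eq_convolution]
  exact hφ.compact.contDiff_convolution_right _ hk hφ.contDiff

theorem partialDeriv_planeConv {k φ : Plane → ℝ} (hk : LocallyIntegrable k) (hφ : IsTest φ)
    (i : Fin 2) : partialDeriv i (planeConv k φ) = planeConv k (partialDeriv i φ) := by
  funext x
  have h1 : ContDiff ℝ 1 φ := hφ.contDiff.of_le (by exact_mod_cast le_top)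
  have h := hφ.compact.hasFDerivAt_convolution_right (ContinuousLinearMap.mul ℝ ℝ) hk h1 x
  rw [partialDeriv, planeConv_eq_convolution, h.fderiv,
    convolution_precompR_apply _ hk (hφ.compact.fderiv ℝ) (h1.continuous_fderiv (by simp))]
  rfl

theorem isTest_planeConv {k φ : Plane → ℝ} (hk : IsTest k) (hφ : IsTest φ) :
    IsTest (planeConv k φ) := by
  refine ⟨contDiff_planeConv hk.contDiff.continuous.locallyIntegrable hφ, ?_⟩
  rw [planeConv_eq_convolution]
  exact hk.compact.convolution (ContinuousLinearMap.mul ℝ ℝ) hφ.compact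

theorem partialDeriv_planeConv_left {k φ : Plane → ℝ} (hk : IsTest k) (hφ : IsTest φ)
    (i : Fin 2) : partialDeriv i (planeConv k φ) = planeConv (partialDeriv i k) φ := by
  rw [planeConv_comm, partialDeriv_planeConv hφ.contDiff.continuous.locallyIntegrable hk,
    planeConv_comm]

/-- Young's inequality. -/
theorem eLpNorm_planeConv_le {k φ : Plane → ℝ} (hk : IsTest k) (hφ : IsTest φ) :
    eLpNorm (planeConv k φ) 2 volume ≤ eLpNorm k 1 volume * eLpNorm φ 2 volume := by
  have hpow : ∀ f : Plane → ℝ, eLpNorm f 2 volume = (∫⁻ x, ‖f x‖ₑ ^ (2 : ℝ)) ^ (1 / (2 : ℝ)) :=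
    fun f => by
      rw [eLpNorm_eq_lintegral_rpow_enorm_toReal (by norm_num) (by norm_num)]
      simp
  rw [hpow, hpow, eLpNorm_one_eq_lintegral_enorm]
  have hcont := hφ.contDiff.continuous
  have h := lintegral_rpow_lintegral_mul_le (μ := (volume : Measure Plane))
    (ν := (volume : Measure Plane)) (p := 2) (by norm_num)
    (a := fun t => ‖k t‖ₑ) (b := fun x t => ‖φ (x - t)‖ₑ) (B := ∫⁻ x, ‖φ x‖ₑ ^ (2 : ℝ))
    hk.contDiff.continuous.measurable.enorm.aemeasurable
    (by
      have : Measurable fun z : Plane × Plane => φ (z.1 - z.2) :=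
        hcont.measurable.comp (measurable_fst.sub measurable_snd)
      exact this.enorm)
    (.of_forall fun t => (lintegral_sub_right_eq_self (fun x => ‖φ x‖ₑ ^ (2 : ℝ)) t).le)
  have h1 : ∫⁻ x, ‖planeConv k φ x‖ₑ ^ (2 : ℝ)
      ≤ ∫⁻ x, (∫⁻ t, ‖k t‖ₑ * ‖φ (x - t)‖ₑ) ^ (2 : ℝ) := by
    refine lintegral_mono fun x => ENNReal.rpow_le_rpow ?_ (by norm_num)
    refine (enorm_integral_le_lintegral_enorm _).trans (lintegral_mono fun t => ?_)
    rw [enorm_mul]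
  refine (ENNReal.rpow_le_rpow (h1.trans h) (by norm_num)).trans (le_of_eq ?_)
  rw [ENNReal.mul_rpow_of_nonneg _ _ (by norm_num), ← ENNReal.rpow_mul]
  norm_num

theorem IsTest.eLpNorm_hessian_planeConv_le {k φ : Plane → ℝ} (hk : IsTest k) (hφ : IsTest φ)
    (i j : Fin 2) :
    eLpNorm (Dimer.planeConv k (Dimer.partialDeriv i (Dimer.partialDeriv j φ))) 2 volume
      ≤ eLpNorm (Dimer.laplacian k) 1 volume * eLpNorm φ 2 volume := by
  have hl := hk.contDiff.continuous.locallyIntegrable (μ := volume)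
  have hv := isTest_planeConv hk hφ
  have e1 : Dimer.planeConv k (Dimer.partialDeriv i (Dimer.partialDeriv j φ))
      = Dimer.partialDeriv i (Dimer.partialDeriv j (Dimer.planeConv k φ)) := by
    rw [partialDeriv_planeConv hl hφ, partialDeriv_planeConv hl (hφ.partialDeriv j)]
  have e2 : Dimer.laplacian (Dimer.planeConv k φ) = Dimer.planeConv (Dimer.laplacian k) φ := by
    funext x
    have hc : ∀ a : Fin 2, Dimer.partialDeriv a (Dimer.partialDeriv a (Dimer.planeConv k φ))
        = Dimer.planeConv (Dimer.partialDeriv a (Dimer.partialDeriv a k)) φ := fun a => by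
      rw [partialDeriv_planeConv_left hk hφ, partialDeriv_planeConv_left (hk.partialDeriv a) hφ]
    have hint : ∀ a : Fin 2, Integrable fun t =>
        Dimer.partialDeriv a (Dimer.partialDeriv a k) t * φ (x - t) := fun a => by
      have hb := (hk.partialDeriv a).partialDeriv a
      refine (hb.contDiff.continuous.mul
        (hφ.contDiff.continuous.comp (continuous_const.sub continuous_id))).integrable_of_hasCompactSupport
        hb.compact.mul_right
    rw [Dimer.laplacian, hc, hc, Dimer.planeConv, Dimer.planeConv, Dimer.planeConv,
      ← integral_add (hint 0) (hint 1)]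
    simp only [Dimer.laplacian, add_mul]
  rw [e1]
  refine (eLpNorm_two_le_of_integral_sq_le (((hv.partialDeriv j).partialDeriv i).memLp 2)
    (hv.laplacian.memLp 2) (hv.integral_hessian_sq_le i j)).trans ?_
  rw [e2]
  exact eLpNorm_planeConv_le hk.laplacian hφ

theorem IsTest.eLpNorm_gradient_planeConv_le {k φ : Plane → ℝ} (hk : IsTest k) (hφ : IsTest φ)
    (i : Fin 2) :
    eLpNorm (Dimer.planeConv k (Dimer.partialDeriv i φ)) 2 volume
      ≤ eLpNorm (Dimer.partialDeriv i k) 1 volume * eLpNorm φ 2 volume := by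
  rw [← partialDeriv_planeConv hk.contDiff.continuous.locallyIntegrable hφ,
    partialDeriv_planeConv_left hk hφ]
  exact eLpNorm_planeConv_le (hk.partialDeriv i) hφ

/-! ### Radial kernels with a logarithmic singularity -/

/-- A smooth profile, supported in `s ≤ S`, with derivatives up to order two bounded by `M`. -/
structure RadialProfile (S M : ℝ) (A : ℝ → ℝ) : Prop where
  contDiff : ContDiff ℝ smooth A
  support : ∀ s, S < s → A s = 0
  bound : ∀ s, 0 ≤ s → |A s| ≤ M ∧ |deriv A s| ≤ M ∧ |deriv (deriv A) s| ≤ M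

theorem RadialProfile.hasDerivAt {S M : ℝ} {A : ℝ → ℝ} (h : RadialProfile S M A) (s : ℝ) :
    HasDerivAt A (deriv A s) s := (h.contDiff.differentiable (by simp) s).hasDerivAt

theorem RadialProfile.contDiff_deriv {S M : ℝ} {A : ℝ → ℝ} (h : RadialProfile S M A) :
    ContDiff ℝ smooth (deriv A) := by
  have := h.contDiff
  rw [contDiff_infty_iff_deriv] at this
  exact this.2

theorem RadialProfile.hasDerivAt_deriv {S M : ℝ} {A : ℝ → ℝ} (h : RadialProfile S M A) (s : ℝ) :
    HasDerivAt (deriv A) (deriv (deriv A) s) s :=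
  (h.contDiff_deriv.differentiable (by simp) s).hasDerivAt

theorem deriv_eq_zero_of_support {S : ℝ} {A : ℝ → ℝ} (h : ∀ s, S < s → A s = 0) :
    ∀ s, S < s → deriv A s = 0 := by
  intro s hs
  have : A =ᶠ[𝓝 s] fun _ => 0 := (lt_mem_nhds hs).mono fun t ht => h t ht
  rw [this.deriv_eq, deriv_const]

theorem RadialProfile.deriv_support {S M : ℝ} {A : ℝ → ℝ} (h : RadialProfile S M A) :
    (∀ s, S < s → deriv A s = 0) ∧ ∀ s, S < s → deriv (deriv A) s = 0 :=
  ⟨deriv_eq_zero_of_support h.support, deriv_eq_zero_of_support (deriv_eq_zero_of_support h.support)⟩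

theorem RadialProfile.nonneg {S M : ℝ} {A : ℝ → ℝ} (h : RadialProfile S M A) : 0 ≤ M :=
  (abs_nonneg _).trans (h.bound 0 le_rfl).1

/-- A kernel with a logarithmic singularity. -/
def singKernel (A B : ℝ → ℝ) (z : Plane) : ℝ := A (‖z‖ ^ 2) + B (‖z‖ ^ 2) * log (‖z‖ ^ 2)

/-- The regularized profile. -/
def regProfile (A B : ℝ → ℝ) (ε s : ℝ) : ℝ := A s + B s * log (s + ε)

/-- The derivative of the regularized profile. -/
def regProfile₁ (A B : ℝ → ℝ) (ε s : ℝ) : ℝ :=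
  deriv A s + (deriv B s * log (s + ε) + B s * (s + ε)⁻¹)

/-- The second derivative of the regularized profile. -/
def regProfile₂ (A B : ℝ → ℝ) (ε s : ℝ) : ℝ :=
  deriv (deriv A) s + ((deriv (deriv B) s * log (s + ε) + deriv B s * (s + ε)⁻¹)
    + (deriv B s * (s + ε)⁻¹ + B s * (-((s + ε) ^ 2)⁻¹)))

/-- The regularized kernel. -/
def regKernel (A B : ℝ → ℝ) (ε : ℝ) (z : Plane) : ℝ := regProfile A B ε (‖z‖ ^ 2)

theorem partialDeriv_radial {F F₁ : ℝ → ℝ} (h : ∀ s, 0 ≤ s → HasDerivAt F (F₁ s) s) (i : Fin 2)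
    (z : Plane) : partialDeriv i (fun z => F (‖z‖ ^ 2)) z = 2 * z i * F₁ (‖z‖ ^ 2) := by
  have h1 := (h (‖z‖ ^ 2) (by positivity)).comp_hasFDerivAt z (hasStrictFDerivAt_norm_sq z).hasFDerivAt
  have h2 : (fun z : Plane => F (‖z‖ ^ 2)) = F ∘ fun z => ‖z‖ ^ 2 := rfl
  rw [partialDeriv, h2, h1.fderiv]
  simp [EuclideanSpace.inner_single_right]
  ring

theorem differentiableAt_radial {F F₁ : ℝ → ℝ} (h : ∀ s, 0 ≤ s → HasDerivAt F (F₁ s) s)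
    (z : Plane) : DifferentiableAt ℝ (fun z : Plane => F (‖z‖ ^ 2)) z :=
  ((h (‖z‖ ^ 2) (by positivity)).comp_hasFDerivAt z
    (hasStrictFDerivAt_norm_sq z).hasFDerivAt).differentiableAt

theorem partialDeriv_partialDeriv_radial {F F₁ F₂ : ℝ → ℝ}
    (h : ∀ s, 0 ≤ s → HasDerivAt F (F₁ s) s) (h₁ : ∀ s, 0 ≤ s → HasDerivAt F₁ (F₂ s) s) (i : Fin 2)
    (z : Plane) : partialDeriv i (partialDeriv i (fun z => F (‖z‖ ^ 2))) z
      = 2 * F₁ (‖z‖ ^ 2) + 4 * z i ^ 2 * F₂ (‖z‖ ^ 2) := by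
  have e : partialDeriv i (fun z => F (‖z‖ ^ 2)) = fun z => 2 * z i * F₁ (‖z‖ ^ 2) :=
    funext (partialDeriv_radial h i)
  have hl : HasFDerivAt (fun z : Plane => 2 * z i)
      ((2 : ℝ) • (EuclideanSpace.proj i : Plane →L[ℝ] ℝ)) z :=
    ((EuclideanSpace.proj i : Plane →L[ℝ] ℝ).hasFDerivAt).const_smul (2 : ℝ)
  have hm := hl.mul (differentiableAt_radial h₁ z).hasFDerivAt
  have h2 := partialDeriv_radial h₁ i z
  rw [partialDeriv] at h2
  have hm' : fderiv ℝ (fun z : Plane => 2 * z i * F₁ (‖z‖ ^ 2)) z = _ := hm.fderiv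
  rw [e, partialDeriv, hm']
  simp only [add_apply, smul_apply, h2, smul_eq_mul]
  simp
  ring

theorem laplacian_radial {F F₁ F₂ : ℝ → ℝ}
    (h : ∀ s, 0 ≤ s → HasDerivAt F (F₁ s) s) (h₁ : ∀ s, 0 ≤ s → HasDerivAt F₁ (F₂ s) s)
    (z : Plane) : laplacian (fun z => F (‖z‖ ^ 2)) z
      = 4 * F₁ (‖z‖ ^ 2) + 4 * ‖z‖ ^ 2 * F₂ (‖z‖ ^ 2) := by
  rw [laplacian, partialDeriv_partialDeriv_radial h h₁, partialDeriv_partialDeriv_radial h h₁]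
  have : ‖z‖ ^ 2 = z 0 ^ 2 + z 1 ^ 2 := by
    rw [EuclideanSpace.real_norm_sq_eq, Fin.sum_univ_two]
  rw [this]; ring

section Bounds

variable {S M : ℝ} {A B : ℝ → ℝ} (hS : 0 ≤ S) (hA : RadialProfile S M A) (hB : RadialProfile S M B)

include hA hB in
theorem hasDerivAt_regProfile {ε : ℝ} (hε : 0 < ε) (s : ℝ) (hs : 0 ≤ s) :
    HasDerivAt (regProfile A B ε) (regProfile₁ A B ε s) s := by
  have hl : HasDerivAt (fun s => log (s + ε)) ((s + ε)⁻¹) s := by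
    simpa using ((hasDerivAt_id s).add_const ε).log (by simp; positivity)
  exact (hA.hasDerivAt s).add ((hB.hasDerivAt s).mul hl)

include hA hB in
theorem hasDerivAt_regProfile₁ {ε : ℝ} (hε : 0 < ε) (s : ℝ) (hs : 0 ≤ s) :
    HasDerivAt (regProfile₁ A B ε) (regProfile₂ A B ε s) s := by
  have hne : s + ε ≠ 0 := by positivity
  have hl : HasDerivAt (fun s => log (s + ε)) ((s + ε)⁻¹) s := by
    simpa using ((hasDerivAt_id s).add_const ε).log hne
  have hi : HasDerivAt (fun s => (s + ε)⁻¹) (-((s + ε) ^ 2)⁻¹) s := by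
    have := ((hasDerivAt_id s).add_const ε).inv hne
    rw [neg_div, one_div] at this
    exact this
  exact (hA.hasDerivAt_deriv s).add
    (((hB.hasDerivAt_deriv s).mul hl).add ((hB.hasDerivAt s).mul hi))

include hS hA hB in
theorem isTest_regKernel {ε : ℝ} (hε : 0 < ε) : IsTest (regKernel A B ε) := by
  have hn : ContDiff ℝ smooth fun z : Plane => ‖z‖ ^ 2 := contDiff_norm_sq ℝ
  refine ⟨(hA.contDiff.comp hn).add ((hB.contDiff.comp hn).mul
    ((hn.add contDiff_const).log fun z => by positivity)), ?_⟩
  refine HasCompactSupport.of_support_subset_isCompact (isCompact_closedBall (0 : Plane) (S + 1)) ?_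
  intro z hz
  by_contra h
  rw [mem_closedBall_zero_iff, not_le] at h
  have : S < ‖z‖ ^ 2 := by nlinarith
  exact hz (by simp [regKernel, regProfile, hA.support _ this, hB.support _ this])

theorem abs_log_add_le {s ε : ℝ} (hs : 0 < s) (hsS : s ≤ S) (hε : 0 < ε) (hε1 : ε ≤ 1) :
    |log (s + ε)| ≤ |log s| + S := by
  rcases le_or_gt (s + ε) 1 with h | h
  · have h1 := Real.log_le_log hs (by linarith : s ≤ s + ε)
    rw [abs_of_nonpos (Real.log_nonpos (by positivity) h),
      abs_of_nonpos (Real.log_nonpos hs.le (by linarith))]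
    linarith
  · rw [abs_of_nonneg (Real.log_nonneg h.le)]
    have := Real.log_le_sub_one_of_pos (by positivity : 0 < s + ε)
    have := abs_nonneg (log s)
    linarith

/-- A weight dominating the regular terms. -/
def logWeight (S : ℝ) (z : Plane) : ℝ :=
  (ball (0 : Plane) (S + 1)).indicator (fun z => |log (‖z‖ ^ 2)| + (S + 1)) z

include hS in
theorem mem_ball_of_norm_sq_le {z : Plane} (h : ‖z‖ ^ 2 ≤ S) : z ∈ ball (0 : Plane) (S + 1) := by
  rw [mem_ball_zero_iff]
  nlinarith [norm_nonneg z]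

include hS in
theorem logWeight_nonneg (z : Plane) : 0 ≤ logWeight S z :=
  indicator_nonneg (fun z _ => by positivity) z

theorem integrable_logWeight (S : ℝ) : Integrable (logWeight S) := by
  have hfin : IsFiniteMeasure (volume.restrict (ball (0 : Plane) (S + 1))) :=
    isFiniteMeasure_restrict.2 measure_ball_lt_top.ne
  have h1 : Integrable (fun z : Plane => log ‖z‖) (volume.restrict (ball 0 (S + 1))) :=
    (memLp_log_norm (S + 1)).integrable (by norm_num)
  have h2 : IntegrableOn (fun z : Plane => |log (‖z‖ ^ 2)| + (S + 1)) (ball 0 (S + 1)) := by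
    refine Integrable.add ?_ (integrable_const _)
    have := (h1.const_mul 2).abs
    refine this.congr (.of_forall fun z => ?_)
    simp [Real.log_pow]
  exact (integrable_indicator_iff measurableSet_ball).2 h2

include hS hA hB in
theorem abs_regKernel_le {ε : ℝ} (hε : 0 < ε) (hε1 : ε ≤ 1) {z : Plane} (hz : z ≠ 0) :
    |regKernel A B ε z| ≤ M * logWeight S z := by
  have h0 : 0 < ‖z‖ ^ 2 := by have := norm_pos_iff.2 hz; positivity
  have hM := hA.nonneg
  rcases lt_or_ge S (‖z‖ ^ 2) with h | h
  · rw [regKernel, regProfile, hA.support _ h, hB.support _ h]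
    simpa using mul_nonneg hM (logWeight_nonneg hS z)
  · rw [logWeight, indicator_of_mem (mem_ball_of_norm_sq_le hS h), regKernel, regProfile]
    have h1 := abs_log_add_le h0 h hε hε1
    have ha := (hA.bound _ h0.le).1
    have hb := (hB.bound _ h0.le).1
    refine (abs_add_le _ _).trans ?_
    rw [abs_mul]
    calc _ ≤ M + M * (|log (‖z‖ ^ 2)| + S) := by gcongr
      _ = _ := by ring

include hS hA hB in
theorem abs_gradient_regKernel_le {ε : ℝ} (hε : 0 < ε) (hε1 : ε ≤ 1) (i : Fin 2) {z : Plane}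
    (hz : z ≠ 0) : |partialDeriv i (regKernel A B ε) z|
      ≤ M * (2 * (S + 1) * logWeight S z
        + (ball (0 : Plane) (S + 1)).indicator (fun z => 2 * ‖z‖⁻¹) z) := by
  have hn : 0 < ‖z‖ := norm_pos_iff.2 hz
  have h0 : 0 < ‖z‖ ^ 2 := by positivity
  have hM := hA.nonneg
  have hw := logWeight_nonneg hS z
  have e : partialDeriv i (regKernel A B ε) z = 2 * z i * regProfile₁ A B ε (‖z‖ ^ 2) :=
    partialDeriv_radial (hasDerivAt_regProfile hA hB hε) i z
  rw [e]
  rcases lt_or_ge S (‖z‖ ^ 2) with h | h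
  · rw [regProfile₁, hA.deriv_support.1 _ h, hB.deriv_support.1 _ h, hB.support _ h]
    have : 0 ≤ (ball (0 : Plane) (S + 1)).indicator (fun z => 2 * ‖z‖⁻¹) z :=
      indicator_nonneg (fun z _ => by positivity) z
    simp only [zero_mul, add_zero, mul_zero, abs_zero]
    positivity
  · have hmem := mem_ball_of_norm_sq_le hS h
    rw [indicator_of_mem hmem, logWeight, indicator_of_mem hmem]
    rw [mem_ball_zero_iff] at hmem
    have h1 := abs_log_add_le h0 h hε hε1
    have ha := (hA.bound _ h0.le).2.1
    have hb := (hB.bound _ h0.le).1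
    have hb' := (hB.bound _ h0.le).2.1
    have hzi : |z i| ≤ ‖z‖ := by
      rw [← Real.norm_eq_abs]; exact PiLp.norm_apply_le z i
    have h2 : |regProfile₁ A B ε (‖z‖ ^ 2)|
        ≤ M + (M * (|log (‖z‖ ^ 2)| + S) + M * (‖z‖ ^ 2)⁻¹) := by
      refine (abs_add_le _ _).trans (add_le_add ha ((abs_add_le _ _).trans ?_))
      rw [abs_mul, abs_mul, abs_inv, abs_of_pos (by positivity : 0 < ‖z‖ ^ 2 + ε)]
      gcongr
      linarith
    rw [abs_mul, abs_mul, abs_two]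
    calc 2 * |z i| * |regProfile₁ A B ε (‖z‖ ^ 2)|
        ≤ 2 * ‖z‖ * (M + (M * (|log (‖z‖ ^ 2)| + S) + M * (‖z‖ ^ 2)⁻¹)) := by gcongr
      _ = M * (2 * ‖z‖ * (|log (‖z‖ ^ 2)| + (S + 1)) + 2 * ‖z‖⁻¹) := by
        field_simp
        ring
      _ ≤ _ := by gcongr

include hS hA hB in
theorem abs_laplacian_regKernel_le {ε : ℝ} (hε : 0 < ε) (hε1 : ε ≤ 1) {z : Plane}
    (hz : z ≠ 0) : |laplacian (regKernel A B ε) z|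
      ≤ M * ((16 + 4 * S) * logWeight S z + 4 * (ε / (‖z‖ ^ 2 + ε) ^ 2)) := by
  have hn : 0 < ‖z‖ := norm_pos_iff.2 hz
  have h0 : 0 < ‖z‖ ^ 2 := by positivity
  have hM := hA.nonneg
  have hw := logWeight_nonneg hS z
  have e : laplacian (regKernel A B ε) z = 4 * regProfile₁ A B ε (‖z‖ ^ 2)
      + 4 * ‖z‖ ^ 2 * regProfile₂ A B ε (‖z‖ ^ 2) :=
    laplacian_radial (hasDerivAt_regProfile hA hB hε) (hasDerivAt_regProfile₁ hA hB hε) z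
  rw [e]
  rcases lt_or_ge S (‖z‖ ^ 2) with h | h
  · rw [regProfile₁, regProfile₂, hA.deriv_support.1 _ h, hB.deriv_support.1 _ h, hB.support _ h,
      hA.deriv_support.2 _ h, hB.deriv_support.2 _ h]
    simp only [zero_mul, add_zero, mul_zero, abs_zero]
    positivity
  · rw [logWeight, indicator_of_mem (mem_ball_of_norm_sq_le hS h)]
    set s := ‖z‖ ^ 2 with hs
    obtain ⟨ha0, ha1, ha2⟩ := hA.bound s h0.le
    obtain ⟨hb0, hb1, hb2⟩ := hB.bound s h0.le
    have h1 := abs_log_add_le h0 h hε hε1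
    set ℓ := log (s + ε)
    have e2 : 4 * regProfile₁ A B ε s + 4 * s * regProfile₂ A B ε s
        = (4 * deriv A s + 4 * s * deriv (deriv A) s)
          + ((4 * deriv B s + 4 * s * deriv (deriv B) s) * ℓ + 8 * deriv B s * (s / (s + ε)))
          + B s * (4 * (ε / (s + ε) ^ 2)) := by
      rw [regProfile₁, regProfile₂]
      have : s + ε ≠ 0 := by positivity
      field_simp
      ring
    have h2 : s / (s + ε) ≤ 1 := by rw [div_le_one (by positivity)]; linarith
    have h3 : |4 * deriv A s + 4 * s * deriv (deriv A) s| ≤ 4 * M + 4 * S * M := by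
      refine (abs_add_le _ _).trans ?_
      rw [abs_mul, abs_mul, abs_of_pos (by positivity : 0 < 4 * s), abs_of_pos (by norm_num : (0 : ℝ) < 4)]
      gcongr
    have h4 : |4 * deriv B s + 4 * s * deriv (deriv B) s| ≤ 4 * M + 4 * S * M := by
      refine (abs_add_le _ _).trans ?_
      rw [abs_mul, abs_mul, abs_of_pos (by positivity : 0 < 4 * s), abs_of_pos (by norm_num : (0 : ℝ) < 4)]
      gcongr
    have h5 : |8 * deriv B s * (s / (s + ε))| ≤ 8 * M := by
      rw [abs_mul, abs_mul, abs_of_nonneg (by positivity : 0 ≤ s / (s + ε)),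
        abs_of_pos (by norm_num : (0 : ℝ) < 8)]
      calc _ ≤ 8 * M * 1 := by gcongr
        _ = _ := mul_one _
    have h6 : |B s * (4 * (ε / (s + ε) ^ 2))| ≤ M * (4 * (ε / (s + ε) ^ 2)) := by
      rw [abs_mul, abs_of_nonneg (by positivity : 0 ≤ 4 * (ε / (s + ε) ^ 2))]
      gcongr
    have hl0 := abs_nonneg (log s)
    rw [e2]
    calc _ ≤ (4 * M + 4 * S * M) + ((4 * M + 4 * S * M) * (|log s| + S) + 8 * M)
          + M * (4 * (ε / (s + ε) ^ 2)) := by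
          refine (abs_add_le _ _).trans (add_le_add ((abs_add_le _ _).trans (add_le_add h3
            ((abs_add_le _ _).trans (add_le_add ?_ h5)))) h6)
          rw [abs_mul]; gcongr
      _ = M * ((4 + 4 * S) * (|log s| + (S + 1)) + 8 + 4 * (ε / (s + ε) ^ 2)) := by ring
      _ ≤ M * ((16 + 4 * S) * (|log s| + (S + 1)) + 4 * (ε / (s + ε) ^ 2)) := by
          gcongr
          nlinarith

/-- The integral of the scaled concentrating part of the Laplacian. -/
def concentrationConst : ℝ := ∫ w : Plane, ((1 : ℝ) + ‖w‖ ^ 2) ^ (-(4 : ℝ) / 2)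

theorem integrable_concentration {ε : ℝ} (hε : 0 < ε) :
    Integrable (fun z : Plane => ε / (‖z‖ ^ 2 + ε) ^ 2) ∧
      ∫ z : Plane, ε / (‖z‖ ^ 2 + ε) ^ 2 = concentrationConst := by
  have hi : Integrable (fun w : Plane => ((1 : ℝ) + ‖w‖ ^ 2) ^ (-(4 : ℝ) / 2)) :=
    integrable_rpow_neg_one_add_norm_sq (by rw [finrank_plane]; norm_num)
  set R := (sqrt ε)⁻¹ with hR
  have hs := Real.sqrt_pos.2 hε
  have hR0 : 0 < R := by positivity
  have hR2 : R ^ 2 = ε⁻¹ := by rw [hR, inv_pow, Real.sq_sqrt hε.le]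
  have e : ∀ z : Plane, ε / (‖z‖ ^ 2 + ε) ^ 2
      = ε⁻¹ * ((1 : ℝ) + ‖R • z‖ ^ 2) ^ (-(4 : ℝ) / 2) := by
    intro z
    rw [norm_smul, mul_pow, Real.norm_of_nonneg hR0.le, hR2,
      show (-(4 : ℝ) / 2) = -((2 : ℕ) : ℝ) by norm_num, Real.rpow_neg (by positivity),
      Real.rpow_natCast]
    have : ‖z‖ ^ 2 + ε ≠ 0 := by positivity
    have h2 : 1 + ε⁻¹ * ‖z‖ ^ 2 = (‖z‖ ^ 2 + ε) / ε := by field_simp; ring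
    rw [h2]
    field_simp
  simp only [e]
  refine ⟨(hi.comp_smul hR0.ne').const_mul _, ?_⟩
  rw [integral_const_mul, Measure.integral_comp_smul_of_nonneg volume
    (fun w : Plane => ((1 : ℝ) + ‖w‖ ^ 2) ^ (-(4 : ℝ) / 2)) R (hR := hR0.le), finrank_plane, hR2, inv_inv,
    smul_eq_mul, ← mul_assoc, inv_mul_cancel₀ hε.ne', one_mul, concentrationConst]

/-- A constant for the second-order estimate. -/
def laplaceConst (S : ℝ) : ℝ := (16 + 4 * S) * (∫ z, logWeight S z) + 4 * concentrationConst

/-- A constant for the first-order estimate. -/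
def gradientConst (S : ℝ) : ℝ :=
  2 * (S + 1) * (∫ z, logWeight S z) + ∫ z in ball (0 : Plane) (S + 1), 2 * ‖z‖⁻¹

theorem eLpNorm_one_le_of_le {f g : Plane → ℝ} (hg : Integrable g) (h : ∀ z ≠ 0, |f z| ≤ g z) :
    eLpNorm f 1 volume ≤ ENNReal.ofReal (∫ z, g z) := by
  have hae : ∀ᵐ z : Plane, z ≠ 0 := compl_mem_ae_iff.2 (measure_singleton 0)
  have hg0 : 0 ≤ᵐ[volume] g := hae.mono fun z hz => (abs_nonneg _).trans (h z hz)
  rw [ofReal_integral_eq_lintegral_ofReal hg hg0, eLpNorm_one_eq_lintegral_enorm]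
  refine lintegral_mono_ae (hae.mono fun z hz => ?_)
  rw [← ofReal_norm]
  exact ENNReal.ofReal_le_ofReal (h z hz)

include hS hA hB in
theorem eLpNorm_laplacian_regKernel_le {ε : ℝ} (hε : 0 < ε) (hε1 : ε ≤ 1) :
    eLpNorm (laplacian (regKernel A B ε)) 1 volume ≤ ENNReal.ofReal (M * laplaceConst S) := by
  obtain ⟨hc1, hc2⟩ := integrable_concentration hε
  have hw := integrable_logWeight S
  refine (eLpNorm_one_le_of_le (((hw.const_mul (16 + 4 * S)).add (hc1.const_mul 4)).const_mul M)
    fun z hz => abs_laplacian_regKernel_le hS hA hB hε hε1 hz).trans (le_of_eq ?_)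
  rw [integral_const_mul]
  simp only [Pi.add_apply]
  rw [integral_add (hw.const_mul (16 + 4 * S)) (hc1.const_mul 4),
    integral_const_mul, integral_const_mul, hc2, laplaceConst]

include hS hA hB in
theorem eLpNorm_gradient_regKernel_le {ε : ℝ} (hε : 0 < ε) (hε1 : ε ≤ 1) (i : Fin 2) :
    eLpNorm (partialDeriv i (regKernel A B ε)) 1 volume ≤ ENNReal.ofReal (M * gradientConst S) := by
  have hw := integrable_logWeight S
  have hi : Integrable ((ball (0 : Plane) (S + 1)).indicator fun z => 2 * ‖z‖⁻¹) :=
    (integrable_indicator_iff measurableSet_ball).2 ((integrableOn_inv_norm (S + 1)).const_mul 2)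
  refine (eLpNorm_one_le_of_le (((hw.const_mul (2 * (S + 1))).add hi).const_mul M)
    fun z hz => abs_gradient_regKernel_le hS hA hB hε hε1 i hz).trans (le_of_eq ?_)
  rw [integral_const_mul]
  simp only [Pi.add_apply]
  rw [integral_add (hw.const_mul (2 * (S + 1))) hi,
    integral_const_mul, integral_indicator measurableSet_ball, gradientConst]

include hS hA hB in
theorem tendsto_planeConv_regKernel {ψ : Plane → ℝ} (hψ : IsTest ψ) (x : Plane) :
    Tendsto (fun n : ℕ => planeConv (regKernel A B (1 / ((n : ℝ) + 1))) ψ x) atTop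
      (𝓝 (planeConv (singKernel A B) ψ x)) := by
  obtain ⟨C, hC⟩ := hψ.compact.exists_bound_of_continuous hψ.contDiff.continuous
  have hM := hA.nonneg
  have hae : ∀ᵐ z : Plane, z ≠ 0 := compl_mem_ae_iff.2 (measure_singleton 0)
  have hpos : ∀ n : ℕ, (0 : ℝ) < 1 / ((n : ℝ) + 1) := fun n => by positivity
  have hle : ∀ n : ℕ, 1 / ((n : ℝ) + 1) ≤ 1 := fun n => by
    rw [div_le_one (by positivity)]; linarith [(Nat.cast_nonneg n : (0 : ℝ) ≤ n)]
  refine tendsto_integral_of_dominated_convergence (fun t => M * logWeight S t * C) (fun n => ?_)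
    (((integrable_logWeight S).const_mul M).mul_const C) (fun n => hae.mono fun t ht => ?_)
    (hae.mono fun t ht => ?_)
  · exact ((isTest_regKernel hS hA hB (hpos n)).contDiff.continuous.mul
      (hψ.contDiff.continuous.comp (continuous_const.sub continuous_id))).aestronglyMeasurable
  · rw [norm_mul]
    have h1 := abs_regKernel_le hS hA hB (hpos n) (hle n) ht
    have := logWeight_nonneg hS t
    rw [← Real.norm_eq_abs] at h1
    gcongr
    exact hC _
  · have h0 : ‖t‖ ^ 2 ≠ 0 := by simpa using ht
    refine Tendsto.mul_const _ (tendsto_const_nhds.add (tendsto_const_nhds.mul ?_))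
    have h1 : Tendsto (fun n : ℕ => ‖t‖ ^ 2 + 1 / ((n : ℝ) + 1)) atTop (𝓝 (‖t‖ ^ 2)) := by
      simpa using (tendsto_const_nhds (x := ‖t‖ ^ 2)).add
        (tendsto_one_div_add_atTop_nhds_zero_nat (𝕜 := ℝ))
    exact (Real.continuousAt_log h0).tendsto.comp h1

include hS hA hB in
theorem eLpNorm_planeConv_singKernel_le {ψ : Plane → ℝ} (hψ : IsTest ψ) {C : ℝ≥0∞}
    (h : ∀ ε : ℝ, 0 < ε → ε ≤ 1 → eLpNorm (planeConv (regKernel A B ε) ψ) 2 volume ≤ C) :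
    eLpNorm (planeConv (singKernel A B) ψ) 2 volume ≤ C := by
  have hpos : ∀ n : ℕ, (0 : ℝ) < 1 / ((n : ℝ) + 1) := fun n => by positivity
  have hle : ∀ n : ℕ, 1 / ((n : ℝ) + 1) ≤ 1 := fun n => by
    rw [div_le_one (by positivity)]; linarith [(Nat.cast_nonneg n : (0 : ℝ) ≤ n)]
  refine (Lp.eLpNorm_lim_le_liminf_eLpNorm
    (f := fun n : ℕ => planeConv (regKernel A B (1 / ((n : ℝ) + 1))) ψ) (fun n => ?_)
    (planeConv (singKernel A B) ψ)
    (.of_forall fun x => tendsto_planeConv_regKernel hS hA hB hψ x)).trans ?_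
  · exact (isTest_planeConv (isTest_regKernel hS hA hB (hpos n)) hψ).contDiff.continuous.aestronglyMeasurable
  · exact liminf_le_of_le (by isBoundedDefault) fun b hb => by
      obtain ⟨n, hn⟩ := hb.exists
      exact hn.trans (h _ (hpos n) (hle n))

include hS hA hB in
theorem eLpNorm_hessian_singKernel_le {φ : Plane → ℝ} (hφ : IsTest φ) (i j : Fin 2) :
    eLpNorm (planeConv (singKernel A B) (partialDeriv i (partialDeriv j φ))) 2 volume
      ≤ ENNReal.ofReal (M * laplaceConst S) * eLpNorm φ 2 volume := by
  refine eLpNorm_planeConv_singKernel_le hS hA hB ((hφ.partialDeriv j).partialDeriv i)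
    fun ε hε hε1 => ?_
  refine ((isTest_regKernel hS hA hB hε).eLpNorm_hessian_planeConv_le hφ i j).trans ?_
  gcongr
  exact eLpNorm_laplacian_regKernel_le hS hA hB hε hε1

include hS hA hB in
theorem eLpNorm_gradient_singKernel_le {φ : Plane → ℝ} (hφ : IsTest φ) (i : Fin 2) :
    eLpNorm (planeConv (singKernel A B) (partialDeriv i φ)) 2 volume
      ≤ ENNReal.ofReal (M * gradientConst S) * eLpNorm φ 2 volume := by
  refine eLpNorm_planeConv_singKernel_le hS hA hB (hφ.partialDeriv i) fun ε hε hε1 => ?_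
  refine ((isTest_regKernel hS hA hB hε).eLpNorm_gradient_planeConv_le hφ i).trans ?_
  gcongr
  exact eLpNorm_gradient_regKernel_le hS hA hB hε hε1 i

end Bounds

/-! ### Second-order regularity of the potentials -/

/-- The test functions supported in `D`. -/
def testSpace (D : Set Plane) : Submodule ℝ (Plane → ℝ) where
  carrier := {φ | IsTest φ ∧ tsupport φ ⊆ D}
  add_mem' h h' := ⟨h.1.add h'.1, (tsupport_add _ _).trans (union_subset h.2 h'.2)⟩
  zero_mem' := ⟨⟨contDiff_const, HasCompactSupport.zero⟩, by simp [tsupport]⟩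
  smul_mem' c _ h := ⟨h.1.const_mul c, (tsupport_smul_subset_right (fun _ => c) _).trans h.2⟩

/-- Partial derivatives of test functions. -/
def testDeriv (D : Set Plane) (i : Fin 2) : testSpace D →ₗ[ℝ] testSpace D where
  toFun φ := ⟨partialDeriv i φ, φ.2.1.partialDeriv i, (tsupport_partialDeriv_subset i _).trans φ.2.2⟩
  map_add' φ ψ := by
    ext x
    change fderiv ℝ ((φ : Plane → ℝ) + (ψ : Plane → ℝ)) x _ = fderiv ℝ (φ : Plane → ℝ) x _ + fderiv ℝ (ψ : Plane → ℝ) x _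
    rw [fderiv_add (φ.2.1.differentiable x) (ψ.2.1.differentiable x), add_apply]
  map_smul' c φ := by
    ext x
    change fderiv ℝ (c • (φ : Plane → ℝ)) x _ = c • fderiv ℝ (φ : Plane → ℝ) x _
    rw [fderiv_const_smul (φ.2.1.differentiable x), smul_apply]

section Jets

variable {D : Set Plane} [hD : Fact (ReflectionDomain D)]

/-- `u` has an `H²` jet of norm at most `C`. -/
def JetBound (D : Set Plane) (u : Plane → ℂ) (C : ℝ) : Prop :=
  ∃ g h, IsH2Jet D u g h ∧ eLpNorm u 2 vol[D]
    + ∑ i, eLpNorm (g i) 2 vol[D]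
    + ∑ i, ∑ j, eLpNorm (h i j) 2 vol[D] ≤ ENNReal.ofReal C

theorem JetBound.memH2 {u : Plane → ℂ} {C : ℝ} (h : JetBound D u C) : MemH2 D u := by
  obtain ⟨g, k, hj, -⟩ := h
  exact ⟨g, k, hj⟩

theorem JetBound.h2Norm_le {u : Plane → ℂ} {C : ℝ} (h : JetBound D u C) :
    h2Norm D u ≤ ENNReal.ofReal C := by
  obtain ⟨g, k, hj, hle⟩ := h
  refine le_trans ?_ hle
  unfold h2Norm
  exact (iInf_le _ g).trans ((iInf_le _ k).trans (iInf_le _ hj))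

theorem JetBound.congr {u v : Plane → ℂ} {C : ℝ} (h : JetBound D u C)
    (huv : u =ᵐ[vol[D]] v) : JetBound D v C := by
  obtain ⟨g, k, hj, hle⟩ := h
  refine ⟨g, k, ⟨hj.memLp.ae_eq huv, hj.memLp_grad, hj.memLp_hess, fun i φ h1 h2 h3 => ?_, hj.hess⟩,
    by rwa [← eLpNorm_congr_ae huv]⟩
  rw [← hj.grad i φ h1 h2 h3]
  exact integral_congr_ae (huv.mono fun x hx => by simp only [hx])

theorem integrable_test_mul {φ : Plane → ℝ} (hφ : IsTest φ) {g : Plane → ℂ}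
    (hg : MemLp g 2 vol[D]) :
    Integrable (fun x => (φ x : ℂ) * g x) vol[D] :=
  ((hφ.memLp 2).restrict D).ofReal.integrable_mul hg

theorem IsWeakDeriv.add {i : Fin 2} {u v g h : Plane → ℂ} (hu : IsWeakDeriv D i u g)
    (hv : IsWeakDeriv D i v h) (mu : MemLp u 2 vol[D])
    (mv : MemLp v 2 vol[D]) (mg : MemLp g 2 vol[D])
    (mh : MemLp h 2 vol[D]) :
    IsWeakDeriv D i (fun x => u x + v x) (fun x => g x + h x) := by
  intro φ h1 h2 h3
  have ht : IsTest φ := ⟨h1, h2⟩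
  simp only [mul_add]
  rw [integral_add (integrable_test_mul (ht.partialDeriv i) mu)
    (integrable_test_mul (ht.partialDeriv i) mv), integral_add (integrable_test_mul ht mg)
    (integrable_test_mul ht mh), hu φ h1 h2 h3, hv φ h1 h2 h3, neg_add]

theorem JetBound.add {u v : Plane → ℂ} {C C' : ℝ} (hC : 0 ≤ C) (hC' : 0 ≤ C')
    (hu : JetBound D u C) (hv : JetBound D v C') : JetBound D (fun x => u x + v x) (C + C') := by
  obtain ⟨g, k, hj, hle⟩ := hu
  obtain ⟨g', k', hj', hle'⟩ := hv
  refine ⟨fun i x => g i x + g' i x, fun i j x => k i j x + k' i j x,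
    ⟨hj.memLp.add hj'.memLp, fun i => (hj.memLp_grad i).add (hj'.memLp_grad i),
      fun i j => (hj.memLp_hess i j).add (hj'.memLp_hess i j),
      fun i => (hj.grad i).add (hj'.grad i) hj.memLp hj'.memLp (hj.memLp_grad i) (hj'.memLp_grad i),
      fun i j => (hj.hess i j).add (hj'.hess i j) (hj.memLp_grad i) (hj'.memLp_grad i)
        (hj.memLp_hess i j) (hj'.memLp_hess i j)⟩, ?_⟩
  rw [ENNReal.ofReal_add hC hC']
  refine le_trans ?_ (add_le_add hle hle')
  have h0 : ∀ {a b : Plane → ℂ}, MemLp a 2 vol[D] → MemLp b 2 vol[D] →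
      eLpNorm (fun x => a x + b x) 2 vol[D]
        ≤ eLpNorm a 2 vol[D] + eLpNorm b 2 vol[D] := fun ha hb =>
    eLpNorm_add_le ha.1 hb.1 (by norm_num)
  calc _ ≤ (eLpNorm u 2 vol[D] + eLpNorm v 2 vol[D])
        + ∑ i, (eLpNorm (g i) 2 vol[D] + eLpNorm (g' i) 2 vol[D])
        + ∑ i, ∑ j, (eLpNorm (k i j) 2 vol[D] + eLpNorm (k' i j) 2 vol[D]) :=
        add_le_add (add_le_add (h0 hj.memLp hj'.memLp)
          (Finset.sum_le_sum fun i _ => h0 (hj.memLp_grad i) (hj'.memLp_grad i)))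
          (Finset.sum_le_sum fun i _ => Finset.sum_le_sum fun j _ =>
            h0 (hj.memLp_hess i j) (hj'.memLp_hess i j))
    _ = _ := by simp only [Finset.sum_add_distrib]; ring

/-- A functional on test functions which is bounded in `L²` is represented by a function. -/
theorem exists_weak_representative {w : Plane → ℂ} (hw : MemLp w 2 vol[D])
    (T : testSpace D →ₗ[ℝ] testSpace D) {C : ℝ} (hC : 0 ≤ C)
    (hT : ∀ φ : testSpace D, ‖∫ x in D, ((T φ : Plane → ℝ) x : ℂ) * w x‖
      ≤ C * (eLpNorm (φ : Plane → ℝ) 2 volume).toReal) :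
    ∃ h : Plane → ℂ, MemLp h 2 vol[D] ∧
      eLpNorm h 2 vol[D] ≤ ENNReal.ofReal (2 * C) ∧
      ∀ φ : testSpace D, ∫ x in D, ((T φ : Plane → ℝ) x : ℂ) * w x
        = ∫ x in D, ((φ : Plane → ℝ) x : ℂ) * h x := by
  have hm : ∀ φ : testSpace D, MemLp (φ : Plane → ℝ) 2 vol[D] := fun φ =>
    (φ.2.1.memLp 2).restrict D
  let ι : testSpace D →ₗ[ℝ] Lp ℝ 2 vol[D] :=
    { toFun φ := (hm φ).toLp
      map_add' φ ψ := MemLp.toLp_add (hm φ) (hm ψ)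
      map_smul' c φ := MemLp.toLp_const_smul c (hm φ) }
  have hι : ∀ φ : testSpace D, ‖ι φ‖ = (eLpNorm (φ : Plane → ℝ) 2 volume).toReal := by
    intro φ
    change ‖(hm φ).toLp‖ = _
    rw [Lp.norm_toLp]
    congr 1
    exact eLpNorm_restrict_eq_of_support_subset ((subset_tsupport _).trans φ.2.2)
  let ℓ : testSpace D →ₗ[ℝ] ℂ :=
    { toFun φ := ∫ x in D, ((T φ : Plane → ℝ) x : ℂ) * w x
      map_add' φ ψ := by
        rw [← integral_add (integrable_test_mul (T φ).2.1 hw) (integrable_test_mul (T ψ).2.1 hw)]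
        refine integral_congr_ae (.of_forall fun x => ?_)
        simp [add_mul]
      map_smul' c φ := by
        rw [RingHom.id_apply, ← integral_smul]
        refine integral_congr_ae (.of_forall fun x => ?_)
        simp [mul_assoc] }
  obtain ⟨a, ha1, ha2⟩ := exists_representative ι (Complex.reLm ∘ₗ ℓ) hC fun φ => by
    rw [hι]; exact (Complex.abs_re_le_norm _).trans (hT φ)
  obtain ⟨b, hb1, hb2⟩ := exists_representative ι (Complex.imLm ∘ₗ ℓ) hC fun φ => by
    rw [hι]; exact (Complex.abs_im_le_norm _).trans (hT φ)
  have hin : ∀ (a : Lp ℝ 2 vol[D]) (φ : testSpace D),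
      inner ℝ a (ι φ) = ∫ x in D, (φ : Plane → ℝ) x * a x := by
    intro a φ
    rw [L2.inner_def]
    refine integral_congr_ae ?_
    filter_upwards [(hm φ).coeFn_toLp] with x hx
    change inner ℝ (a x) (((hm φ).toLp : Lp ℝ 2 vol[D]) x) = _
    rw [hx]; simp
  have hma : MemLp (fun x => (a x : ℂ)) 2 vol[D] := (Lp.memLp a).ofReal
  have hmb : MemLp (fun x => (b x : ℂ)) 2 vol[D] := (Lp.memLp b).ofReal
  have hmb' : MemLp (fun x => Complex.I * (b x : ℂ)) 2 vol[D] := hmb.const_mul _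
  refine ⟨fun x => (a x : ℂ) + Complex.I * (b x : ℂ), hma.add hmb', ?_, fun φ => ?_⟩
  · have e : ∀ {f : Plane → ℂ} {c : Lp ℝ 2 vol[D]}, (∀ x, ‖f x‖ = ‖c x‖) → ‖c‖ ≤ C →
        eLpNorm f 2 vol[D] ≤ ENNReal.ofReal C := fun hf hc => by
      rw [eLpNorm_congr_norm_ae (.of_forall hf), ← Lp.enorm_def, ← ofReal_norm]
      exact ENNReal.ofReal_le_ofReal hc
    refine (eLpNorm_add_le hma.1 hmb'.1 (by norm_num)).trans ?_
    rw [two_mul, ENNReal.ofReal_add hC hC]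
    exact add_le_add (e (fun x => by simp) ha1) (e (fun x => by simp) hb1)
  · have h1 := ha2 φ
    have h2 := hb2 φ
    rw [hin] at h1 h2
    have h3 : (∫ x in D, ((φ : Plane → ℝ) x : ℂ) * ((a x : ℂ) + Complex.I * (b x : ℂ)))
        = ((∫ x in D, (φ : Plane → ℝ) x * a x : ℝ) : ℂ)
          + Complex.I * ((∫ x in D, (φ : Plane → ℝ) x * b x : ℝ) : ℂ) := by
      rw [← integral_complex_ofReal, ← integral_complex_ofReal, ← integral_const_mul]
      simp only [mul_add]
      rw [integral_add (integrable_test_mul φ.2.1 hma) (integrable_test_mul φ.2.1 hmb')]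
      congr 1
      · simp
      · refine integral_congr_ae (.of_forall fun x => ?_)
        push_cast; ring
    rw [h3, ← h1, ← h2]
    change ℓ φ = ((ℓ φ).re : ℂ) + Complex.I * ((ℓ φ).im : ℂ)
    rw [mul_comm, Complex.re_add_im]

theorem isWeakDeriv_iff_testSpace {i : Fin 2} {u g : Plane → ℂ} (h : ∀ φ : testSpace D,
    ∫ x in D, ((testDeriv D i φ : Plane → ℝ) x : ℂ) * u x
      = -∫ x in D, ((φ : Plane → ℝ) x : ℂ) * g x) : IsWeakDeriv D i u g :=
  fun φ h1 h2 h3 => h ⟨φ, ⟨h1, h2⟩, h3⟩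

variable {S M : ℝ} {α β : ℝ → ℂ} {k : Plane → ℂ}

/-- The kernel is given on differences of points of `D` by profiles bounded by `M`. -/
structure HasProfile (D : Set Plane) (S M : ℝ) (α β : ℝ → ℂ) (k : Plane → ℂ) : Prop where
  nonneg : 0 ≤ S
  re_α : RadialProfile S M fun s => (α s).re
  im_α : RadialProfile S M fun s => (α s).im
  re_β : RadialProfile S M fun s => (β s).re
  im_β : RadialProfile S M fun s => (β s).im
  even : ∀ z, k (-z) = k z
  eq : ∀ z ∈ diffBall D, k z = α (‖z‖ ^ 2) + β (‖z‖ ^ 2) * log (‖z‖ ^ 2)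

theorem integrable_singKernel_mul {A B : ℝ → ℝ} (hS : 0 ≤ S) (hA : RadialProfile S M A)
    (hB : RadialProfile S M B) {ψ : Plane → ℝ} (hψ : IsTest ψ) (y : Plane) :
    Integrable fun x => singKernel A B (y - x) * ψ x := by
  have hsing : Integrable (singKernel A B) := by
    have hm : Measurable (singKernel A B) := by
      have h1 := hA.contDiff.continuous.measurable
      have h2 := hB.contDiff.continuous.measurable
      unfold singKernel; fun_prop
    refine ((integrable_logWeight S).const_mul M).mono' hm.aestronglyMeasurable ?_
    have hae : ∀ᵐ z : Plane, z ≠ 0 := compl_mem_ae_iff.2 (measure_singleton 0)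
    refine hae.mono fun z hz => ?_
    have ht : Tendsto (fun n : ℕ => |regKernel A B (1 / ((n : ℝ) + 1)) z|) atTop
        (𝓝 |singKernel A B z|) := by
      have h0 : ‖z‖ ^ 2 ≠ 0 := by simpa using hz
      refine (tendsto_const_nhds.add (tendsto_const_nhds.mul ?_)).abs
      have h1 : Tendsto (fun n : ℕ => ‖z‖ ^ 2 + 1 / ((n : ℝ) + 1)) atTop (𝓝 (‖z‖ ^ 2)) := by
        simpa using (tendsto_const_nhds (x := ‖z‖ ^ 2)).add
          (tendsto_one_div_add_atTop_nhds_zero_nat (𝕜 := ℝ))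
      exact (Real.continuousAt_log h0).tendsto.comp h1
    refine le_of_tendsto ht (.of_forall fun n => ?_)
    refine abs_regKernel_le hS hA hB (by positivity) ?_ hz
    rw [div_le_one (by positivity)]; linarith [(Nat.cast_nonneg n : (0 : ℝ) ≤ n)]
  obtain ⟨C, hC⟩ := hψ.compact.exists_bound_of_continuous hψ.contDiff.continuous
  exact (hsing.comp_sub_left y).mul_bdd
    hψ.contDiff.continuous.aestronglyMeasurable (.of_forall hC)

theorem HasProfile.conv_test (h : HasProfile D S M α β k) (ψ : testSpace D) {y : Plane}
    (hy : y ∈ D) : conv D k (fun x => ((ψ : Plane → ℝ) x : ℂ)) y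
      = (planeConv (singKernel (fun s => (α s).re) fun s => (β s).re) ψ y : ℂ)
        + Complex.I * (planeConv (singKernel (fun s => (α s).im) fun s => (β s).im) ψ y : ℂ) := by
  have i1 := integrable_singKernel_mul h.nonneg h.re_α h.re_β ψ.2.1 y
  have i2 := integrable_singKernel_mul h.nonneg h.im_α h.im_β ψ.2.1 y
  rw [planeConv_swap, planeConv_swap, ← integral_complex_ofReal, ← integral_complex_ofReal,
    ← integral_const_mul, ← integral_add i1.ofReal (i2.ofReal.const_mul _), conv,
    ← integral_indicator measurableSet_domain]
  refine integral_congr_ae (.of_forall fun x => ?_)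
  by_cases hx : x ∈ D
  · simp only [indicator_of_mem hx]
    rw [h.eq _ (sub_mem_diffBall hy hx), singKernel, singKernel]
    conv_lhs => rw [← Complex.re_add_im (α _), ← Complex.re_add_im (β _)]
    push_cast; ring
  · simp only [indicator_of_notMem hx]
    rw [image_eq_zero_of_notMem_tsupport (fun hx' => hx (ψ.2.2 hx'))]
    simp

theorem HasProfile.norm_pairing_le (h : HasProfile D S M α β k) (hk : IsKernel D k) {f : Plane → ℂ}
    (hf : MemLp f 2 vol[D]) (φ ψ : testSpace D) {C : ℝ} (hC : 0 ≤ C)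
    (hψ : ∀ A B : ℝ → ℝ, RadialProfile S M A → RadialProfile S M B →
      eLpNorm (planeConv (singKernel A B) ψ) 2 volume
        ≤ ENNReal.ofReal C * eLpNorm (φ : Plane → ℝ) 2 volume) :
    ‖∫ x in D, ((ψ : Plane → ℝ) x : ℂ) * conv D k f x‖
      ≤ 2 * C * (eLpNorm f 2 vol[D]).toReal
        * (eLpNorm (φ : Plane → ℝ) 2 volume).toReal := by
  have hψm : MemLp (fun x => ((ψ : Plane → ℝ) x : ℂ)) 2 vol[D] :=
    ((ψ.2.1.memLp 2).restrict D).ofReal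
  rw [hk.integral_mul_conv h.even hf hψm]
  refine (norm_integral_mul_le hf (hk.memLp_conv hψm)).trans ?_
  have hφ := (φ.2.1.memLp 2).2.ne
  have e1 : eLpNorm (conv D k fun x => ((ψ : Plane → ℝ) x : ℂ)) 2 vol[D]
      ≤ ENNReal.ofReal C * eLpNorm (φ : Plane → ℝ) 2 volume
        + ENNReal.ofReal C * eLpNorm (φ : Plane → ℝ) 2 volume := by
    have hloc : ∀ {A B : ℝ → ℝ}, RadialProfile S M A → RadialProfile S M B →
        AEStronglyMeasurable (fun y => (planeConv (singKernel A B) ψ y : ℂ)) vol[D] := by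
      intro A B hA hB
      have hlim := aestronglyMeasurable_of_tendsto_ae atTop
        (f := fun (n : ℕ) y => planeConv (regKernel A B (1 / ((n : ℝ) + 1))) ψ y)
        (g := planeConv (singKernel A B) ψ) (μ := vol[D])
        (fun n => (isTest_planeConv (isTest_regKernel h.nonneg hA hB (by positivity))
          ψ.2.1).contDiff.continuous.aestronglyMeasurable)
        (.of_forall fun y => tendsto_planeConv_regKernel h.nonneg hA hB ψ.2.1 y)
      exact Complex.continuous_ofReal.comp_aestronglyMeasurable hlim
    have hb : ∀ {A B : ℝ → ℝ} {c : ℂ}, ‖c‖ = 1 → RadialProfile S M A → RadialProfile S M B →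
        eLpNorm (fun y => c * (planeConv (singKernel A B) ψ y : ℂ)) 2 vol[D]
          ≤ ENNReal.ofReal C * eLpNorm (φ : Plane → ℝ) 2 volume := by
      intro A B c hc hA hB
      refine le_trans ?_ (hψ A B hA hB)
      refine (eLpNorm_mono (fun y => ?_)).trans (eLpNorm_mono_measure _ Measure.restrict_le_self)
      rw [norm_mul, hc, one_mul, Complex.norm_real]
    rw [eLpNorm_congr_ae (ae_mem_domain.mono fun y hy => h.conv_test ψ hy)]
    refine (eLpNorm_add_le (hloc h.re_α h.re_β) ((hloc h.im_α h.im_β).const_mul _)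
      (by norm_num)).trans (add_le_add ?_ (hb (by simp) h.im_α h.im_β))
    simpa using hb (c := 1) (by simp) h.re_α h.re_β
  have e2 := ENNReal.toReal_mono (by finiteness) e1
  rw [ENNReal.toReal_add (by finiteness) (by finiteness), ENNReal.toReal_mul,
    ENNReal.toReal_ofReal hC] at e2
  calc _ ≤ (eLpNorm f 2 vol[D]).toReal
        * (C * (eLpNorm (φ : Plane → ℝ) 2 volume).toReal + C * (eLpNorm (φ : Plane → ℝ) 2 volume).toReal) := by
        gcongr
    _ = _ := by ring

theorem IsKernel.eLpNorm_conv_le (hk : IsKernel D k) {f : Plane → ℂ}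
    (hf : MemLp f 2 vol[D]) : eLpNorm (conv D k f) 2 vol[D]
      ≤ ENNReal.ofReal (sqrt (area D) * kerNorm D k * (eLpNorm f 2 vol[D]).toReal) := by
  have h := (hk.kop_toLp hf) ▸ (kop D k).le_of_opNorm_le hk.norm_kop_le hf.toLp
  rw [Lp.norm_toLp, Lp.norm_toLp] at h
  rw [← ENNReal.ofReal_toReal (hk.memLp_conv hf).2.ne]
  exact ENNReal.ofReal_le_ofReal h

/-- A constant for the `H²` estimate. -/
def jetConst (S : ℝ) : ℝ := 8 * max (gradientConst S) 0 + 16 * max (laplaceConst S) 0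

theorem jetConst_nonneg (S : ℝ) : 0 ≤ jetConst S := by unfold jetConst; positivity

/-- Potentials of square-integrable functions have an `H²` jet. -/
theorem HasProfile.jetBound (h : HasProfile D S M α β k) (hk : IsKernel D k) {f : Plane → ℂ}
    (hf : MemLp f 2 vol[D]) :
    JetBound D (conv D k f) ((sqrt (area D) * kerNorm D k + M * jetConst S)
      * (eLpNorm f 2 vol[D]).toReal) := by
  set F := (eLpNorm f 2 vol[D]).toReal with hF
  have hF0 : 0 ≤ F := ENNReal.toReal_nonneg
  have hM := h.re_α.nonneg
  set G := M * max (gradientConst S) 0 with hG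
  set L := M * max (laplaceConst S) 0 with hL
  have hG0 : 0 ≤ G := by positivity
  have hL0 : 0 ≤ L := by positivity
  have hw := hk.memLp_conv hf
  choose g hg1 hg2 hg3 using fun i => exists_weak_representative hw (testDeriv D i)
    (C := 2 * G * F) (by positivity) (fun φ => h.norm_pairing_le hk hf φ (testDeriv D i φ) hG0
      fun A B hA hB => (eLpNorm_gradient_singKernel_le h.nonneg hA hB φ.2.1 i).trans (by
        gcongr
        exact mul_le_mul_of_nonneg_left (le_max_left _ _) hM))
  choose H hH1 hH2 hH3 using fun i j => exists_weak_representative hw (testDeriv D i ∘ₗ testDeriv D j)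
    (C := 2 * L * F) (by positivity) (fun φ => h.norm_pairing_le hk hf φ
      (testDeriv D i (testDeriv D j φ)) hL0
      fun A B hA hB => (eLpNorm_hessian_singKernel_le h.nonneg hA hB φ.2.1 i j).trans (by
        gcongr
        exact mul_le_mul_of_nonneg_left (le_max_left _ _) hM))
  refine ⟨fun i x => -g i x, H, ⟨hw, fun i => (hg1 i).neg, hH1, fun i => ?_, fun i j => ?_⟩, ?_⟩
  · refine isWeakDeriv_iff_testSpace fun φ => ?_
    rw [hg3]
    simp only [mul_neg, integral_neg, neg_neg]
  · refine isWeakDeriv_iff_testSpace fun φ => ?_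
    simp only [mul_neg, integral_neg]
    rw [← hg3 i, ← hH3 i j φ]
    rfl
  · have e1 : ∀ i, eLpNorm (fun x => -g i x) 2 vol[D]
        ≤ ENNReal.ofReal (2 * (2 * G * F)) := fun i => by
      have : eLpNorm (fun x => -g i x) 2 vol[D] = eLpNorm (g i) 2 vol[D] :=
        eLpNorm_neg (g i) _ _
      rw [this]; exact hg2 i
    have hk0 := kerNorm_nonneg (D := D) k
    calc _ ≤ ENNReal.ofReal (sqrt (area D) * kerNorm D k * F)
          + ∑ _i : Fin 2, ENNReal.ofReal (2 * (2 * G * F))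
          + ∑ _i : Fin 2, ∑ _j : Fin 2, ENNReal.ofReal (2 * (2 * L * F)) :=
          add_le_add (add_le_add (hk.eLpNorm_conv_le hf) (Finset.sum_le_sum fun i _ => e1 i))
            (Finset.sum_le_sum fun i _ => Finset.sum_le_sum fun j _ => hH2 i j)
      _ = ENNReal.ofReal (sqrt (area D) * kerNorm D k * F + (∑ _i : Fin 2, 2 * (2 * G * F))
          + ∑ _i : Fin 2, ∑ _j : Fin 2, 2 * (2 * L * F)) := by
          simp only [Fin.sum_univ_two]
          repeat rw [← ENNReal.ofReal_add (by positivity) (by positivity)]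
      _ = _ := by
          congr 1
          simp only [Fin.sum_univ_two, hG, hL, jetConst]
          ring

end Jets

/-! ### Continuity of the potentials in the coefficients of the Green's function -/

theorem RadialProfile.mono {S M M' : ℝ} {A : ℝ → ℝ} (h : RadialProfile S M A) (hM : M ≤ M') :
    RadialProfile S M' A :=
  ⟨h.contDiff, h.support, fun s hs => let ⟨h1, h2, h3⟩ := h.bound s hs
    ⟨h1.trans hM, h2.trans hM, h3.trans hM⟩⟩

section Parameters

variable {P : Type*} [NormedAddCommGroup P] [NormedSpace ℝ P] {G : P × ℝ → ℝ}

theorem deriv_slice (hG : ContDiff ℝ smooth G) (p : P) :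
    deriv (fun s => G (p, s)) = fun s => fderiv ℝ G (p, s) (0, 1) := by
  funext s
  have h1 : HasDerivAt (fun s : ℝ => (p, s)) ((0 : P), (1 : ℝ)) s :=
    (hasDerivAt_const s p).prodMk (hasDerivAt_id s)
  exact ((hG.differentiable (by simp) (p, s)).hasFDerivAt.comp_hasDerivAt s h1).deriv

theorem contDiff_slice_deriv (hG : ContDiff ℝ smooth G) :
    ContDiff ℝ smooth fun z => fderiv ℝ G z (0, 1) :=
  (hG.fderiv_right (m := smooth) (by simp)).clm_apply contDiff_const

theorem contDiff_slice (hG : ContDiff ℝ smooth G) (p : P) :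
    ContDiff ℝ smooth fun s => G (p, s) := by fun_prop

theorem radialProfile_of_bound {S M : ℝ} {A : ℝ → ℝ} (hA : ContDiff ℝ smooth A)
    (hS : ∀ s, S < s → A s = 0) (hM : 0 ≤ M)
    (h : ∀ s ∈ Icc 0 S, |A s| ≤ M ∧ |deriv A s| ≤ M ∧ |deriv (deriv A) s| ≤ M) :
    RadialProfile S M A := by
  refine ⟨hA, hS, fun s hs => ?_⟩
  rcases le_or_gt s S with h1 | h1
  · exact h s ⟨hs, h1⟩
  · have h2 := deriv_eq_zero_of_support hS
    rw [hS s h1, h2 s h1, deriv_eq_zero_of_support h2 s h1]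
    simpa using hM

theorem exists_radialProfile {S : ℝ} {A : ℝ → ℝ} (hA : ContDiff ℝ smooth A)
    (hS : ∀ s, S < s → A s = 0) : ∃ M, RadialProfile S M A := by
  have h1 : ContDiff ℝ smooth (deriv A) := (contDiff_infty_iff_deriv.1 hA).2
  have h2 : ContDiff ℝ smooth (deriv (deriv A)) := (contDiff_infty_iff_deriv.1 h1).2
  obtain ⟨a, ha⟩ := (isCompact_Icc (a := (0 : ℝ)) (b := S)).exists_bound_of_continuousOn hA.continuous.continuousOn
  obtain ⟨b, hb⟩ := (isCompact_Icc (a := (0 : ℝ)) (b := S)).exists_bound_of_continuousOn h1.continuous.continuousOn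
  obtain ⟨c, hc⟩ := (isCompact_Icc (a := (0 : ℝ)) (b := S)).exists_bound_of_continuousOn h2.continuous.continuousOn
  refine ⟨|a| + |b| + |c|, radialProfile_of_bound hA hS (by positivity) fun s hs => ?_⟩
  have := ha s hs; have := hb s hs; have := hc s hs
  simp only [Real.norm_eq_abs] at *
  have := le_abs_self a; have := le_abs_self b; have := le_abs_self c
  have := abs_nonneg a; have := abs_nonneg b; have := abs_nonneg c
  refine ⟨?_, ?_, ?_⟩ <;> linarith

theorem eventually_radialProfile {S : ℝ} (hG : ContDiff ℝ smooth G)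
    (hS : ∀ p s, S < s → G (p, s) = 0) (p₀ : P) {ε : ℝ} (hε : 0 < ε) :
    ∀ᶠ p in 𝓝 p₀, RadialProfile S ε fun s => G (p, s) - G (p₀, s) := by
  have key : ∀ {F : P × ℝ → ℝ}, Continuous F →
      ∀ᶠ p in 𝓝 p₀, ∀ s ∈ Icc 0 S, |F (p, s) - F (p₀, s)| < ε := by
    intro F hF
    refine (isCompact_Icc (a := (0 : ℝ)) (b := S)).eventually_forall_of_forall_eventually
      (P := fun p s => |F (p, s) - F (p₀, s)| < ε) fun s _ => ?_
    have hc : Continuous fun z : P × ℝ => |F (z.1, z.2) - F (p₀, z.2)| := by fun_prop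
    exact hc.continuousAt.eventually_lt_const (by simpa using hε)
  have h1 := contDiff_slice_deriv hG
  have h2 := contDiff_slice_deriv h1
  filter_upwards [key hG.continuous, key h1.continuous, key h2.continuous] with p e0 e1 e2
  have d1 : deriv (fun s => G (p, s) - G (p₀, s))
      = fun s => fderiv ℝ G (p, s) (0, 1) - fderiv ℝ G (p₀, s) (0, 1) := by
    funext s
    rw [deriv_fun_sub ((contDiff_slice hG p).differentiable (by simp) s)
      ((contDiff_slice hG p₀).differentiable (by simp) s), deriv_slice hG, deriv_slice hG]
  have d2 : deriv (deriv fun s => G (p, s) - G (p₀, s))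
      = fun s => fderiv ℝ (fun z => fderiv ℝ G z (0, 1)) (p, s) (0, 1)
        - fderiv ℝ (fun z => fderiv ℝ G z (0, 1)) (p₀, s) (0, 1) := by
    rw [d1]
    funext s
    rw [deriv_fun_sub ((contDiff_slice h1 p).differentiable (by simp) s)
      ((contDiff_slice h1 p₀).differentiable (by simp) s), deriv_slice h1, deriv_slice h1]
  refine radialProfile_of_bound ((contDiff_slice hG p).sub (contDiff_slice hG p₀))
    (fun s hs => by rw [hS p s hs, hS p₀ s hs, sub_zero]) hε.le fun s hs => ?_
  rw [d2, d1]
  exact ⟨(e0 s hs).le, (e1 s hs).le, (e2 s hs).le⟩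

end Parameters

/-- The cutoff radius (squared) for the profiles of the Green's function. -/
def cutoffRadius (D : Set Plane) : ℝ := (Metric.diam D + 1) ^ 2 + 1

/-- The profile of the part of the Green's function without a logarithm. -/
def greenProfile (D : Set Plane) (z : (ℂ × ℂ) × ℝ) : ℂ :=
  (Real.smoothTransition (cutoffRadius D - z.2) : ℂ)
    * (z.1.1 * besselJ (z.1.2 * z.2) - besselY (z.1.2 * z.2) / (2 * Real.pi))

/-- The profile of the logarithmic part of the Green's function. -/
def logProfile (D : Set Plane) (z : (ℂ × ℂ) × ℝ) : ℂ :=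
  (Real.smoothTransition (cutoffRadius D - z.2) : ℂ) * (-besselJ (z.1.2 * z.2) / (4 * Real.pi))

theorem contDiff_cutoff (D : Set Plane) : ContDiff ℝ smooth
    fun z : (ℂ × ℂ) × ℝ => (Real.smoothTransition (cutoffRadius D - z.2) : ℂ) :=
  Complex.ofRealCLM.contDiff.comp
    (Real.smoothTransition.contDiff.comp (contDiff_const.sub contDiff_snd))

theorem contDiff_entire_mul {F : ℂ → ℂ} (hF : Differentiable ℂ F) :
    ContDiff ℝ smooth fun z : (ℂ × ℂ) × ℝ => F (z.1.2 * z.2) := by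
  have h1 : ContDiff ℝ smooth F := (hF.contDiff).restrict_scalars ℝ
  have h2 : ContDiff ℝ smooth fun z : (ℂ × ℂ) × ℝ => (z.2 : ℂ) :=
    Complex.ofRealCLM.contDiff.comp contDiff_snd
  exact h1.comp ((contDiff_snd.comp contDiff_fst).mul h2)

theorem contDiff_greenProfile (D : Set Plane) :
    ContDiff ℝ smooth (greenProfile D) := by
  have h1 := contDiff_entire_mul differentiable_besselJ
  have h2 := contDiff_entire_mul differentiable_besselY
  exact (contDiff_cutoff D).mul (((contDiff_fst.comp contDiff_fst).mul h1).sub (h2.div_const _))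

theorem contDiff_logProfile (D : Set Plane) :
    ContDiff ℝ smooth (logProfile D) :=
  (contDiff_cutoff D).mul ((contDiff_entire_mul differentiable_besselJ).neg.div_const _)

theorem greenProfile_eq_zero {D : Set Plane} (p : ℂ × ℂ) {s : ℝ} (hs : cutoffRadius D < s) :
    greenProfile D (p, s) = 0 ∧ logProfile D (p, s) = 0 := by
  have h : Real.smoothTransition (cutoffRadius D - s) = 0 :=
    Real.smoothTransition.zero_of_nonpos (by linarith)
  simp [greenProfile, logProfile, h]

theorem greenKernel_neg (c q : ℂ) (z : Plane) : greenKernel c q (-z) = greenKernel c q z := by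
  simp [greenKernel, jKernel, yKernel, logKernel_neg]

theorem greenKernel_eq_profile {D : Set Plane} (p : ℂ × ℂ) {z : Plane} (hz : z ∈ diffBall D) :
    greenKernel p.1 p.2 z
      = greenProfile D (p, ‖z‖ ^ 2) + logProfile D (p, ‖z‖ ^ 2) * log (‖z‖ ^ 2) := by
  have h1 : ‖z‖ ^ 2 ≤ (Metric.diam D + 1) ^ 2 := by
    rw [diffBall, mem_ball_zero_iff] at hz; gcongr
  have h : Real.smoothTransition (cutoffRadius D - ‖z‖ ^ 2) = 1 :=
    Real.smoothTransition.one_of_one_le (by unfold cutoffRadius; linarith)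
  have hpi : (Real.pi : ℂ) ≠ 0 := by exact_mod_cast Real.pi_ne_zero
  simp only [greenKernel, jKernel, yKernel, greenProfile, logProfile, h, Real.log_pow, logKernel,
    logKernelR]
  push_cast
  field_simp
  ring

section Potentials

variable {D : Set Plane} [hD : Fact (ReflectionDomain D)]

theorem contDiff_re_im {G : (ℂ × ℂ) × ℝ → ℂ} (hG : ContDiff ℝ smooth G) :
    ContDiff ℝ smooth (fun z => (G z).re) ∧
      ContDiff ℝ smooth (fun z => (G z).im) :=
  ⟨Complex.reCLM.contDiff.comp hG, Complex.imCLM.contDiff.comp hG⟩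

theorem exists_hasProfile_greenKernel (p : ℂ × ℂ) : ∃ M, HasProfile D (cutoffRadius D) M
    (fun s => greenProfile D (p, s)) (fun s => logProfile D (p, s)) (greenKernel p.1 p.2) := by
  have h1 := contDiff_re_im (contDiff_greenProfile D)
  have h2 := contDiff_re_im (contDiff_logProfile D)
  obtain ⟨a, ha⟩ := exists_radialProfile (contDiff_slice h1.1 p)
    fun s hs => by simp [(greenProfile_eq_zero (D := D) p hs).1]
  obtain ⟨b, hb⟩ := exists_radialProfile (contDiff_slice h1.2 p)
    fun s hs => by simp [(greenProfile_eq_zero (D := D) p hs).1]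
  obtain ⟨c, hc⟩ := exists_radialProfile (contDiff_slice h2.1 p)
    fun s hs => by simp [(greenProfile_eq_zero (D := D) p hs).2]
  obtain ⟨d, hd⟩ := exists_radialProfile (contDiff_slice h2.2 p)
    fun s hs => by simp [(greenProfile_eq_zero (D := D) p hs).2]
  refine ⟨max (max a b) (max c d), by unfold cutoffRadius; positivity, ha.mono (by simp),
    hb.mono (by simp), hc.mono (by simp), hd.mono (by simp), greenKernel_neg _ _,
    fun z hz => greenKernel_eq_profile p hz⟩

theorem eventually_hasProfile_greenKernel (p₀ : ℂ × ℂ) {ε : ℝ} (hε : 0 < ε) :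
    ∀ᶠ p : ℂ × ℂ in 𝓝 p₀, HasProfile D (cutoffRadius D) ε
      (fun s => greenProfile D (p, s) - greenProfile D (p₀, s))
      (fun s => logProfile D (p, s) - logProfile D (p₀, s))
      fun z => greenKernel p.1 p.2 z - greenKernel p₀.1 p₀.2 z := by
  have h1 := contDiff_re_im (contDiff_greenProfile D)
  have h2 := contDiff_re_im (contDiff_logProfile D)
  filter_upwards [
    eventually_radialProfile h1.1 (fun p s hs => by simp [(greenProfile_eq_zero (D := D) p hs).1]) p₀ hε,
    eventually_radialProfile h1.2 (fun p s hs => by simp [(greenProfile_eq_zero (D := D) p hs).1]) p₀ hε,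
    eventually_radialProfile h2.1 (fun p s hs => by simp [(greenProfile_eq_zero (D := D) p hs).2]) p₀ hε,
    eventually_radialProfile h2.2 (fun p s hs => by simp [(greenProfile_eq_zero (D := D) p hs).2]) p₀ hε]
    with p e1 e2 e3 e4
  refine ⟨by unfold cutoffRadius; positivity, e1, e2, e3, e4, fun z => by simp only [greenKernel_neg],
    fun z hz => ?_⟩
  rw [greenKernel_eq_profile p hz, greenKernel_eq_profile p₀ hz]
  ring

theorem tendsto_kerNorm_greenKernel {q₀ : ℂ} (hq₀ : ‖q₀‖ < 1) (c₀ : ℂ) :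
    Tendsto (fun p : ℂ × ℂ => kerNorm D fun z => greenKernel p.1 p.2 z - greenKernel c₀ q₀ z)
      (𝓝 (c₀, q₀)) (𝓝 0) := by
  have hC := kernelConst_nonneg D
  have hb : Tendsto (fun p : ℂ × ℂ => ballConst D * (‖p.1 - c₀‖ * (1 + kernelConst D)
      + (‖c₀‖ + 1) * (kernelConst D * ‖p.2 - q₀‖))) (𝓝 (c₀, q₀)) (𝓝 0) := by
    have : Continuous fun p : ℂ × ℂ => ballConst D * (‖p.1 - c₀‖ * (1 + kernelConst D)
      + (‖c₀‖ + 1) * (kernelConst D * ‖p.2 - q₀‖)) := by fun_prop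
    simpa using this.tendsto (c₀, q₀)
  have hev : ∀ᶠ p : ℂ × ℂ in 𝓝 (c₀, q₀), ‖p.2‖ < 1 :=
    (continuous_snd.norm.continuousAt (x := (c₀, q₀))).eventually_lt_const hq₀
  refine squeeze_zero' (.of_forall fun p => kerNorm_nonneg _) (hev.mono fun p hp => ?_) hb
  refine kerNorm_le (by positivity) fun z hz => ?_
  have hp' : p.2 ∈ 𝔻 := by simpa using hp.le
  have hl := kernel_lipschitz hp' (q := q₀) (by simpa using hq₀.le) hz
  have hn : ‖jKernel p.2 z‖ ≤ kernelConst D :=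
    (norm_kernel_le hp' hz).1.trans (mul_le_of_le_one_right hC hp.le)
  have e : greenKernel p.1 p.2 z - greenKernel c₀ q₀ z = (p.1 - c₀) * (1 + jKernel p.2 z)
      + (c₀ * (jKernel p.2 z - jKernel q₀ z) + (yKernel p.2 z - yKernel q₀ z)) := by
    simp only [greenKernel]; ring
  rw [e]
  calc _ ≤ ‖p.1 - c₀‖ * (1 + ‖jKernel p.2 z‖)
        + (‖c₀‖ * ‖jKernel p.2 z - jKernel q₀ z‖ + ‖yKernel p.2 z - yKernel q₀ z‖) := by
        refine (norm_add_le _ _).trans (add_le_add ?_ ((norm_add_le _ _).trans (by rw [norm_mul])))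
        rw [norm_mul]
        gcongr
        exact (norm_add_le _ _).trans (by simp)
    _ ≤ ‖p.1 - c₀‖ * (1 + kernelConst D)
        + (‖c₀‖ * (kernelConst D * ‖p.2 - q₀‖) + kernelConst D * ‖p.2 - q₀‖) := by
        gcongr
        exacts [hl.1, hl.2]
    _ = _ := by ring

/-- Potentials depend continuously on the coefficients and the density, in `H²(D)`. -/
theorem tendsto_h2Norm_potential {ι : Type*} {l : Filter ι} {c q : ι → ℂ} {c₀ q₀ : ℂ}
    (hc : Tendsto c l (𝓝 c₀)) (hq : Tendsto q l (𝓝 q₀)) (hq₀ : ‖q₀‖ < 1) {f : ι → L2 D} {f₀ : L2 D}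
    (hf : Tendsto f l (𝓝 f₀)) {u : ι → Plane → ℂ} {u₀ : Plane → ℂ}
    (hu : ∀ᶠ i in l, u i =ᵐ[vol[D]] conv D (greenKernel (c i) (q i)) (f i))
    (hu₀ : u₀ =ᵐ[vol[D]] conv D (greenKernel c₀ q₀) f₀) :
    Tendsto (fun i => h2Norm D fun x => u i x - u₀ x) l (𝓝 0) := by
  have hp : Tendsto (fun i => (c i, q i)) l (𝓝 (c₀, q₀)) := hc.prodMk_nhds hq
  have hq' : q₀ ∈ 𝔻 := by simpa using hq₀.le
  obtain ⟨M, hM⟩ := exists_hasProfile_greenKernel (D := D) (c₀, q₀)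
  have hC := jetConst_nonneg (cutoffRadius D)
  set C := jetConst (cutoffRadius D)
  rw [ENNReal.tendsto_nhds_zero]
  intro ε hε
  obtain ⟨e, he, heε⟩ : ∃ e : ℝ, 0 < e ∧ ENNReal.ofReal e ≤ ε := by
    rcases eq_or_ne ε ∞ with rfl | h
    · exact ⟨1, one_pos, le_top⟩
    · exact ⟨ε.toReal, ENNReal.toReal_pos hε.ne' h, (ENNReal.ofReal_toReal h).le⟩
  set η := e / (4 * (C * ‖f₀‖ + 1)) with hη
  have hη0 : 0 < η := by positivity
  have hηC : η * C * ‖f₀‖ < e / 2 := by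
    rw [hη, div_mul_eq_mul_div, div_mul_eq_mul_div, div_lt_div_iff₀ (by positivity) (by norm_num)]
    have : 0 ≤ C * ‖f₀‖ := by positivity
    nlinarith
  have t1 : Tendsto (fun i => (sqrt (area D) * kerNorm D (greenKernel c₀ q₀) + M * C)
      * ‖f i - f₀‖) l (𝓝 0) := by
    simpa using ((hf.sub_const f₀).norm.const_mul
      (sqrt (area D) * kerNorm D (greenKernel c₀ q₀) + M * C))
  have t2 : Tendsto (fun i => (sqrt (area D) * kerNorm D (fun z => greenKernel (c i) (q i) z
      - greenKernel c₀ q₀ z) + η * C) * ‖f i‖) l (𝓝 (η * C * ‖f₀‖)) := by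
    have := ((((tendsto_kerNorm_greenKernel (D := D) hq₀ c₀).comp hp).const_mul
      (sqrt (area D))).add_const (η * C)).mul hf.norm
    simpa using this
  filter_upwards [hu, t1.eventually_lt_const (half_pos he), t2.eventually_lt_const hηC,
    hp.eventually (eventually_hasProfile_greenKernel (D := D) (c₀, q₀) hη0),
    hq.norm.eventually_lt_const hq₀] with i hui h1 h2 h3 h4
  have hk := isKernel_greenKernel (D := D) c₀ hq'
  have hki := isKernel_greenKernel (D := D) (c i) (q := q i) (by simpa using h4.le)
  have hn : ∀ g : L2 D, (eLpNorm g 2 vol[D]).toReal = ‖g‖ := fun g => (Lp.norm_def g).symm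
  have j1 := hM.jetBound hk (Lp.memLp (f i - f₀))
  have j2 := h3.jetBound (hki.sub hk) (Lp.memLp (f i))
  rw [hn] at j1 j2
  have hM0 := hM.re_α.nonneg
  have hk0 := kerNorm_nonneg (D := D) (greenKernel c₀ q₀)
  have hk1 := kerNorm_nonneg (D := D) (fun z => greenKernel (c i) (q i) z - greenKernel c₀ q₀ z)
  have j3 := (JetBound.add (by positivity) (by positivity) j1 j2).congr
    (v := fun x => u i x - u₀ x) (by
      filter_upwards [hui, hu₀, ae_mem_domain (D := D)] with x a1 a2 hx
      rw [a1, a2, conv_congr (Lp.coeFn_sub (f i) f₀)]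
      have b1 : conv D (greenKernel c₀ q₀) (⇑(f i) - ⇑f₀) x
          = conv D (greenKernel c₀ q₀) (f i) x - conv D (greenKernel c₀ q₀) f₀ x := by
        simp only [conv, Pi.sub_apply, mul_sub]
        exact integral_sub (hk.integrable (Lp.memLp _) hx) (hk.integrable (Lp.memLp _) hx)
      have b2 : conv D (fun z => greenKernel (c i) (q i) z - greenKernel c₀ q₀ z) (f i) x
          = conv D (greenKernel (c i) (q i)) (f i) x - conv D (greenKernel c₀ q₀) (f i) x := by
        simp only [conv, sub_mul]
        exact integral_sub (hki.integrable (Lp.memLp _) hx) (hk.integrable (Lp.memLp _) hx)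
      rw [b1, b2]; ring)
  refine j3.h2Norm_le.trans ((ENNReal.ofReal_le_ofReal ?_).trans heε)
  linarith

theorem memH2_potential (c : ℂ) {q : ℂ} (hq : q ∈ 𝔻) {f : Plane → ℂ}
    (hf : MemLp f 2 vol[D]) : MemH2 D (conv D (greenKernel c q) f) := by
  obtain ⟨M, hM⟩ := exists_hasProfile_greenKernel (D := D) (c, q)
  exact (hM.jetBound (isKernel_greenKernel c hq) hf).memH2

theorem IsH2Jet.congr {u v : Plane → ℂ} {g : Fin 2 → Plane → ℂ} {k : Fin 2 → Fin 2 → Plane → ℂ}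
    (hj : IsH2Jet D u g k) (huv : u =ᵐ[vol[D]] v) : IsH2Jet D v g k := by
  refine ⟨hj.memLp.ae_eq huv, hj.memLp_grad, hj.memLp_hess, fun i φ h1 h2 h3 => ?_, hj.hess⟩
  rw [← hj.grad i φ h1 h2 h3]
  exact integral_congr_ae (huv.mono fun x hx => by simp only [hx])

theorem h2Norm_congr {u v : Plane → ℂ} (huv : u =ᵐ[vol[D]] v) :
    h2Norm D u = h2Norm D v := by
  unfold h2Norm
  simp only [eLpNorm_congr_ae huv]
  refine iInf_congr fun g => iInf_congr fun k => iInf_congr_Prop ?_ fun _ => rfl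
  exact ⟨fun hj => hj.congr huv, fun hj => hj.congr huv.symm⟩

theorem MemH2.congr {u v : Plane → ℂ} (h : MemH2 D u) (huv : u =ᵐ[vol[D]] v) :
    MemH2 D v :=
  let ⟨g, k, hj⟩ := h
  ⟨g, k, hj.congr huv⟩

end Potentials

/-! ### Oscillation of potentials -/

/-- The singular kernel at scale `r`. -/
def nearKernel (r : ℝ) (z : Plane) : ℝ := if ‖z‖ < 3 * r then sqrt (r / ‖z‖) else 0

theorem nearKernel_nonneg (r : ℝ) (z : Plane) : 0 ≤ nearKernel r z := by
  unfold nearKernel; split_ifs <;> positivity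

theorem measurable_nearKernel (r : ℝ) : Measurable (nearKernel r) := by
  unfold nearKernel
  exact Measurable.ite (measurableSet_lt measurable_norm measurable_const) (by fun_prop)
    measurable_const

theorem nearKernel_sq {r : ℝ} (hr : 0 < r) (z : Plane) :
    nearKernel r z ^ 2 = (ball (0 : Plane) (3 * r)).indicator (fun z => r * ‖z‖⁻¹) z := by
  unfold nearKernel
  by_cases h : ‖z‖ < 3 * r
  · rw [if_pos h, indicator_of_mem (by simpa using h), Real.sq_sqrt (by positivity), div_eq_mul_inv]
  · rw [if_neg h, indicator_of_notMem (by simpa using h)]; simp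

theorem integral_nearKernel_sq {r : ℝ} (hr : 0 < r) :
    ∫ z, nearKernel r z ^ 2 = 6 * volume.real (ball (0 : Plane) 1) * r ^ 2 := by
  have h := integral_fun_norm_addHaar (volume : Measure Plane)
    (f := fun t => (if t < 3 * r then sqrt (r / t) else 0) ^ 2)
  change ∫ z : Plane, nearKernel r z ^ 2 = _ at h
  rw [h, finrank_plane]
  have h2 : ∫ y in Ioi (0 : ℝ), y ^ (2 - 1) • (if y < 3 * r then sqrt (r / y) else 0) ^ 2
      = 3 * r ^ 2 := by
    have : ∀ y ∈ Ioi (0 : ℝ), y ^ (2 - 1) • (if y < 3 * r then sqrt (r / y) else 0) ^ 2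
        = (Iio (3 * r)).indicator (fun _ => r) y := by
      intro y hy
      have hy' : 0 < y := hy
      by_cases h : y < 3 * r
      · rw [if_pos h, indicator_of_mem (by simpa using h), Real.sq_sqrt (by positivity)]
        simp; field_simp
      · rw [if_neg h, indicator_of_notMem (by simpa using h)]; simp
    rw [setIntegral_congr_fun measurableSet_Ioi this, integral_indicator measurableSet_Iio,
      Measure.restrict_restrict measurableSet_Iio, setIntegral_const, Iio_inter_Ioi]
    simp [hr.le]
    ring
  rw [h2]
  simp
  ring

theorem memLp_nearKernel {r : ℝ} (hr : 0 < r) : MemLp (nearKernel r) 2 volume := by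
  rw [memLp_two_iff_integrable_sq (measurable_nearKernel r).aestronglyMeasurable]
  have h : IntegrableOn (fun z : Plane => r * ‖z‖⁻¹) (ball 0 (3 * r)) :=
    (integrableOn_inv_norm (3 * r)).const_mul r
  exact (h.integrable_indicator measurableSet_ball).congr (.of_forall fun z => (nearKernel_sq hr z).symm)

/-- A constant for the `L²` norm of the singular kernel. -/
def nearConst : ℝ := sqrt (6 * volume.real (ball (0 : Plane) 1))

theorem nearConst_nonneg : 0 ≤ nearConst := Real.sqrt_nonneg _

theorem toReal_eLpNorm_two {E α : Type*} [NormedAddCommGroup E] [MeasurableSpace α] {μ : Measure α}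
    {f : α → E} (hf : MemLp f 2 μ) : (eLpNorm f 2 μ).toReal = sqrt (∫ x, ‖f x‖ ^ 2 ∂μ) := by
  rw [hf.eLpNorm_eq_integral_rpow_norm (by norm_num) (by norm_num), ENNReal.toReal_ofReal (by positivity),
    Real.sqrt_eq_rpow]
  norm_num

theorem toReal_eLpNorm_nearKernel {r : ℝ} (hr : 0 < r) :
    (eLpNorm (nearKernel r) 2 volume).toReal = nearConst * r := by
  rw [toReal_eLpNorm_two (memLp_nearKernel hr)]
  simp only [Real.norm_eq_abs, sq_abs]
  rw [integral_nearKernel_sq hr, Real.sqrt_mul (by positivity), Real.sqrt_sq hr.le, nearConst]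

theorem log_sub_log_le {r s t : ℝ} (hs : 0 < s) (ht : 0 < t) (h : s ≤ t + r) (hr : 0 < r) :
    log s - log t ≤ 2 + 2 * if t < 3 * r then sqrt (r / t) else 0 := by
  rw [← Real.log_div hs.ne' ht.ne']
  split_ifs with h3
  · have h1 : log (s / t) = 2 * log (sqrt (s / t)) := by
      rw [Real.log_sqrt (by positivity)]; ring
    have h2 := Real.log_le_sub_one_of_pos (Real.sqrt_pos.2 (div_pos hs ht))
    have h4 : sqrt (s / t) ≤ 1 + sqrt (r / t) := by
      rw [Real.sqrt_le_left (by positivity)]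
      have h5 := Real.sq_sqrt (div_nonneg hr.le ht.le)
      have h6 := Real.sqrt_nonneg (r / t)
      have h7 : s / t ≤ 1 + r / t := by
        rw [div_le_iff₀ ht, add_mul, div_mul_cancel₀ _ ht.ne']; linarith
      nlinarith
    linarith
  · have h1 := Real.log_le_sub_one_of_pos (div_pos hs ht)
    have h2 : s / t ≤ 3 := by
      rw [div_le_iff₀ ht]; push Not at h3; linarith
    linarith

theorem abs_logKernel_sub_le {r : ℝ} (hr : 0 < r) {a b : Plane} (ha : a ≠ 0) (hb : b ≠ 0)
    (h : ‖a - b‖ ≤ r) :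
    ‖logKernel a - logKernel b‖ ≤ 2 + 2 * (nearKernel r a + nearKernel r b) := by
  have ha' := norm_pos_iff.2 ha
  have hb' := norm_pos_iff.2 hb
  have h1 := log_sub_log_le (r := r) ha' hb' (by have := norm_le_norm_add_norm_sub' a b; linarith) hr
  have h2 := log_sub_log_le (r := r) hb' ha'
    (by have := norm_le_norm_add_norm_sub a b; linarith) hr
  change _ ≤ 2 + 2 * nearKernel r b at h1
  change _ ≤ 2 + 2 * nearKernel r a at h2
  have n1 := nearKernel_nonneg r a
  have n2 := nearKernel_nonneg r b
  have h3 : |log ‖a‖ - log ‖b‖| ≤ 2 + 2 * (nearKernel r a + nearKernel r b) := by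
    rw [abs_le]; constructor <;> linarith
  have hpi : 1 / (2 * Real.pi) ≤ 1 := by
    rw [div_le_one (by positivity)]; linarith [Real.pi_gt_three]
  rw [logKernel, logKernel, ← Complex.ofReal_sub, Complex.norm_real, logKernelR, logKernelR, ← mul_sub,
    norm_mul, Real.norm_eq_abs, Real.norm_eq_abs, abs_neg, abs_of_nonneg (by positivity)]
  exact (mul_le_of_le_one_left (abs_nonneg _) hpi).trans h3

section Oscillation

variable {D : Set Plane} [hD : Fact (ReflectionDomain D)]

theorem integral_norm_mul_le {a : Plane → ℝ} {f : Plane → ℂ} (ha : MemLp a 2 vol[D])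
    (hf : MemLp f 2 vol[D]) : ∫ y in D, |a y| * ‖f y‖
      ≤ (eLpNorm a 2 vol[D]).toReal * (eLpNorm f 2 vol[D]).toReal := by
  have h := norm_integral_mul_le (ha.norm.ofReal (K := ℂ)) (hf.norm.ofReal (K := ℂ))
  have e1 : ∀ {E : Type} [NormedAddCommGroup E] (g : Plane → E),
      eLpNorm (fun x => ((‖g x‖ : ℝ) : ℂ)) 2 vol[D] = eLpNorm g 2 vol[D] :=
    fun g => eLpNorm_congr_norm_ae (.of_forall fun x => by simp)
  change _ ≤ (eLpNorm (fun x => ((‖a x‖ : ℝ) : ℂ)) 2 _).toReal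
    * (eLpNorm (fun x => ((‖f x‖ : ℝ) : ℂ)) 2 _).toReal at h
  rw [e1, e1] at h
  have e2 : ∫ y in D, |a y| * ‖f y‖ = ‖∫ y in D, ((‖a y‖ : ℝ) : ℂ) * ((‖f y‖ : ℝ) : ℂ)‖ := by
    simp only [← Complex.ofReal_mul, integral_complex_ofReal, Complex.norm_real, Real.norm_eq_abs]
    rw [abs_of_nonneg (integral_nonneg fun x => by positivity)]
  rw [e2]
  exact h

theorem integral_norm_le {f : Plane → ℂ} (hf : MemLp f 2 vol[D]) :
    ∫ y in D, ‖f y‖ ≤ sqrt (area D) * (eLpNorm f 2 vol[D]).toReal := by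
  have h := integral_norm_mul_le (memLp_const (1 : ℝ)) hf
  rw [toReal_eLpNorm_two (memLp_const (1 : ℝ))] at h
  simpa [area, measureReal_def] using h

theorem memLp_nearKernel_shift {r : ℝ} (hr : 0 < r) (x : Plane) :
    MemLp (fun y => nearKernel r (x - y)) 2 vol[D] :=
  ((memLp_nearKernel hr).comp_measurePreserving
    (Measure.measurePreserving_sub_left (volume : Measure Plane) x)).restrict D

theorem eLpNorm_nearKernel_shift_le {r : ℝ} (hr : 0 < r) (x : Plane) :
    (eLpNorm (fun y => nearKernel r (x - y)) 2 vol[D]).toReal ≤ nearConst * r := by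
  have h2 := eLpNorm_comp_measurePreserving (p := 2) (memLp_nearKernel hr).1
    (Measure.measurePreserving_sub_left (volume : Measure Plane) x)
  rw [← toReal_eLpNorm_nearKernel hr, ← h2]
  exact ENNReal.toReal_mono (h2 ▸ (memLp_nearKernel hr).2.ne)
    (eLpNorm_mono_measure _ Measure.restrict_le_self)

theorem integrable_nearKernel_mul {r : ℝ} (hr : 0 < r) {f : Plane → ℂ}
    (hf : MemLp f 2 vol[D]) (x : Plane) :
    Integrable (fun y => nearKernel r (x - y) * ‖f y‖) vol[D] :=
  (memLp_nearKernel_shift hr x).integrable_mul hf.norm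

theorem integral_nearKernel_mul_le {r : ℝ} (hr : 0 < r) {f : Plane → ℂ}
    (hf : MemLp f 2 vol[D]) (x : Plane) :
    ∫ y in D, nearKernel r (x - y) * ‖f y‖
        ≤ nearConst * r * (eLpNorm f 2 vol[D]).toReal := by
  have h := (integral_norm_mul_le (memLp_nearKernel_shift hr x) hf).trans
    (mul_le_mul_of_nonneg_right (eLpNorm_nearKernel_shift_le hr x) ENNReal.toReal_nonneg)
  simpa only [abs_of_nonneg (nearKernel_nonneg _ _)] using h

/-- A constant for the oscillation of potentials. -/
def oscConst (D : Set Plane) : ℝ := 2 + 4 * kernelConst D + 4 * nearConst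

theorem oscConst_pos (D : Set Plane) : 0 < oscConst D := by
  have := kernelConst_nonneg D
  have := nearConst_nonneg
  unfold oscConst; positivity

theorem norm_regular_le {c q : ℂ} (hq : ‖q‖ ≤ 1) (hcq : ‖c‖ * ‖q‖ ≤ 1) {z : Plane}
    (hz : z ∈ diffBall D) : ‖c * jKernel q z + yKernel q z‖ ≤ 2 * kernelConst D := by
  have h := norm_kernel_le (q := q) (by simpa using hq) hz
  have hC := kernelConst_nonneg D
  calc _ ≤ ‖c‖ * ‖jKernel q z‖ + ‖yKernel q z‖ := (norm_add_le _ _).trans (by rw [norm_mul])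
    _ ≤ ‖c‖ * (kernelConst D * ‖q‖) + kernelConst D * ‖q‖ := by gcongr; exacts [h.1, h.2]
    _ = kernelConst D * (‖c‖ * ‖q‖ + ‖q‖) := by ring
    _ ≤ kernelConst D * (1 + 1) := by gcongr
    _ = _ := by ring

theorem norm_conv_sub_le {c q : ℂ} (hq : ‖q‖ ≤ 1) (hcq : ‖c‖ * ‖q‖ ≤ 1) {f : Plane → ℂ}
    (hf : MemLp f 2 vol[D]) {x y : Plane} (hx : x ∈ D) (hy : y ∈ D) {r : ℝ} (hr : 0 < r)
    (hxy : ‖x - y‖ ≤ r) :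
    ‖conv D (greenKernel c q) f x - conv D (greenKernel c q) f y‖
      ≤ oscConst D * ((∫ t in D, ‖f t‖) + r * (eLpNorm f 2 vol[D]).toReal) := by
  have hk := isKernel_greenKernel (D := D) c (q := q) (by simpa using hq)
  have hC := kernelConst_nonneg D
  have hn := nearConst_nonneg
  have i1 := integrable_nearKernel_mul hr hf x
  have i2 := integrable_nearKernel_mul hr hf y
  have b1 := integral_nearKernel_mul_le hr hf x
  have b2 := integral_nearKernel_mul_le hr hf y
  have i0 : Integrable (fun t => ‖f t‖) vol[D] := (hf.integrable (by norm_num)).norm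
  rw [conv, conv, ← integral_sub (hk.integrable hf hx) (hk.integrable hf hy)]
  have hne : ∀ a : Plane, ∀ᵐ t : Plane ∂vol[D], t ≠ a := fun a =>
    ae_restrict_of_ae (by rw [ae_iff]; simp)
  have hI0 : 0 ≤ ∫ t in D, ‖f t‖ := integral_nonneg fun _ => norm_nonneg _
  calc _ ≤ ∫ t in D, ((2 + 4 * kernelConst D) * ‖f t‖
        + 2 * (nearKernel r (x - t) * ‖f t‖ + nearKernel r (y - t) * ‖f t‖)) := by
        refine norm_integral_le_of_norm_le ((i0.const_mul _).add ((i1.add i2).const_mul 2)) ?_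
        filter_upwards [hne x, hne y, ae_mem_domain (D := D)] with t h1 h2 ht
        have e : greenKernel c q (x - t) * f t - greenKernel c q (y - t) * f t
            = ((logKernel (x - t) - logKernel (y - t))
              + ((c * jKernel q (x - t) + yKernel q (x - t))
                - (c * jKernel q (y - t) + yKernel q (y - t)))) * f t := by
          simp only [greenKernel]; ring
        rw [e, norm_mul]
        have a1 := abs_logKernel_sub_le hr (sub_ne_zero.2 h1.symm) (sub_ne_zero.2 h2.symm)
          (by rwa [sub_sub_sub_cancel_right])
        have a2 := norm_regular_le hq hcq (sub_mem_diffBall hx ht)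
        have a3 := norm_regular_le hq hcq (sub_mem_diffBall hy ht)
        have a4 := (norm_add_le (logKernel (x - t) - logKernel (y - t))
          ((c * jKernel q (x - t) + yKernel q (x - t)) - (c * jKernel q (y - t) + yKernel q (y - t))))
        have a5 := norm_sub_le (c * jKernel q (x - t) + yKernel q (x - t))
          (c * jKernel q (y - t) + yKernel q (y - t))
        have a6 := mul_le_mul_of_nonneg_right (a4.trans (add_le_add a1 (a5.trans (add_le_add a2 a3))))
          (norm_nonneg (f t))
        refine a6.trans (le_of_eq ?_)
        ring
    _ = (2 + 4 * kernelConst D) * (∫ t in D, ‖f t‖)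
        + 2 * ((∫ t in D, nearKernel r (x - t) * ‖f t‖) + ∫ t in D, nearKernel r (y - t) * ‖f t‖) := by
        have e := integral_add (i0.const_mul (2 + 4 * kernelConst D)) ((i1.add i2).const_mul 2)
        simp only [Pi.add_apply] at e
        rw [e, integral_const_mul, integral_const_mul, integral_add i1 i2]
    _ ≤ (2 + 4 * kernelConst D) * (∫ t in D, ‖f t‖)
        + 2 * (nearConst * r * (eLpNorm f 2 vol[D]).toReal
          + nearConst * r * (eLpNorm f 2 vol[D]).toReal) := by gcongr
    _ ≤ _ := by
        have h2 : 0 ≤ r * (eLpNorm f 2 vol[D]).toReal := by positivity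
        unfold oscConst
        nlinarith [mul_nonneg hn hI0, mul_nonneg hC h2]

/-- Pointwise bound for functions given by potentials. -/
theorem exists_pointwise_bound (D : Set Plane) [hD : Fact (ReflectionDomain D)] :
    ∃ κ r₀ : ℝ, 0 < κ ∧ 0 < r₀ ∧ ∀ (c q Z : ℂ) (f U : Plane → ℂ) (δ : ℝ), 0 < δ → δ ≤ ‖Z‖ →
      ‖q‖ ≤ 1 → ‖c‖ * ‖q‖ ≤ 1 → MemLp f 2 vol[D] → MemLp U 2 vol[D] →
      (∀ x ∈ D, Z * U x = conv D (greenKernel c q) f x) → ∀ r, 0 < r → r ≤ r₀ → ∀ x ∈ D,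
      ‖U x‖ ≤ (eLpNorm U 2 vol[D]).toReal / (κ * r)
        + oscConst D / δ * ((∫ t in D, ‖f t‖) + r * (eLpNorm f 2 vol[D]).toReal) := by
  obtain ⟨κ, r₀, hκ, hr₀, hball⟩ := hD.out.interiorBalls
  refine ⟨κ, r₀, hκ, hr₀, fun c q Z f U δ hδ hZ hq hcq hf hU heq r hr hr' x hx => ?_⟩
  obtain ⟨p, hp⟩ := hball x hx r hr hr'
  set m := (eLpNorm U 2 vol[D]).toReal
  have hm : 0 ≤ m := ENNReal.toReal_nonneg
  have hmsq : m ^ 2 = ∫ t in D, ‖U t‖ ^ 2 := by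
    change (eLpNorm U 2 vol[D]).toReal ^ 2 = _
    rw [toReal_eLpNorm_two hU, Real.sq_sqrt (integral_nonneg fun _ => by positivity)]
  have hint : IntegrableOn (fun t => ‖U t‖ ^ 2) D := hU.integrable_norm_pow (by norm_num)
  have hBD : ball p (κ * r) ⊆ D := hp.trans inter_subset_left
  have hpos : 0 < κ * r := by positivity
  obtain ⟨y, hy, hyle⟩ := exists_le_setAverage (Metric.measure_ball_pos volume p hpos).ne'
    measure_ball_lt_top.ne (hint.mono_set hBD)
  have hvol : volume.real (ball p (κ * r)) = Real.pi * (κ * r) ^ 2 := by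
    rw [measureReal_def, EuclideanSpace.volume_ball_fin_two]
    simp [hpos.le, Real.pi_nonneg]; ring
  have hUy : ‖U y‖ ≤ m / (κ * r) := by
    rw [← sq_le_sq₀ (norm_nonneg _) (by positivity), div_pow]
    refine hyle.trans ?_
    rw [setAverage_eq, hvol, smul_eq_mul, hmsq, div_eq_inv_mul]
    have h1 : ∫ t in ball p (κ * r), ‖U t‖ ^ 2 ≤ ∫ t in D, ‖U t‖ ^ 2 :=
      setIntegral_mono_set hint (.of_forall fun _ => by positivity) hBD.eventuallyLE
    have h2 : 0 ≤ ∫ t in ball p (κ * r), ‖U t‖ ^ 2 := integral_nonneg fun _ => by positivity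
    have h3 : (Real.pi * (κ * r) ^ 2)⁻¹ ≤ ((κ * r) ^ 2)⁻¹ := by
      apply inv_anti₀ (by positivity)
      have := Real.pi_gt_three
      nlinarith [sq_nonneg (κ * r)]
    gcongr
  have hyD := hBD hy
  have hxy : ‖x - y‖ ≤ r := by
    have := (hp hy).2
    rw [Metric.mem_ball, dist_comm, dist_eq_norm] at this
    exact this.le
  have hosc := norm_conv_sub_le hq hcq hf hx hyD hr hxy
  rw [← heq x hx, ← heq y hyD, ← mul_sub, norm_mul] at hosc
  have hUxy : ‖U x - U y‖ ≤ oscConst D / δ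
      * ((∫ t in D, ‖f t‖) + r * (eLpNorm f 2 vol[D]).toReal) := by
    rw [div_mul_eq_mul_div, le_div_iff₀ hδ, mul_comm]
    exact (mul_le_mul_of_nonneg_right hZ (norm_nonneg _)).trans hosc
  have := norm_le_norm_add_norm_sub' (U x) (U y)
  linarith

end Oscillation

/-! ### A priori bounds for solutions -/

section Apriori

variable {D : Set Plane} [hD : Fact (ReflectionDomain D)]

/-- Coefficients in the asymptotic regime. -/
structure Admissible (D : Set Plane) (δ : ℝ) (c q Z : ℂ) : Prop where
  le_norm : δ ≤ ‖Z‖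
  norm_le : ‖q‖ ≤ 1
  norm_mul_le : ‖c‖ * ‖q‖ ≤ 1
  le_re : 1 + 2 * kernelConst D + log (Metric.diam D + 1) ≤ c.re

theorem Admissible.one_le_norm {δ : ℝ} {c q Z : ℂ} (h : Admissible D δ c q Z) {z : Plane}
    (hz : z ∈ diffBall D) : 1 ≤ ‖greenKernel c q z‖ := by
  have h1 := norm_regular_le h.norm_le h.norm_mul_le hz
  have hd := Metric.diam_nonneg (s := D)
  have hl : -log (Metric.diam D + 1) ≤ logKernelR z := by
    have h0 : 0 ≤ log (Metric.diam D + 1) := Real.log_nonneg (by linarith)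
    have h2 : log ‖z‖ ≤ log (Metric.diam D + 1) := by
      rcases eq_or_ne z 0 with rfl | hz0
      · simpa using h0
      · exact Real.log_le_log (norm_pos_iff.2 hz0) (by
          rw [diffBall, mem_ball_zero_iff] at hz; exact hz.le)
    have hpi : 1 / (2 * Real.pi) ≤ 1 := by
      rw [div_le_one (by positivity)]; linarith [Real.pi_gt_three]
    have hpi0 : 0 ≤ 1 / (2 * Real.pi) := by positivity
    rw [logKernelR, neg_mul, neg_le_neg_iff]
    nlinarith
  have h3 := (abs_le.1 ((Complex.abs_re_le_norm _).trans h1)).1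
  have h4 : (greenKernel c q z).re = c.re + logKernelR z + (c * jKernel q z + yKernel q z).re := by
    simp [greenKernel, logKernel]
  have h5 := Complex.re_le_norm (greenKernel c q z)
  have := h.le_re
  linarith

theorem norm_kerr (u : Plane → ℂ) (x : Plane) : ‖kerr u x‖ = (1 + ‖u x‖ ^ 2) * ‖u x‖ := by
  have : kerr u x = ((1 + ‖u x‖ ^ 2 : ℝ) : ℂ) * u x := by unfold kerr; push_cast; ring
  rw [this, norm_mul, Complex.norm_of_nonneg (by positivity)]

theorem aestronglyMeasurable_kerr {μ : Measure Plane} {u : Plane → ℂ} (hu : AEStronglyMeasurable u μ) :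
    AEStronglyMeasurable (kerr u) μ :=
  hu.add ((Complex.continuous_ofReal.comp_aestronglyMeasurable (hu.norm.pow 2)).mul hu)

theorem kerr_congr {μ : Measure Plane} {u v : Plane → ℂ} (h : u =ᵐ[μ] v) : kerr u =ᵐ[μ] kerr v :=
  h.mono fun x hx => by simp only [kerr, hx]

theorem integrable_kerr {δ : ℝ} (hδ : 0 < δ) {c q Z : ℂ} (h : Admissible D δ c q Z) {u : Plane → ℂ}
    (hu : AEStronglyMeasurable u vol[D])
    (heq : ∀ᵐ x ∂vol[D], Z * u x = conv D (greenKernel c q) (kerr u) x) :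
    Integrable (kerr u) vol[D] := by
  by_contra hni
  have hZ : Z ≠ 0 := by rintro rfl; have := h.le_norm; simp at this; linarith
  have hkm := (isKernel_greenKernel (D := D) c (q := q) (by simpa using h.norm_le)).measurable
  have hconv : ∀ x ∈ D, conv D (greenKernel c q) (kerr u) x = 0 := by
    intro x hx
    refine integral_undef fun hi => hni ?_
    refine hi.mono (aestronglyMeasurable_kerr hu) (ae_mem_domain.mono fun y hy => ?_)
    rw [norm_mul]
    exact le_mul_of_one_le_left (norm_nonneg _) (h.one_le_norm (sub_mem_diffBall hx hy))
  refine hni ((integrable_zero Plane ℂ _).congr ?_)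
  filter_upwards [heq, ae_mem_domain (D := D)] with x hx hxD
  rw [hconv x hxD] at hx
  have hx0 : u x = 0 := by simpa [hZ] using hx
  simp [kerr, hx0]

theorem memLp_six_greenKernel {δ : ℝ} {c q Z : ℂ} (h : Admissible D δ c q Z) :
    MemLp (greenKernel c q) 6 (volume.restrict (diffBall D)) := by
  have hq : q ∈ 𝔻 := by simpa using h.norm_le
  have hm : Measurable fun z => c * jKernel q z + yKernel q z :=
    ((measurable_jKernel q).const_mul c).add (measurable_yKernel q)
  exact ((memLp_const c).add (memLp_logKernel D)).add (MemLp.of_bound hm.aestronglyMeasurable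
    (2 * kernelConst D) ((ae_restrict_mem (measurableSet_diffBall D)).mono fun z hz =>
      norm_regular_le h.norm_le h.norm_mul_le hz))

theorem memLp_six_of_solution {δ : ℝ} (hδ : 0 < δ) {c q Z : ℂ} (h : Admissible D δ c q Z)
    {u : Plane → ℂ} (hu : AEStronglyMeasurable u vol[D])
    (heq : ∀ᵐ x ∂vol[D], Z * u x = conv D (greenKernel c q) (kerr u) x) :
    MemLp u 6 vol[D] := by
  have hf := integrable_kerr hδ h hu heq
  have hZ : Z ≠ 0 := by rintro rfl; have := h.le_norm; simp at this; linarith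
  have hkm := (isKernel_greenKernel (D := D) c (q := q) (by simpa using h.norm_le)).measurable
  have h6 := memLp_six_greenKernel h
  have hconv : MemLp (conv D (greenKernel c q) (kerr u)) 6 vol[D] := by
    refine ⟨aestronglyMeasurable_conv hkm hf.1, ?_⟩
    rw [eLpNorm_lt_top_iff_lintegral_rpow_enorm_lt_top (by norm_num) (by norm_num)]
    have hb : Measurable (Function.uncurry fun x t : Plane => ‖greenKernel c q (x - t)‖ₑ) :=
      (hkm.comp (measurable_fst.sub measurable_snd)).enorm
    have hB := lintegral_rpow_lintegral_mul_le (p := 6) (by norm_num) (μ := vol[D])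
      (ν := vol[D]) (a := fun t => ‖kerr u t‖ₑ)
      hf.1.enorm hb
      (B := eLpNorm (greenKernel c q) 6 (volume.restrict (diffBall D)) ^ (6 : ℝ))
      (ae_mem_domain.mono fun t ht => by
        have e := eLpNorm_shift_le (D := D) hkm.stronglyMeasurable 6 ht
        have e2 : ∫⁻ x in D, ‖greenKernel c q (x - t)‖ₑ ^ (6 : ℝ)
            = eLpNorm (fun y => greenKernel c q (t - y)) 6 vol[D] ^ (6 : ℝ) := by
          rw [eLpNorm_eq_lintegral_rpow_enorm_toReal (by norm_num) (by norm_num), ← ENNReal.rpow_mul]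
          norm_num
          refine lintegral_congr fun x => ?_
          rw [← greenKernel_neg, neg_sub]
        rw [e2]
        gcongr)
    refine lt_of_le_of_lt ?_ (hB.trans_lt ?_)
    · rw [show (6 : ℝ≥0∞).toReal = 6 by norm_num]
      refine lintegral_mono fun x => ENNReal.rpow_le_rpow ?_ (by norm_num)
      refine (enorm_integral_le_lintegral_enorm _).trans (lintegral_mono fun t => ?_)
      rw [enorm_mul, mul_comm]
    · exact ENNReal.mul_lt_top (ENNReal.rpow_lt_top_of_nonneg (by norm_num) hf.2.ne)
        (ENNReal.rpow_lt_top_of_nonneg (by norm_num) h6.2.ne)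
  refine (hconv.const_mul Z⁻¹).ae_eq (heq.mono fun x hx => ?_)
  simp only [← hx]
  rw [inv_mul_cancel_left₀ hZ]

theorem memLp_kerr_of_six {u : Plane → ℂ} (hu : MemLp u 6 vol[D]) :
    MemLp (kerr u) 2 vol[D] := by
  have h1 : MemLp u 2 vol[D] := hu.mono_exponent (by norm_num)
  have h2 : MemLp (fun x => ‖u x‖ ^ (3 : ℝ)) 2 vol[D] := by
    have := hu.norm_rpow_div 3
    have e : (6 : ℝ≥0∞) / 3 = 2 := by
      rw [show (6 : ℝ≥0∞) = 2 * 3 by norm_num]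
      exact ENNReal.mul_div_cancel_right (by norm_num) (by norm_num)
    rw [e] at this
    simpa using this
  refine (h1.norm.add h2).mono (aestronglyMeasurable_kerr hu.1) (.of_forall fun x => ?_)
  rw [norm_kerr, Pi.add_apply, Real.norm_of_nonneg (by positivity)]
  have : ‖u x‖ ^ (3 : ℝ) = ‖u x‖ ^ 3 := by norm_cast
  rw [this]
  exact le_of_eq (by ring)

theorem normSq_eq {u : Plane → ℂ} (hu : MemLp u 2 vol[D]) :
    sqrt (normSq D u) = (eLpNorm u 2 vol[D]).toReal :=
  (toReal_eLpNorm_two hu).symm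

theorem eLpNorm_le_of_pointwise {f g : Plane → ℂ} {a : ℝ} (ha : 0 ≤ a)
    (hg : MemLp g 2 vol[D]) (h : ∀ᵐ x ∂vol[D], ‖f x‖ ≤ a * ‖g x‖) :
    (eLpNorm f 2 vol[D]).toReal ≤ a * (eLpNorm g 2 vol[D]).toReal := by
  have h1 := eLpNorm_le_mul_eLpNorm_of_ae_le_mul h 2
  have h2 := ENNReal.toReal_mono (by have := hg.2.ne; finiteness) h1
  rwa [ENNReal.toReal_mul, ENNReal.toReal_ofReal ha] at h2

theorem sup_bound_of_scale {κ r₀ B a M m : ℝ} (hκ : 0 < κ) (hr₀ : 0 < r₀) (hB : 0 < B) (ha : 0 ≤ a)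
    (hm : 0 < m) (hM : 0 ≤ M) (hsmall : B * (1 + 4 / κ) * m ^ 2 ≤ 1 / 4)
    (h : ∀ r, 0 < r → r ≤ r₀ → M ≤ m / (κ * r) + B * (a * m + M * m ^ 2 + r * ((1 + M ^ 2) * m))) :
    M ≤ 2 * (1 / (κ * r₀) + B * (a + r₀)) * m := by
  rcases hM.eq_or_lt with rfl | hM
  · positivity
  set s := 4 / κ * (m / M) with hs
  have hs0 : 0 < s := by positivity
  have hmin : 0 < min r₀ s := lt_min hr₀ hs0
  have h1 := h _ hmin (min_le_left _ _)
  have e1 : m / (κ * min r₀ s) ≤ m / (κ * r₀) + M / 4 := by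
    rcases min_choice r₀ s with h2 | h2 <;> rw [h2]
    · linarith
    · have : m / (κ * s) = M / 4 := by rw [hs]; field_simp
      rw [this]
      have : 0 ≤ m / (κ * r₀) := by positivity
      linarith
  have e2 : min r₀ s * ((1 + M ^ 2) * m) ≤ r₀ * m + 4 / κ * m ^ 2 * M := by
    have a1 : min r₀ s * m ≤ r₀ * m := by gcongr; exact min_le_left _ _
    have a2 : min r₀ s * (M ^ 2 * m) ≤ s * (M ^ 2 * m) := by gcongr; exact min_le_right _ _
    have a3 : s * (M ^ 2 * m) = 4 / κ * m ^ 2 * M := by rw [hs]; field_simp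
    linarith
  have e3 := mul_le_mul_of_nonneg_left e2 hB.le
  have e4 := mul_le_mul_of_nonneg_right hsmall hM.le
  have e5 : m / (κ * r₀) = 1 / (κ * r₀) * m := by ring
  rw [e5] at e1
  linarith

/-- Solutions of small norm in the asymptotic regime are bounded by their norm. -/
theorem exists_apriori_bound (D : Set Plane) [hD : Fact (ReflectionDomain D)] {δ : ℝ} (hδ : 0 < δ) :
    ∃ C N₀ : ℝ, 0 < C ∧ 0 < N₀ ∧ ∀ (c q Z : ℂ) (u : Plane → ℂ), Admissible D δ c q Z →
      MemLp u 2 vol[D] → 0 < normSq D u → normSq D u ≤ N₀ →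
      (∀ᵐ x ∂vol[D], Z * u x = conv D (greenKernel c q) (kerr u) x) →
      ∀ᵐ x ∂vol[D], ‖u x‖ ≤ C * sqrt (normSq D u) := by
  obtain ⟨κ, r₀, hκ, hr₀, hpt⟩ := exists_pointwise_bound D
  have hosc := oscConst_pos D
  set B := oscConst D / δ with hB
  have hB0 : 0 < B := by positivity
  refine ⟨2 * (1 / (κ * r₀) + B * (sqrt (area D) + r₀)), 1 / (4 * (B * (1 + 4 / κ))),
    by positivity, by positivity, fun c q Z u h hu hpos hle heq => ?_⟩
  have hZ : Z ≠ 0 := by rintro rfl; have := h.le_norm; simp at this; linarith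
  set U : Plane → ℂ := fun x => Z⁻¹ * conv D (greenKernel c q) (kerr u) x with hU
  have hUu : u =ᵐ[vol[D]] U := heq.mono fun x hx => by
    simp only [hU, ← hx]; rw [inv_mul_cancel_left₀ hZ]
  have hkU : conv D (greenKernel c q) (kerr u) = conv D (greenKernel c q) (kerr U) :=
    conv_congr (kerr_congr hUu)
  have hf : MemLp (kerr U) 2 vol[D] :=
    (memLp_kerr_of_six (memLp_six_of_solution hδ h hu.1 heq)).ae_eq (kerr_congr hUu)
  have hUm : MemLp U 2 vol[D] := hu.ae_eq hUu
  have heqU : ∀ x ∈ D, Z * U x = conv D (greenKernel c q) (kerr U) x := fun x _ => by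
    rw [← hkU, hU, mul_inv_cancel_left₀ hZ]
  have hk := isKernel_greenKernel (D := D) c (q := q) (by simpa using h.norm_le)
  have hbdd : BddAbove ((fun x => ‖U x‖) '' D) := by
    refine ⟨‖Z⁻¹‖ * (kerNorm D (greenKernel c q) * (eLpNorm (kerr U) 2 vol[D]).toReal), ?_⟩
    rintro _ ⟨x, hx, rfl⟩
    change ‖Z⁻¹ * conv D (greenKernel c q) (kerr u) x‖ ≤ _
    rw [hkU, norm_mul]
    gcongr
    exact hk.norm_conv_le hf hx
  set M := sSup ((fun x => ‖U x‖) '' D) with hMdef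
  have hM : ∀ x ∈ D, ‖U x‖ ≤ M := fun x hx => le_csSup hbdd ⟨x, hx, rfl⟩
  obtain ⟨x₀, hx₀⟩ := hD.out.nonempty
  have hM0 : 0 ≤ M := (norm_nonneg _).trans (hM x₀ hx₀)
  have hnorm : normSq D u = normSq D U := integral_congr_ae (hUu.mono fun x hx => by simp only [hx])
  set m := sqrt (normSq D u) with hm
  have hm0 : 0 < m := Real.sqrt_pos.2 hpos
  have hmsq : m ^ 2 = normSq D u := Real.sq_sqrt hpos.le
  have hmU : (eLpNorm U 2 vol[D]).toReal = m := by rw [← normSq_eq hUm, ← hnorm]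
  have hF2 : (eLpNorm (kerr U) 2 vol[D]).toReal ≤ (1 + M ^ 2) * m := by
    rw [← hmU]
    refine eLpNorm_le_of_pointwise (by positivity) hUm (ae_mem_domain.mono fun x hx => ?_)
    rw [norm_kerr]
    have := hM x hx
    gcongr
  have hU1 : Integrable (fun x => ‖U x‖) vol[D] := (hUm.integrable (by norm_num)).norm
  have hU2 : Integrable (fun x => ‖U x‖ ^ 2) vol[D] := hUm.integrable_norm_pow (by norm_num)
  have hF1 : ∫ x in D, ‖kerr U x‖ ≤ sqrt (area D) * m + M * m ^ 2 := by
    calc _ ≤ ∫ x in D, (‖U x‖ + M * ‖U x‖ ^ 2) := by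
          refine integral_mono_ae (hf.integrable (by norm_num)).norm (hU1.add (hU2.const_mul M))
            (ae_mem_domain.mono fun x hx => ?_)
          simp only [norm_kerr]
          have := mul_le_mul_of_nonneg_right (hM x hx) (sq_nonneg ‖U x‖)
          linarith
      _ = (∫ x in D, ‖U x‖) + M * normSq D U := by
          rw [integral_add hU1 (hU2.const_mul M), integral_const_mul, normSq]
      _ ≤ _ := by
          rw [hmsq, hnorm]
          have := integral_norm_le hUm
          rw [hmU] at this
          linarith
  have key : M ≤ 2 * (1 / (κ * r₀) + B * (sqrt (area D) + r₀)) * m := by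
    refine sup_bound_of_scale hκ hr₀ hB0 (Real.sqrt_nonneg _) hm0 hM0 ?_ fun r hr hr' => ?_
    · rw [hmsq]
      have := mul_le_mul_of_nonneg_left hle (show 0 ≤ B * (1 + 4 / κ) by positivity)
      refine this.trans (le_of_eq ?_)
      field_simp
    · refine csSup_le ⟨_, x₀, hx₀, rfl⟩ ?_
      rintro _ ⟨x, hx, rfl⟩
      have := hpt c q Z (kerr U) U δ hδ h.le_norm h.norm_le h.norm_mul_le hf hUm heqU r hr hr' x hx
      rw [hmU] at this
      refine this.trans ?_
      gcongr
  filter_upwards [hUu, ae_mem_domain (D := D)] with x hx hxD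
  rw [hx]
  exact (hM x hxD).trans key

end Apriori

/-! ### The resonance system of the dimer -/

/-- The cubic nonlinearity, truncated at height `M`. -/
def truncCube (M : ℝ≥0) (z : ℂ) : ℂ := ((min ‖z‖ M) ^ 2 : ℝ) * z

theorem norm_truncCube_sub_le (M : ℝ≥0) {z w : ℂ} (h : ‖w‖ ≤ ‖z‖) :
    ‖truncCube M z - truncCube M w‖ ≤ 3 * M ^ 2 * ‖z - w‖ := by
  have hM := M.2
  have ha0 : 0 ≤ min ‖z‖ (M : ℝ) := le_min (norm_nonneg _) hM
  have hb0 : 0 ≤ min ‖w‖ (M : ℝ) := le_min (norm_nonneg _) hM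
  have ha : min ‖z‖ (M : ℝ) ≤ M := min_le_right _ _
  have hba : min ‖w‖ (M : ℝ) ≤ min ‖z‖ M := min_le_min_right _ h
  have key : (min ‖z‖ (M : ℝ) - min ‖w‖ M) * ‖w‖ ≤ M * ‖z - w‖ := by
    rcases le_total ‖w‖ M with h1 | h1
    · have h2 : min ‖z‖ (M : ℝ) - min ‖w‖ M ≤ ‖z - w‖ := by
        rw [min_eq_left h1]
        have := norm_le_norm_add_norm_sub' z w
        linarith [min_le_left ‖z‖ (M : ℝ)]
      calc _ ≤ ‖z - w‖ * M := by gcongr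
        _ = _ := mul_comm _ _
    · rw [min_eq_right h1, min_eq_right (h1.trans h), sub_self, zero_mul]
      positivity
  have e : truncCube M z - truncCube M w = ((min ‖z‖ M ^ 2 : ℝ) : ℂ) * (z - w)
      + (((min ‖z‖ M) ^ 2 - (min ‖w‖ M) ^ 2 : ℝ) : ℂ) * w := by
    simp only [truncCube]; push_cast; ring
  rw [e]
  refine (norm_add_le _ _).trans ?_
  rw [norm_mul, norm_mul, Complex.norm_of_nonneg (by positivity), Complex.norm_of_nonneg (by nlinarith)]
  have h1 : min ‖z‖ (M : ℝ) ^ 2 * ‖z - w‖ ≤ M ^ 2 * ‖z - w‖ := by gcongr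
  have h2 : (min ‖z‖ (M : ℝ) ^ 2 - min ‖w‖ M ^ 2) * ‖w‖ ≤ (2 * M) * (M * ‖z - w‖) := by
    calc _ = (min ‖z‖ (M : ℝ) + min ‖w‖ M) * ((min ‖z‖ (M : ℝ) - min ‖w‖ M) * ‖w‖) := by ring
      _ ≤ (2 * M) * (M * ‖z - w‖) := by
        apply mul_le_mul (by linarith) key (mul_nonneg (by linarith) (norm_nonneg _)) (by positivity)
  linarith

theorem lipschitzWith_truncCube (M : ℝ≥0) : LipschitzWith (3 * M ^ 2) (truncCube M) := by
  refine LipschitzWith.of_dist_le_mul fun z w => ?_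
  rw [dist_eq_norm, dist_eq_norm]
  push_cast
  rcases le_total ‖w‖ ‖z‖ with h | h
  · exact norm_truncCube_sub_le M h
  · rw [norm_sub_rev, norm_sub_rev z]; exact norm_truncCube_sub_le M h

theorem truncCube_zero (M : ℝ≥0) : truncCube M 0 = 0 := by simp [truncCube]

theorem truncCube_of_le {M : ℝ≥0} {z : ℂ} (h : ‖z‖ ≤ M) : truncCube M z = ((‖z‖ ^ 2 : ℝ) : ℂ) * z := by
  rw [truncCube, min_eq_left h]

theorem norm_truncCube_le (M : ℝ≥0) (z : ℂ) : ‖truncCube M z‖ ≤ M ^ 2 * ‖z‖ := by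
  have hM := M.2
  rw [truncCube, norm_mul, Complex.norm_of_nonneg (by positivity)]
  have h0 : 0 ≤ min ‖z‖ (M : ℝ) := le_min (norm_nonneg _) hM
  gcongr
  exact min_le_right _ _

section System

variable {D : Set Plane} [hD : Fact (ReflectionDomain D)]

/-- The truncated nonlinearity on `L²(D)`. -/
def cubeMap (D : Set Plane) (M : ℝ≥0) (u : L2 D) : L2 D :=
  (lipschitzWith_truncCube M).compLp (truncCube_zero M) u

theorem coeFn_cubeMap (M : ℝ≥0) (u : L2 D) :
    cubeMap D M u =ᵐ[vol[D]] fun x => truncCube M (u x) :=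
  (lipschitzWith_truncCube M).coeFn_compLp (truncCube_zero M) u

theorem norm_cubeMap_sub_le (M : ℝ≥0) (u v : L2 D) :
    ‖cubeMap D M u - cubeMap D M v‖ ≤ 3 * M ^ 2 * ‖u - v‖ := by
  have h := (lipschitzWith_truncCube M).norm_compLp_sub_le (truncCube_zero M) u v
  push_cast at h
  exact h

theorem cubeMap_zero (M : ℝ≥0) : cubeMap D M 0 = 0 := by
  refine Lp.ext ?_
  filter_upwards [coeFn_cubeMap M (0 : L2 D), Lp.coeFn_zero ℂ 2 vol[D]] with x h1 h2
  rw [h1, h2]; exact truncCube_zero M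

theorem norm_cubeMap_le (M : ℝ≥0) (u : L2 D) : ‖cubeMap D M u‖ ≤ M ^ 2 * ‖u‖ := by
  refine Lp.norm_le_mul_norm_of_ae_le_mul ?_
  filter_upwards [coeFn_cubeMap M u] with x h1
  rw [h1]; exact norm_truncCube_le M _

theorem cubeMap_reflectL2 (M : ℝ≥0) (u : L2 D) :
    cubeMap D M (reflectL2 D u) = reflectL2 D (cubeMap D M u) := by
  refine Lp.ext ?_
  filter_upwards [coeFn_cubeMap M (reflectL2 D u), coeFn_reflectL2 u, coeFn_reflectL2 (cubeMap D M u),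
    ae_reflect (coeFn_cubeMap M u)] with x h1 h2 h3 h4
  rw [h1, h2, h3, h4]

theorem cubeMap_neg (M : ℝ≥0) (u : L2 D) : cubeMap D M (-u) = -cubeMap D M u := by
  refine Lp.ext ?_
  filter_upwards [coeFn_cubeMap M (-u), Lp.coeFn_neg u, Lp.coeFn_neg (cubeMap D M u),
    coeFn_cubeMap M u] with x h1 h2 h3 h4
  rw [h1, h2, h3, Pi.neg_apply, Pi.neg_apply, h4]
  simp [truncCube]

variable {φ : L2 D} {lam : ℝ}

theorem norm_correction_sub_le {a b : ℂ} (ha : a ∈ 𝔻)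
    (hb : b ∈ 𝔻) :
    ‖(area D : ℂ)⁻¹ • kop D (jKernel a) - (area D : ℂ)⁻¹ • kop D (jKernel b)‖
        ≤ ((area D)⁻¹ + 1) * opConst D * ‖a - b‖ ∧
      ‖kop D (yKernel a) - kop D (yKernel b)‖ ≤ ((area D)⁻¹ + 1) * opConst D * ‖a - b‖ := by
  have hA := inv_nonneg.2 (area_pos (D := D)).le
  have h1 := mul_le_mul_of_nonneg_left (norm_kop_jKernel_sub_le (D := D) ha hb) hA
  have h2 := norm_kop_yKernel_sub_le (D := D) ha hb
  have h3 : 0 ≤ opConst D * ‖a - b‖ := mul_nonneg (opConst_nonneg D) (norm_nonneg _)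
  have h4 := mul_nonneg hA h3
  have h5 : ‖(area D : ℂ)⁻¹‖ = (area D)⁻¹ := by
    rw [norm_inv, Complex.norm_of_nonneg (area_pos (D := D)).le]
  rw [← smul_sub, norm_smul, h5]
  constructor <;> linarith

/-- The resonance system of the dimer, with truncated nonlinearity. -/
def dimerSystem (h : SimpleMode (constMode D) φ (logOp D) lam) (M : ℝ≥0) : ResonanceSystem (L2 D) where
  e := constMode D
  φ := φ
  K := logOp D
  S := h.exists_reducedResolvent.choose
  lam := lam
  κ := area D / (4 * Real.pi)
  c₀ := area D * (Complex.I / 4 + (log 2 - Real.eulerMascheroniConstant) / (2 * Real.pi))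
  J q := (area D : ℂ)⁻¹ • kop D (jKernel q)
  Y q := kop D (yKernel q)
  g := cubeMap D M
  B := ((area D)⁻¹ + 1) * opConst D
  G := 3 * M ^ 2
  norm_e := h.norm_e
  norm_φ := h.norm_φ
  inner_e_φ := h.inner_e_φ
  lam_pos := h.lam_pos
  κ_pos := div_pos area_pos (by positivity)
  K_φ := h.eigen
  inner_φ_K := h.inner_φ_K
  inner_e_S := h.exists_reducedResolvent.choose_spec.1
  inner_φ_S := h.exists_reducedResolvent.choose_spec.2.1
  resolvent_S := h.exists_reducedResolvent.choose_spec.2.2.1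
  S_resolvent := h.exists_reducedResolvent.choose_spec.2.2.2.1
  S_e := h.exists_reducedResolvent.choose_spec.2.2.2.2.1
  S_φ := h.exists_reducedResolvent.choose_spec.2.2.2.2.2
  B_nonneg := mul_nonneg (add_nonneg (inv_nonneg.2 area_pos.le) zero_le_one) (opConst_nonneg D)
  J_zero := (congrArg _ (kop_eq_zero jKernel_zero)).trans (smul_zero _)
  Y_zero := kop_eq_zero yKernel_zero
  J_lip _ ha _ hb := (norm_correction_sub_le ha hb).1
  Y_lip _ ha _ hb := (norm_correction_sub_le ha hb).2
  G_nonneg := mul_nonneg zero_le_three (sq_nonneg _)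
  g_zero := cubeMap_zero M
  g_lip := norm_cubeMap_sub_le M

/-- The frequency with `(τ ω²)⁻¹ = Z`. -/
def freq (τ : ℝ) (Z : ℂ) : ℂ := Complex.exp (-(log τ + Complex.log Z) / 2)

theorem freq_ne_zero (τ : ℝ) (Z : ℂ) : freq τ Z ≠ 0 := Complex.exp_ne_zero _

theorem freq_sq {τ : ℝ} (hτ : 0 < τ) {Z : ℂ} (hZ : Z ≠ 0) : freq τ Z ^ 2 = (τ * Z)⁻¹ := by
  have hτ' : (τ : ℂ) ≠ 0 := by exact_mod_cast hτ.ne'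
  rw [freq, ← Complex.exp_nat_mul, show ((2 : ℕ) : ℂ) * (-(log τ + Complex.log Z) / 2)
    = -(log τ + Complex.log Z) by push_cast; ring, Complex.exp_neg, Complex.exp_add,
    Complex.exp_log hZ, Complex.ofReal_log hτ.le, Complex.exp_log hτ']

theorem mul_freq_sq {τ : ℝ} (hτ : 0 < τ) {Z : ℂ} (hZ : Z ≠ 0) : τ * freq τ Z ^ 2 = Z⁻¹ := by
  have hτ' : (τ : ℂ) ≠ 0 := by exact_mod_cast hτ.ne'
  rw [freq_sq hτ hZ, mul_inv, mul_inv_cancel_left₀ hτ']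

theorem freq_im (τ : ℝ) (Z : ℂ) : (-(log τ + Complex.log Z) / 2).im = -(Z.arg / 2) := by
  have : (-(log τ + Complex.log Z) / 2 : ℂ) = ((-1 / 2 : ℝ) : ℂ) * ((log τ : ℝ) + Complex.log Z) := by
    push_cast; ring
  rw [this, Complex.im_ofReal_mul, Complex.add_im, Complex.ofReal_im, Complex.log_im]
  ring

theorem log_freq (τ : ℝ) (Z : ℂ) : Complex.log (freq τ Z) = -(log τ + Complex.log Z) / 2 := by
  have h1 := Complex.neg_pi_lt_arg Z
  have h2 := Complex.arg_le_pi Z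
  have := Real.pi_pos
  exact Complex.log_exp (by rw [freq_im]; linarith) (by rw [freq_im]; linarith)

theorem freq_re_pos (τ : ℝ) {Z : ℂ} (hZ : 0 < Z.re) : 0 < (freq τ Z).re := by
  have h := abs_lt.1 (Complex.abs_arg_lt_pi_div_two_iff.2 (Or.inl hZ))
  rw [freq, Complex.exp_re, freq_im]
  refine mul_pos (Real.exp_pos _) (Real.cos_pos_of_mem_Ioo ⟨?_, ?_⟩) <;> linarith [Real.pi_pos]

theorem eq_freq {τ : ℝ} (hτ : 0 < τ) {ω Z : ℂ} (hω : 0 ≤ ω.re) (hZ : 0 < Z.re)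
    (h : (τ * ω ^ 2)⁻¹ = Z) : ω = freq τ Z := by
  have hZ0 : Z ≠ 0 := by rintro rfl; simp at hZ
  have hτ' : (τ : ℂ) ≠ 0 := by exact_mod_cast hτ.ne'
  have h1 : ω ^ 2 = freq τ Z ^ 2 := by
    refine mul_left_cancel₀ hτ' ?_
    rw [mul_freq_sq hτ hZ0, ← h, inv_inv]
  rcases sq_eq_sq_iff_eq_or_eq_neg.1 h1 with h2 | h2
  · exact h2
  · have := freq_re_pos τ hZ
    rw [h2, Complex.neg_re] at hω
    linarith

theorem area_mul_greenCoeff_freq (h : SimpleMode (constMode D) φ (logOp D) lam) (M : ℝ≥0) (τ : ℝ)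
    (Z : ℂ) : greenCoeff (freq τ Z) * area D = (dimerSystem h M).coeff τ Z := by
  have hpi : (Real.pi : ℂ) ≠ 0 := by exact_mod_cast Real.pi_ne_zero
  rw [greenCoeff, log_freq]
  simp only [ResonanceSystem.coeff, dimerSystem]
  push_cast
  field_simp
  ring

theorem exists_admissible (D : Set Plane) (C : ℝ) : ∃ T : ℝ, 0 < T ∧ ∀ (δ s : ℝ) (c q Z : ℂ), T ≤ s →
    δ ≤ ‖Z‖ → ‖q‖ = s⁻¹ → ‖c - (1 / (4 * Real.pi) * log s : ℝ)‖ ≤ C → Admissible D δ c q Z := by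
  have t1 : ∀ᶠ s : ℝ in atTop, 1 + 2 * kernelConst D + log (Metric.diam D + 1) + C
      ≤ 1 / (4 * Real.pi) * log s :=
    (Real.tendsto_log_atTop.const_mul_atTop (by positivity)).eventually_ge_atTop _
  have t2 : Tendsto (fun s : ℝ => (1 / (4 * Real.pi) * log s + C) * s⁻¹) atTop (𝓝 0) := by
    have h1 := (Real.isLittleO_log_id_atTop.tendsto_div_nhds_zero).const_mul (1 / (4 * Real.pi))
    have h2 := tendsto_inv_atTop_zero.const_mul C (α := ℝ)
    have := h1.add h2
    simp only [mul_zero, add_zero] at this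
    refine this.congr fun s => ?_
    simp only [id]; ring
  obtain ⟨T, hT⟩ := ((t1.and (t2.eventually_le_const one_pos)).and
    (eventually_ge_atTop (1 : ℝ))).exists_forall_of_atTop
  refine ⟨max T 1, by positivity, fun δ s c q Z hs hZ hq hc => ?_⟩
  obtain ⟨⟨h1, h2⟩, h3⟩ := hT s ((le_max_left _ _).trans hs)
  have hl := Real.log_nonneg h3
  refine ⟨hZ, ?_, ?_, ?_⟩
  · rw [hq]; exact inv_le_one_of_one_le₀ h3
  · have h4 : ‖c‖ ≤ 1 / (4 * Real.pi) * log s + C := by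
      have := norm_le_norm_add_norm_sub' c ((1 / (4 * Real.pi) * log s : ℝ) : ℂ)
      rw [Complex.norm_of_nonneg (by positivity)] at this
      linarith
    rw [hq]
    exact (mul_le_mul_of_nonneg_right h4 (by positivity)).trans h2
  · have := (abs_le.1 ((Complex.abs_re_le_norm _).trans hc)).1
    rw [Complex.sub_re, Complex.ofReal_re] at this
    linarith

/-- A bound for the bounded part of the coefficient of the Green's function. -/
def coeffBound : ℝ := 1 + |log 2| + |Real.eulerMascheroniConstant|

theorem norm_greenCoeff_sub_le {τ : ℝ} (hτ : 0 < τ) {ω Z : ℂ} (h : (τ * ω ^ 2)⁻¹ = Z) :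
    ‖greenCoeff ω - (1 / (4 * Real.pi) * log (τ * ‖Z‖) : ℝ)‖ ≤ coeffBound := by
  have hpi : (Real.pi : ℂ) ≠ 0 := by exact_mod_cast Real.pi_ne_zero
  have hp := Real.pi_gt_three
  have h1 : τ * ‖Z‖ = (‖ω‖ ^ 2)⁻¹ := by
    rw [← h, norm_inv, norm_mul, norm_pow, Complex.norm_of_nonneg hτ.le, mul_inv,
      mul_inv_cancel_left₀ hτ.ne']
  have h2 : greenCoeff ω - (1 / (4 * Real.pi) * log (τ * ‖Z‖) : ℝ) = Complex.I / 4
      - Complex.arg ω * Complex.I / (2 * Real.pi)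
      + (log 2 - Real.eulerMascheroniConstant) / (2 * Real.pi) := by
    have h3 : Complex.log ω = log ‖ω‖ + Complex.arg ω * Complex.I := rfl
    rw [h1, Real.log_inv, Real.log_pow, greenCoeff, h3]
    push_cast
    field_simp
    ring
  rw [h2]
  have e1 : ‖Complex.I / 4‖ ≤ 1 / 4 := by simp
  have e0 : ‖(2 * Real.pi : ℂ)‖ = 2 * Real.pi := by simp [abs_of_pos Real.pi_pos]
  have e2 : ‖(Complex.arg ω : ℂ) * Complex.I / (2 * Real.pi)‖ ≤ 1 / 2 := by
    rw [norm_div, norm_mul, Complex.norm_I, mul_one, e0, Complex.norm_real, div_le_iff₀ (by positivity)]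
    have := Complex.abs_arg_le_pi ω
    rw [Real.norm_eq_abs]; linarith
  have e3 : ‖((log 2 : ℂ) - Real.eulerMascheroniConstant) / (2 * Real.pi)‖
      ≤ |log 2| + |Real.eulerMascheroniConstant| := by
    rw [norm_div, e0]
    refine (div_le_self (norm_nonneg _) (by linarith)).trans ((norm_sub_le _ _).trans (le_of_eq ?_))
    rw [Complex.norm_real, Complex.norm_real, Real.norm_eq_abs, Real.norm_eq_abs]
  refine (norm_add_le _ _).trans ?_
  have := norm_sub_le (Complex.I / 4) ((Complex.arg ω : ℂ) * Complex.I / (2 * Real.pi))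
  unfold coeffBound
  linarith

theorem coeff_split {H : Type*} [NormedAddCommGroup H] [InnerProductSpace ℂ H] {c A : ℂ} (hA : A ≠ 0)
    (e : H) (K J Y : H →L[ℂ] H) (u n : H) :
    (c * A * ⟪e, u + n⟫) • e + K u + (K n + ((c * A) • (A⁻¹ • J) + Y) (u + n))
      = (c * A * ⟪e, u + n⟫) • e + K (u + n) + (c • J (u + n) + Y (u + n)) := by
  rw [smul_smul, mul_inv_cancel_right₀ hA, add_apply, smul_apply, map_add K]
  abel

theorem kop_greenKernel_add {c q : ℂ} (hq : q ∈ 𝔻) (u n : L2 D) :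
    kop D (greenKernel c q) (u + n) = (c * area D * ⟪constMode D, u + n⟫) • constMode D + logOp D u
      + (logOp D n + ((c * area D) • ((area D : ℂ)⁻¹ • kop D (jKernel q)) + kop D (yKernel q)) (u + n)) :=
  (kop_greenKernel c hq (u + n)).trans (coeff_split
    (by exact_mod_cast (area_pos (D := D)).ne') (constMode D) (logOp D) _ _ u n).symm

theorem solves_iff (h : SimpleMode (constMode D) φ (logOp D) lam) (M : ℝ≥0) {τ N : ℝ} {Z : ℂ}
    {u : L2 D} (hq : (τ * Z)⁻¹ ∈ 𝔻) :
    (dimerSystem h M).Solves τ N Z u ↔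
      Z • u = kop D (greenKernel (greenCoeff (freq τ Z)) ((τ * Z)⁻¹))
        (u + (dimerSystem h M).nonlin N u) := by
  rw [kop_greenKernel_add hq, area_mul_greenCoeff_freq h M]
  rfl

end System

/-! ### From the resonance system to solutions -/

section Branches

variable {D : Set Plane} [hD : Fact (ReflectionDomain D)] {φ : L2 D} {lam : ℝ}
  (h : SimpleMode (constMode D) φ (logOp D) lam) (M : ℝ≥0)

/-- The multiple of `U` of squared norm `N`. -/
def state (N : ℝ) (U : L2 D) : L2 D := ((sqrt N / ‖U‖ : ℝ) : ℂ) • U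

theorem norm_state {N : ℝ} {U : L2 D} (hU : U ≠ 0) : ‖state N U‖ = sqrt N := by
  rw [state, norm_smul, Complex.norm_of_nonneg (by positivity),
    div_mul_cancel₀ _ (norm_ne_zero_iff.2 hU)]

theorem normSq_coe (f : L2 D) : normSq D f = ‖f‖ ^ 2 := by
  rw [Lp.norm_def, ← normSq_eq (Lp.memLp f), Real.sq_sqrt (show 0 ≤ normSq D f from integral_nonneg fun _ => by positivity)]

theorem nonlin_eq (N : ℝ) (U : L2 D) :
    (dimerSystem h M).nonlin N U = ((N / ‖U‖ ^ 2 : ℝ) : ℂ) • cubeMap D M U := by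
  rw [ResonanceSystem.nonlin, div_eq_mul_inv]
  push_cast
  rfl

theorem norm_nonlin_le {N : ℝ} (hN : 0 ≤ N) {U : L2 D} (hU : U ≠ 0) :
    ‖(dimerSystem h M).nonlin N U‖ ≤ N * M ^ 2 / ‖U‖ := by
  have hU' := norm_pos_iff.2 hU
  rw [nonlin_eq, norm_smul, Complex.norm_of_nonneg (by positivity)]
  refine (mul_le_mul_of_nonneg_left (norm_cubeMap_le M U) (by positivity)).trans (le_of_eq ?_)
  field_simp

theorem kerr_state {N : ℝ} (hN : 0 ≤ N) {U : L2 D} (hb : ∀ᵐ x ∂vol[D], ‖U x‖ ≤ M) :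
    kerr (state N U) =ᵐ[vol[D]]
      (((sqrt N / ‖U‖ : ℝ) : ℂ) • (U + (dimerSystem h M).nonlin N U) : L2 D) := by
  rw [nonlin_eq]
  filter_upwards [hb, Lp.coeFn_smul ((sqrt N / ‖U‖ : ℝ) : ℂ) U,
    Lp.coeFn_smul ((sqrt N / ‖U‖ : ℝ) : ℂ) (U + ((N / ‖U‖ ^ 2 : ℝ) : ℂ) • cubeMap D M U),
    Lp.coeFn_add U (((N / ‖U‖ ^ 2 : ℝ) : ℂ) • cubeMap D M U),
    Lp.coeFn_smul ((N / ‖U‖ ^ 2 : ℝ) : ℂ) (cubeMap D M U), coeFn_cubeMap M U] with x h0 h1 h2 h3 h4 h5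
  have e1 : state N U x = ((sqrt N / ‖U‖ : ℝ) : ℂ) * U x := h1
  rw [h2, Pi.smul_apply, h3, Pi.add_apply, h4, Pi.smul_apply, h5, truncCube_of_le h0, kerr, e1,
    norm_mul, Complex.norm_of_nonneg (by positivity), mul_pow, div_pow, Real.sq_sqrt hN]
  simp only [smul_eq_mul]
  push_cast
  ring

/-- The density of a state. -/
def density (N : ℝ) (Z : ℂ) (U : L2 D) : L2 D :=
  Z⁻¹ • (((sqrt N / ‖U‖ : ℝ) : ℂ) • (U + (dimerSystem h M).nonlin N U))

variable {τ N : ℝ} {Z : ℂ} {U : L2 D}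

theorem ResonanceSystem.Solves.eq_kop (hs : (dimerSystem h M).Solves τ N Z U) (hZ : Z ≠ 0)
    (hq : (τ * Z)⁻¹ ∈ 𝔻) :
    U = kop D (greenKernel (greenCoeff (freq τ Z)) ((τ * Z)⁻¹))
      (Z⁻¹ • (U + (dimerSystem h M).nonlin N U)) := by
  rw [map_smul, ← (solves_iff h M hq).1 hs, inv_smul_smul₀ hZ]

theorem ResonanceSystem.Solves.state_eq (hs : (dimerSystem h M).Solves τ N Z U) (hZ : Z ≠ 0)
    (hq : (τ * Z)⁻¹ ∈ 𝔻) :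
    state N U =ᵐ[vol[D]]
      conv D (greenKernel (greenCoeff (freq τ Z)) ((τ * Z)⁻¹)) (density h M N Z U) := by
  have e : state N U
      = kop D (greenKernel (greenCoeff (freq τ Z)) ((τ * Z)⁻¹)) (density h M N Z U) := by
    rw [density, smul_comm, map_smul, ← hs.eq_kop h M hZ hq, state]
  rw [e]
  exact (isKernel_greenKernel _ hq).coeFn_kop _

theorem volumePotential_freq (hτ : 0 < τ) (hZ : Z ≠ 0) (f : Plane → ℂ) (x : Plane) :
    τ * freq τ Z ^ 2 * volumePotential D (freq τ Z) f x
      = Z⁻¹ * conv D (greenKernel (greenCoeff (freq τ Z)) ((τ * Z)⁻¹)) f x := by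
  rw [mul_freq_sq hτ hZ, ← freq_sq hτ hZ, ← conv_green (freq_ne_zero τ Z)]
  rfl

theorem conv_smul (k : Plane → ℂ) (c : ℂ) (f : L2 D) (x : Plane) :
    conv D k (c • f : L2 D) x = c * conv D k f x := by
  rw [conv_congr (Lp.coeFn_smul c f), ← conv_const_mul]
  rfl

theorem ResonanceSystem.Solves.isSolution (hs : (dimerSystem h M).Solves τ N Z U) (hτ : 0 < τ)
    (hN : 0 ≤ N) (hZ : Z ≠ 0) (hq : (τ * Z)⁻¹ ∈ 𝔻)
    (hb : ∀ᵐ x ∂vol[D], ‖U x‖ ≤ M) : IsSolution D τ (freq τ Z) (state N U) := by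
  have e := hs.state_eq h M hZ hq
  refine ⟨(memH2_potential _ hq (Lp.memLp _)).congr e.symm, e.trans (.of_forall fun x => ?_)⟩
  simp only [volumePotential_freq hτ hZ]
  rw [density, conv_smul, conv_congr (kerr_state h M hN hb)]

theorem ResonanceSystem.Solves.isLinearResonance (hs : (dimerSystem h M).Solves τ 0 Z U) (hτ : 0 < τ)
    (hZ : Z ≠ 0) (hq : (τ * Z)⁻¹ ∈ 𝔻) (hU : U ≠ 0) :
    IsLinearResonance D τ (freq τ Z) := by
  have h0 : (dimerSystem h M).nonlin 0 U = 0 := by rw [nonlin_eq]; simp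
  have e1 := hs.eq_kop h M hZ hq
  rw [h0, add_zero] at e1
  have e : U =ᵐ[vol[D]]
      conv D (greenKernel (greenCoeff (freq τ Z)) ((τ * Z)⁻¹)) (Z⁻¹ • U : L2 D) := by
    nth_rewrite 1 [e1]
    exact (isKernel_greenKernel _ hq).coeFn_kop _
  refine ⟨U, (memH2_potential _ hq (Lp.memLp _)).congr e.symm,
    fun h' => hU (Lp.ext (h'.trans (Lp.coeFn_zero ℂ 2 _).symm)), e.trans (.of_forall fun x => ?_)⟩
  simp only [volumePotential_freq hτ hZ]
  rw [conv_smul]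

/-- Solutions of the truncated problem are bounded. -/
theorem exists_trunc_bound (D : Set Plane) [hD : Fact (ReflectionDomain D)] {δ : ℝ} (hδ : 0 < δ) :
    ∃ M₀ : ℝ, ∀ {φ : L2 D} {lam : ℝ} (h : SimpleMode (constMode D) φ (logOp D) lam) (M : ℝ≥0)
      {τ N : ℝ} {Z : ℂ} {U : L2 D}, 0 ≤ N → 4 * N * M ^ 2 ≤ 1 →
      Admissible D δ (greenCoeff (freq τ Z)) ((τ * Z)⁻¹) Z → 1 / 2 ≤ ‖U‖ → ‖U‖ ≤ 2 →
      (dimerSystem h M).Solves τ N Z U → ∀ᵐ x ∂vol[D], ‖U x‖ ≤ M₀ := by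
  obtain ⟨κ, r₀, hκ, hr₀, hpt⟩ := exists_pointwise_bound D
  have hosc := oscConst_pos D
  refine ⟨2 / (κ * r₀) + oscConst D / δ * (sqrt (area D) * 3 + r₀ * 3),
    fun {φ lam} h M {τ N Z U} hN hNM ha hU1 hU2 hs => ?_⟩
  have hZ : Z ≠ 0 := by rintro rfl; have := ha.le_norm; simp at this; linarith
  have hq : (τ * Z)⁻¹ ∈ 𝔻 := by simpa using ha.norm_le
  have hU0 : U ≠ 0 := norm_pos_iff.1 (by linarith)
  set f := U + (dimerSystem h M).nonlin N U with hf
  have hfn : ‖f‖ ≤ 3 := by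
    have h1 := norm_nonlin_le h M hN hU0
    have h2 : N * M ^ 2 / ‖U‖ ≤ 1 := by
      rw [div_le_one (by linarith)]; linarith
    have := norm_add_le U ((dimerSystem h M).nonlin N U)
    linarith
  have hk := isKernel_greenKernel (D := D) (greenCoeff (freq τ Z)) hq
  have e := hs.eq_kop h M hZ hq
  rw [map_smul, ← hf] at e
  set V : Plane → ℂ := fun x => Z⁻¹ * conv D (greenKernel (greenCoeff (freq τ Z)) ((τ * Z)⁻¹)) f x with hV
  have hUV : U =ᵐ[vol[D]] V := by
    filter_upwards [Lp.coeFn_smul Z⁻¹ (kop D (greenKernel (greenCoeff (freq τ Z)) ((τ * Z)⁻¹)) f),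
      hk.coeFn_kop f] with x h1 h2
    rw [← e] at h1
    rw [h1, Pi.smul_apply, h2, smul_eq_mul]
  have hVm : MemLp V 2 vol[D] := (Lp.memLp U).ae_eq hUV
  have hVn : (eLpNorm V 2 vol[D]).toReal = ‖U‖ := by
    rw [← eLpNorm_congr_ae hUV, Lp.norm_def]
  have h3 := integral_norm_le (Lp.memLp f)
  rw [← Lp.norm_def] at h3
  filter_upwards [hUV, ae_mem_domain (D := D)] with x hx hxD
  have h4 := hpt _ _ Z f V δ hδ ha.le_norm ha.norm_le ha.norm_mul_le (Lp.memLp f) hVm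
    (fun x _ => by rw [hV, mul_inv_cancel_left₀ hZ]) r₀ hr₀ le_rfl x hxD
  rw [hVn, ← Lp.norm_def] at h4
  rw [hx]
  refine h4.trans ?_
  have h5 : ∫ t in D, ‖f t‖ ≤ sqrt (area D) * 3 := h3.trans (by gcongr)
  gcongr

theorem continuousAt_freq (τ : ℝ) (hZ : 0 < Z.re) : ContinuousAt (freq τ) Z := by
  have : ContinuousAt Complex.log Z := continuousAt_clog (Or.inl hZ)
  unfold freq
  fun_prop

theorem continuousAt_greenCoeff {ω : ℂ} (hω : 0 < ω.re) : ContinuousAt greenCoeff ω := by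
  have : ContinuousAt Complex.log ω := continuousAt_clog (Or.inl hω)
  unfold greenCoeff
  fun_prop

theorem continuous_cubeMap (M : ℝ≥0) : Continuous (cubeMap D M) :=
  (LipschitzWith.of_dist_le_mul (K := 3 * M ^ 2) fun u v => by
    rw [dist_eq_norm, dist_eq_norm]; push_cast; exact norm_cubeMap_sub_le M u v).continuous

theorem continuousOn_density {S : Set ℝ} {Zf : ℝ → ℂ} {Uf : ℝ → L2 D}
    (hZc : ContinuousOn Zf S) (hUc : ContinuousOn Uf S) (hZ : ∀ N ∈ S, Zf N ≠ 0)
    (hU : ∀ N ∈ S, Uf N ≠ 0) : ContinuousOn (fun N => density h M N (Zf N) (Uf N)) S := by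
  have hn : ContinuousOn (fun N => ‖Uf N‖) S := hUc.norm
  have hn0 : ∀ N ∈ S, ‖Uf N‖ ≠ 0 := fun N hN => norm_ne_zero_iff.2 (hU N hN)
  have hsq : ContinuousOn (fun N : ℝ => sqrt N / ‖Uf N‖) S :=
    Real.continuous_sqrt.continuousOn.div hn hn0
  have hN2 : ContinuousOn (fun N : ℝ => N / ‖Uf N‖ ^ 2) S :=
    continuousOn_id.div (hn.pow 2) fun N hN => pow_ne_zero 2 (hn0 N hN)
  simp only [density, nonlin_eq]
  exact (hZc.inv₀ hZ).smul ((Complex.continuous_ofReal.comp_continuousOn hsq).smul (hUc.add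
    ((Complex.continuous_ofReal.comp_continuousOn hN2).smul
      ((continuous_cubeMap M).comp_continuousOn hUc))))

theorem continuousOn_freq (τ : ℝ) {S : Set ℝ} {Zf : ℝ → ℂ} (hZc : ContinuousOn Zf S)
    (hre : ∀ N ∈ S, 0 < (Zf N).re) : ContinuousOn (fun N => freq τ (Zf N)) S :=
  fun N hN => (continuousAt_freq τ (hre N hN)).comp_continuousWithinAt (hZc N hN)

theorem tendsto_h2Norm_state (hτ : 0 < τ) {S : Set ℝ} {Zf : ℝ → ℂ} {Uf : ℝ → L2 D}
    (hZc : ContinuousOn Zf S) (hUc : ContinuousOn Uf S)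
    (hs : ∀ N ∈ S, (dimerSystem h M).Solves τ N (Zf N) (Uf N))
    (hre : ∀ N ∈ S, 0 < (Zf N).re) (hZ : ∀ N ∈ S, Zf N ≠ 0) (hq : ∀ N ∈ S, ‖(τ * Zf N)⁻¹‖ < 1)
    (hU : ∀ N ∈ S, Uf N ≠ 0) {N : ℝ} (hN : N ∈ S) :
    Tendsto (fun N' => h2Norm D fun x => state N' (Uf N') x - state N (Uf N) x) (𝓝[S] N) (𝓝 0) := by
  have hq' : ∀ N ∈ S, (τ * Zf N)⁻¹ ∈ 𝔻 := fun N hN => by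
    simpa using (hq N hN).le
  have h1 : Tendsto (fun N' => greenCoeff (freq τ (Zf N'))) (𝓝[S] N) (𝓝 (greenCoeff (freq τ (Zf N)))) :=
    (continuousAt_greenCoeff (freq_re_pos τ (hre N hN))).tendsto.comp (continuousOn_freq τ hZc hre N hN)
  have h2 : Tendsto (fun N' => (τ * Zf N')⁻¹) (𝓝[S] N) (𝓝 ((τ * Zf N)⁻¹)) :=
    ((hZc N hN).tendsto.const_mul (τ : ℂ)).inv₀ (mul_ne_zero (by exact_mod_cast hτ.ne') (hZ N hN))
  have h3 : Tendsto (fun N' => density h M N' (Zf N') (Uf N')) (𝓝[S] N) (𝓝 (density h M N (Zf N) (Uf N))) :=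
    continuousOn_density h M hZc hUc hZ hU N hN
  have h4 : ∀ᶠ N' in 𝓝[S] N, state N' (Uf N') =ᵐ[vol[D]]
      conv D (greenKernel (greenCoeff (freq τ (Zf N'))) ((τ * Zf N')⁻¹)) (density h M N' (Zf N') (Uf N')) :=
    eventually_mem_nhdsWithin.mono fun N' hN' => (hs N' hN').state_eq h M (hZ N' hN') (hq' N' hN')
  exact tendsto_h2Norm_potential h1 h2 (hq N hN) h3 h4 ((hs N hN).state_eq h M (hZ N hN) (hq' N hN))

/-- A continuous family of fixed points gives a branch of solutions. -/
theorem isBranch_of_solves (hτ : 0 < τ) {N₁ : ℝ} (hN₁ : 0 < N₁) {Zf : ℝ → ℂ} {Uf : ℝ → L2 D}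
    (hZc : ContinuousOn Zf (Icc 0 N₁)) (hUc : ContinuousOn Uf (Icc 0 N₁))
    (hs : ∀ N ∈ Icc 0 N₁, (dimerSystem h M).Solves τ N (Zf N) (Uf N))
    (hre : ∀ N ∈ Icc 0 N₁, 0 < (Zf N).re) (hq : ∀ N ∈ Icc 0 N₁, ‖(τ * Zf N)⁻¹‖ < 1)
    (hU : ∀ N ∈ Icc 0 N₁, Uf N ≠ 0)
    (hb : ∀ N ∈ Icc 0 N₁, ∀ᵐ x ∂vol[D], ‖Uf N x‖ ≤ M) :
    IsLinearResonance D τ (freq τ (Zf 0)) ∧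
      IsBranch D τ N₁ (freq τ (Zf 0)) (fun N => freq τ (Zf N)) (fun N => state N (Uf N)) := by
  have hZ : ∀ N ∈ Icc 0 N₁, Zf N ≠ 0 := fun N hN h0 => by have := hre N hN; rw [h0] at this; simp at this
  have hq' : ∀ N ∈ Icc 0 N₁, (τ * Zf N)⁻¹ ∈ 𝔻 := fun N hN => by
    simpa using (hq N hN).le
  have h0 : (0 : ℝ) ∈ Icc 0 N₁ := ⟨le_rfl, hN₁.le⟩
  have hω := continuousOn_freq τ hZc hre
  have hlim : ∀ N ∈ Icc 0 N₁, Tendsto (fun M' => h2Norm D fun x => state M' (Uf M') x - state N (Uf N) x)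
      (𝓝[Icc 0 N₁] N) (𝓝 0) := fun N hN => tendsto_h2Norm_state h M hτ hZc hUc hs hre hZ hq hU hN
  have hnhds : 𝓝[>] (0 : ℝ) ≤ 𝓝[Icc 0 N₁] 0 := by
    rw [← nhdsWithin_Ioo_eq_nhdsGT hN₁]
    exact nhdsWithin_mono _ Ioo_subset_Icc_self
  refine ⟨(hs 0 h0).isLinearResonance h M hτ (hZ 0 h0) (hq' 0 h0) (hU 0 h0), fun N hN => ?_, fun N hN => ?_,
    hω.mono Ioo_subset_Icc_self, fun N hN => ?_, ?_, ?_⟩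
  · have hN' := Ioo_subset_Icc_self hN
    exact (hs N hN').isSolution h M hτ hN'.1 (hZ N hN') (hq' N hN') (hb N hN')
  · rw [normSq_coe, norm_state (hU N (Ioo_subset_Icc_self hN)), Real.sq_sqrt hN.1.le]
  · have := hlim N (Ioo_subset_Icc_self hN)
    rwa [nhdsWithin_eq_nhds.2 (Icc_mem_nhds hN.1 hN.2)] at this
  · exact (hω 0 h0).mono_left hnhds
  · refine ((hlim 0 h0).mono_left hnhds).congr' (.of_forall fun N => ?_)
    have e0 : state 0 (Uf 0) = 0 := by simp [state]
    have e1 : (fun x => state N (Uf N) x - state 0 (Uf 0) x) =ᵐ[vol[D]] state N (Uf N) := by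
      rw [e0]
      filter_upwards [Lp.coeFn_zero ℂ 2 vol[D]] with x hx
      rw [hx]; simp
    exact h2Norm_congr e1

end Branches

/-! ### From solutions to the resonance system -/

section Converse

variable {D : Set Plane} [hD : Fact (ReflectionDomain D)] {φ : L2 D} {lam : ℝ}
  (h : SimpleMode (constMode D) φ (logOp D) lam) (M : ℝ≥0)

include h in
theorem mem_frequencyRegion_iff {τ : ℝ} (hτ : 0 < τ) {ω : ℂ} : ω ∈ frequencyRegion D lam τ ↔
    0 ≤ ω.re ∧ halfGap D lam < infDist (τ * ω ^ 2)⁻¹ (reducedSpectrum D \ {(lam : ℂ)}) := by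
  have e : ((sqrt τ : ℂ) * ω) ^ 2 = τ * ω ^ 2 := by
    rw [mul_pow, ← Complex.ofReal_pow, Real.sq_sqrt hτ.le]
  simp only [frequencyRegion, scaledRegion, mem_ofPred_eq, e, halfGap]

theorem dimerSystem_eq_of_kop {c q Z : ℂ} (hq : q ∈ 𝔻) {u n : L2 D}
    (hu : Z • u = kop D (greenKernel c q) (u + n)) :
    Z • u = (c * area D * ⟪(dimerSystem h M).e, u + n⟫) • (dimerSystem h M).e + (dimerSystem h M).K u
      + ((dimerSystem h M).K n
        + ((c * area D) • (dimerSystem h M).J q + (dimerSystem h M).Y q) (u + n)) :=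
  hu.trans (kop_greenKernel_add hq u n)

theorem exists_candidate : ∃ (C : ℝ≥0) (N₁ τ₁ C₁ : ℝ), 0 < N₁ ∧ 0 < τ₁ ∧ 0 ≤ C₁ ∧
    ∀ (M : ℝ≥0) (τ : ℝ) (ω : ℂ) (u : Plane → ℂ), τ₁ ≤ τ → IsSolution D τ ω u → 0 < normSq D u →
      normSq D u ≤ N₁ → ω ∈ frequencyRegion D lam τ → ∃ U : L2 D,
        u =ᵐ[vol[D]] ((sqrt (normSq D u) : ℂ) • U : L2 D) ∧ ‖U‖ = 1 ∧
        (∀ᵐ x ∂vol[D], ‖U x‖ ≤ C) ∧ ω ≠ 0 ∧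
        (τ * ω ^ 2)⁻¹ • U = kop D (greenKernel (greenCoeff ω) (ω ^ 2))
          (U + (normSq D u : ℂ) • cubeMap D C U) ∧
        (dimerSystem h M).Candidate (halfGap D lam) C₁ τ (normSq D u) (τ * ω ^ 2)⁻¹
          (greenCoeff ω * area D) (ω ^ 2) U ((normSq D u : ℂ) • cubeMap D C U) := by
  have hδ := h.halfGap_pos
  obtain ⟨C, N₁, hC, hN₁, hap⟩ := exists_apriori_bound D hδ
  obtain ⟨T, hT, hadm⟩ := exists_admissible D coeffBound
  have hA := area_pos (D := D)
  obtain ⟨C, rfl⟩ : ∃ C' : ℝ≥0, (C' : ℝ) = C := ⟨⟨C, hC.le⟩, rfl⟩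
  refine ⟨C, N₁, T / halfGap D lam, max (C ^ 2) (area D * coeffBound), hN₁, by positivity,
    le_max_of_le_left (by positivity), fun M τ ω u hτ hu hpos hle hω => ?_⟩
  have hτ0 : 0 < τ := (by positivity : 0 < T / halfGap D lam).trans_le hτ
  have hτ' : (τ : ℂ) ≠ 0 := by exact_mod_cast hτ0.ne'
  obtain ⟨-, hreg⟩ := (mem_frequencyRegion_iff h hτ0).1 hω
  set Z : ℂ := (τ * ω ^ 2)⁻¹ with hZdef
  have hZδ : halfGap D lam < ‖Z‖ := hreg.trans_le (h.infDist_le_norm Z)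
  have hZ : Z ≠ 0 := by rintro h0; rw [h0, norm_zero] at hZδ; linarith
  have hω0 : ω ≠ 0 := by rintro rfl; simp [hZdef] at hZ
  have hZinv : Z⁻¹ = τ * ω ^ 2 := by rw [hZdef, inv_inv]
  have hqn : ‖ω ^ 2‖ = (τ * ‖Z‖)⁻¹ := by
    rw [hZdef, norm_inv, norm_mul, Complex.norm_of_nonneg hτ0.le, mul_inv, mul_inv,
      mul_inv, inv_inv, inv_inv, inv_mul_cancel_left₀ hτ0.ne']
  have hTs : T ≤ τ * ‖Z‖ := by
    rw [div_le_iff₀ hδ] at hτ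
    exact hτ.trans (by gcongr)
  have hc := norm_greenCoeff_sub_le hτ0 (ω := ω) (Z := Z) rfl
  have had : Admissible D (halfGap D lam) (greenCoeff ω) (ω ^ 2) Z :=
    hadm _ _ _ _ _ hTs hZδ.le hqn hc
  have hq : ω ^ 2 ∈ 𝔻 := by simpa using had.norm_le
  have hum : MemLp u 2 vol[D] := let ⟨_, _, hj⟩ := hu.1; hj.memLp
  have heq : ∀ᵐ x ∂vol[D], Z * u x
      = conv D (greenKernel (greenCoeff ω) (ω ^ 2)) (kerr u) x := hu.2.mono fun x hx => by
    rw [hx, ← hZinv, ← conv_green hω0, mul_inv_cancel_left₀ hZ]; rfl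
  have hbd := hap _ _ _ u had hum hpos hle heq
  set N := normSq D u with hN
  have hs0 : 0 < sqrt N := Real.sqrt_pos.2 hpos
  have hs0' : (sqrt N : ℂ) ≠ 0 := by exact_mod_cast hs0.ne'
  obtain ⟨U, hU⟩ : ∃ U : L2 D, U = ((sqrt N : ℂ)⁻¹) • hum.toLp := ⟨_, rfl⟩
  have hsU : (sqrt N : ℂ) • U = hum.toLp := by rw [hU, smul_inv_smul₀ hs0']
  have huU : u =ᵐ[vol[D]] ((sqrt N : ℂ) • U : L2 D) := by
    rw [hsU]; exact hum.coeFn_toLp.symm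
  have huU' : ∀ᵐ x ∂vol[D], u x = sqrt N * U x := by
    filter_upwards [huU, Lp.coeFn_smul (sqrt N : ℂ) U] with x h1 h2
    rw [h1, h2]; rfl
  have hU1 : ‖U‖ = 1 := by
    rw [hU, norm_smul, norm_inv, Complex.norm_of_nonneg hs0.le, Lp.norm_toLp,
      ← normSq_eq hum, inv_mul_cancel₀ hs0.ne']
  have hUC : ∀ᵐ x ∂vol[D], ‖U x‖ ≤ C := by
    filter_upwards [hbd, huU'] with x h1 h2
    rw [h2, norm_mul, Complex.norm_of_nonneg hs0.le, mul_comm] at h1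
    exact le_of_mul_le_mul_right h1 hs0
  set n : L2 D := (N : ℂ) • cubeMap D C U with hn
  have hker : kerr u =ᵐ[vol[D]] ((sqrt N : ℂ) • (U + n) : L2 D) := by
    filter_upwards [huU', hUC, Lp.coeFn_smul (sqrt N : ℂ) (U + n), Lp.coeFn_add U n,
      Lp.coeFn_smul (N : ℂ) (cubeMap D C U), coeFn_cubeMap C U] with x h1 h2 h3 h4 h5 h6
    rw [h3, Pi.smul_apply, h4, Pi.add_apply, hn, h5, Pi.smul_apply, h6, truncCube_of_le h2, kerr, h1,
      norm_mul, Complex.norm_of_nonneg hs0.le, mul_pow, Real.sq_sqrt hpos.le]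
    simp only [smul_eq_mul]
    push_cast
    ring
  have hk := isKernel_greenKernel (D := D) (greenCoeff ω) hq
  have hop : Z • U = kop D (greenKernel (greenCoeff ω) (ω ^ 2)) (U + n) := by
    have e1 : (sqrt N : ℂ) • (Z • U)
        = (sqrt N : ℂ) • kop D (greenKernel (greenCoeff ω) (ω ^ 2)) (U + n) := by
      rw [← map_smul, smul_comm, hsU]
      refine Lp.ext ?_
      filter_upwards [heq, Lp.coeFn_smul Z hum.toLp, hum.coeFn_toLp,
        hk.coeFn_kop ((sqrt N : ℂ) • (U + n))] with x h1 h2 h3 h4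
      rw [h2, h4, Pi.smul_apply, h3, smul_eq_mul, h1, conv_congr hker]
    exact smul_right_injective _ hs0' e1
  refine ⟨U, huU, hU1, hUC, hω0, hop, hU1, ?_, hZδ.le, ?_, ?_, hqn, ?_⟩
  · rw [norm_smul, Complex.norm_of_nonneg hpos.le]
    have h1 := norm_cubeMap_le C U
    rw [hU1, mul_one] at h1
    rw [mul_comm]
    have := h1.trans (le_max_left ((C : ℝ) ^ 2) (area D * coeffBound))
    gcongr
  · intro w hw hw'
    exact h.resolvent_bound hδ (by rw [← reducedSpectrum_eq]; exact hreg.le) w hw hw'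
  · refine le_trans (le_of_eq ?_) ((mul_le_mul_of_nonneg_left hc hA.le).trans (le_max_right _ _))
    have e0 : ‖((area D : ℝ) : ℂ)‖ = area D := by rw [Complex.norm_of_nonneg hA.le]
    have e1 : greenCoeff ω * area D - ((area D / (4 * Real.pi) * (log τ + log ‖Z‖) : ℝ) : ℂ)
        = area D * (greenCoeff ω - (1 / (4 * Real.pi) * log (τ * ‖Z‖) : ℝ)) := by
      rw [Real.log_mul hτ0.ne' (norm_ne_zero_iff.2 hZ)]
      push_cast
      ring
    change ‖greenCoeff ω * area D - ((area D / (4 * Real.pi) * (log τ + log ‖Z‖) : ℝ) : ℂ)‖ = _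
    rw [e1, norm_mul, e0]
  · exact dimerSystem_eq_of_kop h M hq hop

theorem solves_of_candidate {C : ℝ≥0} (hCM : 2 * C ≤ M) {τ N : ℝ} {ω Z b : ℂ} {U : L2 D} (hτ : 0 < τ)
    (hU1 : ‖U‖ = 1) (hUC : ∀ᵐ x ∂vol[D], ‖U x‖ ≤ C) (hb : 1 / 2 ≤ ‖b‖) (hZ : 0 < Z.re)
    (hω : ω = freq τ Z) (hq : (τ * Z)⁻¹ ∈ 𝔻)
    (hop : Z • U = kop D (greenKernel (greenCoeff ω) (ω ^ 2)) (U + (N : ℂ) • cubeMap D C U)) :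
    (dimerSystem h M).Solves τ N Z (b⁻¹ • U) := by
  have hZ0 : Z ≠ 0 := by rintro rfl; simp at hZ
  have hb0 : 0 < ‖b‖ := by linarith
  rw [solves_iff h M hq, ← freq_sq hτ hZ0, ← hω]
  have e : (dimerSystem h M).nonlin N (b⁻¹ • U) = b⁻¹ • ((N : ℂ) • cubeMap D C U) := by
    rw [nonlin_eq, norm_smul, hU1, mul_one, norm_inv]
    refine Lp.ext ?_
    filter_upwards [hUC, Lp.coeFn_smul (((N / ‖b‖⁻¹ ^ 2 : ℝ) : ℂ)) (cubeMap D M (b⁻¹ • U)),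
      coeFn_cubeMap M (b⁻¹ • U), Lp.coeFn_smul b⁻¹ U, Lp.coeFn_smul b⁻¹ ((N : ℂ) • cubeMap D C U),
      Lp.coeFn_smul (N : ℂ) (cubeMap D C U), coeFn_cubeMap C U] with x h0 h1 h2 h3 h4 h5 h6
    have h7 : ‖b⁻¹ * U x‖ ≤ M := by
      have h8 : ‖b‖⁻¹ ≤ 2 := by rw [inv_le_comm₀ hb0 two_pos]; linarith
      have h9 : (2 * C : ℝ) ≤ M := by exact_mod_cast hCM
      rw [norm_mul, norm_inv]
      exact (mul_le_mul h8 h0 (norm_nonneg _) two_pos.le).trans h9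
    rw [h1, Pi.smul_apply, h2, h3, Pi.smul_apply, h4, Pi.smul_apply, h5, Pi.smul_apply, h6]
    simp only [smul_eq_mul]
    rw [truncCube_of_le h7, truncCube_of_le h0, norm_mul, norm_inv]
    have hb1 : (‖b‖ : ℂ) ≠ 0 := by exact_mod_cast hb0.ne'
    push_cast
    field_simp
  rw [e, ← smul_add, map_smul, ← hop, smul_comm]

theorem nonlin_reflectL2 (N : ℝ) (U : L2 D) : (dimerSystem h M).nonlin N (reflectL2 D U)
    = reflectL2 D ((dimerSystem h M).nonlin N U) := by
  rw [nonlin_eq, nonlin_eq, cubeMap_reflectL2, LinearIsometry.norm_map, map_smul]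

theorem nonlin_neg (N : ℝ) (U : L2 D) : (dimerSystem h M).nonlin N (-U)
    = -(dimerSystem h M).nonlin N U := by
  rw [nonlin_eq, nonlin_eq, cubeMap_neg, norm_neg, smul_neg]

variable {τ N : ℝ} {Z : ℂ} {U : L2 D}

theorem ResonanceSystem.Solves.reflect (hs : (dimerSystem h M).Solves τ N Z U)
    (hq : (τ * Z)⁻¹ ∈ 𝔻) : (dimerSystem h M).Solves τ N Z (reflectL2 D U) := by
  rw [solves_iff h M hq] at hs ⊢
  rw [nonlin_reflectL2, ← map_add, kop_reflectL2 (isKernel_greenKernel _ hq) (fun z => by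
    simp only [greenKernel, jKernel_reflect, yKernel_reflect, logKernel_reflect]), ← hs, map_smul]

theorem ResonanceSystem.Solves.neg (hs : (dimerSystem h M).Solves τ N Z U)
    (hq : (τ * Z)⁻¹ ∈ 𝔻) : (dimerSystem h M).Solves τ N Z (-U) := by
  rw [solves_iff h M hq] at hs ⊢
  rw [nonlin_neg, ← neg_add, map_neg, ← hs, smul_neg]

theorem isSymm_state (hU : reflectL2 D U = U) : IsSymm D (state N U) := by
  rw [isSymm_coe, state, map_smul, hU]

theorem isAntisymm_state (hU : reflectL2 D U = -U) : IsAntisymm D (state N U) := by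
  rw [isAntisymm_coe, state, map_smul, hU, smul_neg]

theorem eqUpToPhase_state {u : Plane → ℂ} {W : L2 D} {b : ℂ} (hW : ‖W‖ = 1) (hb : 1 / 2 ≤ ‖b‖)
    (hWU : b⁻¹ • W = U) (hu : u =ᵐ[vol[D]] ((sqrt N : ℂ) • W : L2 D)) :
    EqUpToPhase D u (state N U) := by
  have hb0 : ‖b‖ ≠ 0 := by linarith
  have hb1 : b ≠ 0 := norm_ne_zero_iff.1 hb0
  refine ⟨b.arg, ?_⟩
  have hn : ‖U‖ = ‖b‖⁻¹ := by rw [← hWU, norm_smul, hW, mul_one, norm_inv]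
  have e : (sqrt N : ℂ) • W = Complex.exp (b.arg * Complex.I) • state N U := by
    have hbb : b = ‖b‖ * Complex.exp (b.arg * Complex.I) := (Complex.norm_mul_exp_arg_mul_I b).symm
    rw [state, hn, ← hWU, smul_smul, smul_smul]
    congr 1
    rw [div_inv_eq_mul, Complex.ofReal_mul]
    rw [eq_comm, ← div_eq_mul_inv, div_eq_iff hb1]
    linear_combination -(sqrt N : ℂ) * hbb
  rw [e] at hu
  exact hu.trans (Lp.coeFn_smul _ _)

end Converse

section Solutions

variable {D : Set Plane} [hD : Fact (ReflectionDomain D)]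

theorem IsWeakDeriv.const_mul {i : Fin 2} {u g : Plane → ℂ} (hu : IsWeakDeriv D i u g) (c : ℂ) :
    IsWeakDeriv D i (fun x => c * u x) (fun x => c * g x) := by
  intro ψ h1 h2 h3
  simp only [mul_left_comm _ c, integral_const_mul, hu ψ h1 h2 h3, mul_neg]

theorem MemH2.const_mul {u : Plane → ℂ} (hu : MemH2 D u) (c : ℂ) : MemH2 D fun x => c * u x := by
  obtain ⟨g, k, hj⟩ := hu
  exact ⟨fun i x => c * g i x, fun i j x => c * k i j x, hj.memLp.const_mul c,
    fun i => (hj.memLp_grad i).const_mul c, fun i j => (hj.memLp_hess i j).const_mul c,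
    fun i => (hj.grad i).const_mul c, fun i j => (hj.hess i j).const_mul c⟩

theorem MemH2.memLp {u : Plane → ℂ} (hu : MemH2 D u) : MemLp u 2 vol[D] :=
  let ⟨_, _, hj⟩ := hu
  hj.memLp

theorem IsSolution.of_eqUpToPhase {τ : ℝ} {ω : ℂ} {u v : Plane → ℂ} (hv : IsSolution D τ ω v)
    (huv : EqUpToPhase D u v) : IsSolution D τ ω u ∧ normSq D u = normSq D v := by
  obtain ⟨θ, hθ⟩ := huv
  have hn : ‖Complex.exp (θ * Complex.I)‖ = 1 := Complex.norm_exp_ofReal_mul_I θ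
  have hker : kerr u =ᵐ[vol[D]] fun x => Complex.exp (θ * Complex.I) * kerr v x := by
    filter_upwards [hθ] with x hx
    simp only [kerr, hx, norm_mul, hn, one_mul]
    ring
  refine ⟨⟨(hv.1.const_mul _).congr hθ.symm, ?_⟩, integral_congr_ae ?_⟩
  · filter_upwards [hθ, hv.2] with x h1 h2
    have e : volumePotential D ω (kerr u) x
        = Complex.exp (θ * Complex.I) * volumePotential D ω (kerr v) x := by
      change conv D (green ω) (kerr u) x = _ * conv D (green ω) (kerr v) x
      rw [conv_congr hker, conv_const_mul]
    rw [h1, e, h2]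
    ring
  · filter_upwards [hθ] with x hx
    rw [hx, norm_mul, hn, one_mul]

theorem IsSymm.of_eqUpToPhase {u v : Plane → ℂ} (hv : IsSymm D v) (huv : EqUpToPhase D u v) :
    IsSymm D u := by
  obtain ⟨θ, hθ⟩ := huv
  refine IsSymm.congr (f := fun x => Complex.exp (θ * Complex.I) * v x) ?_ hθ.symm
  exact hv.mono fun x hx => by simp only [hx]

theorem IsAntisymm.of_eqUpToPhase {u v : Plane → ℂ} (hv : IsAntisymm D v) (huv : EqUpToPhase D u v) :
    IsAntisymm D u := by
  obtain ⟨θ, hθ⟩ := huv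
  refine IsAntisymm.congr (f := fun x => Complex.exp (θ * Complex.I) * v x) ?_ hθ.symm
  exact hv.mono fun x hx => by simp only [hx, mul_neg]

theorem eLpNorm_le_h2Norm (u : Plane → ℂ) : eLpNorm u 2 vol[D] ≤ h2Norm D u :=
  le_iInf fun _ => le_iInf fun _ => le_iInf fun _ => by
    rw [add_assoc]; exact le_self_add

/-- Away from solutions without symmetry there is no symmetry breaking. -/
theorem not_isSymmetryBreakingPoint {φ : L2 D} {lam : ℝ}
    (h : SimpleMode (constMode D) φ (logOp D) lam) {τ N N₀ : ℝ} (hτ : 0 < τ) {ω₀ : ℂ} {u₀ : Plane → ℂ}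
    (hω₀ : 0 < ω₀.re) (hreg : ω₀ ∈ frequencyRegion D lam τ) (hu₀ : MemLp u₀ 2 vol[D])
    (hN₀ : normSq D u₀ = N) (hN : N ∈ Ioo 0 N₀)
    (H : ∀ ω u, IsSolution D τ ω u → normSq D u ∈ Ioo 0 N₀ → ω ∈ frequencyRegion D lam τ →
      IsSymm D u ∨ IsAntisymm D u) : ¬ IsSymmetryBreakingPoint D τ ω₀ u₀ := by
  intro hbreak
  have hτ' : (τ : ℂ) ≠ 0 := by exact_mod_cast hτ.ne'
  have hω0 : ω₀ ≠ 0 := by rintro rfl; simp at hω₀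
  have hev : ∀ᶠ ω in 𝓝 ω₀, ω ∈ frequencyRegion D lam τ := by
    have h1 : ∀ᶠ ω in 𝓝 ω₀, 0 < ω.re := Complex.continuous_re.continuousAt.eventually_const_lt hω₀
    have h2 : ContinuousAt (fun ω : ℂ => infDist (τ * ω ^ 2)⁻¹
        (reducedSpectrum D \ {(lam : ℂ)})) ω₀ := by
      refine (Metric.continuous_infDist_pt _).continuousAt.comp ?_
      exact ContinuousAt.inv₀ (by fun_prop) (mul_ne_zero hτ' (pow_ne_zero 2 hω0))
    filter_upwards [h1, h2.eventually_const_lt ((mem_frequencyRegion_iff h hτ).1 hreg).2] with ω a1 a2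
    exact (mem_frequencyRegion_iff h hτ).2 ⟨a1.le, a2⟩
  obtain ⟨r, hr, hball⟩ := Metric.eventually_nhds_iff.1 hev
  have hs0 : 0 < sqrt N := Real.sqrt_pos.2 hN.1
  have hs1 : sqrt N < sqrt N₀ := Real.sqrt_lt_sqrt hN.1.le hN.2
  have hN0' : 0 < N₀ := hN.1.trans hN.2
  obtain ⟨ω, u, hsol, hω, hu, hns, hna⟩ := hbreak (min r (min (sqrt N) (sqrt N₀ - sqrt N)))
    (lt_min hr (lt_min hs0 (by linarith)))
  have hum := hsol.1.memLp
  have hlt := ((eLpNorm_le_h2Norm _).trans_lt hu)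
  have hd : ‖hum.toLp - hu₀.toLp‖ < min (sqrt N) (sqrt N₀ - sqrt N) := by
    rw [← MemLp.toLp_sub, Lp.norm_toLp]
    have := ENNReal.toReal_lt_of_lt_ofReal hlt
    exact this.trans_le (min_le_right _ _)
  have n1 : ‖hum.toLp‖ = sqrt (normSq D u) := by rw [Lp.norm_toLp, normSq_eq hum]
  have n2 : ‖hu₀.toLp‖ = sqrt N := by rw [Lp.norm_toLp, ← normSq_eq hu₀, hN₀]
  have t1 := norm_le_norm_add_norm_sub' (hum.toLp) (hu₀.toLp)
  have t2 := norm_le_norm_add_norm_sub (hum.toLp) (hu₀.toLp)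
  rw [n1, n2] at t1 t2
  have hd1 := hd.trans_le (min_le_left _ _)
  have hd2 := hd.trans_le (min_le_right _ _)
  rcases H ω u hsol ⟨Real.sqrt_pos.1 (by linarith), (Real.sqrt_lt_sqrt_iff_of_pos hN0').1 (by linarith)⟩
    (hball (by rw [dist_eq_norm]; exact hω.trans_le (min_le_left _ _))) with h1 | h1
  · exact hns h1
  · exact hna h1

theorem freq_mul {τ a : ℝ} (hτ : 0 < τ) (ha : 0 < a) {ζ : ℂ} (hζ : ζ ≠ 0) :
    freq τ (a * ζ) = Complex.exp (-Complex.log ζ / 2) * (sqrt (1 / (τ * a)) : ℝ) := by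
  have e : (sqrt (1 / (τ * a)) : ℝ) = Real.exp (-(log τ + log a) / 2) := by
    rw [← Real.log_mul hτ.ne' ha.ne', ← Real.log_inv, ← one_div, ← Real.log_sqrt (by positivity),
      Real.exp_log (by positivity)]
  rw [freq, Complex.log_ofReal_mul ha hζ, e, Complex.ofReal_exp, ← Complex.exp_add]
  congr 1
  push_cast
  ring

theorem isEquivalent_freq {a : ℝ → ℝ} {ζ : ℝ → ℂ} (ha : ∀ᶠ τ in atTop, 0 < a τ)
    (hζ : Tendsto ζ atTop (𝓝 1)) :
    Asymptotics.IsEquivalent atTop (fun τ => freq τ (a τ * ζ τ))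
      (fun τ => ((sqrt (1 / (τ * a τ)) : ℝ) : ℂ)) := by
  rw [Asymptotics.isEquivalent_iff_exists_eq_mul]
  refine ⟨fun τ => Complex.exp (-Complex.log (ζ τ) / 2), ?_, ?_⟩
  · have hc : ContinuousAt (fun z : ℂ => Complex.exp (-Complex.log z / 2)) 1 := by
      have : ContinuousAt Complex.log 1 := continuousAt_clog (by simp)
      fun_prop
    simpa [Function.comp_def] using hc.tendsto.comp hζ
  · filter_upwards [ha, eventually_gt_atTop 0, hζ.eventually_ne one_ne_zero] with τ h1 h2 h3
    exact freq_mul h2 h1 h3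

end Solutions

/-! ### The solutions of a symmetric dimer -/

theorem isometry_constraints {H : Type*} [NormedAddCommGroup H] [InnerProductSpace ℂ H]
    (R : H →ₗᵢ[ℂ] H) {w u : H} {r : ℝ} (hw : R w = w) (h1 : ‖u - w‖ ≤ r) (h2 : ⟪w, u - w⟫ = 0) :
    ‖R u - w‖ ≤ r ∧ ⟪w, R u - w⟫ = 0 := by
  have e : R u - w = R (u - w) := by rw [map_sub, hw]
  rw [e, R.norm_map]
  refine ⟨h1, ?_⟩
  nth_rewrite 1 [← hw]
  rw [R.inner_map_map, h2]

theorem norm_bounds_of_unit {H : Type*} [NormedAddCommGroup H] {w u : H} (hw : ‖w‖ = 1)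
    (h : ‖u - w‖ ≤ 1 / 2) : 1 / 2 ≤ ‖u‖ ∧ ‖u‖ ≤ 2 := by
  have h1 := norm_le_norm_add_norm_sub' w u
  have h2 := norm_le_norm_add_norm_sub' u w
  rw [norm_sub_rev] at h1
  constructor <;> linarith

theorem exists_norm_le_of_mem_spectrum {W : Type*} [NormedAddCommGroup W] [NormedSpace ℂ W]
    [CompleteSpace W] (A : W →L[ℂ] W) : ∃ R : ℝ, ∀ x ∈ spectrum ℂ A, ‖x‖ ≤ R :=
  ⟨_, fun _ hx => spectrum.norm_le_norm_mul_of_mem hx⟩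

theorem SimpleMode.exists_norm_sub_le {H : Type*} [NormedAddCommGroup H] [InnerProductSpace ℂ H]
    [CompleteSpace H] {e φ : H} {K : H →L[ℂ] H} {lam : ℝ} (h : SimpleMode e φ K lam)
    (hne : (spectrum ℂ h.restr).Nonempty) :
    ∃ R : ℝ, ∀ z : ℂ, ‖z‖ - R ≤ infDist z (compressionSpectrum e K \ {(lam : ℂ)}) := by
  obtain ⟨R, hR⟩ := exists_norm_le_of_mem_spectrum h.restr
  refine ⟨R, fun z => ?_⟩
  rw [h.compressionSpectrum_diff]
  refine (Metric.le_infDist hne).2 fun x hx => ?_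
  have h1 := hR x hx
  have h2 := norm_sub_norm_le z x
  rw [dist_eq_norm]
  linarith

section Dimers

variable {D : Set Plane} [hD : Fact (ReflectionDomain D)] {φ : L2 D} {lam : ℝ}

theorem SimpleMode.exists_norm_sub_le_infDist (h : SimpleMode (constMode D) φ (logOp D) lam) :
    ∃ R : ℝ, ∀ z : ℂ, ‖z‖ - R ≤ infDist z (reducedSpectrum D \ {(lam : ℂ)}) := by
  rw [reducedSpectrum_eq]
  exact h.exists_norm_sub_le ⟨0, h.zero_mem⟩

theorem sub_norm_le_infDist_lam (z : ℂ) :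
    2 * halfGap D lam - ‖z - lam‖ ≤ infDist z (reducedSpectrum D \ {(lam : ℂ)}) := by
  have h1 := Metric.infDist_le_infDist_add_dist (s := reducedSpectrum D \ {(lam : ℂ)}) (x := (lam : ℂ))
    (y := z)
  rw [dist_comm, dist_eq_norm] at h1
  rw [halfGap]
  linarith

/-- A family of solutions of the resonance system near the mode `w`, unique for `Z` in `V`. -/
structure ModalBranch (h : SimpleMode (constMode D) φ (logOp D) lam) (M : ℝ≥0) (w : L2 D) (V : Set ℂ)
    (r τ N₁ : ℝ) (Z : ℝ → ℂ) (U : ℝ → L2 D) : Prop where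
  norm_mode : ‖w‖ = 1
  continuousOn_fst : ContinuousOn Z (Icc 0 N₁)
  continuousOn_snd : ContinuousOn U (Icc 0 N₁)
  re_pos : ∀ z ∈ V, 0 < z.re
  gap : ∀ z ∈ V, halfGap D lam < infDist z (reducedSpectrum D \ {(lam : ℂ)})
  radius_le : r ≤ 1 / 2
  mem : ∀ N ∈ Icc 0 N₁, Z N ∈ V
  norm_sub_le : ∀ N ∈ Icc 0 N₁, ‖U N - w‖ ≤ r
  inner_sub : ∀ N ∈ Icc 0 N₁, ⟪w, U N - w⟫ = 0
  solves : ∀ N ∈ Icc 0 N₁, (dimerSystem h M).Solves τ N (Z N) (U N)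
  unique : ∀ N ∈ Icc 0 N₁, ∀ z v, z ∈ V → ‖v - w‖ ≤ r → ⟪w, v - w⟫ = 0 →
    (dimerSystem h M).Solves τ N z v → z = Z N ∧ v = U N

namespace ModalBranch

variable {h : SimpleMode (constMode D) φ (logOp D) lam} {M : ℝ≥0} {w : L2 D} {V : Set ℂ}
  {r τ N₁ : ℝ} {Z : ℝ → ℂ} {U : ℝ → L2 D}

theorem mono (hB : ModalBranch h M w V r τ N₁ Z U) {N₀ : ℝ} (hN : N₀ ≤ N₁) :
    ModalBranch h M w V r τ N₀ Z U :=
  have hs : Icc 0 N₀ ⊆ Icc 0 N₁ := Icc_subset_Icc_right hN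
  { hB with
    continuousOn_fst := hB.continuousOn_fst.mono hs
    continuousOn_snd := hB.continuousOn_snd.mono hs
    mem := fun N hN => hB.mem N (hs hN)
    norm_sub_le := fun N hN => hB.norm_sub_le N (hs hN)
    inner_sub := fun N hN => hB.inner_sub N (hs hN)
    solves := fun N hN => hB.solves N (hs hN)
    unique := fun N hN => hB.unique N (hs hN) }

theorem halfGap_lt_norm (hB : ModalBranch h M w V r τ N₁ Z U) {z : ℂ} (hz : z ∈ V) :
    halfGap D lam < ‖z‖ :=
  (hB.gap z hz).trans_le (h.infDist_le_norm z)

theorem norm_inv_lt_one (hB : ModalBranch h M w V r τ N₁ Z U) (hτ : 0 < τ)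
    (hτδ : 1 < τ * halfGap D lam) {z : ℂ} (hz : z ∈ V) : ‖((τ : ℂ) * z)⁻¹‖ < 1 := by
  rw [norm_inv, norm_mul, Complex.norm_of_nonneg hτ.le]
  exact inv_lt_one_of_one_lt₀ (hτδ.trans (by have := hB.halfGap_lt_norm hz; gcongr))

theorem inv_mem_closedBall (hB : ModalBranch h M w V r τ N₁ Z U) (hτ : 0 < τ)
    (hτδ : 1 < τ * halfGap D lam) {z : ℂ} (hz : z ∈ V) :
    ((τ : ℂ) * z)⁻¹ ∈ 𝔻 :=
  mem_closedBall_zero_iff.2 (hB.norm_inv_lt_one hτ hτδ hz).le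

theorem fixed (hB : ModalBranch h M w V r τ N₁ Z U) (R : L2 D →ₗᵢ[ℂ] L2 D) (hw : R w = w)
    (hR : ∀ N z v, z ∈ V → (dimerSystem h M).Solves τ N z v → (dimerSystem h M).Solves τ N z (R v))
    {N : ℝ} (hN : N ∈ Icc 0 N₁) : R (U N) = U N := by
  obtain ⟨h1, h2⟩ := isometry_constraints R hw (hB.norm_sub_le N hN) (hB.inner_sub N hN)
  exact (hB.unique N hN _ _ (hB.mem N hN) h1 h2 (hR N _ _ (hB.mem N hN) (hB.solves N hN))).2

theorem reflect_eq (hB : ModalBranch h M w V r τ N₁ Z U) (hτ : 0 < τ) (hτδ : 1 < τ * halfGap D lam)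
    (hw : reflectL2 D w = w) {N : ℝ} (hN : N ∈ Icc 0 N₁) : reflectL2 D (U N) = U N :=
  hB.fixed _ hw (fun _ _ _ hz hs => hs.reflect h M (hB.inv_mem_closedBall hτ hτδ hz)) hN

theorem reflect_eq_neg (hB : ModalBranch h M w V r τ N₁ Z U) (hτ : 0 < τ)
    (hτδ : 1 < τ * halfGap D lam) (hw : reflectL2 D w = -w) {N : ℝ} (hN : N ∈ Icc 0 N₁) :
    reflectL2 D (U N) = -U N := by
  have h1 := hB.fixed ((LinearIsometryEquiv.neg ℂ).toLinearIsometry.comp (reflectL2 D))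
    (by change -(reflectL2 D w) = w; rw [hw, neg_neg]) (fun _ _ _ hz hs =>
      (hs.reflect h M (hB.inv_mem_closedBall hτ hτδ hz)).neg h M (hB.inv_mem_closedBall hτ hτδ hz)) hN
  exact neg_eq_iff_eq_neg.1 h1

theorem eq_of_candidate (hB : ModalBranch h M w V r τ N₁ Z U) (hτ : 0 < τ)
    (hτδ : 1 < τ * halfGap D lam) {C : ℝ≥0} (hCM : 2 * C ≤ M) {N : ℝ} (hN : N ∈ Icc 0 N₁) {ω b : ℂ}
    {u : Plane → ℂ} {W : L2 D} (hω : 0 ≤ ω.re)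
    (hu : u =ᵐ[vol[D]] ((sqrt N : ℂ) • W : L2 D)) (hW : ‖W‖ = 1)
    (hWC : ∀ᵐ x ∂vol[D], ‖W x‖ ≤ C)
    (hop : (τ * ω ^ 2)⁻¹ • W = kop D (greenKernel (greenCoeff ω) (ω ^ 2)) (W + (N : ℂ) • cubeMap D C W))
    (hb : 1 / 2 ≤ ‖b‖) (hbi : ⟪w, b⁻¹ • W - w⟫ = 0) (hbn : ‖b⁻¹ • W - w‖ ≤ r)
    (hV : ((τ : ℂ) * ω ^ 2)⁻¹ ∈ V) : ω = freq τ (Z N) ∧ EqUpToPhase D u (state N (U N)) := by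
  have hre := hB.re_pos _ hV
  have hωf := eq_freq hτ hω hre rfl
  have hs := solves_of_candidate h M hCM hτ hW hWC hb hre hωf (hB.inv_mem_closedBall hτ hτδ hV) hop
  obtain ⟨h1, h2⟩ := hB.unique N hN _ _ hV hbn hbi hs
  exact ⟨by rw [← h1]; exact hωf, eqUpToPhase_state hW hb h2 hu⟩

end ModalBranch

/-- Modal branches give branches of solutions of the resonance problem. -/
theorem exists_isBranch (h : SimpleMode (constMode D) φ (logOp D) lam) :
    ∃ T M₀ : ℝ, ∀ {M : ℝ≥0} {w : L2 D} {V : Set ℂ} {r τ N₁ : ℝ} {Zf : ℝ → ℂ} {Uf : ℝ → L2 D},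
      ModalBranch h M w V r τ N₁ Zf Uf → T ≤ τ → M₀ ≤ M →
      1 < τ * halfGap D lam → 0 < τ → 0 < N₁ → 4 * N₁ * M ^ 2 ≤ 1 →
      IsLinearResonance D τ (freq τ (Zf 0)) ∧
      IsBranch D τ N₁ (freq τ (Zf 0)) (fun N => freq τ (Zf N)) (fun N => state N (Uf N)) ∧
      ∀ N ∈ Icc 0 N₁, 0 < (freq τ (Zf N)).re ∧ freq τ (Zf N) ∈ frequencyRegion D lam τ := by
  have hδ := h.halfGap_pos
  obtain ⟨T, hT, hadm⟩ := exists_admissible D coeffBound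
  obtain ⟨M₀, hM₀⟩ := exists_trunc_bound D hδ
  refine ⟨T / halfGap D lam, M₀, fun {M w V r τ N₁ Zf Uf} hB hTτ hM hτδ hτ hN₁ hNM => ?_⟩
  have hZδ : ∀ N ∈ Icc 0 N₁, halfGap D lam < ‖Zf N‖ := fun N hN => hB.halfGap_lt_norm (hB.mem N hN)
  have hre : ∀ N ∈ Icc 0 N₁, 0 < (Zf N).re := fun N hN => hB.re_pos _ (hB.mem N hN)
  have hinv : ∀ N ∈ Icc 0 N₁, (τ * freq τ (Zf N) ^ 2)⁻¹ = Zf N := fun N hN => by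
    rw [mul_freq_sq hτ (norm_pos_iff.1 (hδ.trans (hZδ N hN))), inv_inv]
  have hqn : ∀ N ∈ Icc 0 N₁, ‖(τ * Zf N)⁻¹‖ = (τ * ‖Zf N‖)⁻¹ := fun N hN => by
    rw [norm_inv, norm_mul, Complex.norm_of_nonneg hτ.le]
  have hU : ∀ N ∈ Icc 0 N₁, 1 / 2 ≤ ‖Uf N‖ ∧ ‖Uf N‖ ≤ 2 := fun N hN =>
    norm_bounds_of_unit hB.norm_mode ((hB.norm_sub_le N hN).trans hB.radius_le)
  have hb : ∀ N ∈ Icc 0 N₁, ∀ᵐ x ∂vol[D], ‖Uf N x‖ ≤ M := fun N hN => by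
    have hNM' : 4 * N * (M : ℝ) ^ 2 ≤ 1 := le_trans (by have := hN.2; gcongr) hNM
    have had : Admissible D (halfGap D lam) (greenCoeff (freq τ (Zf N))) ((τ * Zf N)⁻¹) (Zf N) := by
      refine hadm _ _ _ _ _ ?_ (hZδ N hN).le (hqn N hN) (norm_greenCoeff_sub_le hτ (hinv N hN))
      rw [div_le_iff₀ hδ] at hTτ
      exact hTτ.trans (by have := (hZδ N hN).le; gcongr)
    exact (hM₀ h M hN.1 hNM' had (hU N hN).1 (hU N hN).2 (hB.solves N hN)).mono fun x hx => hx.trans hM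
  obtain ⟨r1, r2⟩ := isBranch_of_solves h M hτ hN₁ hB.continuousOn_fst hB.continuousOn_snd hB.solves hre
    (fun N hN => hB.norm_inv_lt_one hτ hτδ (hB.mem N hN))
    (fun N hN => norm_pos_iff.1 (by have := (hU N hN).1; linarith)) hb
  refine ⟨r1, r2, fun N hN => ⟨freq_re_pos τ (hre N hN),
    (mem_frequencyRegion_iff h hτ).2 ⟨(freq_re_pos τ (hre N hN)).le, ?_⟩⟩⟩
  rw [hinv N hN]
  exact hB.gap _ (hB.mem N hN)

theorem re_pos_of_norm_sub_le {z : ℂ} {a : ℝ} (ha : 0 < a) (hz : ‖z - a‖ ≤ a / 2) : 0 < z.re := by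
  have h1 := (Complex.abs_re_le_norm (z - a)).trans hz
  rw [Complex.sub_re, Complex.ofReal_re, abs_le] at h1
  linarith

/-- The branch of the constant mode. -/
theorem exists_modalBranch_constMode (h : SimpleMode (constMode D) φ (logOp D) lam) (M : ℝ≥0) :
    ∃ r N₁ τ₁ : ℝ, 0 < r ∧ 0 < N₁ ∧ ∃ (Z : ℝ → ℝ → ℂ) (U : ℝ → ℝ → L2 D),
      Asymptotics.IsEquivalent atTop (fun τ => freq τ (Z τ 0))
        (fun τ => ((sqrt (4 * Real.pi / (area D * τ * log τ)) : ℝ) : ℂ)) ∧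
      ∀ τ ≥ τ₁, ModalBranch h M (constMode D)
        {z | ‖z - (dimerSystem h M).large τ‖ ≤ r * (dimerSystem h M).large τ} r τ N₁ (Z τ) (U τ) := by
  have hA := area_pos (D := D)
  obtain ⟨R, hR⟩ := h.exists_norm_sub_le_infDist
  obtain ⟨r, N₁, τ₁, C, hr, -, hr2, hN₁, -, ζ, U, hB⟩ :=
    (dimerSystem h M).exists_branch_plus (1 / 2) (by norm_num)
  obtain ⟨T, hT⟩ := (dimerSystem h M).exists_le_large (max 1 (2 * (R + halfGap D lam + 1)))
  have hpos : ∀ τ ≥ T, 0 < (dimerSystem h M).large τ := fun τ hτ =>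
    one_pos.trans_le ((le_max_left _ _).trans (hT τ hτ))
  refine ⟨r, N₁, max τ₁ T, hr, hN₁, fun τ N => (dimerSystem h M).large τ * ζ τ N, U, ?_, fun τ hτ => ?_⟩
  · have hζ : Tendsto (fun τ => ζ τ 0) atTop (𝓝 1) := by
      rw [tendsto_iff_norm_sub_tendsto_zero]
      refine squeeze_zero' (.of_forall fun _ => norm_nonneg _)
        ((eventually_ge_atTop τ₁).mono fun τ hτ => (hB τ hτ).2.2.2) ?_
      simpa using tendsto_smallness_zero.const_mul C
    have ha : ∀ᶠ τ in atTop, 0 < (dimerSystem h M).large τ := (eventually_ge_atTop T).mono hpos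
    refine (isEquivalent_freq ha hζ).congr_right (.of_forall fun τ => ?_)
    have e : 1 / (τ * (dimerSystem h M).large τ) = 4 * Real.pi / (area D * τ * log τ) := by
      change 1 / (τ * (area D / (4 * Real.pi) * log τ)) = _
      rw [div_mul_eq_mul_div, mul_div_assoc', one_div_div]
      congr 1
      ring
    simp only [e]
  · obtain ⟨hall, hc1, hc2, -⟩ := hB τ ((le_max_left _ _).trans hτ)
    have hl := hpos τ ((le_max_right _ _).trans hτ)
    have hl2 := (le_max_right _ _).trans (hT τ ((le_max_right _ _).trans hτ))
    obtain ⟨l, hld⟩ : ∃ l, l = (dimerSystem h M).large τ := ⟨_, rfl⟩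
    rw [← hld] at hl hl2 hall ⊢
    have hl0 : (l : ℂ) ≠ 0 := by exact_mod_cast hl.ne'
    have hV : ∀ z : ℂ, ‖z - l‖ ≤ r * l → ‖z - l‖ ≤ l / 2 := fun z hz => by nlinarith
    refine ⟨h.norm_e, continuousOn_const.mul hc1, hc2, fun z hz => re_pos_of_norm_sub_le hl (hV z hz),
      fun z hz => ?_, hr2, fun N hN => ?_, fun N hN => (hall N hN).2.1, fun N hN => (hall N hN).2.2.1,
      fun N hN => ?_, fun N hN z v hz hv hi hs => ?_⟩
    · refine lt_of_lt_of_le ?_ (hR z)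
      have h1 := hV z hz
      have h2 := norm_le_norm_add_norm_sub z (l : ℂ)
      rw [Complex.norm_of_nonneg hl.le] at h2
      linarith
    · have e : (l * ζ τ N - l : ℂ) = (ζ τ N - 1) * l := by ring
      simp only [← hld, mem_ofPred_eq, e, norm_mul, Complex.norm_of_nonneg hl.le]
      exact mul_le_mul_of_nonneg_right (hall N hN).1 hl.le
    · simp only [← hld]
      exact (hall N hN).2.2.2.1
    · have e : z = l * (z / l) := (mul_div_cancel₀ z hl0).symm
      have h1 : ‖z / l - 1‖ ≤ r := by
        rw [div_sub_one hl0, norm_div, Complex.norm_of_nonneg hl.le, div_le_iff₀ hl]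
        exact hz
      rw [e] at hs
      obtain ⟨h2, h3⟩ := (hall N hN).2.2.2.2 _ v h1 hv hi hs
      refine ⟨?_, h3⟩
      simp only [← hld]
      rw [← h2, ← e]

/-- The branch of the principal eigenfunction. -/
theorem exists_modalBranch_eigenfunction (h : SimpleMode (constMode D) φ (logOp D) lam) (M : ℝ≥0) :
    ∃ r N₁ τ₁ : ℝ, 0 < r ∧ 0 < N₁ ∧ ∃ (Z : ℝ → ℝ → ℂ) (U : ℝ → ℝ → L2 D),
      Asymptotics.IsEquivalent atTop (fun τ => freq τ (Z τ 0))
        (fun τ => ((sqrt (1 / (τ * lam)) : ℝ) : ℂ)) ∧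
      ∀ τ ≥ τ₁, ModalBranch h M φ {z | ‖z - lam‖ ≤ r} r τ N₁ (Z τ) (U τ) := by
  have hδ := h.halfGap_pos
  have hlam := h.lam_pos
  obtain ⟨r, N₁, τ₁, C, hr, hr1, hr2, hN₁, -, Z, U, hB⟩ :=
    (dimerSystem h M).exists_branch_minus (min (1 / 2) (halfGap D lam / 2)) (by positivity)
  refine ⟨r, N₁, τ₁, hr, hN₁, Z, U, ?_, fun τ hτ => ?_⟩
  · have hl0 : (lam : ℂ) ≠ 0 := by exact_mod_cast hlam.ne'
    have hZ : Tendsto (fun τ => Z τ 0) atTop (𝓝 lam) := by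
      rw [tendsto_iff_norm_sub_tendsto_zero]
      refine squeeze_zero' (.of_forall fun _ => norm_nonneg _)
        ((eventually_ge_atTop τ₁).mono fun τ hτ => (hB τ hτ).2.2.2) ?_
      simpa using tendsto_smallness_zero.const_mul C
    have hζ : Tendsto (fun τ => Z τ 0 / lam) atTop (𝓝 1) := by
      simpa [hl0] using hZ.div_const (lam : ℂ)
    have h1 := isEquivalent_freq (a := fun _ => lam) (.of_forall fun _ => hlam) hζ
    simpa only [mul_div_cancel₀ _ hl0] using h1
  · obtain ⟨hall, hc1, hc2, -⟩ := hB τ hτ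
    refine ⟨h.norm_φ, hc1, hc2, fun z hz => re_pos_of_norm_sub_le hlam (le_trans hz hr2),
      fun z hz => ?_, hr1.trans (min_le_left _ _), fun N hN => (hall N hN).1,
      fun N hN => (hall N hN).2.1, fun N hN => (hall N hN).2.2.1, fun N hN => (hall N hN).2.2.2.1,
      fun N hN z v hz hv hi hs => (hall N hN).2.2.2.2 z v hz hv hi hs⟩
    have h1 := sub_norm_le_infDist_lam (D := D) (lam := lam) z
    have h2 : ‖z - lam‖ ≤ r := hz
    have h3 := hr1.trans (min_le_right _ _)
    linarith

theorem exists_principal_solutions (hlam : IsPrincipalAntisymm D lam) :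
    ∃ N₀ : ℝ, 0 < N₀ ∧ ∃ τ₀ : ℝ, 1 < τ₀ ∧
    ∃ (ωlinp ωlinm : ℝ → ℂ) (ωp ωm : ℝ → ℝ → ℂ) (up um : ℝ → ℝ → Plane → ℂ),
      Asymptotics.IsEquivalent atTop ωlinp
        (fun τ => ((sqrt (4 * Real.pi / (area D * τ * log τ)) : ℝ) : ℂ)) ∧
      Asymptotics.IsEquivalent atTop ωlinm (fun τ => ((sqrt (1 / (τ * lam)) : ℝ) : ℂ)) ∧
      ∀ τ : ℝ, τ₀ < τ →
        IsLinearResonance D τ (ωlinp τ) ∧ IsLinearResonance D τ (ωlinm τ) ∧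
        IsBranch D τ N₀ (ωlinp τ) (ωp τ) (up τ) ∧ IsBranch D τ N₀ (ωlinm τ) (ωm τ) (um τ) ∧
        ∀ N ∈ Ioo 0 N₀, IsSymm D (up τ N) ∧ IsAntisymm D (um τ N) ∧
          (∀ (ω : ℂ) (u : Plane → ℂ),
            (IsSolution D τ ω u ∧ normSq D u = N ∧ ω ∈ frequencyRegion D lam τ) ↔
              (ω = ωp τ N ∧ EqUpToPhase D u (up τ N)) ∨ (ω = ωm τ N ∧ EqUpToPhase D u (um τ N))) ∧
          ¬ IsSymmetryBreakingPoint D τ (ωp τ N) (up τ N) ∧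
          ¬ IsSymmetryBreakingPoint D τ (ωm τ N) (um τ N) := by
  obtain ⟨φ, h, hφ⟩ := hlam.exists_simpleMode
  have hδ := h.halfGap_pos
  obtain ⟨C, N₁, τ₁, C₁, hN₁, -, hC₁, hcand⟩ := exists_candidate h
  obtain ⟨T, M₀, hbr⟩ := exists_isBranch h
  obtain ⟨M, hM⟩ : ∃ M, M = max (2 * C) M₀.toNNReal := ⟨_, rfl⟩
  have hCM : 2 * C ≤ M := hM ▸ le_max_left _ _
  have hM₀ : M₀ ≤ M := (Real.le_coe_toNNReal M₀).trans (by rw [hM]; exact_mod_cast le_max_right _ _)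
  obtain ⟨rp, Np, τp, hrp, hNp, Zp, Up, hasp, hBp⟩ := exists_modalBranch_constMode h M
  obtain ⟨rm, Nm, τm, hrm, hNm, Zm, Um, hasm, hBm⟩ := exists_modalBranch_eigenfunction h M
  obtain ⟨N₂, τ₂, hN₂, -, hloc⟩ := (dimerSystem h M).localization hδ hC₁ (lt_min hrp hrm)
  obtain ⟨T', hT'⟩ := (dimerSystem h M).exists_le_large 0
  obtain ⟨N₀, hN₀, b1, b2, b3, b4, b5⟩ : ∃ N₀ : ℝ, 0 < N₀ ∧ N₀ ≤ N₁ ∧ N₀ ≤ N₂ ∧ N₀ ≤ Np ∧ N₀ ≤ Nm ∧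
      4 * N₀ * (M : ℝ) ^ 2 ≤ 1 := by
    have hev : ∀ᶠ x : ℝ in 𝓝[>] 0, x < N₁ ∧ x < N₂ ∧ x < Np ∧ x < Nm ∧ 4 * x * (M : ℝ) ^ 2 < 1 := by
      refine nhdsWithin_le_nhds ?_
      have hc : ContinuousAt (fun x : ℝ => 4 * x * (M : ℝ) ^ 2) 0 := by fun_prop
      filter_upwards [gt_mem_nhds hN₁, gt_mem_nhds hN₂, gt_mem_nhds hNp, gt_mem_nhds hNm,
        hc.eventually_lt_const (show 4 * (0 : ℝ) * (M : ℝ) ^ 2 < 1 by simp)] with x h1 h2 h3 h4 h5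
      exact ⟨h1, h2, h3, h4, h5⟩
    obtain ⟨x, ⟨h1, h2, h3, h4, h5⟩, h0⟩ := (hev.and self_mem_nhdsWithin).exists
    exact ⟨x, h0, h1.le, h2.le, h3.le, h4.le, h5.le⟩
  obtain ⟨τ₀, hτ₀⟩ := eventually_atTop.1 ((eventually_ge_atTop (1 : ℝ)).and <|
    (eventually_ge_atTop τ₁).and <| (eventually_ge_atTop τ₂).and <| (eventually_ge_atTop τp).and <|
    (eventually_ge_atTop τm).and <| (eventually_ge_atTop T).and <| (eventually_ge_atTop T').and <|
    (tendsto_id.atTop_mul_const hδ).eventually_gt_atTop 1)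
  refine ⟨N₀, hN₀, max τ₀ 2, lt_max_of_lt_right one_lt_two, fun τ => freq τ (Zp τ 0),
    fun τ => freq τ (Zm τ 0), fun τ N => freq τ (Zp τ N), fun τ N => freq τ (Zm τ N),
    fun τ N => state N (Up τ N), fun τ N => state N (Um τ N), hasp, hasm, fun τ hτ => ?_⟩
  obtain ⟨c0, c1, c2, c3, c4, c5, c6, hτδ⟩ := hτ₀ τ ((le_max_left _ _).trans hτ.le)
  have hτ0 : 0 < τ := one_pos.trans_le c0
  have hp := (hBp τ c3).mono b3
  have hm := (hBm τ c4).mono b4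
  obtain ⟨p1, p2, p3⟩ := hbr hp c5 hM₀ hτδ hτ0 hN₀ b5
  obtain ⟨m1, m2, m3⟩ := hbr hm c5 hM₀ hτδ hτ0 hN₀ b5
  have hsym : ∀ N ∈ Ioo 0 N₀, IsSymm D (state N (Up τ N)) := fun N hN =>
    isSymm_state (hp.reflect_eq hτ0 hτδ reflectL2_constMode (Ioo_subset_Icc_self hN))
  have hanti : ∀ N ∈ Ioo 0 N₀, IsAntisymm D (state N (Um τ N)) := fun N hN =>
    isAntisymm_state (hm.reflect_eq_neg hτ0 hτδ hφ (Ioo_subset_Icc_self hN))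
  have huniq : ∀ N ∈ Ioo 0 N₀, ∀ (ω : ℂ) (u : Plane → ℂ), IsSolution D τ ω u → normSq D u = N →
      ω ∈ frequencyRegion D lam τ → (ω = freq τ (Zp τ N) ∧ EqUpToPhase D u (state N (Up τ N))) ∨
        (ω = freq τ (Zm τ N) ∧ EqUpToPhase D u (state N (Um τ N))) := by
    rintro _ hN ω u hsol rfl hreg
    have hN' := Ioo_subset_Icc_self hN
    obtain ⟨W, hu, hW, hWC, -, hop, hc⟩ := hcand M τ ω u c1 hsol hN.1 (hN.2.le.trans b1) hreg
    rcases hloc τ _ c2 ⟨hN.1.le, hN.2.le.trans b2⟩ hc with ⟨b, d1, d2, d3, d4⟩ | ⟨b, d1, d2, d3, d4⟩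
    · exact .inl (hp.eq_of_candidate hτ0 hτδ hCM hN' hreg.1 hu hW hWC hop d1 d2
        (d3.trans (min_le_left _ _)) (d4.trans (mul_le_mul_of_nonneg_right (min_le_left _ _) (hT' τ c6))))
    · exact .inr (hm.eq_of_candidate hτ0 hτδ hCM hN' hreg.1 hu hW hWC hop d1 d2
        (d3.trans (min_le_right _ _)) (d4.trans (min_le_right _ _)))
  have hnb : ∀ ω u, IsSolution D τ ω u → normSq D u ∈ Ioo 0 N₀ → ω ∈ frequencyRegion D lam τ →
      IsSymm D u ∨ IsAntisymm D u := fun ω u hsol hN hreg =>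
    (huniq _ hN ω u hsol rfl hreg).imp (fun H => (hsym _ hN).of_eqUpToPhase H.2)
      (fun H => (hanti _ hN).of_eqUpToPhase H.2)
  refine ⟨p1, m1, p2, m2, fun N hN => ⟨hsym N hN, hanti N hN, fun ω u => ⟨fun H =>
    huniq N hN ω u H.1 H.2.1 H.2.2, ?_⟩, ?_, ?_⟩⟩
  · rintro (⟨rfl, hu⟩ | ⟨rfl, hu⟩)
    · obtain ⟨e1, e2⟩ := (p2.solution N hN).of_eqUpToPhase hu
      exact ⟨e1, e2.trans (p2.normalized N hN), (p3 N (Ioo_subset_Icc_self hN)).2⟩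
    · obtain ⟨e1, e2⟩ := (m2.solution N hN).of_eqUpToPhase hu
      exact ⟨e1, e2.trans (m2.normalized N hN), (m3 N (Ioo_subset_Icc_self hN)).2⟩
  · obtain ⟨e1, e2⟩ := p3 N (Ioo_subset_Icc_self hN)
    exact not_isSymmetryBreakingPoint h hτ0 e1 e2 (p2.solution N hN).1.memLp (p2.normalized N hN) hN hnb
  · obtain ⟨e1, e2⟩ := m3 N (Ioo_subset_Icc_self hN)
    exact not_isSymmetryBreakingPoint h hτ0 e1 e2 (m2.solution N hN).1.memLp (m2.normalized N hN) hN hnb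

end Dimers

end Dimer

end

theorem mainTheorem5 (D₀ : Set Dimer.Plane) (L : ℝ) (hD₀ : Dimer.IsParticle D₀) (hL : 0 < L)
    (hdisj : Disjoint (Dimer.leftParticle D₀ L) (Dimer.rightParticle D₀ L))
    (D : Set Dimer.Plane) (hD : D = Dimer.dimer D₀ L)
    (lam : ℝ) (hlam : Dimer.IsPrincipalAntisymm D lam) :
    ∃ N₀ : ℝ, 0 < N₀ ∧ ∃ τ₀ : ℝ, 1 < τ₀ ∧
    ∃ (ωlinp ωlinm : ℝ → ℂ) (ωp ωm : ℝ → ℝ → ℂ) (up um : ℝ → ℝ → Dimer.Plane → ℂ),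
      Asymptotics.IsEquivalent atTop ωlinp
        (fun τ => ((Real.sqrt (4 * Real.pi / (Dimer.area D * τ * Real.log τ)) : ℝ) : ℂ)) ∧
      Asymptotics.IsEquivalent atTop ωlinm
        (fun τ => ((Real.sqrt (1 / (τ * lam)) : ℝ) : ℂ)) ∧
      ∀ τ : ℝ, τ₀ < τ →
        Dimer.IsLinearResonance D τ (ωlinp τ) ∧
        Dimer.IsLinearResonance D τ (ωlinm τ) ∧
        Dimer.IsBranch D τ N₀ (ωlinp τ) (ωp τ) (up τ) ∧
        Dimer.IsBranch D τ N₀ (ωlinm τ) (ωm τ) (um τ) ∧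
        ∀ N ∈ Ioo 0 N₀,
          Dimer.IsSymm D (up τ N) ∧
          Dimer.IsAntisymm D (um τ N) ∧
          (∀ (ω : ℂ) (u : Dimer.Plane → ℂ),
            (Dimer.IsSolution D τ ω u ∧ Dimer.normSq D u = N ∧
                ω ∈ Dimer.frequencyRegion D lam τ) ↔
              (ω = ωp τ N ∧ Dimer.EqUpToPhase D u (up τ N)) ∨
              (ω = ωm τ N ∧ Dimer.EqUpToPhase D u (um τ N))) ∧
          ¬ Dimer.IsSymmetryBreakingPoint D τ (ωp τ N) (up τ N) ∧
          ¬ Dimer.IsSymmetryBreakingPoint D τ (ωm τ N) (um τ N) := by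
  subst hD
  have : Fact (Dimer.ReflectionDomain (Dimer.dimer D₀ L)) := ⟨Dimer.reflectionDomain_dimer hD₀ L⟩
  exact Dimer.exists_principal_solutions hlam
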